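/- **Setting.** Let $\mathcal A$ be a finite index set and $S$ a compact connected complex manifold which is a local product of constant scalar curvature Kähler (CSCK) metrics: $S$ carries tensors $g_a$ ($a\in\mathcal A$) and signs $\varepsilon_a\in\{\pm1\}$ such that, near every point, there are holomorphic coordinates with values in a product $\prod_{a\in\mathcal A}\mathbb C^{d_a}$, $d_a\ge 1$, in which $\varepsilon_a g_a$ is the pull-back of a Kähler metric on an open subset of the $a$-th factor, of constant scalar curvature $c_a$ (the same constant near all points). The Kähler metric of $S$ is $g_S=\sum_a\varepsilon_a g_a$; set $\omega_a(v,w)=g_a(Jv,w)$. Let $E_0,E_\infty\to S$ be holomorphic vector bundles of ranks $d_0+1,\,d_\infty+1\ge 1$, with projectively flat hermitian metrics $h_0,h_\infty$ whose Chern curvatures are $\Omega_0\otimes\mathrm{Id}$, $\Omega_\infty\otimes \mathrm{Id}$ (with the sign for which $\Omega_0/2\pi$ represents $c_1(E_0)/(d_0+1)$, and likewise for $E_\infty$), where $\Omega_\infty-\Omega_0=\sum_{a\in\mathcal A}\omega_a$. Then $M=P(E_0\oplus E_\infty)\to S$ is called an admissible manifold over the CSCK base $S$. Let $r_0,r_\infty$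 be the norms of the two components of a vector in $E_0\oplus E_\infty$, let $M_0\subset M$ be the open set where both homogeneous components are non-zero, and put, with $d^cf=-df\circ J$, $$\theta=d^c\log r_0-d^c\log r_\infty ,\qquad \omega_0=dd^c\log r_0+\Omega_0,\qquad \omega_\infty=-dd^c\log r_\infty-\Omega_\infty ,$$ $g_0=\omega_0(\cdot,J\cdot)$, $g_\infty=\omega_\infty(\cdot,J\cdot)$; these are well-defined on $M_0$ ($g_0$ and $-g_\infty$ are the Fubini–Study tensors of $P(E_0)$ and $P(E_\infty)$). Let $x=(x_a)_{a\in\mathcal A}$ be real numbers with $|x_a|<1$ and $\varepsilon_a x_a>0$ (admissible parameters). An *admissible Kähler metric* with parameters $x$ is a Kähler metric $g$ on $M$ for which there are a smooth function $z:M\to\mathbb R$ with $z(M_0)\subset(-1,1)$ and a smooth function $\Theta$ on $[-1,1]$ with $\Theta>0$ on $(-1,1)$, $\Theta(\pm1)=0$, $\Theta'(\pm1)=\mp2$, such that on $M_0$ one has $-dz\circ J=\Theta(z)\,\theta$ and $$g=\sum_{a\in\mathcal A}\frac{1+x_az}{x_a}\,g_a+(1+z)\,g_0-(1-z)\,g_\infty+\frac{dz^2}{\Theta(z)}+\Theta(z)\,\theta^2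 .$$ The *admissible Kähler class* $\Omega_x$ is the Kähler class of the canonical such metric, the one with $\Theta(z)=1-z^2$ and $z=(r_0^2-r_\infty^2)/(r_0^2+r_\infty^2)$. For a function $f$ and $p\in\mathbb R$ the $(f,p)$-scalar curvature of a Kähler metric $g$ is $$\mathrm{Scal}_{f,p}(g)=f^2\,\mathrm{Scal}(g)-2(p-1)f\,\Delta_gf-p(p-1)|df|_g^2,\qquad \Delta_g=-\mathrm{div}\,\mathrm{grad},$$ and $g$ is *$(f,p)$-extremal* if $f$ is a positive Killing potential and $\mathrm{Scal}_{f,p}(g)$ is a Killing potential of $g$ (a smooth function $u$ is a Killing potential if $J\,\mathrm{grad}_g u$ is a Killing field). **Theorem.** Let $M=P(E_0\oplus E_\infty)\to S$ be an admissible manifold over a CSCK base as above. 1. For all real $\boldsymbol a>1$ and $p$ there is $\delta>0$ such that, for all admissible parameters $x$ with $|x_a|<\delta$ for every $a\in\mathcal A$, the class $\Omega_x$ contains an admissible Kähler metric with parameters $x$ which is $(z+\boldsymbol a,p)$-extremal. 2. If moreover $S$ is a local product of nonnegative CSCK metrics, that is $c_a\ge0$ for all $a\in\mathcal A$, then for all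 real $\boldsymbol a>1$ and $p$ and all admissible parameters $x$, the class $\Omega_x$ contains an admissible Kähler metric with parameters $x$ which is $(z+\boldsymbol a,p)$-extremal. -/

import Mathlib

open scoped Manifold ContDiff Bundle
open Bundle

noncomputable section

namespace WeightedExtremal

/-! ### Tensors on a finite-dimensional complex vector space

A real `(1,1)`-form `ω` is represented throughout by the symmetric tensor `g = ω(·, J ·)`, so that
`ω(v, w) = g(J v, w)`, where `J` is multiplication by `i`. -/

section LinearAlgebra

variable {V V' : Type*} [NormedAddCommGroup V] [NormedSpace ℂ V]
  [NormedAddCommGroup V'] [NormedSpace ℂ V']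

/-- Real bilinear forms on a complex vector space. -/
abbrev Bil (V : Type*) [NormedAddCommGroup V] [NormedSpace ℂ V] : Type _ := V →L[ℝ] V →L[ℝ] ℝ

/-- Pull-back of a bilinear form by a complex linear map. -/
def pull (b : Bil V') (T : V →L[ℂ] V') : Bil V :=
  b.bilinearComp (T.restrictScalars ℝ) (T.restrictScalars ℝ)

/-- Multiplication by `i`. -/
def mulI (V : Type*) [NormedAddCommGroup V] [NormedSpace ℂ V] : V →L[ℂ] V :=
  Complex.I • ContinuousLinearMap.id ℂ V

/-- The symmetric square `α ⊗ α` of a real covector. -/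
def sq (α : V →L[ℝ] ℝ) : Bil V := α.smulRight α

/-- The covector `J α = - α ∘ J`, so that `d^c f = J (d f)`. -/
def jmul (α : V →L[ℝ] ℝ) : V →L[ℝ] ℝ := -(α.comp ((mulI V).restrictScalars ℝ))

variable [FiniteDimensional ℂ V]

/-- Gram matrix of a bilinear form in a fixed real basis. -/
def gram (b : Bil V) :
    Matrix (Fin (Module.finrank ℝ V)) (Fin (Module.finrank ℝ V)) ℝ :=
  Matrix.of fun i j => b (Module.finBasis ℝ V i) (Module.finBasis ℝ V j)

/-- The (real) trace of `b` with respect to the inner product `g`; it does not depend on the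
basis. -/
def traceWrt (g b : Bil V) : ℝ := ((gram g)⁻¹ * gram b).trace

end LinearAlgebra

/-! ### Kähler metrics on open subsets of a complex vector space -/

section Flat

variable {V : Type*} [NormedAddCommGroup V] [NormedSpace ℂ V]

/-- The symmetric tensor of the form `dd^c F = 2 i ∂∂̄ F`, namely
`(v, w) ↦ dd^c F (v, J w) = D²F(v, w) + D²F(J v, J w)`. -/
def ddcFlat (F : V → ℝ) (u : V) : Bil V :=
  fderiv ℝ (fderiv ℝ F) u + pull (fderiv ℝ (fderiv ℝ F) u) (mulI V)

/-- `G` is a Kähler metric on the set `U` (used for open `U`): a smooth Riemannian metric which is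
`J`-invariant and whose fundamental form `ω(v, w) = G(J v, w)` is closed. -/
structure IsKahlerOn (G : V → Bil V) (U : Set V) : Prop where
  smooth : ContDiffOn ℝ ∞ G U
  symm : ∀ u ∈ U, ∀ v w, G u v w = G u w v
  invariant : ∀ u ∈ U, ∀ v w, G u (Complex.I • v) (Complex.I • w) = G u v w
  pos : ∀ u ∈ U, ∀ v, v ≠ 0 → 0 < G u v v
  closed : ∀ u ∈ U, ∀ v₁ v₂ v₃,
    fderiv ℝ G u v₁ (Complex.I • v₂) v₃ + fderiv ℝ G u v₂ (Complex.I • v₃) v₁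
      + fderiv ℝ G u v₃ (Complex.I • v₁) v₂ = 0

variable [FiniteDimensional ℂ V]

/-- Scalar curvature of a Kähler metric. The real Gram determinant in linear holomorphic
coordinates is, up to a constant, the square of `det (g_{j k̄})`, so the tensor of the Ricci form
`ρ = - ½ dd^c log det (g_{j k̄})` is `- ½ dd^c (½ log det G)`, and the scalar curvature is its trace.
The normalization is the Riemannian one: the round metric of curvature `K` on a sphere of
real dimension two has scalar curvature `2 K`. -/
def scalFlat (G : V → Bil V) (u : V) : ℝ :=
  -(1 / 2) * traceWrt (G u) (ddcFlat (fun u' => 1 / 2 * Real.log (gram (G u')).det) u)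

end Flat

/-! ### Calculus on complex manifolds

As in Mathlib, the tangent space at `x` of a manifold modelled on `V` is `V`, through the preferred
chart at `x`. A tensor field is thus a function with values in `Bil V`. -/

section Calculus

variable {V H M : Type*} [NormedAddCommGroup V] [NormedSpace ℂ V] [TopologicalSpace H]
  (I : ModelWithCorners ℂ V H) [TopologicalSpace M] [ChartedSpace H M]

/-- The differential of a real function on a complex manifold. -/
def dReal (f : M → ℝ) (x : M) : V →L[ℝ] ℝ :=
  fderiv ℝ (f ∘ (extChartAt I x).symm) (extChartAt I x x)

/-- The symmetric tensor of `dd^c f` for a real function `f` on a complex manifold. -/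
def ddc (f : M → ℝ) (x : M) : Bil V :=
  ddcFlat (f ∘ (extChartAt I x).symm) (extChartAt I x x)

/-- The differential of a holomorphic map, in terms of the model vector spaces. -/
def mdiff {V' H' M' : Type*} [NormedAddCommGroup V'] [NormedSpace ℂ V'] [TopologicalSpace H']
    (I' : ModelWithCorners ℂ V' H') [TopologicalSpace M'] [ChartedSpace H' M']
    (f : M → M') (x : M) : V →L[ℂ] V' :=
  mfderiv I I' f x

end Calculus

section KahlerManifold

variable {V M : Type*} [NormedAddCommGroup V] [NormedSpace ℂ V]
  [TopologicalSpace M] [ChartedSpace V M]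

/-- Smooth real functions on a complex manifold, viewed as a real manifold. -/
def SmoothOn (f : M → ℝ) (s : Set M) : Prop := ContMDiffOn 𝓘(ℝ, V) 𝓘(ℝ, ℝ) ∞ f s

variable [IsManifold 𝓘(ℂ, V) ω M]

/-- The expression of a tensor field in the preferred chart around `x`. -/
def inChart (g : M → Bil V) (x : M) (u : V) : Bil V :=
  pull (g ((extChartAt 𝓘(ℂ, V) x).symm u))
    (tangentCoordChange 𝓘(ℂ, V) x ((extChartAt 𝓘(ℂ, V) x).symm u)
      ((extChartAt 𝓘(ℂ, V) x).symm u))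

/-- Kähler metrics on a complex manifold. -/
def IsKahlerMetric (g : M → Bil V) : Prop :=
  ∀ x : M, IsKahlerOn (inChart g x) (extChartAt 𝓘(ℂ, V) x).target

/-- Killing potentials of a Kähler metric: smooth functions `f` such that `J grad f`, the vector
field `X` with `g(X, ·) = - df ∘ J`, is a Killing field, that is, `L_X g = 0`.
Both conditions are written in the preferred charts. -/
def IsKillingPotential (g : M → Bil V) (f : M → ℝ) : Prop :=
  SmoothOn (V := V) f Set.univ ∧
  ∀ x : M, ∃ X : V → V, ∀ u ∈ (extChartAt 𝓘(ℂ, V) x).target,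
    (∀ v, inChart g x u (X u) v
      = -(fderiv ℝ (f ∘ (extChartAt 𝓘(ℂ, V) x).symm) u (Complex.I • v))) ∧
    ∀ v w, fderiv ℝ (inChart g x) u (X u) v w + inChart g x u (fderiv ℝ X u v) w
      + inChart g x u v (fderiv ℝ X u w) = 0

variable [FiniteDimensional ℂ V]

/-- Scalar curvature of a Kähler metric. -/
def scal (g : M → Bil V) (x : M) : ℝ := scalFlat (inChart g x) (extChartAt 𝓘(ℂ, V) x x)

/-- The (nonnegative) Laplacian `- div grad` of a Kähler metric, which is `- tr_ω dd^c`. -/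
def laplacian (g : M → Bil V) (f : M → ℝ) (x : M) : ℝ :=
  -(1 / 2) * traceWrt (g x) (ddc 𝓘(ℂ, V) f x)

/-- The squared norm `|df|²_g`. -/
def normSqDiff (g : M → Bil V) (f : M → ℝ) (x : M) : ℝ :=
  traceWrt (g x) (sq (dReal 𝓘(ℂ, V) f x))

/-- The `(f, p)`-scalar curvature. -/
def weightedScal (f : M → ℝ) (p : ℝ) (g : M → Bil V) (x : M) : ℝ :=
  f x ^ 2 * scal g x - 2 * (p - 1) * f x * laplacian g f x - p * (p - 1) * normSqDiff g f x

/-- `(f, p)`-extremal Kähler metrics: `f` is a positive Killing potential and the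
`(f, p)`-scalar curvature is a Killing potential. -/
structure IsWeightedExtremal (f : M → ℝ) (p : ℝ) (g : M → Bil V) : Prop where
  kahler : IsKahlerMetric g
  pos : ∀ x, 0 < f x
  killing : IsKillingPotential g f
  extremal : IsKillingPotential g (weightedScal f p g)

end KahlerManifold

/-! ### The base and the bundles -/

section Base

variable {A : Type*} [Fintype A] {W : A → Type*} [∀ a, NormedAddCommGroup (W a)]
  [∀ a, NormedSpace ℂ (W a)] [∀ a, FiniteDimensional ℂ (W a)]
  {B : Type*} [NormedAddCommGroup B] [NormedSpace ℂ B]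
  {S : Type*} [TopologicalSpace S] [ChartedSpace B S]

/-- `S` is a local product of Kähler manifolds of constant scalar curvature: around every point
there are holomorphic coordinates with values in `∏ W a` in which each tensor `g a` is the
pull-back of `sign a` times a Kähler metric `k a` on (an open subset of) the factor `W a`, of
constant scalar curvature `c a`. -/
def IsLocalProductCSCK (sign : A → ℝ) (g : A → S → Bil B) (c : A → ℝ) : Prop :=
  ∀ x : S, ∃ Φ : OpenPartialHomeomorph S (∀ a, W a), x ∈ Φ.source ∧
    ContMDiffOn 𝓘(ℂ, B) 𝓘(ℂ, ∀ a, W a) ω Φ Φ.source ∧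
    ContMDiffOn 𝓘(ℂ, ∀ a, W a) 𝓘(ℂ, B) ω Φ.symm Φ.target ∧
    ∀ a, ∃ k : W a → Bil (W a),
      IsKahlerOn k ((fun u => u a) '' Φ.target) ∧
      (∀ u ∈ (fun u => u a) '' Φ.target, scalFlat k u = c a) ∧
      ∀ y ∈ Φ.source, g a y = sign a • pull (k (Φ y a))
        ((ContinuousLinearMap.proj (R := ℂ) (φ := W) a).comp
          (mdiff 𝓘(ℂ, B) 𝓘(ℂ, ∀ a, W a) Φ y))

variable {F : Type*} [NormedAddCommGroup F] [InnerProductSpace ℂ F]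
  {E : S → Type*} [TopologicalSpace (TotalSpace F E)] [∀ x, TopologicalSpace (E x)]
  [∀ x, AddCommGroup (E x)] [∀ x, Module ℂ (E x)] [FiberBundle F E]

/-- The holomorphic vector bundle `E` with the hermitian metric whose squared norm is `h` is
projectively flat with Chern curvature `Ω ⊗ Id`: around every point there is a
holomorphic frame in which the hermitian metric is a multiple `exp (-ψ)` of the standard one, that
is, a frame which is parallel and unitary up to scale for the connection induced on `P(E)`.
The Chern curvature of such a metric is `Ω ⊗ Id` with
`Ω = - dd^c log |s|_h = ½ dd^c ψ`, `s` being any member of the frame; with this sign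
`Ω / 2π` represents `c₁(E) / rank E`. -/
def IsProjectivelyFlat (h : ∀ x, E x → ℝ) (Ω : S → Bil B) : Prop :=
  ∀ x : S, ∃ (e : Trivialization F (TotalSpace.proj : TotalSpace F E → S)) (ψ : S → ℝ),
    x ∈ e.baseSet ∧ e.IsLinear ℂ ∧
    ContMDiffOn (𝓘(ℂ, B).prod 𝓘(ℂ, F)) (𝓘(ℂ, B).prod 𝓘(ℂ, F)) ω e e.source ∧
    ContMDiffOn (𝓘(ℂ, B).prod 𝓘(ℂ, F)) (𝓘(ℂ, B).prod 𝓘(ℂ, F)) ω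
      e.toOpenPartialHomeomorph.symm e.target ∧
    SmoothOn (V := B) ψ e.baseSet ∧
    (∀ y ∈ e.baseSet, ∀ v : E y, h y v = Real.exp (-ψ y) * ‖(e ⟨y, v⟩).2‖ ^ 2) ∧
    ∀ y ∈ e.baseSet, Ω y = (1 / 2 : ℝ) • ddc 𝓘(ℂ, B) ψ y

end Base

section Projectivization

variable {B : Type*} [NormedAddCommGroup B] [NormedSpace ℂ B]
  {S : Type*} [TopologicalSpace S] [ChartedSpace B S]
  {F : Type*} [NormedAddCommGroup F] [NormedSpace ℂ F]
  {E : S → Type*} [TopologicalSpace (TotalSpace F E)] [∀ x, TopologicalSpace (E x)]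
  [∀ x, AddCommGroup (E x)] [∀ x, Module ℂ (E x)] [FiberBundle F E]
  {V M : Type*} [NormedAddCommGroup V] [NormedSpace ℂ V]
  [TopologicalSpace M] [ChartedSpace V M]

/-- The map `q` presents the complex manifold `M` as the projectivization `P(E)` of the holomorphic
vector bundle `E`: on the complement of the zero section it is a surjective holomorphic submersion
whose fibres are the punctured lines in the fibres of `E`. These properties determine the
complex manifold `M` and the map up to a unique biholomorphism. (The values of `q` on the zero
section are irrelevant.) -/
structure IsProjectivization (q : TotalSpace F E → M) : Prop where
  submersion : ∀ v : TotalSpace F E, v.2 ≠ 0 →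
    Manifold.IsSubmersionAt (𝓘(ℂ, B).prod 𝓘(ℂ, F)) 𝓘(ℂ, V) ω q v
  surjective : ∀ m : M, ∃ v : TotalSpace F E, v.2 ≠ 0 ∧ q v = m
  fibres : ∀ v w : TotalSpace F E, v.2 ≠ 0 → w.2 ≠ 0 →
    (q v = q w ↔ ∃ c : ℂ, w = ⟨v.proj, c • v.2⟩)

end Projectivization

/-! ### Admissible manifolds and admissible metrics -/

section Admissible

variable (A : Type*) [Fintype A] (W : A → Type*) [∀ a, NormedAddCommGroup (W a)]
  [∀ a, NormedSpace ℂ (W a)] [∀ a, FiniteDimensional ℂ (W a)]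
  (B : Type*) [NormedAddCommGroup B] [NormedSpace ℂ B]
  {S : Type*} [TopologicalSpace S] [ChartedSpace B S]
  (F₀ : Type*) [NormedAddCommGroup F₀] [InnerProductSpace ℂ F₀]
  (E₀ : S → Type*) [TopologicalSpace (TotalSpace F₀ E₀)] [∀ x, TopologicalSpace (E₀ x)]
  [∀ x, AddCommGroup (E₀ x)] [∀ x, Module ℂ (E₀ x)] [FiberBundle F₀ E₀]
  (F₁ : Type*) [NormedAddCommGroup F₁] [InnerProductSpace ℂ F₁]
  (E₁ : S → Type*) [TopologicalSpace (TotalSpace F₁ E₁)] [∀ x, TopologicalSpace (E₁ x)]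
  [∀ x, AddCommGroup (E₁ x)] [∀ x, Module ℂ (E₁ x)] [FiberBundle F₁ E₁]
  (V : Type*) [NormedAddCommGroup V] [NormedSpace ℂ V]
  (M : Type*) [TopologicalSpace M] [ChartedSpace V M]

/-- The structure of an admissible manifold `M = P(E₀ ⊕ E_∞) → S` over a CSCK base, where `E_∞` is
written `E₁`. The signs are those of the tensors `g a`. The base `S` carries the Kähler metric
`∑ a, sign a • g a`, locally a product of metrics of constant scalar curvature `c a`. The
hermitian metrics on the bundles (given by their squared norms `h₀`, `h₁`) are projectively flat,
with curvatures `Ω₀ ⊗ Id`, `Ω₁ ⊗ Id` such that `Ω₁ - Ω₀ = ∑ a, ω a`. -/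
structure AdmissibleManifold where
  sign : A → ℝ
  sign_eq : ∀ a, sign a = 1 ∨ sign a = -1
  g : A → S → Bil B
  c : A → ℝ
  localProduct : IsLocalProductCSCK (W := W) sign g c
  h₀ : ∀ x, E₀ x → ℝ
  h₁ : ∀ x, E₁ x → ℝ
  Ω₀ : S → Bil B
  Ω₁ : S → Bil B
  flat₀ : IsProjectivelyFlat (F := F₀) h₀ Ω₀
  flat₁ : IsProjectivelyFlat (F := F₁) h₁ Ω₁
  curvature : ∀ x, Ω₁ x - Ω₀ x = ∑ a, g a x
  q : TotalSpace (F₀ × F₁) (E₀ ×ᵇ E₁) → M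
  projectivization : IsProjectivization (B := B) (V := V) q

namespace AdmissibleManifold

variable {A W B F₀ E₀ F₁ E₁ V M} (D : AdmissibleManifold A W B F₀ E₀ F₁ E₁ V M)

/-- Points of the total space of `E₀ ⊕ E_∞`. -/
abbrev Total (_ : AdmissibleManifold A W B F₀ E₀ F₁ E₁ V M) : Type _ :=
  TotalSpace (F₀ × F₁) (E₀ ×ᵇ E₁)

/-- The differential of the projection `E₀ ⊕ E_∞ → S`. -/
def dProj (v : D.Total) : B × (F₀ × F₁) →L[ℂ] B :=
  mdiff (𝓘(ℂ, B).prod 𝓘(ℂ, F₀ × F₁)) 𝓘(ℂ, B)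
    (TotalSpace.proj : TotalSpace (F₀ × F₁) (E₀ ×ᵇ E₁) → S) v

/-- The differential of the quotient map `(E₀ ⊕ E_∞) ∖ 0 → M`. -/
def dq (v : D.Total) : B × (F₀ × F₁) →L[ℂ] V :=
  mdiff (𝓘(ℂ, B).prod 𝓘(ℂ, F₀ × F₁)) 𝓘(ℂ, V) D.q v

/-- The squared norm `r₀²` of the first component of a vector in `E₀ ⊕ E_∞`. -/
def rsq₀ (v : D.Total) : ℝ := D.h₀ v.proj v.2.1

/-- The squared norm `r_∞²` of the second component of a vector in `E₀ ⊕ E_∞`. -/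
def rsq₁ (v : D.Total) : ℝ := D.h₁ v.proj v.2.2

/-- The function `log r₀`. -/
def logr₀ (v : D.Total) : ℝ := Real.log (D.rsq₀ v) / 2

/-- The function `log r_∞`. -/
def logr₁ (v : D.Total) : ℝ := Real.log (D.rsq₁ v) / 2

/-- Where both components are nonzero: the pull-back to `E₀ ⊕ E_∞` of the Fubini-Study tensor `g₀`
of `P(E₀)`, that is `ω₀ = d θ₀ + Ω₀ = dd^c log r₀ + Ω₀`. -/
def fs₀ (v : D.Total) : Bil (B × (F₀ × F₁)) :=
  ddc (𝓘(ℂ, B).prod 𝓘(ℂ, F₀ × F₁)) D.logr₀ v + pull (D.Ω₀ v.proj) (D.dProj v)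

/-- Where both components are nonzero: the pull-back to `E₀ ⊕ E_∞` of the *negative* tensor `g_∞`,
minus the Fubini-Study tensor of `P(E_∞)`, that is
`ω_∞ = - d θ_∞ - Ω_∞ = - dd^c log r_∞ - Ω_∞`. -/
def fs₁ (v : D.Total) : Bil (B × (F₀ × F₁)) :=
  -(ddc (𝓘(ℂ, B).prod 𝓘(ℂ, F₀ × F₁)) D.logr₁ v + pull (D.Ω₁ v.proj) (D.dProj v))

/-- The difference `θ = θ₀ - θ_∞ = d^c log r₀ - d^c log r_∞` of the Chern connection forms. -/
def θ (v : D.Total) : B × (F₀ × F₁) →L[ℝ] ℝ :=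
  jmul (dReal (𝓘(ℂ, B).prod 𝓘(ℂ, F₀ × F₁)) (fun w => D.logr₀ w - D.logr₁ w) v)

/-- Admissible parameters `x = (x_a)`: `|x_a| < 1`, and `x_a g_a` is positive definite
on the `a`-th factor. -/
def IsParameter (x : A → ℝ) : Prop := ∀ a, |x a| < 1 ∧ 0 < D.sign a * x a

variable [IsManifold 𝓘(ℂ, V) ω M]

/-- The admissible Kähler metrics `g` on `M` with parameters `x`, momentum `z` and profile `Θ`.
The function `z` is smooth on `M`, and on the open set `M₀` where both homogeneous components are
nonzero, with `x_0 = 1` and `x_∞ = -1`,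
`g = ∑_a (1 + x_a z) / x_a g_a + (1 + z) g_0 - (1 - z) g_∞ + dz² / Θ(z) + Θ(z) θ²`,
`J dz = Θ(z) θ`, where `Θ` is smooth on `[-1, 1]`, positive inside, `Θ(±1) = 0` and
`Θ'(±1) = ∓ 2`. The tensors on `M₀` are compared after pull-back by the submersion `q`. -/
structure IsAdmissibleMetric (x : A → ℝ) (Θ : ℝ → ℝ) (z : M → ℝ) (g : M → Bil V) : Prop where
  profile_smooth : ContDiffOn ℝ ∞ Θ (Set.Icc (-1) 1)
  profile_pos : ∀ t ∈ Set.Ioo (-1 : ℝ) 1, 0 < Θ t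
  profile_left : Θ (-1) = 0
  profile_right : Θ 1 = 0
  profile_deriv_left : HasDerivWithinAt Θ 2 (Set.Icc (-1) 1) (-1)
  profile_deriv_right : HasDerivWithinAt Θ (-2) (Set.Icc (-1) 1) 1
  kahler : IsKahlerMetric g
  moment_smooth : SmoothOn (V := V) z Set.univ
  moment_mem : ∀ v : D.Total, v.2.1 ≠ 0 → v.2.2 ≠ 0 → z (D.q v) ∈ Set.Ioo (-1 : ℝ) 1
  moment : ∀ v : D.Total, v.2.1 ≠ 0 → v.2.2 ≠ 0 →
    jmul (dReal (𝓘(ℂ, B).prod 𝓘(ℂ, F₀ × F₁)) (fun w => z (D.q w)) v) = Θ (z (D.q v)) • D.θ v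
  metric : ∀ v : D.Total, v.2.1 ≠ 0 → v.2.2 ≠ 0 →
    pull (g (D.q v)) (D.dq v) =
      ∑ a, ((1 + x a * z (D.q v)) / x a) • pull (D.g a v.proj) (D.dProj v)
        + (1 + z (D.q v)) • D.fs₀ v - (1 - z (D.q v)) • D.fs₁ v
        + (Θ (z (D.q v)))⁻¹ •
            sq (dReal (𝓘(ℂ, B).prod 𝓘(ℂ, F₀ × F₁)) (fun w => z (D.q w)) v)
        + Θ (z (D.q v)) • sq (D.θ v)

/-- Membership in the admissible Kähler class `Ω_x`, the class of the canonical admissible metric,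
whose profile is `1 - z²` and whose momentum is `(r₀² - r_∞²) / (r₀² + r_∞²)`: the two Kähler
forms differ by `dd^c φ` for a smooth function `φ` on the compact manifold `M`. For Kähler forms on a
compact complex manifold this is equality of de Rham classes. -/
def InClass (x : A → ℝ) (g : M → Bil V) : Prop :=
  ∃ (g_c : M → Bil V) (z_c φ : M → ℝ),
    D.IsAdmissibleMetric x (fun t => 1 - t ^ 2) z_c g_c ∧
    (∀ v : D.Total, v.2 ≠ 0 → z_c (D.q v) = (D.rsq₀ v - D.rsq₁ v) / (D.rsq₀ v + D.rsq₁ v)) ∧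
    SmoothOn (V := V) φ Set.univ ∧
    ∀ m, g m = g_c m + ddc 𝓘(ℂ, V) φ m

end AdmissibleManifold

end Admissible

end WeightedExtremal

end

open WeightedExtremal

noncomputable section

namespace WeightedExtremal

open Matrix Module

set_option linter.unusedSectionVars false

/-! ### Gram matrices, determinants and traces of real bilinear forms on complex vector spaces. -/

section LinearAlgebraLemmas

variable {V V' V'' : Type*} [NormedAddCommGroup V] [NormedSpace ℂ V]
  [NormedAddCommGroup V'] [NormedSpace ℂ V'] [NormedAddCommGroup V''] [NormedSpace ℂ V'']

/-! On `M₀` the ansatz turns curvature into a function of `z` alone. Let `P(z) = ∏ (1 + x_a z)^{d_a}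
(1 + z)^{d_0} (1 - z)^{d_∞}` be the relative volume density and `F = Θ P`. Then `Scal = σ - F'' /
P`, `Δz = -F' / P` and `|dz|² = Θ`, where `σ` collects the terms `|x_a| c_a / (1 + x_a z)` and those
of the Fubini–Study fibres (`scalFlat_modelMetric`, `laplacian_modelMetric`,
`traceWrt_modelMetric_sq`). Since `z` is a Killing potential, it is enough that the weighted scalar
curvature be affine in `z`, say `α z + β`. For `G = (z + a)^{1 - p} F` this is the linear equation
`G'' = (z + a)^{-1 - p} ((z + a)² σ - α z - β) P`.

The end conditions on `Θ` determine `α` and `β`. Indeed `G` is the solution of the canonical profile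
`1 - z²` plus a second primitive starting at `-1`, and the correction vanishes to the right order at
`1` exactly when two moments vanish (`moment_residual`, `secondPrimitive_divisible`). Hence a
solution with the right boundary behaviour always exists, and only the positivity of `G` on `(-1,
1)` is at stake.

If all `c_a ≥ 0`, then `(z + a)² σ` is a nonnegative combination of the convex functions `(z + a)² /
(1 + x z)`, so `G''` is a positive weight times a convex function `Q`. A nonpositive value of `G`
would lie between two local maxima with `Q ≤ 0`; then `Q ≤ 0` in between and `G` would be concave
there, which is absurd (`pos_of_deriv2_convex`). For small `x` the equation is a perturbation of the
one at `x = 0`, where the base contributes no curvature and the previous case applies; the quotient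
of `G` by `(1 - z²) (1 + z)^{d_0} (1 - z)^{d_∞}` is positive up to the ends, so positivity persists
(`solution_pos_of_close`, `solution_pos_of_small`).

It remains to build the metric. Let `y = (r_0² - r_∞²) / (r_0² + r_∞²)`. Solving `dz / Θ(z) = dy /
(1 - y²)` gives `z` and a relative potential `u` as smooth functions of `y` up to `y = ±1`
(`exists_isMomentProfile`). The metric is `∑ g_a / x_a + Ω_0 + Ω_∞ + dd^c (log (r_0² + r_∞²) +
u(y))`, written on the total space of `E_0 ⊕ E_∞`. It descends to `M` because rescaling a vector
changes the potential by a pluriharmonic function. Smoothness, closedness and membership in `Ω_x`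
are then visible from the potential. Positivity is checked on `M₀` and separately where one
component vanishes (`IsLocalModel.pos`). Curvature and Killing identities are computed on `M₀`, in
coordinates in which the metric is a Calabi ansatz on `N × ℂ`, and extended by density
(`IsLocalSection.mem_closure`). -/

instance Bil.instNormedAddCommGroup : NormedAddCommGroup (V →L[ℝ] V' →L[ℝ] ℝ) :=
  ContinuousLinearMap.toNormedAddCommGroup

instance Bil.instNormedSpace : NormedSpace ℝ (V →L[ℝ] V' →L[ℝ] ℝ) :=
  ContinuousLinearMap.toNormedSpace

instance Bil.instAddCommGroup : AddCommGroup (V →L[ℝ] V' →L[ℝ] ℝ) :=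
  ContinuousLinearMap.addCommGroup

instance Bil.instAddCommMonoid : AddCommMonoid (V →L[ℝ] V' →L[ℝ] ℝ) :=
  ContinuousLinearMap.addCommMonoid

instance Bil.instAddZeroClass : AddZeroClass (V →L[ℝ] V' →L[ℝ] ℝ) := inferInstance

instance Bil.instAddMonoid : AddMonoid (V →L[ℝ] V' →L[ℝ] ℝ) := inferInstance

instance Bil.instAddGroup : AddGroup (V →L[ℝ] V' →L[ℝ] ℝ) := inferInstance

instance Bil.instModule : Module ℝ (V →L[ℝ] V' →L[ℝ] ℝ) := ContinuousLinearMap.module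

instance Bil.instDistribMulAction : DistribMulAction ℝ (V →L[ℝ] V' →L[ℝ] ℝ) := inferInstance

instance Bil.instSMulZeroClass : SMulZeroClass ℝ (V →L[ℝ] V' →L[ℝ] ℝ) := inferInstance

@[simp] theorem pull_apply (b : Bil V') (T : V →L[ℂ] V') (v w : V) :
    pull b T v w = b (T v) (T w) := rfl

@[simp] theorem sq_apply (α : V →L[ℝ] ℝ) (v w : V) : sq α v w = α v * α w := rfl

@[simp] theorem jmul_apply (α : V →L[ℝ] ℝ) (v : V) : jmul α v = -α (Complex.I • v) := rfl

@[simp] theorem mulI_apply (v : V) : mulI V v = Complex.I • v := rfl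

theorem pull_pull (b : Bil V'') (T : V' →L[ℂ] V'') (T' : V →L[ℂ] V') :
    pull (pull b T) T' = pull b (T.comp T') := rfl

theorem pull_add (b b' : Bil V') (T : V →L[ℂ] V') : pull (b + b') T = pull b T + pull b' T := rfl

theorem pull_sub (b b' : Bil V') (T : V →L[ℂ] V') : pull (b - b') T = pull b T - pull b' T := rfl

theorem pull_smul (c : ℝ) (b : Bil V') (T : V →L[ℂ] V') : pull (c • b) T = c • pull b T := rfl

theorem pull_zero (T : V →L[ℂ] V') : pull (0 : Bil V') T = 0 := rfl

theorem pull_sum {ι : Type*} (s : Finset ι) (b : ι → Bil V') (T : V →L[ℂ] V') :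
    pull (∑ i ∈ s, b i) T = ∑ i ∈ s, pull (b i) T := by
  classical
  induction s using Finset.induction_on with
  | empty => simp [pull_zero]
  | insert a s ha ih => rw [Finset.sum_insert ha, Finset.sum_insert ha, pull_add, ih]

theorem pull_id (b : Bil V) : pull b (ContinuousLinearMap.id ℂ V) = b := rfl

theorem pull_sq (α : V' →L[ℝ] ℝ) (T : V →L[ℂ] V') :
    pull (sq α) T = sq (α.comp (T.restrictScalars ℝ)) := rfl

theorem jmul_comp (α : V' →L[ℝ] ℝ) (T : V →L[ℂ] V') :
    jmul (α.comp (T.restrictScalars ℝ)) = (jmul α).comp (T.restrictScalars ℝ) := by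
  ext v; simp

/-- Gram matrix of a bilinear form in a given real basis. -/
def gramIn {ι : Type*} (β : Basis ι ℝ V) (b : Bil V) : Matrix ι ι ℝ :=
  Matrix.of fun i j => b (β i) (β j)

theorem gramIn_add (β : Basis ι ℝ V) (b b' : Bil V) :
    gramIn β (b + b') = gramIn β b + gramIn β b' := rfl

theorem gramIn_smul (β : Basis ι ℝ V) (c : ℝ) (b : Bil V) :
    gramIn β (c • b) = c • gramIn β b := rfl

section basis

variable {ι ι' : Type*} [Fintype ι] [DecidableEq ι] [Fintype ι'] [DecidableEq ι']

theorem gramIn_basis_change (β : Basis ι ℝ V) (β' : Basis ι' ℝ V) (b : Bil V) :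
    gramIn β' b = (β.toMatrix β')ᵀ * gramIn β b * β.toMatrix β' := by
  ext i j
  simp only [gramIn, Matrix.of_apply, Matrix.mul_apply, Matrix.transpose_apply]
  conv_lhs => rw [← β.sum_toMatrix_smul_self β' i, ← β.sum_toMatrix_smul_self β' j]
  simp only [map_sum, map_smul, _root_.sum_apply, _root_.smul_apply,
    smul_eq_mul, Finset.sum_mul, Finset.mul_sum]
  refine Finset.sum_congr rfl fun k _ => Finset.sum_congr rfl fun l _ => ?_
  ring

theorem gramIn_pull (β : Basis ι ℝ V') (T : V ≃L[ℂ] V') (b : Bil V') :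
    gramIn (β.map (T.symm.toLinearEquiv.restrictScalars ℝ)) (pull b (T : V →L[ℂ] V')) =
      gramIn β b := by
  ext i j; simp [gramIn]

theorem det_gramIn_endo (β : Basis ι ℝ V) (T : V →L[ℂ] V) (b : Bil V) :
    (gramIn β (pull b T)).det =
      (LinearMap.det ((T : V →ₗ[ℂ] V).restrictScalars ℝ)) ^ 2 * (gramIn β b).det := by
  set T' : V →ₗ[ℝ] V := (T : V →ₗ[ℂ] V).restrictScalars ℝ
  have key : gramIn β (pull b T) =
      (LinearMap.toMatrix β β T')ᵀ * gramIn β b * LinearMap.toMatrix β β T' := by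
    ext i j
    simp only [gramIn, Matrix.of_apply, Matrix.mul_apply, Matrix.transpose_apply, pull_apply]
    have h : ∀ i, T (β i) = ∑ k, LinearMap.toMatrix β β T' k i • β k := by
      intro i
      rw [← β.sum_repr (T (β i))]
      simp [LinearMap.toMatrix_apply, T']
    rw [h i, h j]
    simp only [map_sum, map_smul, _root_.sum_apply, _root_.smul_apply,
      smul_eq_mul, Finset.sum_mul, Finset.mul_sum]
    refine Finset.sum_congr rfl fun k _ => Finset.sum_congr rfl fun l _ => ?_
    ring
  rw [key, Matrix.det_mul, Matrix.det_mul, Matrix.det_transpose, LinearMap.det_toMatrix]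
  ring

theorem gramIn_posDef (β : Basis ι ℝ V) {g : Bil V} (hs : ∀ v w, g v w = g w v)
    (hp : ∀ v, v ≠ 0 → 0 < g v v) : (gramIn β g).PosDef := by
  refine Matrix.PosDef.of_dotProduct_mulVec_pos ?_ ?_
  · ext i j; simp [gramIn, hs (β i) (β j)]
  · intro x hx
    have hne : ∑ i, x i • β i ≠ 0 := by
      intro h
      apply hx
      ext i
      exact Fintype.linearIndependent_iff.1 β.linearIndependent x h i
    have := hp _ hne
    simp only [map_sum, map_smul, _root_.sum_apply, _root_.smul_apply,
      smul_eq_mul] at this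
    simp only [dotProduct, Matrix.mulVec, gramIn, Matrix.of_apply, star_trivial]
    refine this.trans_eq ?_
    refine Finset.sum_congr rfl fun i _ => ?_
    congr 1
    refine Finset.sum_congr rfl fun j _ => ?_
    rw [hs, mul_comm]

end basis

variable [FiniteDimensional ℂ V] [FiniteDimensional ℂ V']

theorem gram_eq_gramIn (b : Bil V) : gram b = gramIn (finBasis ℝ V) b := rfl

/-- The determinant of the Gram matrix in the fixed basis. -/
def gdet (b : Bil V) : ℝ := (gram b).det

section
variable {ι : Type*} [Fintype ι] [DecidableEq ι]

/-- The square of the determinant of the change of basis from a given basis to the fixed one. -/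
theorem exists_gdet_eq (β : Basis ι ℝ V) :
    ∃ c : ℝ, 0 < c ∧ ∀ b : Bil V, gdet b = c * (gramIn β b).det := by
  have hcard : Fintype.card (Fin (finrank ℝ V)) = Fintype.card ι := by
    rw [Fintype.card_fin, finrank_eq_card_basis β]
  let e : Fin (finrank ℝ V) ≃ ι := Fintype.equivOfCardEq hcard
  let β' := β.reindex e.symm
  have hu : IsUnit (β'.toMatrix (finBasis ℝ V)).det := by
    have := β'.toMatrix_mul_toMatrix_flip (finBasis ℝ V)
    have h2 := congrArg Matrix.det this
    rw [Matrix.det_mul, Matrix.det_one] at h2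
    exact IsUnit.of_mul_eq_one _ h2
  refine ⟨(β'.toMatrix (finBasis ℝ V)).det ^ 2, by positivity [hu.ne_zero], fun b => ?_⟩
  have h1 : (gramIn β' b).det = (gramIn β b).det := by
    have : gramIn β' b = (gramIn β b).submatrix e e := by ext i j; simp [gramIn, β']
    rw [this, Matrix.det_submatrix_equiv_self]
  rw [gdet, gram_eq_gramIn, gramIn_basis_change β' (finBasis ℝ V), Matrix.det_mul, Matrix.det_mul,
    Matrix.det_transpose, h1]
  ring

theorem gdet_ne_zero_iff (β : Basis ι ℝ V) (g : Bil V) : gdet g ≠ 0 ↔ (gramIn β g).det ≠ 0 := by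
  obtain ⟨c, hc, h⟩ := exists_gdet_eq β
  rw [h]; simp [hc.ne']

theorem traceWrt_eq (β : Basis ι ℝ V) (g b : Bil V) :
    traceWrt g b = ((gramIn β g)⁻¹ * gramIn β b).trace := by
  set P := (finBasis ℝ V).toMatrix β with hP
  set Q := β.toMatrix (finBasis ℝ V) with hQ
  have hPQ : P * Q = 1 := (finBasis ℝ V).toMatrix_mul_toMatrix_flip β
  have hQP : Q * P = 1 := β.toMatrix_mul_toMatrix_flip (finBasis ℝ V)
  have e1 : ∀ b : Bil V, gramIn β b = Pᵀ * gram b * P :=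
    fun b => gramIn_basis_change (finBasis ℝ V) β b
  have e2 : ∀ b : Bil V, gram b = Qᵀ * gramIn β b * Q :=
    fun b => gramIn_basis_change β (finBasis ℝ V) b
  have hQPt : Pᵀ * Qᵀ = 1 := by rw [← Matrix.transpose_mul, hQP, Matrix.transpose_one]
  have hPQt : Qᵀ * Pᵀ = 1 := by rw [← Matrix.transpose_mul, hPQ, Matrix.transpose_one]
  by_cases hg : IsUnit (gramIn β g).det
  · have hinv : (gram g)⁻¹ = P * (gramIn β g)⁻¹ * Pᵀ := by
      apply Matrix.inv_eq_left_inv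
      rw [e2 g]
      calc P * (gramIn β g)⁻¹ * Pᵀ * (Qᵀ * gramIn β g * Q)
          = P * (gramIn β g)⁻¹ * (Pᵀ * Qᵀ) * gramIn β g * Q := by simp only [Matrix.mul_assoc]
        _ = P * ((gramIn β g)⁻¹ * gramIn β g) * Q := by
            rw [hQPt, Matrix.mul_one]; simp only [Matrix.mul_assoc]
        _ = 1 := by rw [Matrix.nonsing_inv_mul _ hg, Matrix.mul_one, hPQ]
    rw [traceWrt, hinv, e2 b]
    calc (P * (gramIn β g)⁻¹ * Pᵀ * (Qᵀ * gramIn β b * Q)).trace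
        = (P * ((gramIn β g)⁻¹ * (Pᵀ * Qᵀ) * gramIn β b * Q)).trace := by
          simp only [Matrix.mul_assoc]
      _ = ((gramIn β g)⁻¹ * gramIn β b * (Q * P)).trace := by
          rw [hQPt, Matrix.mul_one, Matrix.trace_mul_comm]; simp only [Matrix.mul_assoc]
      _ = _ := by rw [hQP, Matrix.mul_one]
  -- The inverse of a singular matrix is `0` by convention, and singularity does not depend on the
  -- basis, so both traces are `0`.
  · have hg' : ¬ IsUnit (gram g).det := by
      rw [isUnit_iff_ne_zero] at hg ⊢
      exact fun h => hg ((gdet_ne_zero_iff β g).1 h)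
    rw [traceWrt, Matrix.nonsing_inv_apply_not_isUnit _ hg,
      Matrix.nonsing_inv_apply_not_isUnit _ hg']
    simp

end

theorem gdet_pos {g : Bil V} (hs : ∀ v w, g v w = g w v) (hp : ∀ v, v ≠ 0 → 0 < g v v) :
    0 < gdet g := (gramIn_posDef (finBasis ℝ V) hs hp).det_pos

theorem traceWrt_add (g b b' : Bil V) : traceWrt g (b + b') = traceWrt g b + traceWrt g b' := by
  simp only [traceWrt, gram_eq_gramIn, gramIn_add, Matrix.mul_add, Matrix.trace_add]

theorem traceWrt_smul (g b : Bil V) (c : ℝ) : traceWrt g (c • b) = c * traceWrt g b := by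
  simp only [traceWrt, gram_eq_gramIn, gramIn_smul, Matrix.mul_smul, Matrix.trace_smul, smul_eq_mul]

theorem traceWrt_zero (g : Bil V) : traceWrt g 0 = 0 := by
  have := traceWrt_add g 0 0
  rw [add_zero] at this
  linarith

theorem traceWrt_smul_left (g b : Bil V) {c : ℝ} (hc : c ≠ 0) :
    traceWrt (c • g) b = c⁻¹ * traceWrt g b := by
  by_cases hg : IsUnit (gram g).det
  · have : (c • gram g)⁻¹ = c⁻¹ • (gram g)⁻¹ := by
      apply Matrix.inv_eq_left_inv
      rw [Matrix.smul_mul, Matrix.mul_smul, smul_smul, inv_mul_cancel₀ hc, one_smul,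
        Matrix.nonsing_inv_mul _ hg]
    have h2 : gram (c • g) = c • gram g := rfl
    rw [traceWrt, h2, this, Matrix.smul_mul, Matrix.trace_smul, smul_eq_mul, traceWrt]
  · have h2 : gram (c • g) = c • gram g := rfl
    have hg' : ¬ IsUnit (gram (c • g)).det := by
      rw [h2, Matrix.det_smul]
      rw [isUnit_iff_ne_zero] at hg ⊢
      simp only [ne_eq, mul_eq_zero, not_or, not_and_or, not_not] at hg ⊢
      exact Or.inr hg
    rw [traceWrt, traceWrt, Matrix.nonsing_inv_apply_not_isUnit _ hg,
      Matrix.nonsing_inv_apply_not_isUnit _ hg']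
    simp

theorem traceWrt_self {g : Bil V} (hg : gdet g ≠ 0) : traceWrt g g = finrank ℝ V := by
  rw [traceWrt, Matrix.nonsing_inv_mul _ (isUnit_iff_ne_zero.2 hg)]
  simp

theorem gdet_smul (c : ℝ) (g : Bil V) : gdet (c • g) = c ^ finrank ℝ V * gdet g := by
  have h2 : gram (c • g) = c • gram g := rfl
  rw [gdet, h2, Matrix.det_smul, Fintype.card_fin, gdet]

theorem finrank_real_eq : finrank ℝ V = 2 * finrank ℂ V := by
  rw [← finrank_mul_finrank ℝ ℂ V, Complex.finrank_real_complex]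

theorem traceWrt_pull (T : V ≃L[ℂ] V') (g b : Bil V') :
    traceWrt (pull g (T : V →L[ℂ] V')) (pull b (T : V →L[ℂ] V')) = traceWrt g b := by
  rw [traceWrt_eq ((finBasis ℝ V').map (T.symm.toLinearEquiv.restrictScalars ℝ)), gramIn_pull,
    gramIn_pull]
  rfl

theorem exists_gdet_pull (T : V ≃L[ℂ] V') :
    ∃ c : ℝ, 0 < c ∧ ∀ b : Bil V', gdet (pull b (T : V →L[ℂ] V')) = c * gdet b := by
  obtain ⟨c, hc, h⟩ := exists_gdet_eq
    ((finBasis ℝ V').map (T.symm.toLinearEquiv.restrictScalars ℝ))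
  refine ⟨c, hc, fun b => ?_⟩
  rw [h, gramIn_pull]; rfl

/-- The real determinant of a complex linear map is the squared modulus of its complex determinant,
and a Gram determinant involves it twice. Half the logarithm of a volume density thus changes by `2
log |det|`, which is pluriharmonic when `T` varies holomorphically. -/
theorem gdet_pull_endo (T : V →L[ℂ] V) (b : Bil V) :
    gdet (pull b T) = Complex.normSq (LinearMap.det (T : V →ₗ[ℂ] V)) ^ 2 * gdet b := by
  rw [gdet, gram_eq_gramIn, det_gramIn_endo, LinearMap.det_restrictScalars,
    Algebra.norm_complex_apply]
  rfl

/-- The orthogonal sum of two bilinear forms. -/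
def prodBil (b : Bil V) (b' : Bil V') : Bil (V × V') :=
  pull b (ContinuousLinearMap.fst ℂ V V') + pull b' (ContinuousLinearMap.snd ℂ V V')

theorem gramIn_prodBil {ι ι' : Type*} [Fintype ι] [DecidableEq ι] [Fintype ι'] [DecidableEq ι']
    (β : Basis ι ℝ V) (β' : Basis ι' ℝ V') (b : Bil V) (b' : Bil V') :
    gramIn (β.prod β') (prodBil b b') = Matrix.fromBlocks (gramIn β b) 0 0 (gramIn β' b') := by
  ext i j
  rcases i with i | i <;> rcases j with j | j <;> simp [gramIn, prodBil]

variable (V V') in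
theorem exists_gdet_prodBil :
    ∃ c : ℝ, 0 < c ∧ ∀ (b : Bil V) (b' : Bil V'), gdet (prodBil b b') = c * (gdet b * gdet b') := by
  obtain ⟨c, hc, h⟩ := exists_gdet_eq ((finBasis ℝ V).prod (finBasis ℝ V'))
  refine ⟨c, hc, fun b b' => ?_⟩
  rw [h, gramIn_prodBil, Matrix.det_fromBlocks_zero₁₂]
  rfl

theorem traceWrt_prodBil {g : Bil V} {g' : Bil V'} (hg : gdet g ≠ 0) (hg' : gdet g' ≠ 0)
    (b : Bil V) (b' : Bil V') :
    traceWrt (prodBil g g') (prodBil b b') = traceWrt g b + traceWrt g' b' := by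
  rw [traceWrt_eq ((finBasis ℝ V).prod (finBasis ℝ V')), gramIn_prodBil, gramIn_prodBil,
    ← gram_eq_gramIn, ← gram_eq_gramIn, ← gram_eq_gramIn, ← gram_eq_gramIn]
  have : (Matrix.fromBlocks (gram g) 0 0 (gram g'))⁻¹ =
      Matrix.fromBlocks (gram g)⁻¹ 0 0 (gram g')⁻¹ := by
    apply Matrix.inv_eq_left_inv
    rw [Matrix.fromBlocks_multiply]
    simp [Matrix.nonsing_inv_mul _ (isUnit_iff_ne_zero.2 hg),
      Matrix.nonsing_inv_mul _ (isUnit_iff_ne_zero.2 hg')]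
  rw [this, Matrix.fromBlocks_multiply]
  simp [traceWrt, Matrix.trace, Fintype.sum_sum_type]

end LinearAlgebraLemmas

theorem det_blockDiagonal_sigma {A : Type*} [Fintype A] [DecidableEq A] {ι : A → Type*}
    [∀ a, Fintype (ι a)] [∀ a, DecidableEq (ι a)] (N : ∀ a, Matrix (ι a) (ι a) ℝ) :
    (Matrix.blockDiagonal' N).det = ∏ a, (N a).det := by
  -- The determinant formula for block triangular matrices needs an order on the blocks; any order
  -- will do.
  let _ : LinearOrder A := LinearOrder.lift' (Fintype.equivFin A) (Fintype.equivFin A).injective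
  rw [(Matrix.blockTriangular_blockDiagonal' N).det_fintype]
  refine Finset.prod_congr rfl fun a _ => ?_
  let e : ι a ≃ {i : Σ a, ι a // i.1 = a} :=
    { toFun := fun j => ⟨⟨a, j⟩, rfl⟩
      invFun := fun i => i.2 ▸ i.1.2
      left_inv := fun j => rfl
      right_inv := by rintro ⟨⟨b, j⟩, h⟩; subst h; rfl }
  rw [← Matrix.det_submatrix_equiv_self e]
  congr 1
  ext i j
  simp [Matrix.toSquareBlock_def, e]

/-! ### Orthogonal sums over a finite family of factors. -/

section PiForms

variable {A : Type*} [Fintype A] {W : A → Type*} [∀ a, NormedAddCommGroup (W a)]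
  [∀ a, NormedSpace ℂ (W a)]

/-- The orthogonal sum of a finite family of bilinear forms. -/
def piBil (b : ∀ a, Bil (W a)) : Bil (∀ a, W a) :=
  ∑ a, pull (b a) (ContinuousLinearMap.proj (R := ℂ) (φ := W) a)

theorem piBil_apply (b : ∀ a, Bil (W a)) (v w : ∀ a, W a) :
    piBil b v w = ∑ a, b a (v a) (w a) := by
  simp [piBil]

theorem piBil_add (b b' : ∀ a, Bil (W a)) : piBil (fun a => b a + b' a) = piBil b + piBil b' := by
  simp [piBil, pull_add, Finset.sum_add_distrib]

theorem piBil_smul (c : ℝ) (b : ∀ a, Bil (W a)) : piBil (fun a => c • b a) = c • piBil b := by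
  simp [piBil, pull_smul, Finset.smul_sum]

variable [∀ a, FiniteDimensional ℂ (W a)]

theorem gramIn_piBil [DecidableEq A] {ι : A → Type*} [∀ a, Fintype (ι a)] [∀ a, DecidableEq (ι a)]
    (β : ∀ a, Basis (ι a) ℝ (W a)) (b : ∀ a, Bil (W a)) :
    gramIn (Pi.basis β) (piBil b) = Matrix.blockDiagonal' fun a => gramIn (β a) (b a) := by
  ext ⟨i, i'⟩ ⟨j, j'⟩
  simp only [gramIn, Matrix.of_apply, piBil_apply, Pi.basis_apply, Matrix.blockDiagonal'_apply]
  split_ifs with h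
  · subst h
    rw [Finset.sum_eq_single i]
    · simp
    · intro k _ hk
      rw [Pi.single_eq_of_ne hk]; simp
    · simp
  · refine Finset.sum_eq_zero fun k _ => ?_
    by_cases hk : k = i
    · subst hk
      rw [Pi.single_eq_of_ne (i := j) h]; simp
    · rw [Pi.single_eq_of_ne hk]; simp

variable (W) in
theorem exists_gdet_piBil :
    ∃ c : ℝ, 0 < c ∧ ∀ b : ∀ a, Bil (W a), gdet (piBil b) = c * ∏ a, gdet (b a) := by
  classical
  obtain ⟨c, hc, h⟩ := exists_gdet_eq (Pi.basis fun a => finBasis ℝ (W a))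
  refine ⟨c, hc, fun b => ?_⟩
  rw [h, gramIn_piBil, det_blockDiagonal_sigma]
  rfl

theorem traceWrt_piBil {g : ∀ a, Bil (W a)} (hg : ∀ a, gdet (g a) ≠ 0) (b : ∀ a, Bil (W a)) :
    traceWrt (piBil g) (piBil b) = ∑ a, traceWrt (g a) (b a) := by
  classical
  rw [traceWrt_eq (Pi.basis fun a => finBasis ℝ (W a)), gramIn_piBil, gramIn_piBil]
  have : (Matrix.blockDiagonal' fun a => gramIn (finBasis ℝ (W a)) (g a))⁻¹ =
      Matrix.blockDiagonal' fun a => (gramIn (finBasis ℝ (W a)) (g a))⁻¹ := by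
    apply Matrix.inv_eq_left_inv
    rw [← Matrix.blockDiagonal'_mul]
    rw [← Matrix.blockDiagonal'_one]
    congr 1
    ext1 a
    exact Matrix.nonsing_inv_mul _ (isUnit_iff_ne_zero.2 (hg a))
  rw [this, ← Matrix.blockDiagonal'_mul, Matrix.trace_blockDiagonal']
  rfl

end PiForms

end WeightedExtremal
end


noncomputable section

namespace WeightedExtremal

open Module Filter Topology

/-! ### Calculus of `dd^c` and of pulled-back tensors on complex vector spaces. -/

section FlatCalculus

variable {V V' : Type*} [NormedAddCommGroup V] [NormedSpace ℂ V]
  [NormedAddCommGroup V'] [NormedSpace ℂ V']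

theorem ddcFlat_apply (F : V → ℝ) (u v w : V) :
    ddcFlat F u v w = fderiv ℝ (fderiv ℝ F) u v w
      + fderiv ℝ (fderiv ℝ F) u (Complex.I • v) (Complex.I • w) := rfl

theorem ddcFlat_congr {F F' : V → ℝ} {u : V} (h : F =ᶠ[𝓝 u] F') : ddcFlat F u = ddcFlat F' u := by
  simp only [ddcFlat, h.fderiv.fderiv_eq]

theorem ContDiffAt.differentiableAt_fderiv {F : V → ℝ} {u : V} (hF : ContDiffAt ℝ 2 F u) :
    DifferentiableAt ℝ (fderiv ℝ F) u :=
  (hF.fderiv_right (m := 1) (by norm_num)).differentiableAt (by norm_num)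

theorem ContDiffAt.eventually_differentiableAt {F : V → ℝ} {u : V} (hF : ContDiffAt ℝ 2 F u) :
    ∀ᶠ y in 𝓝 u, DifferentiableAt ℝ F y :=
  (hF.eventually (by simp)).mono fun _ hy => hy.differentiableAt (by norm_num)

theorem ddcFlat_add {F F' : V → ℝ} {u : V} (hF : ContDiffAt ℝ 2 F u) (hF' : ContDiffAt ℝ 2 F' u) :
    ddcFlat (fun y => F y + F' y) u = ddcFlat F u + ddcFlat F' u := by
  have h : fderiv ℝ (fun y => F y + F' y) =ᶠ[𝓝 u] fun y => fderiv ℝ F y + fderiv ℝ F' y := by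
    filter_upwards [ContDiffAt.eventually_differentiableAt hF,
      ContDiffAt.eventually_differentiableAt hF'] with y h1 h2
    exact fderiv_fun_add h1 h2
  have h2 : fderiv ℝ (fderiv ℝ fun y => F y + F' y) u =
      fderiv ℝ (fderiv ℝ F) u + fderiv ℝ (fderiv ℝ F') u := by
    rw [h.fderiv_eq]
    exact fderiv_fun_add (ContDiffAt.differentiableAt_fderiv hF)
      (ContDiffAt.differentiableAt_fderiv hF')
  ext v w
  simp only [ddcFlat_apply, h2, _root_.add_apply]
  ring

theorem ddcFlat_const_mul {F : V → ℝ} {u : V} (hF : ContDiffAt ℝ 2 F u) (c : ℝ) :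
    ddcFlat (fun y => c * F y) u = c • ddcFlat F u := by
  have h : fderiv ℝ (fun y => c * F y) =ᶠ[𝓝 u] fun y => c • fderiv ℝ F y := by
    filter_upwards [ContDiffAt.eventually_differentiableAt hF] with y h1
    exact fderiv_const_mul h1 c
  have h2 : fderiv ℝ (fderiv ℝ fun y => c * F y) u = c • fderiv ℝ (fderiv ℝ F) u := by
    rw [h.fderiv_eq]
    exact fderiv_fun_const_smul (ContDiffAt.differentiableAt_fderiv hF) c
  ext v w
  simp only [ddcFlat_apply, h2, _root_.smul_apply, smul_eq_mul]
  ring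

theorem ddcFlat_const (c : ℝ) (u : V) : ddcFlat (fun _ : V => c) u = 0 := by
  have h : fderiv ℝ (fun _ : V => c) = fun _ => 0 := by ext1 y; exact fderiv_const_apply c
  ext v w
  simp [ddcFlat_apply, h]

theorem ddcFlat_sub {F F' : V → ℝ} {u : V} (hF : ContDiffAt ℝ 2 F u) (hF' : ContDiffAt ℝ 2 F' u) :
    ddcFlat (fun y => F y - F' y) u = ddcFlat F u - ddcFlat F' u := by
  have h := ddcFlat_add hF ((contDiffAt_const (c := (-1 : ℝ))).mul hF')
  rw [ddcFlat_const_mul hF' (-1)] at h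
  have e : (fun y => F y - F' y) = fun y => F y + -1 * F' y := by ext y; ring
  rw [e, h, neg_one_smul, sub_eq_add_neg]

theorem ddcFlat_symm {F : V → ℝ} {u : V} (hF : ContDiffAt ℝ 2 F u) (v w : V) :
    ddcFlat F u v w = ddcFlat F u w v := by
  have h := hF.isSymmSndFDerivAt (by simp)
  rw [ddcFlat_apply, ddcFlat_apply, h.eq v w, h.eq (Complex.I • v)]

theorem I_smul_I_smul (v : V) : Complex.I • Complex.I • v = -v := by
  rw [smul_smul, Complex.I_mul_I, neg_one_smul]

theorem ddcFlat_invariant (F : V → ℝ) (u v w : V) :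
    ddcFlat F u (Complex.I • v) (Complex.I • w) = ddcFlat F u v w := by
  simp only [ddcFlat_apply, I_smul_I_smul, map_neg, _root_.neg_apply, neg_neg]
  ring

theorem fderiv_real_eq {h : V → V'} {u : V} (hh : DifferentiableAt ℂ h u) :
    fderiv ℝ h u = (fderiv ℂ h u).restrictScalars ℝ :=
  (hh.hasFDerivAt.restrictScalars ℝ).fderiv

theorem ContDiffAt.fderiv_hol {h : V → V'} {u : V} (hh : ContDiffAt ℂ ω h u) :
    ContDiffAt ℂ ω (fderiv ℂ h) u := hh.fderiv_right (by simp)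

theorem ContDiffAt.real_of_hol {h : V → V'} {u : V} (hh : ContDiffAt ℂ ω h u) {n : WithTop ℕ∞} :
    ContDiffAt ℝ n h u := (hh.restrict_scalars ℝ).of_le le_top

theorem ContDiffAt.eventually_hol {h : V → V'} {u : V} (hh : ContDiffAt ℂ ω h u) :
    ∀ᶠ y in 𝓝 u, ContDiffAt ℂ ω h y := hh.eventually (by simp)

theorem ContDiffAt.differentiableAt_hol {h : V → V'} {u : V} (hh : ContDiffAt ℂ ω h u) :
    DifferentiableAt ℂ h u := hh.differentiableAt (by simp)

theorem fderiv_fderiv_comp {F : V' → ℝ} {h : V → V'} {u : V} (hF : ContDiffAt ℝ 2 F (h u))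
    (hh : ContDiffAt ℂ ω h u) (v w : V) :
    fderiv ℝ (fderiv ℝ (F ∘ h)) u v w =
      fderiv ℝ (fderiv ℝ F) (h u) (fderiv ℂ h u v) (fderiv ℂ h u w)
        + fderiv ℝ F (h u) (fderiv ℂ (fderiv ℂ h) u v w) := by
  have hFh : ContDiffAt ℝ 2 (F ∘ h) u := hF.comp u (ContDiffAt.real_of_hol hh)
  have hd := ContDiffAt.differentiableAt_fderiv hFh
  have e1 : fderiv ℝ (fun y => fderiv ℝ (F ∘ h) y w) u v = fderiv ℝ (fderiv ℝ (F ∘ h)) u v w := by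
    have := (hd.hasFDerivAt.clm_apply (hasFDerivAt_const w u)).fderiv
    rw [this]; simp
  rw [← e1]
  have hev : (fun y => fderiv ℝ (F ∘ h) y w) =ᶠ[𝓝 u]
      fun y => fderiv ℝ F (h y) (fderiv ℂ h y w) := by
    filter_upwards [hh.continuousAt.eventually (ContDiffAt.eventually_differentiableAt hF),
      ContDiffAt.eventually_hol hh] with y h1 h2
    have h3 := ContDiffAt.differentiableAt_hol h2
    rw [fderiv_comp y h1 (h3.restrictScalars ℝ), fderiv_real_eq h3]
    rfl
  rw [hev.fderiv_eq]
  have h1 : HasFDerivAt (fun y => fderiv ℝ F (h y))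
      ((fderiv ℝ (fderiv ℝ F) (h u)).comp ((fderiv ℂ h u).restrictScalars ℝ)) u :=
    (ContDiffAt.differentiableAt_fderiv hF).hasFDerivAt.comp u
      ((ContDiffAt.differentiableAt_hol hh).hasFDerivAt.restrictScalars ℝ)
  have h2 : HasFDerivAt (fun y => fderiv ℂ h y w) _ u :=
    ((ContDiffAt.differentiableAt_hol (ContDiffAt.fderiv_hol hh)).hasFDerivAt.clm_apply
      (hasFDerivAt_const w u)).restrictScalars ℝ
  rw [(h1.clm_apply h2).fderiv]
  simp
  ring

/-- The second derivative of a holomorphic map is complex bilinear, so its values at `(v, w)` and at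
`(i v, i w)` are opposite and cancel in `dd^c`. -/
theorem ddcFlat_comp_hol {F : V' → ℝ} {h : V → V'} {u : V} (hF : ContDiffAt ℝ 2 F (h u))
    (hh : ContDiffAt ℂ ω h u) :
    ddcFlat (fun y => F (h y)) u = pull (ddcFlat F (h u)) (fderiv ℂ h u) := by
  ext v w
  have := fderiv_fderiv_comp hF hh
  simp only [Function.comp_def] at this
  simp only [ddcFlat_apply, pull_apply, this, map_smul, _root_.smul_apply,
    I_smul_I_smul, map_neg]
  ring

/-- The rank-one term `H'' dτ ⊗ dτ` of the Hessian and its transform under `J` produce the two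
squares. This is how the vertical part of the ansatz arises from a potential. -/
theorem ddcFlat_real_comp {H : ℝ → ℝ} {τ : V → ℝ} {u : V} (hH : ContDiffAt ℝ 2 H (τ u))
    (hτ : ContDiffAt ℝ 2 τ u) :
    ddcFlat (fun y => H (τ y)) u = deriv H (τ u) • ddcFlat τ u
      + deriv (deriv H) (τ u) • (sq (fderiv ℝ τ u) + sq (jmul (fderiv ℝ τ u))) := by
  have hdH : DifferentiableAt ℝ (deriv H) (τ u) := by
    have h1 := (ContDiffAt.fderiv_right (m := 1) hH (by norm_num)).differentiableAt
      (by norm_num)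
    have : deriv H = fun t => fderiv ℝ H t 1 := by ext t; simp
    rw [this]
    exact h1.clm_apply (differentiableAt_const _)
  have hev : fderiv ℝ (fun y => H (τ y)) =ᶠ[𝓝 u] fun y => deriv H (τ y) • fderiv ℝ τ y := by
    have hH1 : ∀ᶠ t in 𝓝 (τ u), DifferentiableAt ℝ H t :=
      (hH.eventually (by simp)).mono fun _ hy => hy.differentiableAt (by norm_num)
    filter_upwards [hτ.continuousAt.eventually hH1,
      ContDiffAt.eventually_differentiableAt hτ] with y h1 h2
    exact (h1.hasDerivAt.comp_hasFDerivAt y h2.hasFDerivAt).fderiv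
  have key : fderiv ℝ (fderiv ℝ fun y => H (τ y)) u =
      deriv H (τ u) • fderiv ℝ (fderiv ℝ τ) u
        + (deriv (deriv H) (τ u) • fderiv ℝ τ u).smulRight (fderiv ℝ τ u) := by
    rw [hev.fderiv_eq]
    exact ((hdH.hasDerivAt.comp_hasFDerivAt u
      (hτ.differentiableAt (by norm_num)).hasFDerivAt).smul
      (ContDiffAt.differentiableAt_fderiv hτ).hasFDerivAt).fderiv
  ext v w
  simp only [ddcFlat_apply, key, _root_.add_apply, _root_.smul_apply,
    ContinuousLinearMap.smulRight_apply, sq_apply, jmul_apply, smul_eq_mul]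
  ring

/-- The function `Re` on `ℂ` is real linear and has no Hessian; naturality under holomorphic maps
does the rest. -/
theorem ddcFlat_re_comp {f : V → ℂ} {u : V} (hf : ContDiffAt ℂ ω f u) :
    ddcFlat (fun y => (f y).re) u = 0 := by
  have hre : ContDiff ℝ 2 Complex.re := Complex.reCLM.contDiff
  rw [ddcFlat_comp_hol (F := Complex.re) hre.contDiffAt hf]
  have : fderiv ℝ Complex.re = fun _ => Complex.reCLM := by
    ext1 z; exact Complex.reCLM.fderiv
  ext v w
  simp [ddcFlat_apply, this]

/-- The logarithm of the modulus of a holomorphic function is pluriharmonic. -/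
theorem ddcFlat_log_norm {f : V → ℂ} {u : V} (hf : ContDiffAt ℂ ω f u) (h0 : f u ≠ 0) :
    ddcFlat (fun y => Real.log ‖f y‖) u = 0 := by
  -- Dividing by `f u` moves the value at `u` to `1`, well inside the domain where the principal
  -- logarithm is holomorphic.
  have hq : ContDiffAt ℂ ω (fun y => f y / f u) u := by
    simpa only [div_eq_mul_inv] using hf.mul contDiffAt_const
  have hl : ContDiffAt ℂ ω (fun y => Complex.log (f y / f u)) u := by
    exact (hq.analyticAt.clog (by simp [h0])).contDiffAt
  have hev : (fun y => Real.log ‖f y‖) =ᶠ[𝓝 u]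
      fun y => Real.log ‖f u‖ + (Complex.log (f y / f u)).re := by
    filter_upwards [hf.continuousAt.eventually_ne h0] with y hy
    rw [Complex.log_re, norm_div, Real.log_div (by simpa using hy) (by simpa using h0)]
    ring
  rw [ddcFlat_congr hev, ddcFlat_add contDiffAt_const, ddcFlat_const, ddcFlat_re_comp hl, zero_add]
  exact Complex.reCLM.contDiff.contDiffAt.comp u (ContDiffAt.real_of_hol hl)

/-! Derivatives of pulled back tensors. -/

theorem contDiffAt_pull {X : Type*} [NormedAddCommGroup X] [NormedSpace ℝ X] {n : WithTop ℕ∞}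
    {b : X → Bil V'} {T : X → V →L[ℂ] V'} {x : X} (hb : ContDiffAt ℝ n b x)
    (hT : ContDiffAt ℝ n T x) : ContDiffAt ℝ n (fun y => pull (b y) (T y)) x := by
  have hT' : ContDiffAt ℝ n (fun y => (T y).restrictScalars ℝ) x :=
    (ContinuousLinearMap.restrictScalarsL ℂ V V' ℝ ℝ).contDiff.contDiffAt.comp x hT
  have h1 : ContDiffAt ℝ n (fun y => (b y).comp ((T y).restrictScalars ℝ)) x := hb.clm_comp hT'
  have h2 : ContDiffAt ℝ n (fun y => ((b y).comp ((T y).restrictScalars ℝ)).flip) x :=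
    (ContinuousLinearMap.flipₗᵢ ℝ V V' ℝ).toContinuousLinearEquiv.contDiff.contDiffAt.comp x h1
  have h3 := h2.clm_comp hT'
  exact (ContinuousLinearMap.flipₗᵢ ℝ V V ℝ).contDiff.contDiffAt.comp x h3

theorem fderiv_bil_apply {G : V → Bil V} {u : V} (hG : DifferentiableAt ℝ G u) (v a b : V) :
    fderiv ℝ (fun y => G y a b) u v = fderiv ℝ G u v a b := by
  have h := ((hG.hasFDerivAt.clm_apply (hasFDerivAt_const a u)).clm_apply
    (hasFDerivAt_const b u)).fderiv
  rw [h]; simp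

theorem differentiableAt_pull_comp {G : V' → Bil V'} {h : V → V'} {u : V}
    (hG : DifferentiableAt ℝ G (h u)) (hh : ContDiffAt ℂ ω h u) :
    DifferentiableAt ℝ (fun y => pull (G (h y)) (fderiv ℂ h y)) u := by
  have h0 : DifferentiableAt ℝ h u := (ContDiffAt.differentiableAt_hol hh).restrictScalars ℝ
  have h1 : DifferentiableAt ℝ (fun y => (fderiv ℂ h y).restrictScalars ℝ) u :=
    (ContinuousLinearMap.restrictScalarsL ℂ V V' ℝ ℝ).differentiableAt.comp u
      ((ContDiffAt.differentiableAt_hol (ContDiffAt.fderiv_hol hh)).restrictScalars ℝ)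
  have h2 : DifferentiableAt ℝ (fun y => G (h y)) u := hG.comp u h0
  have h3 : DifferentiableAt ℝ (fun y => ((G (h y)).comp ((fderiv ℂ h y).restrictScalars ℝ)).flip) u :=
    (ContinuousLinearMap.flipₗᵢ ℝ V V' ℝ).differentiableAt.comp u (h2.clm_comp h1)
  exact (ContinuousLinearMap.flipₗᵢ ℝ V V ℝ).differentiableAt.comp u (h3.clm_comp h1)

theorem fderiv_pull_comp {G : V' → Bil V'} {h : V → V'} {u : V}
    (hG : DifferentiableAt ℝ G (h u)) (hh : ContDiffAt ℂ ω h u) (v a b : V) :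
    fderiv ℝ (fun y => pull (G (h y)) (fderiv ℂ h y)) u v a b =
      fderiv ℝ G (h u) (fderiv ℂ h u v) (fderiv ℂ h u a) (fderiv ℂ h u b)
        + G (h u) (fderiv ℂ (fderiv ℂ h) u v a) (fderiv ℂ h u b)
        + G (h u) (fderiv ℂ h u a) (fderiv ℂ (fderiv ℂ h) u v b) := by
  rw [← fderiv_bil_apply (differentiableAt_pull_comp hG hh)]
  simp only [pull_apply]
  have h1 : HasFDerivAt (fun y => G (h y))
      ((fderiv ℝ G (h u)).comp ((fderiv ℂ h u).restrictScalars ℝ)) u :=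
    hG.hasFDerivAt.comp u ((ContDiffAt.differentiableAt_hol hh).hasFDerivAt.restrictScalars ℝ)
  have h2 : ∀ w, HasFDerivAt (fun y => fderiv ℂ h y w) _ u := fun w =>
    ((ContDiffAt.differentiableAt_hol (ContDiffAt.fderiv_hol hh)).hasFDerivAt.clm_apply
      (hasFDerivAt_const w u)).restrictScalars ℝ
  rw [((h1.clm_apply (h2 a)).clm_apply (h2 b)).fderiv]
  simp
  ring

/-- Closedness at a point of the form `ω(v, w) = G(J v, w)`. -/
def ClosedAt (G : V → Bil V) (u : V) : Prop :=
  ∀ v₁ v₂ v₃, fderiv ℝ G u v₁ (Complex.I • v₂) v₃ + fderiv ℝ G u v₂ (Complex.I • v₃) v₁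
      + fderiv ℝ G u v₃ (Complex.I • v₁) v₂ = 0

theorem ClosedAt.add {G G' : V → Bil V} {u : V} (hG : ClosedAt G u) (hG' : ClosedAt G' u)
    (h : DifferentiableAt ℝ G u) (h' : DifferentiableAt ℝ G' u) :
    ClosedAt (fun y => G y + G' y) u := by
  intro v₁ v₂ v₃
  rw [fderiv_fun_add h h']
  have := hG v₁ v₂ v₃
  have := hG' v₁ v₂ v₃
  simp only [_root_.add_apply]
  linarith

theorem ClosedAt.const_smul {G : V → Bil V} {u : V} (hG : ClosedAt G u)
    (h : DifferentiableAt ℝ G u) (c : ℝ) : ClosedAt (fun y => c • G y) u := by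
  intro v₁ v₂ v₃
  rw [fderiv_fun_const_smul h c]
  have := hG v₁ v₂ v₃
  simp only [_root_.smul_apply, smul_eq_mul, ← mul_add, this, mul_zero]

theorem ClosedAt.sum {ι : Type*} {s : Finset ι} {G : ι → V → Bil V} {u : V}
    (hG : ∀ i ∈ s, ClosedAt (G i) u) (h : ∀ i ∈ s, DifferentiableAt ℝ (G i) u) :
    ClosedAt (fun y => ∑ i ∈ s, G i y) u := by
  intro v₁ v₂ v₃
  rw [fderiv_fun_sum h]
  simp only [_root_.sum_apply, ← Finset.sum_add_distrib]
  exact Finset.sum_eq_zero fun i hi => hG i hi v₁ v₂ v₃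

/-- Apart from the pulled-back closedness relation, the cyclic sum contains six terms with second
derivatives of `h`. They cancel in pairs, `D²h` being symmetric and `(v, w) ↦ G (i v) w`
antisymmetric. -/
theorem ClosedAt.pull_comp {G : V' → Bil V'} {h : V → V'} {u : V} (hc : ClosedAt G (h u))
    (hG : DifferentiableAt ℝ G (h u)) (hs : ∀ v w, G (h u) v w = G (h u) w v)
    (hi : ∀ v w, G (h u) (Complex.I • v) (Complex.I • w) = G (h u) v w)
    (hh : ContDiffAt ℂ ω h u) : ClosedAt (fun y => pull (G (h y)) (fderiv ℂ h y)) u := by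
  intro v₁ v₂ v₃
  have hsym : ∀ v w, fderiv ℂ (fderiv ℂ h) u v w = fderiv ℂ (fderiv ℂ h) u w v :=
    (hh.isSymmSndFDerivAt (by simp)).eq
  have hanti : ∀ v w, G (h u) (Complex.I • v) w = -G (h u) (Complex.I • w) v := by
    intro v w
    rw [← hi, I_smul_I_smul, hs]; simp
  simp only [fderiv_pull_comp hG hh, map_smul]
  have h0 := hc (fderiv ℂ h u v₁) (fderiv ℂ h u v₂) (fderiv ℂ h u v₃)
  have a1 := hanti (fderiv ℂ (fderiv ℂ h) u v₁ v₂) (fderiv ℂ h u v₃)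
  have a2 := hanti (fderiv ℂ (fderiv ℂ h) u v₂ v₃) (fderiv ℂ h u v₁)
  have a3 := hanti (fderiv ℂ (fderiv ℂ h) u v₃ v₁) (fderiv ℂ h u v₂)
  rw [hsym v₁ v₃, hsym v₂ v₁, hsym v₃ v₂]
  linarith

/-- The cyclic sum consists of six third derivatives of `F`, each with one argument multiplied by
`i`, which cancel in pairs by the total symmetry of the third derivative. -/
theorem closedAt_ddcFlat {F : V → ℝ} {u : V} (hF : ContDiffAt ℝ ∞ F u) : ClosedAt (ddcFlat F) u := by
  have hF3 : ContDiffAt ℝ 3 F u := hF.of_le (by norm_cast)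
  have h2 : ContDiffAt ℝ 2 (fderiv ℝ F) u := hF3.fderiv_right (by norm_num)
  have h1 : ContDiffAt ℝ 1 (fderiv ℝ (fderiv ℝ F)) u := h2.fderiv_right (by norm_num)
  have hd : DifferentiableAt ℝ (fderiv ℝ (fderiv ℝ F)) u := h1.differentiableAt (by norm_num)
  set T := fderiv ℝ (fderiv ℝ (fderiv ℝ F)) u with hT
  have s12 : ∀ a b c, T a b c = T b a c := fun a b c => by
    have := (h2.isSymmSndFDerivAt (by simp)).eq a b
    rw [hT, this]
  have s23 : ∀ a b c, T a b c = T a c b := fun a b c => by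
    rw [hT, ← fderiv_bil_apply hd, ← fderiv_bil_apply hd]
    have : (fun y => fderiv ℝ (fderiv ℝ F) y b c) =ᶠ[𝓝 u]
        fun y => fderiv ℝ (fderiv ℝ F) y c b := by
      filter_upwards [(hF3.of_le (by norm_num : (2 : WithTop ℕ∞) ≤ 3)).eventually (by simp)]
        with y hy
      exact (hy.isSymmSndFDerivAt (by simp)).eq b c
    rw [this.fderiv_eq]
  have hdd : DifferentiableAt ℝ (ddcFlat F) u := by
    refine DifferentiableAt.add hd ?_
    exact (contDiffAt_pull h1 contDiffAt_const).differentiableAt (by norm_num)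
  have key : ∀ a b c, fderiv ℝ (ddcFlat F) u a b c =
      T a b c + T a (Complex.I • b) (Complex.I • c) := by
    intro a b c
    rw [← fderiv_bil_apply hdd]
    simp only [ddcFlat_apply]
    rw [fderiv_fun_add]
    · simp only [_root_.add_apply]
      rw [fderiv_bil_apply hd, fderiv_bil_apply hd]
    · exact (hd.clm_apply (differentiableAt_const _)).clm_apply (differentiableAt_const _)
    · exact (hd.clm_apply (differentiableAt_const _)).clm_apply (differentiableAt_const _)
  intro v₁ v₂ v₃
  simp only [key, I_smul_I_smul, map_neg, _root_.neg_apply]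
  have e1 := s12 v₁ (Complex.I • v₂) v₃
  have e2 := s23 (Complex.I • v₂) v₁ v₃
  have e3 := s12 (Complex.I • v₂) v₃ v₁
  have e4 := s23 v₃ (Complex.I • v₂) v₁
  have f1 := s12 v₁ v₂ (Complex.I • v₃)
  have f2 := s23 v₂ v₁ (Complex.I • v₃)
  have g1 := s12 v₂ v₃ (Complex.I • v₁)
  have g2 := s23 v₃ v₂ (Complex.I • v₁)
  linarith

theorem contDiffAt_ddcFlat {F : V → ℝ} {u : V} (hF : ContDiffAt ℝ ∞ F u) :
    ContDiffAt ℝ ∞ (ddcFlat F) u := by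
  have h1 : ContDiffAt ℝ ∞ (fderiv ℝ (fderiv ℝ F)) u :=
    (hF.fderiv_right (m := ∞) (by simp)).fderiv_right (m := ∞) (by simp)
  exact h1.add (contDiffAt_pull h1 contDiffAt_const)

end FlatCalculus

end WeightedExtremal
end


noncomputable section

namespace WeightedExtremal

open Module Filter Topology

/-! ### Regularity and biholomorphic invariance of the scalar curvature. -/

section ScalarCurvature

variable {V V' : Type*} [NormedAddCommGroup V] [NormedSpace ℂ V]
  [NormedAddCommGroup V'] [NormedSpace ℂ V'] [FiniteDimensional ℂ V] [FiniteDimensional ℂ V']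

theorem gdet_eq_sum (b : Bil V) : gdet b = ∑ σ : Equiv.Perm (Fin (finrank ℝ V)),
    (Equiv.Perm.sign σ : ℤ) * ∏ i, b (finBasis ℝ V (σ i)) (finBasis ℝ V i) := by
  rw [gdet, Matrix.det_apply']
  rfl

theorem contDiff_gdet {n : WithTop ℕ∞} : ContDiff ℝ n (gdet : Bil V → ℝ) := by
  have : (gdet : Bil V → ℝ) = fun b => ∑ σ : Equiv.Perm (Fin (finrank ℝ V)),
    ((Equiv.Perm.sign σ : ℤ) : ℝ) * ∏ i, b (finBasis ℝ V (σ i)) (finBasis ℝ V i) :=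
    funext gdet_eq_sum
  rw [this]
  refine ContDiff.sum fun σ _ => contDiff_const.mul (contDiff_prod fun i _ => ?_)
  exact (contDiff_id.clm_apply contDiff_const).clm_apply contDiff_const

/-- The adjugate exhibits the trace as a polynomial divided by a determinant. Its continuity, needed
for the density arguments, is then immediate. -/
theorem traceWrt_eq_adjugate (g b : Bil V) :
    traceWrt g b = (gdet g)⁻¹ * ((gram g).adjugate * gram b).trace := by
  rw [traceWrt, Matrix.inv_def, Ring.inverse_eq_inv', Matrix.smul_mul, Matrix.trace_smul,
    smul_eq_mul, gdet]

theorem continuous_gram : Continuous (gram : Bil V → _) := by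
  refine continuous_matrix fun i j => ?_
  exact (continuous_id.clm_apply continuous_const).clm_apply continuous_const

theorem continuousAt_traceWrt {X : Type*} [TopologicalSpace X] {g b : X → Bil V} {x : X}
    (hg : ContinuousAt g x) (hb : ContinuousAt b x) (h0 : gdet (g x) ≠ 0) :
    ContinuousAt (fun y => traceWrt (g y) (b y)) x := by
  simp only [traceWrt_eq_adjugate]
  have h1 : ContinuousAt (fun y => gdet (g y)) x :=
    (contDiff_gdet (n := 0)).continuous.continuousAt.comp hg
  refine (h1.inv₀ h0).mul ?_
  have h2 : Continuous fun p : Bil V × Bil V => ((gram p.1).adjugate * gram p.2).trace :=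
    ((continuous_gram.comp continuous_fst).matrix_adjugate.matrix_mul
      (continuous_gram.comp continuous_snd)).matrix_trace
  exact h2.continuousAt.comp (f := fun y => (g y, b y)) (hg.prodMk hb)

theorem contDiffAt_det_clm {n : WithTop ℕ∞} (T : V →L[ℂ] V) :
    ContDiffAt ℂ n (fun T : V →L[ℂ] V => LinearMap.det (T : V →ₗ[ℂ] V)) T := by
  have : (fun T : V →L[ℂ] V => LinearMap.det (T : V →ₗ[ℂ] V)) =
      fun T => ∑ σ : Equiv.Perm (Fin (finrank ℂ V)), ((Equiv.Perm.sign σ : ℤ) : ℂ) *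
        ∏ i, (LinearMap.toContinuousLinearMap ((finBasis ℂ V).coord (σ i))) (T (finBasis ℂ V i)) := by
    ext T
    rw [← LinearMap.det_toMatrix (finBasis ℂ V), Matrix.det_apply']
    simp [LinearMap.toMatrix_apply]
  rw [this]
  refine ContDiffAt.sum fun σ _ => contDiffAt_const.mul (contDiffAt_prod fun i _ => ?_)
  exact (ContinuousLinearMap.contDiff _).contDiffAt.comp T
    (contDiffAt_id.clm_apply contDiffAt_const)

theorem scalFlat_eq (G : V → Bil V) (u : V) :
    scalFlat G u = -(1 / 2) * traceWrt (G u) (ddcFlat (fun y => 1 / 2 * Real.log (gdet (G y))) u) :=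
  rfl

theorem scalFlat_congr {G G' : V → Bil V} {u : V} (h : G =ᶠ[𝓝 u] G') :
    scalFlat G u = scalFlat G' u := by
  rw [scalFlat_eq, scalFlat_eq, h.eq_of_nhds]
  congr 2
  refine ddcFlat_congr ?_
  filter_upwards [h] with y hy
  rw [hy]

/-- The scalar curvature is invariant under biholomorphisms. -/
theorem scalFlat_pull {h : V → V'} {G : V → Bil V} {G' : V' → Bil V'} {u : V}
    (hh : ContDiffAt ℂ ω h u) (e : V ≃L[ℂ] V') (he : (e : V →L[ℂ] V') = fderiv ℂ h u)
    (hG' : ContDiffAt ℝ ∞ G' (h u)) (hdet : 0 < gdet (G' (h u)))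
    (hG : G =ᶠ[𝓝 u] fun y => pull (G' (h y)) (fderiv ℂ h y)) :
    scalFlat G u = scalFlat G' (h u) := by
  obtain ⟨c, hc, hcdet⟩ := exists_gdet_pull e
  -- The differential of `h` goes between different spaces and has no determinant. Composing with
  -- the inverse of its value at `u` gives endomorphisms `E y` with `E u = id`, holomorphic in `y`.
  let E : V → V →L[ℂ] V := fun y => (e.symm : V' →L[ℂ] V).comp (fderiv ℂ h y)
  have hE : ContDiffAt ℂ ω E u := contDiffAt_const.clm_comp (ContDiffAt.fderiv_hol hh)
  let f : V → ℂ := fun y => LinearMap.det (E y : V →ₗ[ℂ] V)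
  have hf : ContDiffAt ℂ ω f u := (contDiffAt_det_clm (E u)).comp u hE
  have hf0 : f u ≠ 0 := by
    have : (E u : V →ₗ[ℂ] V) = LinearMap.id := by
      ext v; simp [E, ← he]
    simp [f, this]
  have hGd : ContDiffAt ℝ 2 (fun y => gdet (G' y)) (h u) :=
    contDiff_gdet.contDiffAt.comp (h u) (hG'.of_le (by norm_cast))
  have hl : ContDiffAt ℝ 2 (fun y => 1 / 2 * Real.log (gdet (G' y))) (h u) :=
    contDiffAt_const.mul (hGd.log hdet.ne')
  have hlh : ContDiffAt ℝ 2 (fun y => 1 / 2 * Real.log (gdet (G' (h y)))) u :=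
    hl.comp u (ContDiffAt.real_of_hol hh)
  have hpos : ∀ᶠ y in 𝓝 u, 0 < gdet (G' (h y)) :=
    (hGd.continuousAt.comp hh.continuousAt).eventually (lt_mem_nhds hdet)
  -- The logarithmic volume densities differ by a constant and `2 log |det E|`, both of which are
  -- killed by `dd^c`.
  have hev : (fun y => 1 / 2 * Real.log (gdet (G y))) =ᶠ[𝓝 u]
      fun y => (2 * Real.log ‖f y‖ + 1 / 2 * Real.log c) + 1 / 2 * Real.log (gdet (G' (h y))) := by
    filter_upwards [hG, hpos, hf.continuousAt.eventually_ne hf0] with y h1 h2 h3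
    have e1 : pull (G' (h y)) (fderiv ℂ h y) = pull (pull (G' (h y)) (e : V →L[ℂ] V')) (E y) := by
      rw [pull_pull]; congr 1; ext v; simp [E]
    rw [h1, e1, gdet_pull_endo, hcdet]
    have h4 : 0 < ‖f y‖ := norm_pos_iff.2 h3
    rw [show LinearMap.det (E y : V →ₗ[ℂ] V) = f y from rfl, Complex.normSq_eq_norm_sq,
      Real.log_mul (by positivity) (by positivity), Real.log_mul hc.ne' h2.ne', Real.log_pow,
      Real.log_pow]
    push_cast
    ring
  have hlog : ContDiffAt ℝ 2 (fun y => Real.log ‖f y‖) u :=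
    ((ContDiffAt.real_of_hol hf).norm ℂ hf0).log (by simpa using hf0)
  rw [scalFlat_eq, scalFlat_eq, ddcFlat_congr hev,
    ddcFlat_add ((contDiffAt_const.mul hlog).add contDiffAt_const) hlh,
    ddcFlat_add (contDiffAt_const.mul hlog) contDiffAt_const, ddcFlat_const_mul hlog,
    ddcFlat_log_norm hf hf0, ddcFlat_const,
    ddcFlat_comp_hol (F := fun y => 1 / 2 * Real.log (gdet (G' y))) hl hh, hG.eq_of_nhds, ← he,
    smul_zero, zero_add, zero_add, traceWrt_pull]

end ScalarCurvature

end WeightedExtremal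
end


noncomputable section

namespace WeightedExtremal

open Module Filter Topology Set

set_option linter.unusedSectionVars false

/-! ### Pencils of Kähler metrics `G₀ + z K` over the base of a Calabi ansatz. -/

section CalabiBase

variable {N N' : Type*} [NormedAddCommGroup N] [NormedSpace ℂ N] [FiniteDimensional ℂ N]
  [NormedAddCommGroup N'] [NormedSpace ℂ N'] [FiniteDimensional ℂ N']

/-- The pencil of Kähler metrics `G₀ + z K`, `-1 < z < 1`, on a neighbourhood of `u₀` has volume
density `P(z)` relative to a volume form whose logarithmic density is `ε`, and the trace of the
Ricci form of the latter at `u₀` is `σ(z)`. -/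
structure IsCalabiBase (G₀ K : N → Bil N) (ε : N → ℝ) (P σ : ℝ → ℝ) (u₀ : N) : Prop where
  eps_smooth : ContDiffAt ℝ 2 ε u₀
  symm : ∀ᶠ u in 𝓝 u₀, ∀ z ∈ Ioo (-1 : ℝ) 1, ∀ v w, (G₀ u + z • K u) v w = (G₀ u + z • K u) w v
  pos : ∀ᶠ u in 𝓝 u₀, ∀ z ∈ Ioo (-1 : ℝ) 1, ∀ v, v ≠ 0 → 0 < (G₀ u + z • K u) v v
  P_pos : ∀ z ∈ Ioo (-1 : ℝ) 1, 0 < P z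
  P_smooth : ContDiff ℝ ∞ P
  det : ∀ᶠ u in 𝓝 u₀, ∀ z ∈ Ioo (-1 : ℝ) 1, gdet (G₀ u + z • K u) = P z ^ 2 * Real.exp (2 * ε u)
  trace_K : ∀ z ∈ Ioo (-1 : ℝ) 1, traceWrt (G₀ u₀ + z • K u₀) (K u₀) = 2 * logDeriv P z
  trace_ricci : ∀ z ∈ Ioo (-1 : ℝ) 1,
    -(1 / 2) * traceWrt (G₀ u₀ + z • K u₀) (ddcFlat ε u₀) = σ z

theorem one_add_mul_pos {x z : ℝ} (hx : |x| ≤ 1) (hz : z ∈ Ioo (-1 : ℝ) 1) : 0 < 1 + x * z := by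
  have h1 : |x * z| < 1 := by
    rw [abs_mul]
    calc |x| * |z| ≤ 1 * |z| := by gcongr
      _ < 1 := by rw [one_mul]; exact abs_lt.2 hz
  linarith [(abs_lt.1 h1).1]

/-- The base data of a Kähler metric whose scalar curvature at `u₀` is `c`. -/
theorem isCalabiBase_factor {k : N → Bil N} {u₀ : N} {s x c : ℝ} (hs : s = 1 ∨ s = -1)
    (hx : |x| ≤ 1) (hsx : 0 < s * x) (hk : ContDiffAt ℝ ∞ k u₀)
    (hsymm : ∀ᶠ u in 𝓝 u₀, ∀ v w, k u v w = k u w v)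
    (hpos : ∀ᶠ u in 𝓝 u₀, ∀ v, v ≠ 0 → 0 < k u v v) (hc : scalFlat k u₀ = c) :
    IsCalabiBase (fun u => (s / x) • k u) (fun u => s • k u)
      (fun u => 1 / 2 * Real.log (gdet (k u)) - finrank ℂ N * Real.log |x|)
      (fun z => (1 + x * z) ^ finrank ℂ N) (fun z => |x| * c / (1 + x * z)) u₀ := by
  have hx0 : x ≠ 0 := by rintro rfl; simp at hsx
  have habs : 0 < |x| := abs_pos.2 hx0
  have hsabs : s * x = |x| := by
    rcases hs with rfl | rfl
    · rw [one_mul] at hsx ⊢; exact (abs_of_pos hsx).symm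
    · rw [abs_of_neg (by linarith)]; ring
  have hss : s * s = 1 := by rcases hs with rfl | rfl <;> norm_num
  -- Because `s x = |x|` and `s² = 1`, the whole pencil consists of multiples of the single metric
  -- `k`. The density is therefore a power of `1 + x z`, and the factor `|x|` moves into the
  -- constant part of `ε`.
  have hcoef : ∀ z u, (s / x) • k u + z • s • k u = ((1 + x * z) / |x|) • k u := by
    intro z u
    rw [smul_smul, ← add_smul]
    congr 1
    rw [← hsabs]
    have hs0 : s ≠ 0 := by rintro rfl; simp at hss
    field_simp
    linear_combination (1 + x * z) * hss
  have hdetpos : ∀ᶠ u in 𝓝 u₀, 0 < gdet (k u) := by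
    filter_upwards [hsymm, hpos] with u h1 h2
    exact gdet_pos h1 h2
  have hε : ContDiffAt ℝ 2 (fun u => 1 / 2 * Real.log (gdet (k u))) u₀ :=
    contDiffAt_const.mul ((contDiff_gdet.contDiffAt.comp u₀ (hk.of_le (by norm_cast))).log
      hdetpos.self_of_nhds.ne')
  refine ⟨hε.sub contDiffAt_const, ?_, ?_, ?_, by fun_prop, ?_, ?_, ?_⟩
  · filter_upwards [hsymm] with u h z _ v w
    rw [hcoef, _root_.smul_apply, _root_.smul_apply, _root_.smul_apply, _root_.smul_apply, h]
  · filter_upwards [hpos] with u h z hz v hv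
    rw [hcoef, _root_.smul_apply, _root_.smul_apply, smul_eq_mul]
    exact mul_pos (div_pos (one_add_mul_pos hx hz) habs) (h v hv)
  · intro z hz
    exact pow_pos (one_add_mul_pos hx hz) _
  · filter_upwards [hdetpos] with u h z hz
    rw [hcoef, gdet_smul, finrank_real_eq, mul_sub, Real.exp_sub]
    rw [show 2 * (1 / 2 * Real.log (gdet (k u))) = Real.log (gdet (k u)) by ring, Real.exp_log h,
      show (2 : ℝ) * (finrank ℂ N * Real.log |x|) = (2 * finrank ℂ N : ℕ) * Real.log |x| by
        push_cast; ring, ← Real.log_pow, Real.exp_log (by positivity), div_pow, ← pow_mul, mul_comm (finrank ℂ N) 2]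
    field_simp
  · intro z hz
    have hp := one_add_mul_pos hx hz
    have hd : logDeriv (fun z => (1 + x * z) ^ finrank ℂ N) z =
        finrank ℂ N * (x / (1 + x * z)) := by
      rw [logDeriv_fun_pow (by fun_prop), logDeriv_apply]
      congr 2
      rw [deriv_const_add]
      simp
    rw [hcoef, hd, traceWrt_smul_left _ _ (by positivity), traceWrt_smul,
      traceWrt_self hdetpos.self_of_nhds.ne', finrank_real_eq]
    push_cast
    field_simp
    rw [← hsabs]
    linear_combination x * finrank ℂ N * hss
  · intro z hz
    have hp := one_add_mul_pos hx hz
    rw [hcoef, traceWrt_smul_left _ _ (by positivity), ddcFlat_sub hε contDiffAt_const,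
      ddcFlat_const, sub_zero, ← hc, scalFlat_eq]
    field_simp

theorem IsCalabiBase.gdet_pos {G₀ K : N → Bil N} {ε : N → ℝ} {P σ : ℝ → ℝ} {u₀ : N}
    (h : IsCalabiBase G₀ K ε P σ u₀) {z : ℝ} (hz : z ∈ Ioo (-1 : ℝ) 1) :
    0 < gdet (G₀ u₀ + z • K u₀) :=
  WeightedExtremal.gdet_pos (h.symm.self_of_nhds z hz) (h.pos.self_of_nhds z hz)

theorem prodBil_add_smul (b c : Bil N) (b' c' : Bil N') (z : ℝ) :
    prodBil b b' + z • prodBil c c' = prodBil (b + z • c) (b' + z • c') := by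
  refine ContinuousLinearMap.ext fun v => ContinuousLinearMap.ext fun w => ?_
  simp only [prodBil, pull_apply, _root_.add_apply, _root_.smul_apply, smul_eq_mul]
  ring

theorem ddcFlat_prod {ε : N → ℝ} {ε' : N' → ℝ} {u : N × N'} (h : ContDiffAt ℝ 2 ε u.1)
    (h' : ContDiffAt ℝ 2 ε' u.2) :
    ddcFlat (fun p : N × N' => ε p.1 + ε' p.2) u = prodBil (ddcFlat ε u.1) (ddcFlat ε' u.2) := by
  have h1 : ContDiffAt ℂ ω (Prod.fst : N × N' → N) u := contDiffAt_fst
  have h2 : ContDiffAt ℂ ω (Prod.snd : N × N' → N') u := contDiffAt_snd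
  have e1 : ContDiffAt ℝ 2 (fun p : N × N' => ε p.1) u := h.comp u contDiffAt_fst
  have e2 : ContDiffAt ℝ 2 (fun p : N × N' => ε' p.2) u := h'.comp u contDiffAt_snd
  rw [ddcFlat_add e1 e2, ddcFlat_comp_hol h h1,
    ddcFlat_comp_hol h' h2, fderiv_fst, fderiv_snd]
  rfl

/-- Densities multiply and traces add for an orthogonal sum. The constant `c` only compensates for
the fixed bases in which the Gram determinants of the factors and of the product are taken. -/
theorem IsCalabiBase.prod {G₀ K : N → Bil N} {ε : N → ℝ} {P σ : ℝ → ℝ} {u₀ : N}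
    {G₀' K' : N' → Bil N'} {ε' : N' → ℝ} {P' σ' : ℝ → ℝ} {u₀' : N'}
    (h : IsCalabiBase G₀ K ε P σ u₀) (h' : IsCalabiBase G₀' K' ε' P' σ' u₀') :
    ∃ c : ℝ, IsCalabiBase (fun u : N × N' => prodBil (G₀ u.1) (G₀' u.2))
      (fun u => prodBil (K u.1) (K' u.2)) (fun u => ε u.1 + ε' u.2 + c)
      (fun z => P z * P' z) (fun z => σ z + σ' z) (u₀, u₀') := by
  obtain ⟨c, hc, hdet⟩ := exists_gdet_prodBil N N'
  have hε : ContDiffAt ℝ 2 (fun u : N × N' => ε u.1) (u₀, u₀') :=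
    h.eps_smooth.comp (u₀, u₀') contDiffAt_fst
  have hε' : ContDiffAt ℝ 2 (fun u : N × N' => ε' u.2) (u₀, u₀') :=
    h'.eps_smooth.comp (u₀, u₀') contDiffAt_snd
  have tf : Tendsto Prod.fst (𝓝 (u₀, u₀')) (𝓝 u₀) := continuous_fst.tendsto _
  have ts : Tendsto Prod.snd (𝓝 (u₀, u₀')) (𝓝 u₀') := continuous_snd.tendsto _
  refine ⟨1 / 2 * Real.log c, (hε.add hε').add contDiffAt_const, ?_, ?_,
    fun z hz => mul_pos (h.P_pos z hz) (h'.P_pos z hz), h.P_smooth.mul h'.P_smooth, ?_, ?_, ?_⟩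
  · filter_upwards [tf.eventually h.symm, ts.eventually h'.symm] with u h1 h2 z hz v w
    rw [prodBil_add_smul]
    exact congrArg₂ (· + ·) (h1 z hz v.1 w.1) (h2 z hz v.2 w.2)
  · filter_upwards [tf.eventually h.pos, ts.eventually h'.pos] with u h1 h2 z hz v hv
    rw [prodBil_add_smul]
    change 0 < (G₀ u.1 + z • K u.1) v.1 v.1 + (G₀' u.2 + z • K' u.2) v.2 v.2
    have n1 : 0 ≤ (G₀ u.1 + z • K u.1) v.1 v.1 := by
      by_cases hv1 : v.1 = 0
      · simp [hv1]
      · exact (h1 z hz _ hv1).le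
    have n2 : 0 ≤ (G₀' u.2 + z • K' u.2) v.2 v.2 := by
      by_cases hv2 : v.2 = 0
      · simp [hv2]
      · exact (h2 z hz _ hv2).le
    by_cases hv1 : v.1 = 0
    · have hv2 : v.2 ≠ 0 := fun hv2 => hv (Prod.ext hv1 hv2)
      linarith [h2 z hz _ hv2]
    · linarith [h1 z hz _ hv1]
  · filter_upwards [tf.eventually h.det, ts.eventually h'.det] with u h1 h2 z hz
    rw [prodBil_add_smul, hdet, h1 z hz, h2 z hz, mul_add, mul_add, Real.exp_add, Real.exp_add,
      show 2 * (1 / 2 * Real.log c) = Real.log c by ring, Real.exp_log hc]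
    ring
  · intro z hz
    have e := logDeriv_mul (f := P) (g := P') z (h.P_pos z hz).ne' (h'.P_pos z hz).ne'
      (h.P_smooth.differentiable (by simp) z) (h'.P_smooth.differentiable (by simp) z)
    rw [prodBil_add_smul, traceWrt_prodBil (h.gdet_pos hz).ne' (h'.gdet_pos hz).ne',
      h.trace_K z hz, h'.trace_K z hz, e]
    ring
  · intro z hz
    rw [prodBil_add_smul, ddcFlat_add (hε.add hε') contDiffAt_const, ddcFlat_const, add_zero,
      ddcFlat_prod (u := (u₀, u₀')) h.eps_smooth h'.eps_smooth,
      traceWrt_prodBil (h.gdet_pos hz).ne' (h'.gdet_pos hz).ne',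
      ← h.trace_ricci z hz, ← h'.trace_ricci z hz]
    ring

section Pi

variable {A : Type*} [Fintype A] {W : A → Type*} [∀ a, NormedAddCommGroup (W a)]
  [∀ a, NormedSpace ℂ (W a)] [∀ a, FiniteDimensional ℂ (W a)]

theorem piBil_add_smul (b c : ∀ a, Bil (W a)) (z : ℝ) :
    piBil b + z • piBil c = piBil (fun a => b a + z • c a) := by
  rw [piBil_add, piBil_smul]

theorem ddcFlat_sum {ι : Type*} (s : Finset ι) {F : ι → N → ℝ} {u : N}
    (hF : ∀ i ∈ s, ContDiffAt ℝ 2 (F i) u) :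
    ddcFlat (fun y => ∑ i ∈ s, F i y) u = ∑ i ∈ s, ddcFlat (F i) u := by
  classical
  induction s using Finset.induction_on with
  | empty => simpa using ddcFlat_const 0 u
  | insert a s ha ih =>
    simp only [Finset.sum_insert ha]
    rw [ddcFlat_add (hF a (by simp)) (ContDiffAt.sum fun i hi => hF i (by simp [hi])),
      ih fun i hi => hF i (by simp [hi])]

theorem contDiffAt_apply_hol (a : A) (u : ∀ a, W a) :
    ContDiffAt ℂ ω (fun u : ∀ a, W a => u a) u :=
  (ContinuousLinearMap.proj (R := ℂ) (φ := W) a).contDiff.contDiffAt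

theorem fderiv_apply_hol (a : A) (u : ∀ a, W a) :
    fderiv ℂ (fun u : ∀ a, W a => u a) u = ContinuousLinearMap.proj (R := ℂ) (φ := W) a :=
  (ContinuousLinearMap.proj (R := ℂ) (φ := W) a).fderiv

theorem isCalabiBase_pi {G₀ K : ∀ a, W a → Bil (W a)} {ε : ∀ a, W a → ℝ} {P σ : A → ℝ → ℝ}
    {u₀ : ∀ a, W a} (h : ∀ a, IsCalabiBase (G₀ a) (K a) (ε a) (P a) (σ a) (u₀ a)) :
    ∃ c : ℝ, IsCalabiBase (fun u : ∀ a, W a => piBil fun a => G₀ a (u a))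
      (fun u => piBil fun a => K a (u a)) (fun u => ∑ a, ε a (u a) + c)
      (fun z => ∏ a, P a z) (fun z => ∑ a, σ a z) u₀ := by
  obtain ⟨c, hc, hdet⟩ := exists_gdet_piBil W
  have hε : ∀ a, ContDiffAt ℝ 2 (fun u : ∀ a, W a => ε a (u a)) u₀ := fun a =>
    (h a).eps_smooth.comp u₀ (ContDiffAt.real_of_hol (contDiffAt_apply_hol a u₀))
  have hsum : ContDiffAt ℝ 2 (fun u : ∀ a, W a => ∑ a, ε a (u a)) u₀ :=
    ContDiffAt.sum fun a _ => hε a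
  have ta : ∀ a, Tendsto (fun u : ∀ a, W a => u a) (𝓝 u₀) (𝓝 (u₀ a)) :=
    fun a => (continuous_apply a).tendsto u₀
  refine ⟨1 / 2 * Real.log c, hsum.add contDiffAt_const, ?_, ?_,
    fun z hz => Finset.prod_pos fun a _ => (h a).P_pos z hz,
    contDiff_prod fun a _ => (h a).P_smooth, ?_, ?_, ?_⟩
  · filter_upwards [eventually_all.2 fun a => (ta a).eventually (h a).symm] with u h1 z hz v w
    rw [piBil_add_smul, piBil_apply, piBil_apply]
    exact Finset.sum_congr rfl fun a _ => h1 a z hz _ _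
  · filter_upwards [eventually_all.2 fun a => (ta a).eventually (h a).pos] with u h1 z hz v hv
    rw [piBil_add_smul, piBil_apply]
    obtain ⟨a, ha⟩ := Function.ne_iff.1 hv
    refine Finset.sum_pos' (fun b _ => ?_) ⟨a, Finset.mem_univ a, h1 a z hz _ ha⟩
    by_cases hb : v b = 0
    · simp [hb]
    · exact (h1 b z hz _ hb).le
  · filter_upwards [eventually_all.2 fun a => (ta a).eventually (h a).det] with u h1 z hz
    rw [piBil_add_smul, hdet, mul_add, Real.exp_add,
      show 2 * (1 / 2 * Real.log c) = Real.log c by ring, Real.exp_log hc, Finset.mul_sum,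
      Real.exp_sum, ← Finset.prod_pow, Finset.prod_congr rfl fun a _ => h1 a z hz,
      Finset.prod_mul_distrib]
    ring
  · intro z hz
    rw [piBil_add_smul, traceWrt_piBil fun a => ((h a).gdet_pos hz).ne',
      Finset.sum_congr rfl fun a _ => (h a).trace_K z hz, ← Finset.mul_sum]
    have := logDeriv_prod (s := Finset.univ) (f := P) (x := z)
      (fun a _ => ((h a).P_pos z hz).ne')
      (fun a _ => (h a).P_smooth.differentiable (by simp) z)
    rw [this]
  · intro z hz
    rw [piBil_add_smul, ddcFlat_add hsum contDiffAt_const, ddcFlat_const, add_zero,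
      ddcFlat_sum _ fun a _ => hε a]
    have e : ∑ a, ddcFlat (fun u : ∀ a, W a => ε a (u a)) u₀ =
        piBil fun a => ddcFlat (ε a) (u₀ a) := by
      refine Finset.sum_congr rfl fun a _ => ?_
      rw [ddcFlat_comp_hol (F := ε a) (h a).eps_smooth (contDiffAt_apply_hol a u₀),
        fderiv_apply_hol]
    rw [e, traceWrt_piBil fun a => ((h a).gdet_pos hz).ne', Finset.mul_sum]
    exact Finset.sum_congr rfl fun a _ => (h a).trace_ricci z hz

end Pi

end CalabiBase

end WeightedExtremal
end


noncomputable section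

namespace WeightedExtremal

open Module Filter Topology Set

set_option linter.unusedSectionVars false

/-! ### The Calabi ansatz on `N × ℂ`: volume, scalar curvature, Laplacian and positivity. -/

section CalabiModel

/-- The standard inner product of `ℂ`. -/
def stdBil : Bil ℂ := sq Complex.reCLM + sq Complex.imCLM

theorem gramIn_smul_stdBil (c : ℝ) : gramIn Complex.basisOneI (c • stdBil) = c • 1 := by
  ext i j
  fin_cases i <;> fin_cases j <;> simp [gramIn, stdBil]

theorem gdet_smul_stdBil_pos : ∃ c : ℝ, 0 < c ∧ ∀ t : ℝ, gdet (t • stdBil) = c * t ^ 2 := by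
  obtain ⟨c, hc, h⟩ := exists_gdet_eq Complex.basisOneI
  refine ⟨c, hc, fun t => ?_⟩
  rw [h, gramIn_smul_stdBil, Matrix.det_smul]
  simp

theorem traceWrt_smul_stdBil {t : ℝ} (ht : t ≠ 0) (b : Bil ℂ) :
    traceWrt (t • stdBil) b = t⁻¹ * (b 1 1 + b Complex.I Complex.I) := by
  rw [traceWrt_eq Complex.basisOneI, gramIn_smul_stdBil]
  have : (t • (1 : Matrix (Fin 2) (Fin 2) ℝ))⁻¹ = t⁻¹ • 1 := by
    apply Matrix.inv_eq_left_inv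
    rw [Matrix.smul_mul, Matrix.mul_smul, smul_smul, inv_mul_cancel₀ ht]; simp
  rw [this, Matrix.smul_mul, Matrix.one_mul, Matrix.trace_smul, Matrix.trace_fin_two]
  simp [gramIn]

variable {N : Type*} [NormedAddCommGroup N] [NormedSpace ℂ N] [FiniteDimensional ℂ N]

/-- Twice the `(1,0)`-part of a real covector. -/
def holPart (D : N →L[ℝ] ℝ) : N →ₗ[ℂ] ℂ := Dual.extendRCLike (D : N →ₗ[ℝ] ℝ)

theorem holPart_apply (D : N →L[ℝ] ℝ) (v : N) :
    holPart D v = (D v : ℂ) - Complex.I * (D (Complex.I • v) : ℂ) := rfl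

/-- The shear `(v, w) ↦ (v, w - ∂ v)` of `N × ℂ` attached to a real covector. -/
def shear (D : N →L[ℝ] ℝ) : (N × ℂ) ≃L[ℂ] (N × ℂ) :=
  (LinearEquiv.transvection (f := -(holPart D).comp (LinearMap.fst ℂ N ℂ)) (v := ((0 : N), (1 : ℂ)))
    (by simp)).toContinuousLinearEquiv

theorem shear_apply (D : N →L[ℝ] ℝ) (p : N × ℂ) : shear D p = (p.1, p.2 - holPart D p.1) := by
  change p + (-(holPart D).comp (LinearMap.fst ℂ N ℂ)) p • ((0 : N), (1 : ℂ)) = _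
  ext <;> simp [sub_eq_add_neg]

/-- A transvection has determinant one, so straightening the ansatz by the shear does not affect the
volume density. -/
theorem det_shear (D : N →L[ℝ] ℝ) :
    LinearMap.det ((shear D : (N × ℂ) →L[ℂ] (N × ℂ)) : (N × ℂ) →ₗ[ℂ] (N × ℂ)) = 1 := by
  have : ((shear D : (N × ℂ) →L[ℂ] (N × ℂ)) : (N × ℂ) →ₗ[ℂ] (N × ℂ)) =
      LinearMap.transvection (-(holPart D).comp (LinearMap.fst ℂ N ℂ)) ((0 : N), (1 : ℂ)) := rfl
  rw [this, LinearMap.transvection.det]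
  simp

/-- The logarithm of the ratio of the norms in the Calabi model. -/
def modelTau (χ : N → ℝ) (p : N × ℂ) : ℝ := χ p.1 - p.2.re

theorem modelTau_smooth {n : WithTop ℕ∞} {χ : N → ℝ} {p : N × ℂ} (h : ContDiffAt ℝ n χ p.1) :
    ContDiffAt ℝ n (modelTau χ) p :=
  (h.comp p contDiffAt_fst).sub
    ((Complex.reCLM.contDiff.contDiffAt).comp p contDiffAt_snd)

theorem fderiv_modelTau {χ : N → ℝ} {p : N × ℂ} (h : DifferentiableAt ℝ χ p.1) (v : N × ℂ) :
    fderiv ℝ (modelTau χ) p v = -(shear (fderiv ℝ χ p.1) v).2.re := by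
  have h1 : HasFDerivAt (fun p : N × ℂ => χ p.1)
      ((fderiv ℝ χ p.1).comp (ContinuousLinearMap.fst ℝ N ℂ)) p :=
    h.hasFDerivAt.comp p hasFDerivAt_fst
  have h2 : HasFDerivAt (fun p : N × ℂ => p.2.re)
      (Complex.reCLM.comp (ContinuousLinearMap.snd ℝ N ℂ)) p :=
    Complex.reCLM.hasFDerivAt.comp p hasFDerivAt_snd
  have : HasFDerivAt (modelTau χ) _ p := h1.sub h2
  rw [this.fderiv, shear_apply]
  simp [holPart_apply]

theorem jmul_fderiv_modelTau {χ : N → ℝ} {p : N × ℂ} (h : DifferentiableAt ℝ χ p.1) (v : N × ℂ) :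
    jmul (fderiv ℝ (modelTau χ) p) v = -(shear (fderiv ℝ χ p.1) v).2.im := by
  rw [jmul_apply, fderiv_modelTau h, map_smul]
  simp

/-- After the shear, `dτ` and `J dτ` are minus the real and imaginary parts of the `ℂ`-coordinate,
whence the standard inner product of `ℂ`. -/
theorem sq_add_sq_modelTau {χ : N → ℝ} {p : N × ℂ} (h : DifferentiableAt ℝ χ p.1) :
    sq (fderiv ℝ (modelTau χ) p) + sq (jmul (fderiv ℝ (modelTau χ) p)) =
      pull (prodBil 0 stdBil) (shear (fderiv ℝ χ p.1) : (N × ℂ) →L[ℂ] (N × ℂ)) := by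
  refine ContinuousLinearMap.ext fun v => ContinuousLinearMap.ext fun w => ?_
  rw [_root_.add_apply, _root_.add_apply, sq_apply, sq_apply, fderiv_modelTau h,
    fderiv_modelTau h, jmul_fderiv_modelTau h, jmul_fderiv_modelTau h]
  simp [prodBil, stdBil]

theorem pull_fst_eq_pull_shear (b : Bil N) (D : N →L[ℝ] ℝ) :
    pull b (ContinuousLinearMap.fst ℂ N ℂ) =
      pull (prodBil b 0) (shear D : (N × ℂ) →L[ℂ] (N × ℂ)) := by
  refine ContinuousLinearMap.ext fun v => ContinuousLinearMap.ext fun w => ?_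
  simp [prodBil, shear_apply]

/-- The metric of the Calabi ansatz on `N × ℂ`. -/
def modelMetric (G₀ K : N → Bil N) (χ : N → ℝ) (Θ zf : ℝ → ℝ) (p : N × ℂ) : Bil (N × ℂ) :=
  pull (G₀ p.1 + zf (modelTau χ p) • K p.1) (ContinuousLinearMap.fst ℂ N ℂ)
    + Θ (zf (modelTau χ p)) • (sq (fderiv ℝ (modelTau χ) p) + sq (jmul (fderiv ℝ (modelTau χ) p)))

/-- In the sheared frame the ansatz is an orthogonal sum of a member of the base pencil and a
multiple of the flat metric of `ℂ`. Determinants and traces can be read off block by block. -/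
theorem modelMetric_eq {G₀ K : N → Bil N} {χ : N → ℝ} {Θ zf : ℝ → ℝ} {p : N × ℂ}
    (h : DifferentiableAt ℝ χ p.1) :
    modelMetric G₀ K χ Θ zf p = pull (prodBil (G₀ p.1 + zf (modelTau χ p) • K p.1)
      (Θ (zf (modelTau χ p)) • stdBil)) (shear (fderiv ℝ χ p.1) : (N × ℂ) →L[ℂ] (N × ℂ)) := by
  rw [modelMetric, sq_add_sq_modelTau h, pull_fst_eq_pull_shear _ (fderiv ℝ χ p.1), ← pull_smul,
    ← pull_add]
  congr 1
  refine ContinuousLinearMap.ext fun v => ContinuousLinearMap.ext fun w => ?_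
  simp [prodBil]

/-- The profile of the Calabi ansatz: `zf` maps to `(-1, 1)` and solves `zf' = Θ(zf)`. -/
structure IsProfileFlow (Θ zf : ℝ → ℝ) : Prop where
  mem : ∀ t, zf t ∈ Ioo (-1 : ℝ) 1
  hasDeriv : ∀ t, HasDerivAt zf (Θ (zf t)) t
  smooth : ContDiff ℝ ∞ zf
  profile_pos : ∀ t ∈ Ioo (-1 : ℝ) 1, 0 < Θ t
  profile_smooth : ∀ t ∈ Ioo (-1 : ℝ) 1, ContDiffAt ℝ ∞ Θ t

variable {G₀ K : N → Bil N} {ε χ : N → ℝ} {P σ Θ zf : ℝ → ℝ} {p : N × ℂ}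

theorem IsProfileFlow.deriv_comp (hz : IsProfileFlow Θ zf) {f : ℝ → ℝ} {t : ℝ}
    (hf : DifferentiableAt ℝ f (zf t)) :
    HasDerivAt (fun t => f (zf t)) (deriv f (zf t) * Θ (zf t)) t :=
  hf.hasDerivAt.comp t (hz.hasDeriv t)

/-- As `Re` is pluriharmonic, `dd^c τ` is the pull-back of `dd^c χ = K`. Thus `dd^c f(τ)` has
horizontal part `f' K`, contributing the logarithmic derivative of `P`, and vertical part `f''`
times the flat tensor, contributing `2 f'' / Θ`. -/
theorem traceWrt_modelMetric_ddc (h : IsCalabiBase G₀ K ε P σ p.1) (hz : IsProfileFlow Θ zf)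
    (hχ : ContDiffAt ℝ ∞ χ p.1) (hK : K p.1 = ddcFlat χ p.1) {f : ℝ → ℝ}
    (hf : ContDiffAt ℝ 2 f (modelTau χ p)) :
    traceWrt (modelMetric G₀ K χ Θ zf p) (ddcFlat (fun p => f (modelTau χ p)) p) =
      deriv f (modelTau χ p) * (2 * logDeriv P (zf (modelTau χ p)))
        + deriv (deriv f) (modelTau χ p) * (2 / Θ (zf (modelTau χ p))) := by
  have hχ2 : ContDiffAt ℝ 2 χ p.1 := hχ.of_le (by norm_cast)
  have hd : DifferentiableAt ℝ χ p.1 := hχ.differentiableAt (by simp)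
  have hm := hz.mem (modelTau χ p)
  have hΘ := hz.profile_pos _ hm
  obtain ⟨c, hc, hcdet⟩ := gdet_smul_stdBil_pos
  have e1 : ddcFlat (modelTau χ) p = pull (ddcFlat χ p.1) (ContinuousLinearMap.fst ℂ N ℂ) := by
    have hre : ddcFlat (fun p : N × ℂ => p.2.re) p = 0 := ddcFlat_re_comp contDiffAt_snd
    have h1 : ContDiffAt ℝ 2 (fun p : N × ℂ => χ p.1) p := hχ2.comp p contDiffAt_fst
    have h2 : ContDiffAt ℝ 2 (fun p : N × ℂ => p.2.re) p :=
      Complex.reCLM.contDiff.contDiffAt.comp p contDiffAt_snd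
    have h3 := ddcFlat_sub h1 h2
    rw [hre, sub_zero, ddcFlat_comp_hol hχ2 contDiffAt_fst, fderiv_fst] at h3
    exact h3
  rw [ddcFlat_real_comp hf (modelTau_smooth hχ2), e1, ← hK, sq_add_sq_modelTau hd,
    pull_fst_eq_pull_shear _ (fderiv ℝ χ p.1), modelMetric_eq hd, traceWrt_add, traceWrt_smul,
    traceWrt_smul, traceWrt_pull, traceWrt_pull,
    traceWrt_prodBil (h.gdet_pos hm).ne' (by rw [hcdet]; positivity),
    traceWrt_prodBil (h.gdet_pos hm).ne' (by rw [hcdet]; positivity), traceWrt_zero, traceWrt_zero,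
    h.trace_K _ hm, traceWrt_smul_stdBil hΘ.ne']
  have : stdBil 1 1 + stdBil Complex.I Complex.I = 2 := by
    simp [stdBil]; norm_num
  rw [this]
  ring

theorem traceWrt_modelMetric_sq (h : IsCalabiBase G₀ K ε P σ p.1) (hz : IsProfileFlow Θ zf)
    (hχ : ContDiffAt ℝ ∞ χ p.1) :
    traceWrt (modelMetric G₀ K χ Θ zf p) (sq (fderiv ℝ (fun p => zf (modelTau χ p)) p)) =
      Θ (zf (modelTau χ p)) := by
  have hd : DifferentiableAt ℝ χ p.1 := hχ.differentiableAt (by simp)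
  have hm := hz.mem (modelTau χ p)
  have hΘ := hz.profile_pos _ hm
  obtain ⟨c, hc, hcdet⟩ := gdet_smul_stdBil_pos
  have e0 : fderiv ℝ (fun p => zf (modelTau χ p)) p =
      Θ (zf (modelTau χ p)) • fderiv ℝ (modelTau χ) p :=
    ((hz.hasDeriv _).comp_hasFDerivAt p
      ((modelTau_smooth hχ).differentiableAt (by simp)).hasFDerivAt).fderiv
  have e1 : sq (fderiv ℝ (fun p => zf (modelTau χ p)) p) =
      pull (prodBil 0 (Θ (zf (modelTau χ p)) ^ 2 • sq Complex.reCLM))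
        (shear (fderiv ℝ χ p.1) : (N × ℂ) →L[ℂ] (N × ℂ)) := by
    refine ContinuousLinearMap.ext fun v => ContinuousLinearMap.ext fun w => ?_
    rw [e0, sq_apply, _root_.smul_apply, _root_.smul_apply, fderiv_modelTau hd, fderiv_modelTau hd]
    simp [prodBil]
    ring
  rw [e1, modelMetric_eq hd, traceWrt_pull,
    traceWrt_prodBil (h.gdet_pos hm).ne' (by rw [hcdet]; positivity), traceWrt_zero,
    traceWrt_smul_stdBil hΘ.ne']
  simp
  field_simp

theorem gdet_modelMetric (h : IsCalabiBase G₀ K ε P σ p.1) (hz : IsProfileFlow Θ zf)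
    (hχ : ContDiffAt ℝ ∞ χ p.1) :
    ∃ c : ℝ, 0 < c ∧ ∀ᶠ p' in 𝓝 p, gdet (modelMetric G₀ K χ Θ zf p') =
      c * (Θ (zf (modelTau χ p')) * P (zf (modelTau χ p'))) ^ 2 * Real.exp (2 * ε p'.1) := by
  obtain ⟨c, hc, hcdet⟩ := gdet_smul_stdBil_pos
  obtain ⟨c', hc', hprod⟩ := exists_gdet_prodBil N ℂ
  refine ⟨c * c', by positivity, ?_⟩
  have tf : Tendsto (Prod.fst : N × ℂ → N) (𝓝 p) (𝓝 p.1) := continuous_fst.tendsto _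
  have hχ1 : ContDiffAt ℝ 1 χ p.1 := hχ.of_le (by norm_cast)
  filter_upwards [tf.eventually h.det, tf.eventually (hχ1.eventually (by simp))] with p' h1 h2
  rw [modelMetric_eq (h2.differentiableAt (by simp)), gdet_pull_endo, det_shear, hprod, hcdet,
    h1 _ (hz.mem _)]
  simp
  ring

/-- The momentum construction formula for the scalar curvature. -/
theorem scalFlat_modelMetric (h : IsCalabiBase G₀ K ε P σ p.1) (hz : IsProfileFlow Θ zf)
    (hχ : ContDiffAt ℝ ∞ χ p.1) (hK : K p.1 = ddcFlat χ p.1) :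
    scalFlat (modelMetric G₀ K χ Θ zf) p = σ (zf (modelTau χ p))
      - deriv (deriv fun t => Θ t * P t) (zf (modelTau χ p)) / P (zf (modelTau χ p)) := by
  obtain ⟨c, hc, hdet⟩ := gdet_modelMetric h hz hχ
  have hd : DifferentiableAt ℝ χ p.1 := hχ.differentiableAt (by simp)
  have hm := hz.mem (modelTau χ p)
  have hΘ := hz.profile_pos _ hm
  have hP := h.P_pos _ hm
  obtain ⟨c₁, hc₁, hcdet⟩ := gdet_smul_stdBil_pos
  set F : ℝ → ℝ := fun t => Θ t * P t with hF
  have hFs : ∀ t ∈ Ioo (-1 : ℝ) 1, ContDiffAt ℝ ∞ F t := fun t ht =>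
    (hz.profile_smooth t ht).mul h.P_smooth.contDiffAt
  have hFpos : ∀ t ∈ Ioo (-1 : ℝ) 1, 0 < F t := fun t ht =>
    mul_pos (hz.profile_pos t ht) (h.P_pos t ht)
  have hlogF : ∀ t, ContDiffAt ℝ 2 (fun t => Real.log (F (zf t))) t := fun t =>
    (((hFs _ (hz.mem t)).of_le (by norm_cast)).comp t
      (hz.smooth.contDiffAt.of_le (by norm_cast))).log (hFpos _ (hz.mem t)).ne'
  have hτ : ContDiffAt ℝ 2 (modelTau χ) p := modelTau_smooth (hχ.of_le (by norm_cast))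
  have hlog : ContDiffAt ℝ 2 (fun p => Real.log (F (zf (modelTau χ p)))) p :=
    (hlogF (modelTau χ p)).comp p hτ
  have hε : ContDiffAt ℝ 2 (fun p : N × ℂ => ε p.1) p := h.eps_smooth.comp p contDiffAt_fst
  have hev : (fun p' => 1 / 2 * Real.log (gdet (modelMetric G₀ K χ Θ zf p'))) =ᶠ[𝓝 p]
      fun p' => (Real.log (F (zf (modelTau χ p'))) + ε p'.1) + 1 / 2 * Real.log c := by
    filter_upwards [hdet] with p' hp'
    have := hFpos _ (hz.mem (modelTau χ p'))
    rw [hp', Real.log_mul (by positivity) (by positivity), Real.log_mul hc.ne' (by positivity),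
      Real.log_exp, Real.log_pow]
    push_cast
    ring
  -- Since `zf' = Θ(zf)`, the factor `Θ` of `F = Θ P` cancels in the logarithmic derivative.
  have d1 : ∀ t, deriv (fun t => Real.log (F (zf t))) t = deriv F (zf t) / P (zf t) := by
    intro t
    have hmt := hz.mem t
    have h1 := hz.deriv_comp ((hFs _ hmt).differentiableAt (by simp))
    have h2 := (h1.log (hFpos _ hmt).ne').deriv
    rw [h2]
    have := hz.profile_pos _ hmt
    have := h.P_pos _ hmt
    simp only [hF]
    field_simp
  have hdF : DifferentiableAt ℝ (deriv F) (zf (modelTau χ p)) := by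
    have h1 : ContDiffAt ℝ 1 (deriv F) (zf (modelTau χ p)) := by
      have := ((hFs _ hm).of_le (by norm_cast : (2 : WithTop ℕ∞) ≤ ∞)).fderiv_right
        (m := 1) (by norm_num)
      have e : deriv F = fun t => fderiv ℝ F t 1 := by ext t; simp
      rw [e]
      exact this.clm_apply contDiffAt_const
    exact h1.differentiableAt (by simp)
  have hdP : DifferentiableAt ℝ P (zf (modelTau χ p)) := h.P_smooth.differentiable (by simp) _
  have d2 : deriv (deriv fun t => Real.log (F (zf t))) (modelTau χ p) =
      (deriv (deriv F) (zf (modelTau χ p)) * P (zf (modelTau χ p))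
        - deriv F (zf (modelTau χ p)) * deriv P (zf (modelTau χ p)))
        / P (zf (modelTau χ p)) ^ 2 * Θ (zf (modelTau χ p)) := by
    have e : (deriv fun t => Real.log (F (zf t))) = fun t => (fun s => deriv F s / P s) (zf t) :=
      funext d1
    have h1 := (hdF.hasDerivAt.fun_div hdP.hasDerivAt hP.ne')
    rw [e]
    exact (h1.comp _ (hz.hasDeriv _)).deriv
  have etr : traceWrt (modelMetric G₀ K χ Θ zf p) (ddcFlat (fun p => ε p.1) p) =
      traceWrt (G₀ p.1 + zf (modelTau χ p) • K p.1) (ddcFlat ε p.1) := by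
    rw [ddcFlat_comp_hol h.eps_smooth contDiffAt_fst, fderiv_fst, modelMetric_eq hd,
      pull_fst_eq_pull_shear _ (fderiv ℝ χ p.1), traceWrt_pull,
      traceWrt_prodBil (h.gdet_pos hm).ne' (by rw [hcdet]; positivity), traceWrt_zero, add_zero]
  rw [scalFlat_eq, ddcFlat_congr hev, ddcFlat_add (hlog.add hε) contDiffAt_const, ddcFlat_const,
    add_zero, ddcFlat_add hlog hε, traceWrt_add, etr, mul_add, h.trace_ricci _ hm,
    traceWrt_modelMetric_ddc h hz hχ hK (hlogF _), d1, d2, logDeriv_apply]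
  field_simp
  ring

/-- This is the trace formula with `f = zf`, whose first two derivatives are `Θ(z)` and `Θ'(z)
Θ(z)`. -/
theorem laplacian_modelMetric (h : IsCalabiBase G₀ K ε P σ p.1) (hz : IsProfileFlow Θ zf)
    (hχ : ContDiffAt ℝ ∞ χ p.1) (hK : K p.1 = ddcFlat χ p.1) :
    -(1 / 2) * traceWrt (modelMetric G₀ K χ Θ zf p) (ddcFlat (fun p => zf (modelTau χ p)) p) =
      -(deriv (fun t => Θ t * P t) (zf (modelTau χ p)) / P (zf (modelTau χ p))) := by
  have hm := hz.mem (modelTau χ p)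
  have hΘ := hz.profile_pos _ hm
  have hP := h.P_pos _ hm
  have hΘd := (hz.profile_smooth _ hm).differentiableAt (by simp)
  have hdP : DifferentiableAt ℝ P (zf (modelTau χ p)) := h.P_smooth.differentiable (by simp) _
  have d1 : deriv zf = fun t => Θ (zf t) := funext fun t => (hz.hasDeriv t).deriv
  have d2 : deriv (fun t => Θ (zf t)) (modelTau χ p) = _ := (hz.deriv_comp hΘd).deriv
  rw [traceWrt_modelMetric_ddc h hz hχ hK (hz.smooth.contDiffAt.of_le (by norm_cast)), d1, d2,
    deriv_fun_mul hΘd hdP, logDeriv_apply]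
  field_simp
  ring

theorem modelMetric_pos (h : IsCalabiBase G₀ K ε P σ p.1) (hz : IsProfileFlow Θ zf)
    (hχ : ContDiffAt ℝ ∞ χ p.1) {v : N × ℂ} (hv : v ≠ 0) :
    0 < modelMetric G₀ K χ Θ zf p v v := by
  have hd : DifferentiableAt ℝ χ p.1 := hχ.differentiableAt (by simp)
  have hm := hz.mem (modelTau χ p)
  have hΘ := hz.profile_pos _ hm
  rw [modelMetric_eq hd, pull_apply]
  have hw : (shear (fderiv ℝ χ p.1) : (N × ℂ) →L[ℂ] (N × ℂ)) v ≠ 0 := by simpa using hv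
  generalize (shear (fderiv ℝ χ p.1) : (N × ℂ) →L[ℂ] (N × ℂ)) v = w at hw
  simp only [prodBil, _root_.add_apply, pull_apply, _root_.smul_apply, stdBil, sq_apply,
    ContinuousLinearMap.coe_fst', ContinuousLinearMap.coe_snd', Complex.reCLM_apply,
    Complex.imCLM_apply, smul_eq_mul]
  have hpos := h.pos.self_of_nhds _ hm
  simp only [_root_.add_apply, _root_.smul_apply, smul_eq_mul] at hpos
  have h2 : 0 ≤ w.2.re * w.2.re + w.2.im * w.2.im :=
    add_nonneg (mul_self_nonneg _) (mul_self_nonneg _)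
  by_cases h1 : w.1 = 0
  · have hw2 : w.2 ≠ 0 := fun h2 => hw (Prod.ext h1 h2)
    have : 0 < w.2.re * w.2.re + w.2.im * w.2.im := Complex.normSq_pos.2 hw2
    rw [h1]
    simp only [map_zero, mul_zero, zero_add]
    positivity
  · have := hpos _ h1
    positivity

end CalabiModel

end WeightedExtremal
end


noncomputable section

namespace WeightedExtremal

open Module Filter Topology Set
open scoped InnerProductSpace

set_option linter.unusedSectionVars false

/-! ### Fubini–Study metrics in affine coordinates. -/

section FubiniStudy

variable {F : Type*} [NormedAddCommGroup F] [InnerProductSpace ℂ F]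

variable (F) in
/-- The real part of the inner product. -/
def reInner : Bil F :=
  LinearMap.mkContinuous₂ (LinearMap.mk₂ ℝ (fun v w : F => (inner ℂ v w).re)
    (fun a b c => by simp) (fun a b c => by simp [inner_smul_left_eq_smul])
    (fun a b c => by simp) (fun a b c => by simp [inner_smul_right_eq_smul])) 1
    (fun v w => by
      rw [one_mul]
      exact (Complex.abs_re_le_norm _).trans (norm_inner_le_norm v w))

theorem reInner_apply (v w : F) : reInner F v w = (inner ℂ v w).re := rfl

theorem reInner_self (v : F) : reInner F v v = ‖v‖ ^ 2 := by
  rw [reInner_apply, ← inner_self_eq_norm_sq (𝕜 := ℂ)]; rfl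

theorem reInner_symm (v w : F) : reInner F v w = reInner F w v := by
  rw [reInner_apply, reInner_apply]
  exact inner_re_symm (𝕜 := ℂ) v w

theorem fderiv_const_add_norm_sq (c : ℝ) :
    fderiv ℝ (fun v : F => c + ‖v‖ ^ 2) = fun v => ((2 : ℝ) • reInner F) v := by
  ext1 v
  have h : HasFDerivAt (fun v : F => reInner F v v) _ v :=
    (reInner F).hasFDerivAt.clm_apply (hasFDerivAt_id v)
  have e : (fun v : F => c + ‖v‖ ^ 2) = fun v => c + reInner F v v := by
    ext v; rw [reInner_self]
  rw [e, (h.const_add c).fderiv]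
  ext w
  simp [reInner_symm w v]
  ring

theorem contDiff_const_add_norm_sq {n : WithTop ℕ∞} (c : ℝ) :
    ContDiff ℝ n (fun v : F => c + ‖v‖ ^ 2) :=
  contDiff_const.add (contDiff_norm_sq ℂ)

theorem ddcFlat_const_add_norm_sq (c : ℝ) (v ξ η : F) :
    ddcFlat (fun v : F => c + ‖v‖ ^ 2) v ξ η = 4 * (inner ℂ ξ η).re := by
  have h2 : fderiv ℝ (fderiv ℝ (fun v : F => c + ‖v‖ ^ 2)) v = (2 : ℝ) • reInner F := by
    rw [fderiv_const_add_norm_sq]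
    exact ((2 : ℝ) • reInner F).fderiv
  rw [ddcFlat_apply, h2]
  simp [reInner_apply]
  ring

theorem ddcFlat_log_const_add_norm_sq {c : ℝ} {v : F} (h0 : 0 < c + ‖v‖ ^ 2) (ξ η : F) :
    ddcFlat (fun v : F => Real.log (c + ‖v‖ ^ 2)) v ξ η =
      4 * ((inner ℂ ξ η).re / (c + ‖v‖ ^ 2)
        - ((inner ℂ ξ v) * (inner ℂ v η)).re / (c + ‖v‖ ^ 2) ^ 2) := by
  have d1 : deriv Real.log = fun t => t⁻¹ := by ext t; simp
  have d2 : deriv (fun t : ℝ => t⁻¹) (c + ‖v‖ ^ 2) = -((c + ‖v‖ ^ 2) ^ 2)⁻¹ := by simp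
  rw [ddcFlat_real_comp (H := Real.log) (τ := fun v : F => c + ‖v‖ ^ 2)
    (Real.contDiffAt_log.2 h0.ne') (contDiff_const_add_norm_sq c).contDiffAt, d1, d2,
    fderiv_const_add_norm_sq]
  have e : inner ℂ ξ v = (starRingEnd ℂ) (inner ℂ v ξ) := (inner_conj_symm ξ v).symm
  simp only [_root_.add_apply, _root_.smul_apply, ddcFlat_const_add_norm_sq, sq_apply,
    jmul_apply, smul_eq_mul, reInner_apply, inner_smul_right, e, Complex.mul_re, Complex.conj_re,
    Complex.conj_im, Complex.I_re, Complex.I_im]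
  ring

/-- The Fubini-Study tensor `½ dd^c log (c + |v|²)`. -/
def fsBil (c : ℝ) (v : F) : Bil F := (1 / 2 : ℝ) • ddcFlat (fun v : F => Real.log (c + ‖v‖ ^ 2)) v

theorem const_add_norm_sq_pos {c : ℝ} (hc : 0 < c) (v : F) : 0 < c + ‖v‖ ^ 2 := by positivity

theorem contDiff_log_const_add_norm_sq {c : ℝ} (hc : 0 < c) {n : WithTop ℕ∞} :
    ContDiff ℝ n (fun v : F => Real.log (c + ‖v‖ ^ 2)) :=
  (contDiff_const_add_norm_sq c).log fun v => (const_add_norm_sq_pos hc v).ne'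

theorem contDiffAt_fsBil {c : ℝ} (hc : 0 < c) (v : F) : ContDiffAt ℝ ∞ (fsBil (F := F) c) v :=
  (contDiffAt_ddcFlat (contDiff_log_const_add_norm_sq hc).contDiffAt).const_smul (1 / 2 : ℝ)

theorem fsBil_symm {c : ℝ} (hc : 0 < c) (v ξ η : F) : fsBil c v ξ η = fsBil c v η ξ := by
  rw [fsBil, _root_.smul_apply, _root_.smul_apply, _root_.smul_apply, _root_.smul_apply,
    ddcFlat_symm (contDiff_log_const_add_norm_sq hc).contDiffAt]

/-- The numerator is split into `c |ξ|²` and the Cauchy–Schwarz defect of `v` and `ξ`. For `c > 0`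
this gives definiteness; for `c = 0` only the defect remains, which degenerates exactly along the
complex line of `v`. -/
theorem ddcFlat_log_self {c : ℝ} {v : F} (h0 : 0 < c + ‖v‖ ^ 2) (ξ : F) :
    ddcFlat (fun v : F => Real.log (c + ‖v‖ ^ 2)) v ξ ξ =
      4 * (c * ‖ξ‖ ^ 2 + (‖v‖ ^ 2 * ‖ξ‖ ^ 2 - ‖(inner ℂ v ξ : ℂ)‖ ^ 2)) / (c + ‖v‖ ^ 2) ^ 2 := by
  have e1 : (inner ℂ ξ ξ : ℂ).re = ‖ξ‖ ^ 2 := reInner_self ξ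
  have e2 : ((inner ℂ ξ v : ℂ) * inner ℂ v ξ).re = ‖(inner ℂ v ξ : ℂ)‖ ^ 2 := by
    rw [← inner_conj_symm ξ v, ← Complex.normSq_eq_conj_mul_self, Complex.normSq_eq_norm_sq,
      Complex.ofReal_re]
  rw [ddcFlat_log_const_add_norm_sq h0, e1, e2]
  field_simp
  ring

theorem norm_inner_sq_le (v ξ : F) : ‖(inner ℂ v ξ : ℂ)‖ ^ 2 ≤ ‖v‖ ^ 2 * ‖ξ‖ ^ 2 := by
  rw [← mul_pow]
  exact pow_le_pow_left₀ (norm_nonneg _) (norm_inner_le_norm v ξ) 2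

theorem fsBil_pos {c : ℝ} (hc : 0 < c) (v : F) {ξ : F} (hξ : ξ ≠ 0) : 0 < fsBil c v ξ ξ := by
  have h1 := norm_inner_sq_le v ξ
  have h2 : 0 < ‖ξ‖ ^ 2 := by positivity
  rw [fsBil, _root_.smul_apply, _root_.smul_apply, smul_eq_mul,
    ddcFlat_log_self (const_add_norm_sq_pos hc v)]
  have : 0 < c * ‖ξ‖ ^ 2 + (‖v‖ ^ 2 * ‖ξ‖ ^ 2 - ‖(inner ℂ v ξ : ℂ)‖ ^ 2) := by
    have := mul_pos hc h2
    linarith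
  have := const_add_norm_sq_pos hc v
  positivity

variable [FiniteDimensional ℂ F]

/-- Composing one argument with a complex linear map multiplies the Gram matrix by its real matrix,
whose determinant is the squared modulus of the complex determinant. -/
theorem gdet_right {b b' : Bil F} (T : F →ₗ[ℂ] F) (h : ∀ v w, b' v w = b v (T w)) :
    gdet b' = Complex.normSq (LinearMap.det T) * gdet b := by
  set T' : F →ₗ[ℝ] F := T.restrictScalars ℝ
  have key : gram b' = gram b * LinearMap.toMatrix (finBasis ℝ F) (finBasis ℝ F) T' := by
    ext i j
    simp only [gram, Matrix.of_apply, Matrix.mul_apply, h]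
    have h : T (finBasis ℝ F j) =
        ∑ k, LinearMap.toMatrix (finBasis ℝ F) (finBasis ℝ F) T' k j • finBasis ℝ F k := by
      rw [← (finBasis ℝ F).sum_repr (T (finBasis ℝ F j))]
      simp [LinearMap.toMatrix_apply, T']
    rw [h]
    simp only [map_sum, map_smul, smul_eq_mul]
    exact Finset.sum_congr rfl fun k _ => mul_comm _ _
  rw [gdet, key, Matrix.det_mul, LinearMap.det_toMatrix, LinearMap.det_restrictScalars,
    Algebra.norm_complex_apply, mul_comm]
  rfl

/-- Up to a scalar factor, the Fubini–Study tensor is the flat one composed with a rank-one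
perturbation of the identity, of complex determinant `1 - |v|² / (c + |v|²) = c / (c + |v|²)`. -/
theorem gdet_fsBil {c : ℝ} (hc : 0 < c) (v : F) :
    gdet (fsBil c v) = (2 / (c + ‖v‖ ^ 2)) ^ (2 * finrank ℂ F) * (c / (c + ‖v‖ ^ 2)) ^ 2
      * gdet (reInner F) := by
  have hp := const_add_norm_sq_pos hc v
  have hb : fsBil c v = (2 / (c + ‖v‖ ^ 2)) • ((c + ‖v‖ ^ 2) / 2) • fsBil c v := by
    rw [smul_smul, show 2 / (c + ‖v‖ ^ 2) * ((c + ‖v‖ ^ 2) / 2) = 1 by field_simp, one_smul]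
  let f : Dual ℂ F := (-(1 / (c + ‖v‖ ^ 2) : ℝ) : ℂ) • ((innerSL ℂ v : F →L[ℂ] ℂ) : F →ₗ[ℂ] ℂ)
  have hdet := gdet_right (b := reInner F) (b' := ((c + ‖v‖ ^ 2) / 2) • fsBil c v)
    (LinearMap.transvection f v) (by
      intro ξ η
      rw [fsBil]
      simp only [_root_.smul_apply, smul_eq_mul]
      rw [ddcFlat_log_const_add_norm_sq hp]
      change _ = reInner F ξ (η + f η • v)
      have : (inner ℂ ξ (f η • v)) = (-(1 / (c + ‖v‖ ^ 2) : ℝ) : ℂ) * (inner ℂ ξ v * inner ℂ v η) := by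
        rw [inner_smul_right]
        simp only [f, LinearMap.smul_apply, ContinuousLinearMap.coe_coe, innerSL_apply_apply,
          smul_eq_mul]
        ring
      rw [map_add, reInner_apply, reInner_apply, this, ← Complex.ofReal_neg, Complex.re_ofReal_mul]
      field_simp
      ring)
  rw [LinearMap.transvection.det] at hdet
  have hf : (1 + f v : ℂ) = ((c / (c + ‖v‖ ^ 2) : ℝ) : ℂ) := by
    have e1 : (inner ℂ v v : ℂ) = ((‖v‖ ^ 2 : ℝ) : ℂ) := by
      rw [inner_self_eq_norm_sq_to_K]; push_cast; rfl
    simp only [f, LinearMap.smul_apply, ContinuousLinearMap.coe_coe, innerSL_apply_apply,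
      smul_eq_mul, e1]
    norm_cast
    field_simp
    ring
  rw [hf, Complex.normSq_ofReal] at hdet
  rw [hb, gdet_smul, hdet, finrank_real_eq]
  ring

theorem gdet_reInner_pos : 0 < gdet (reInner F) :=
  gdet_pos reInner_symm fun v hv => by rw [reInner_self]; positivity

/-- The scalar curvature of the Fubini-Study metric. -/
theorem scalFlat_fsBil {c : ℝ} (hc : 0 < c) :
    scalFlat (fsBil (F := F) c) 0 = 2 * finrank ℂ F * (finrank ℂ F + 1) := by
  set d := finrank ℂ F
  have hG := gdet_reInner_pos (F := F)
  -- The logarithmic volume is a constant minus `(d + 1) log (c + |v|²)`, so the Ricci tensor is a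
  -- multiple of the metric and its trace needs no further computation.
  have e : (fun v : F => 1 / 2 * Real.log (gdet (fsBil c v))) = fun v =>
      -(d + 1 : ℝ) * Real.log (c + ‖v‖ ^ 2) +
        (d * Real.log 2 + Real.log c + 1 / 2 * Real.log (gdet (reInner F))) := by
    ext v
    have hp := const_add_norm_sq_pos hc v
    rw [gdet_fsBil hc, Real.log_mul (by positivity) hG.ne', Real.log_mul (by positivity)
      (by positivity), Real.log_pow, Real.log_pow, Real.log_div (by norm_num) hp.ne',
      Real.log_div hc.ne' hp.ne']
    push_cast
    ring
  have h2 := (contDiff_log_const_add_norm_sq (F := F) hc (n := 2)).contDiffAt (x := 0)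
  have e2 : ddcFlat (fun v : F => Real.log (c + ‖v‖ ^ 2)) 0 = (2 : ℝ) • fsBil c 0 := by
    rw [fsBil, smul_smul]; norm_num
  have hdet : gdet (fsBil c (0 : F)) ≠ 0 :=
    (gdet_pos (fsBil_symm hc 0) fun ξ hξ => fsBil_pos hc 0 hξ).ne'
  rw [scalFlat_eq, e, ddcFlat_add (contDiffAt_const.mul h2) contDiffAt_const, ddcFlat_const,
    add_zero, ddcFlat_const_mul h2, e2, traceWrt_smul, traceWrt_smul, traceWrt_self hdet,
    finrank_real_eq]
  push_cast
  ring

/-- The base data contributed by the Fubini-Study metric; here `s = ± 1` is the sign. -/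
theorem isCalabiBase_fsBil {c s : ℝ} (hc : 0 < c) (hs : s = 1 ∨ s = -1) :
    ∃ ε : F → ℝ, IsCalabiBase (fun u => fsBil c u) (fun u => s • fsBil c u) ε
      (fun z => (1 + s * z) ^ finrank ℂ F)
      (fun z => 2 * finrank ℂ F * (finrank ℂ F + 1) / (1 + s * z)) 0 := by
  have habs : |s| = 1 := by rcases hs with rfl | rfl <;> simp
  -- A projective fibre behaves like a base factor in the limiting case `|x| = 1`, with `x_0 = 1`
  -- and `x_∞ = -1`.
  have h := isCalabiBase_factor (x := s) hs habs.le (by rcases hs with rfl | rfl <;> norm_num)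
    (contDiffAt_fsBil hc (0 : F)) (Eventually.of_forall fun v => fsBil_symm hc v)
    (Eventually.of_forall fun v ξ hξ => fsBil_pos hc v hξ) (scalFlat_fsBil hc)
  have hs1 : s / s = 1 := by rcases hs with rfl | rfl <;> norm_num
  simp only [hs1, one_smul, habs, one_mul] at h
  exact ⟨_, h⟩

end FubiniStudy

end WeightedExtremal
end


noncomputable section

namespace WeightedExtremal

open Filter Topology Set intervalIntegral MeasureTheory

/-! ### Second primitives against the weight `(1 + t)^m (1 - t)^n` and their behaviour at the ends.
-/

section BoundaryValue

/-- Differentiation under the integral sign gives an integral of the same shape, with `k s` replaced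
by `k s * s` and `h` by its derivative; hence an induction on the order. -/
theorem contDiff_integral_affine {k h : ℝ → ℝ} (hk : Continuous k) (hh : ContDiff ℝ ∞ h) (c : ℝ) :
    ContDiff ℝ ∞ fun z => ∫ s in (0 : ℝ)..1, k s * h (c + s * (z - c)) := by
  rw [contDiff_infty]
  intro n
  induction n generalizing k h with
  | zero =>
    rw [Nat.cast_zero, contDiff_zero]
    refine continuous_parametric_intervalIntegral_of_continuous' ?_ 0 1
    have := hh.continuous
    fun_prop
  | succ n ih =>
    have hd : ∀ t, HasDerivAt h (deriv h t) t := fun t =>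
      (hh.differentiable (by simp) t).hasDerivAt
    have hh' : ContDiff ℝ ∞ (deriv h) := (contDiff_infty_iff_deriv.1 hh).2
    have key : ∀ z, HasDerivAt (fun z => ∫ s in (0 : ℝ)..1, k s * h (c + s * (z - c)))
        (∫ s in (0 : ℝ)..1, (k s * s) * deriv h (c + s * (z - c))) z := by
      intro z
      have hcF : Continuous fun p : ℝ × ℝ => (k p.2 * p.2) * deriv h (c + p.2 * (p.1 - c)) := by
        have := hh'.continuous
        fun_prop
      obtain ⟨C, hC⟩ := ((isCompact_closedBall z 1).prod
        (isCompact_Icc (a := (0 : ℝ)) (b := 1))).exists_bound_of_continuousOn hcF.continuousOn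
      have hc := hh.continuous
      have hc' := hh'.continuous
      refine (intervalIntegral.hasDerivAt_integral_of_dominated_loc_of_deriv_le
        (F := fun z s => k s * h (c + s * (z - c)))
        (F' := fun z s => (k s * s) * deriv h (c + s * (z - c))) (bound := fun _ => C)
        (Metric.ball_mem_nhds z one_pos) ?_ ?_ ?_ ?_ ?_ ?_).2
      · exact Eventually.of_forall fun x =>
          (by fun_prop : Continuous fun s => k s * h (c + s * (x - c))).aestronglyMeasurable
      · exact (by fun_prop : Continuous fun s => k s * h (c + s * (z - c))).intervalIntegrable _ _
      · exact (by fun_prop :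
          Continuous fun s => (k s * s) * deriv h (c + s * (z - c))).aestronglyMeasurable
      · refine Eventually.of_forall fun s hs x hx => hC (x, s) ⟨Metric.ball_subset_closedBall hx, ?_⟩
        rw [uIoc_of_le zero_le_one] at hs
        exact ⟨hs.1.le, hs.2⟩
      · exact intervalIntegrable_const
      · refine Eventually.of_forall fun s _ x _ => ?_
        have h1 : HasDerivAt (fun x => c + s * (x - c)) s x := by
          simpa using (((hasDerivAt_id x).sub_const c).const_mul s).const_add c
        have h2 := ((hd (c + s * (x - c))).comp x h1).const_mul (k s)
        refine h2.congr_deriv ?_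
        ring
    rw [show ((n + 1 : ℕ) : WithTop ℕ∞) = (n : WithTop ℕ∞) + 1 by norm_cast, contDiff_succ_iff_deriv]
    refine ⟨fun z => (key z).differentiableAt, fun h => absurd h (by simp), ?_⟩
    rw [show deriv (fun z => ∫ s in (0 : ℝ)..1, k s * h (c + s * (z - c))) = _ from
      funext fun z => (key z).deriv]
    exact ih (k := fun s => k s * s) (by fun_prop) hh'

/-- The polynomial `(1 + t)^m (1 - t)^n`. -/
def endWeight (m n : ℕ) (t : ℝ) : ℝ := (1 + t) ^ m * (1 - t) ^ n

theorem endWeight_neg (m n : ℕ) (t : ℝ) : endWeight m n (-t) = endWeight n m t := by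
  simp only [endWeight]; ring

theorem contDiff_endWeight (m n : ℕ) {k : WithTop ℕ∞} : ContDiff ℝ k (endWeight m n) := by
  unfold endWeight; fun_prop

theorem endWeight_pos {m n : ℕ} {t : ℝ} (ht : t ∈ Ioo (-1 : ℝ) 1) : 0 < endWeight m n t := by
  have h1 : 0 < 1 + t := by linarith [ht.1]
  have h2 : 0 < 1 - t := by linarith [ht.2]
  unfold endWeight; positivity

theorem endWeight_nonneg {m n : ℕ} {t : ℝ} (ht : t ∈ Icc (-1 : ℝ) 1) : 0 ≤ endWeight m n t := by
  have h1 : 0 ≤ 1 + t := by linarith [ht.1]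
  have h2 : 0 ≤ 1 - t := by linarith [ht.2]
  unfold endWeight; positivity

/-- The second primitive of `endWeight m n * e` vanishing to second order at `-1`. -/
def secondPrimitive (m n : ℕ) (e : ℝ → ℝ) (z : ℝ) : ℝ :=
  ∫ t in (-1 : ℝ)..z, (z - t) * (endWeight m n t * e t)

variable {m n : ℕ} {e : ℝ → ℝ}

theorem continuous_endWeight_mul (he : Continuous e) : Continuous fun t => endWeight m n t * e t :=
  (contDiff_endWeight m n (k := 0)).continuous.mul he

theorem hasDerivAt_firstPrimitive (he : Continuous e) (z : ℝ) :
    HasDerivAt (fun z => ∫ t in (-1 : ℝ)..z, endWeight m n t * e t) (endWeight m n z * e z) z :=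
  integral_hasDerivAt_right ((continuous_endWeight_mul he).intervalIntegrable _ _)
    (continuous_endWeight_mul he).stronglyMeasurable.stronglyMeasurableAtFilter
    (continuous_endWeight_mul he).continuousAt

theorem secondPrimitive_eq (he : Continuous e) (z : ℝ) :
    secondPrimitive m n e z = z * (∫ t in (-1 : ℝ)..z, endWeight m n t * e t)
      - ∫ t in (-1 : ℝ)..z, t * (endWeight m n t * e t) := by
  have hc := continuous_endWeight_mul (m := m) (n := n) he
  rw [secondPrimitive, ← intervalIntegral.integral_const_mul, ← intervalIntegral.integral_sub]
  · simp only [sub_mul]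
  · exact (continuous_const.mul hc).intervalIntegrable _ _
  · exact (continuous_id.mul hc).intervalIntegrable _ _

theorem hasDerivAt_secondPrimitive (he : Continuous e) (z : ℝ) :
    HasDerivAt (secondPrimitive m n e) (∫ t in (-1 : ℝ)..z, endWeight m n t * e t) z := by
  have hc := continuous_endWeight_mul (m := m) (n := n) he
  have hc' : Continuous fun t => t * (endWeight m n t * e t) := continuous_id.mul hc
  have h2 : HasDerivAt (fun z => ∫ t in (-1 : ℝ)..z, t * (endWeight m n t * e t))
      (z * (endWeight m n z * e z)) z :=
    integral_hasDerivAt_right (hc'.intervalIntegrable _ _)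
      hc'.stronglyMeasurable.stronglyMeasurableAtFilter hc'.continuousAt
  have h := ((hasDerivAt_id z).mul (hasDerivAt_firstPrimitive (m := m) (n := n) he z)).sub h2
  rw [show secondPrimitive m n e = _ from funext (secondPrimitive_eq he)]
  refine h.congr_deriv ?_
  simp

theorem secondPrimitive_sub {e' : ℝ → ℝ} (he : Continuous e) (he' : Continuous e') (z : ℝ) :
    secondPrimitive m n (fun t => e t - e' t) z =
      secondPrimitive m n e z - secondPrimitive m n e' z := by
  have hc := continuous_endWeight_mul (m := m) (n := n) he
  have hc' := continuous_endWeight_mul (m := m) (n := n) he'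
  rw [secondPrimitive, secondPrimitive, secondPrimitive, ← intervalIntegral.integral_sub]
  · refine integral_congr fun t _ => ?_
    ring
  · exact ((continuous_const.sub continuous_id).mul hc).intervalIntegrable _ _
  · exact ((continuous_const.sub continuous_id).mul hc').intervalIntegrable _ _

/-- The substitution `t = -1 + s (1 + z)` extracts one factor `1 + z` from `z - t`, one from `dt`
and `m` from the weight. What remains is smooth in `z`. -/
theorem secondPrimitive_left (e : ℝ → ℝ) (z : ℝ) :
    secondPrimitive m n e z = (1 + z) ^ (m + 2) * ∫ s in (0 : ℝ)..1,
      ((1 - s) * s ^ m) * (fun t => (1 - t) ^ n * e t) (-1 + s * (z - -1)) := by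
  have h := intervalIntegral.smul_integral_comp_add_mul (a := 0) (b := 1)
    (fun t => (z - t) * (endWeight m n t * e t)) (1 + z) (-1)
  rw [show (-1 : ℝ) + (1 + z) * 0 = -1 by ring, show -1 + (1 + z) * 1 = z by ring] at h
  rw [secondPrimitive, ← h, smul_eq_mul, ← intervalIntegral.integral_const_mul,
    ← intervalIntegral.integral_const_mul]
  refine integral_congr fun s _ => ?_
  simp only [endWeight]
  rw [show -1 + s * (z - -1) = -1 + (1 + z) * s by ring,
    show 1 + (-1 + (1 + z) * s) = (1 + z) * s by ring, mul_pow]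
  ring

/-- The two moment conditions say that the integral of `(z - t)` times the weighted function over
all of `[-1, 1]` vanishes for every `z`. The primitive from `-1` is therefore also the second
primitive from `1`, and the two ends play symmetric roles. -/
theorem secondPrimitive_reflect (he : Continuous e)
    (h0 : ∫ t in (-1 : ℝ)..1, endWeight m n t * e t = 0)
    (h1 : ∫ t in (-1 : ℝ)..1, t * (endWeight m n t * e t) = 0) (z : ℝ) :
    secondPrimitive m n e z = secondPrimitive n m (fun t => e (-t)) (-z) := by
  have hc := continuous_endWeight_mul (m := m) (n := n) he
  have hc' : Continuous fun t => t * (endWeight m n t * e t) := continuous_id.mul hc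
  have e1 : secondPrimitive n m (fun t => e (-t)) (-z) =
      ∫ t in z..1, (t - z) * (endWeight m n t * e t) := by
    have := intervalIntegral.integral_comp_neg (a := -1) (b := -z)
      (fun t => (t - z) * (endWeight m n t * e t))
    rw [neg_neg, neg_neg] at this
    rw [← this, secondPrimitive]
    refine integral_congr fun t _ => ?_
    simp only [endWeight_neg]
    ring
  have e2 : ∫ t in z..1, (t - z) * (endWeight m n t * e t) =
      (∫ t in z..1, t * (endWeight m n t * e t)) - z * ∫ t in z..1, endWeight m n t * e t := by
    rw [← intervalIntegral.integral_const_mul, ← intervalIntegral.integral_sub]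
    · simp only [sub_mul]
    · exact hc'.intervalIntegrable _ _
    · exact (continuous_const.mul hc).intervalIntegrable _ _
  have i0 := integral_add_adjacent_intervals (hc.intervalIntegrable (μ := volume) (-1) z)
    (hc.intervalIntegrable z 1)
  have i1 := integral_add_adjacent_intervals (hc'.intervalIntegrable (μ := volume) (-1) z)
    (hc'.intervalIntegrable z 1)
  rw [e1, e2, secondPrimitive_eq he]
  rw [h0] at i0
  rw [h1] at i1
  linear_combination z * i0 - i1

/-- A second primitive vanishing to second order at both ends is smoothly divisible. -/
theorem secondPrimitive_divisible (he : ContDiff ℝ ∞ e)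
    (h0 : ∫ t in (-1 : ℝ)..1, endWeight m n t * e t = 0)
    (h1 : ∫ t in (-1 : ℝ)..1, t * (endWeight m n t * e t) = 0) :
    ∃ η : ℝ → ℝ, ContDiff ℝ ∞ η ∧
      ∀ z, secondPrimitive m n e z = (1 - z ^ 2) ^ 2 * endWeight m n z * η z := by
  have left : ∀ (m n : ℕ) (e : ℝ → ℝ), ContDiff ℝ ∞ e → ∃ L : ℝ → ℝ, ContDiff ℝ ∞ L ∧
      ∀ z, secondPrimitive m n e z = (1 + z) ^ (m + 2) * L z := by
    intro m n e he
    exact ⟨_, contDiff_integral_affine (k := fun s => (1 - s) * s ^ m) (by fun_prop)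
      (h := fun t => (1 - t) ^ n * e t) (by fun_prop) (-1), secondPrimitive_left e⟩
  obtain ⟨L, hL, hLe⟩ := left m n e he
  obtain ⟨R, hR, hRe⟩ := left n m (fun t => e (-t)) (he.comp contDiff_neg)
  have hRz : ∀ z, secondPrimitive m n e z = (1 - z) ^ (n + 2) * R (-z) := by
    intro z
    rw [secondPrimitive_reflect he.continuous h0 h1, hRe]
    ring
  -- One quotient is smooth away from `1`, the other away from `-1`. They agree on `(-1, 1)`, where
  -- the divisor is nonzero, and are glued at `0`.
  let ηL : ℝ → ℝ := fun z => L z / (1 - z) ^ (n + 2)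
  let ηR : ℝ → ℝ := fun z => R (-z) / (1 + z) ^ (m + 2)
  have hηL : ∀ z < 1, secondPrimitive m n e z = (1 - z ^ 2) ^ 2 * endWeight m n z * ηL z := by
    intro z hz
    have : 1 - z ≠ 0 := by linarith
    rw [hLe]
    simp only [ηL, endWeight]
    field_simp
    ring
  have hηR : ∀ z > -1, secondPrimitive m n e z = (1 - z ^ 2) ^ 2 * endWeight m n z * ηR z := by
    intro z hz
    have : 1 + z ≠ 0 := by linarith
    rw [hRz]
    simp only [ηR, endWeight]
    field_simp
    ring
  have hagree : ∀ z ∈ Ioo (-1 : ℝ) 1, ηL z = ηR z := by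
    intro z hz
    have h := (hηL z hz.2).symm.trans (hηR z hz.1)
    have h2 : (1 - z ^ 2) ^ 2 * endWeight m n z ≠ 0 := by
      have := endWeight_pos (m := m) (n := n) hz
      have : 0 < 1 - z ^ 2 := by nlinarith [hz.1, hz.2]
      positivity
    exact mul_left_cancel₀ h2 h
  refine ⟨fun z => if z < 0 then ηL z else ηR z, ?_, ?_⟩
  · rw [contDiff_iff_contDiffAt]
    intro z
    rcases lt_or_ge z (1 / 2) with hz | hz
    · have hsm : ContDiffAt ℝ ∞ ηL z :=
        hL.contDiffAt.div (by fun_prop) (pow_ne_zero _ (by linarith))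
      refine hsm.congr_of_eventuallyEq ?_
      filter_upwards [Iio_mem_nhds hz] with y hy
      split_ifs with h
      · rfl
      · exact (hagree y ⟨by linarith, by linarith [mem_Iio.1 hy]⟩).symm
    · have hsm : ContDiffAt ℝ ∞ ηR z :=
        (hR.comp contDiff_neg).contDiffAt.div (by fun_prop) (pow_ne_zero _ (by linarith))
      refine hsm.congr_of_eventuallyEq ?_
      filter_upwards [Ioi_mem_nhds (show (0 : ℝ) < z by linarith)] with y hy
      rw [if_neg (not_lt.2 (mem_Ioi.1 hy).le)]
  · intro z
    dsimp only
    split_ifs with h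
    · exact hηL z (by linarith)
    · exact hηR z (by linarith)

/-- On `[-1, z]` one has `|z - t| ≤ 1 + z` and weight at most `(1 + z)^m 2^n`, and the interval has
length `1 + z`. One factor `1 + z` is spent on the crude bound by `2`, and `1 - z ≥ 1` restores the
missing powers. -/
theorem abs_secondPrimitive_le_left {δ : ℝ} (hδ : ∀ t ∈ Icc (-1 : ℝ) 1, |e t| ≤ δ) {z : ℝ}
    (hz : z ∈ Icc (-1 : ℝ) 0) :
    |secondPrimitive m n e z| ≤ δ * 2 ^ (n + 1) * ((1 - z ^ 2) * endWeight m n z) := by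
  have hδ0 : 0 ≤ δ := (abs_nonneg _).trans (hδ 0 (by norm_num))
  have hz1 : 0 ≤ 1 + z := by linarith [hz.1]
  have hz2 : 1 ≤ 1 - z := by linarith [hz.2]
  have key : ∀ t ∈ uIoc (-1 : ℝ) z, ‖(z - t) * (endWeight m n t * e t)‖ ≤
      (1 + z) * ((1 + z) ^ m * 2 ^ n * δ) := by
    intro t ht
    rw [uIoc_of_le hz.1] at ht
    have h1 : |z - t| ≤ 1 + z := by rw [abs_of_nonneg (by linarith [ht.2])]; linarith [ht.1]
    have h2 : |e t| ≤ δ := hδ t ⟨ht.1.le, by linarith [ht.2, hz.2]⟩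
    have h3 : |endWeight m n t| ≤ (1 + z) ^ m * 2 ^ n := by
      have a1 : 0 ≤ 1 + t := by linarith [ht.1]
      have a2 : 0 ≤ 1 - t := by linarith [ht.2, hz.2]
      have a3 : 1 + t ≤ 1 + z := by linarith [ht.2]
      have a4 : 1 - t ≤ 2 := by linarith [ht.1]
      rw [endWeight, abs_of_nonneg (by positivity)]
      gcongr
    rw [Real.norm_eq_abs, abs_mul, abs_mul]
    gcongr
  have h := intervalIntegral.norm_integral_le_of_norm_le_const key
  rw [Real.norm_eq_abs] at h
  refine h.trans ?_
  rw [abs_of_nonneg (by linarith : 0 ≤ z - -1), endWeight]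
  have h4 : 1 ≤ (1 - z) ^ (n + 1) := one_le_pow₀ hz2
  calc (1 + z) * ((1 + z) ^ m * 2 ^ n * δ) * (z - -1)
      = δ * 2 ^ n * (1 + z) ^ (m + 1) * (1 + z) := by ring
    _ ≤ δ * 2 ^ n * (1 + z) ^ (m + 1) * (2 * (1 - z) ^ (n + 1)) := by
        gcongr
        linarith [hz.2]
    _ = δ * 2 ^ (n + 1) * ((1 - z ^ 2) * ((1 + z) ^ m * (1 - z) ^ n)) := by ring

/-- The bound is relative to `(1 - z²) * endWeight`, the size of the canonical solution near the
ends, so that a small remainder cannot destroy positivity there. Reflection reduces the right half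
to the left one. -/
theorem abs_secondPrimitive_le (he : Continuous e)
    (h0 : ∫ t in (-1 : ℝ)..1, endWeight m n t * e t = 0)
    (h1 : ∫ t in (-1 : ℝ)..1, t * (endWeight m n t * e t) = 0)
    {δ : ℝ} (hδ : ∀ t ∈ Icc (-1 : ℝ) 1, |e t| ≤ δ) {z : ℝ} (hz : z ∈ Icc (-1 : ℝ) 1) :
    |secondPrimitive m n e z| ≤ δ * 2 ^ (m + n + 1) * ((1 - z ^ 2) * endWeight m n z) := by
  have hδ0 : 0 ≤ δ := (abs_nonneg _).trans (hδ 0 (by norm_num))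
  have hw := endWeight_nonneg (m := m) (n := n) hz
  have hz2 : 0 ≤ 1 - z ^ 2 := by nlinarith [hz.1, hz.2]
  rcases le_total z 0 with h | h
  · refine (abs_secondPrimitive_le_left hδ ⟨hz.1, h⟩).trans ?_
    gcongr
    · norm_num
    · omega
  · rw [secondPrimitive_reflect he h0 h1]
    refine (abs_secondPrimitive_le_left (δ := δ) (fun t ht => hδ (-t) ⟨by linarith [ht.2],
      by linarith [ht.1]⟩) ⟨by linarith [hz.2], by linarith⟩).trans ?_
    rw [endWeight_neg, neg_sq]
    gcongr
    · norm_num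
    · omega

end BoundaryValue

end WeightedExtremal
end


noncomputable section

namespace WeightedExtremal

open Filter Topology Set intervalIntegral MeasureTheory

/-! ### A positivity criterion for functions whose second derivative has the sign of a convex
function. -/

section Convexity

/-- With a positive second derivative the point would also be a local minimum, and the function
would be constant nearby. -/
theorem deriv2_nonpos_of_isLocalMax {G G' : ℝ → ℝ} {g y : ℝ} (h1 : ∀ᶠ t in 𝓝 y, HasDerivAt G (G' t) t)
    (h2 : HasDerivAt G' g y) (hmax : IsLocalMax G y) : g ≤ 0 := by
  by_contra! hg
  have e1 : deriv G =ᶠ[𝓝 y] G' := h1.mono fun t ht => ht.deriv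
  have e2 : deriv (deriv G) y = g := by rw [e1.deriv_eq, h2.deriv]
  have h0 : deriv G y = 0 := hmax.deriv_eq_zero
  have hmin : IsLocalMin G y := isLocalMin_of_deriv_deriv_pos (by rw [e2]; exact hg) h0
    h1.self_of_nhds.continuousAt
  have hc : G =ᶠ[𝓝 y] fun _ => G y := by
    filter_upwards [hmax, hmin] with t ha hb
    exact le_antisymm ha hb
  have : deriv (deriv G) y = 0 := by
    have h3 : deriv G =ᶠ[𝓝 y] fun _ => 0 := by
      filter_upwards [hc.eventuallyEq_nhds] with t ht
      rw [ht.deriv_eq, deriv_const]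
    rw [h3.deriv_eq, deriv_const]
  linarith

/-- A function vanishing at both ends, positive near them, and whose second derivative has the sign
of a convex function, is positive. -/
theorem pos_of_deriv2_convex {G G' Q wt : ℝ → ℝ} (hc : ContinuousOn G (Icc (-1) 1))
    (h1 : ∀ t ∈ Ioo (-1 : ℝ) 1, HasDerivAt G (G' t) t)
    (h2 : ∀ t ∈ Ioo (-1 : ℝ) 1, HasDerivAt G' (wt t * Q t) t)
    (hwt : ∀ t ∈ Ioo (-1 : ℝ) 1, 0 < wt t) (hQ : ConvexOn ℝ (Ioo (-1) 1) Q)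
    (hl : G (-1) = 0) (hr : G 1 = 0) (hl' : ∀ᶠ t in 𝓝[>] (-1 : ℝ), 0 < G t)
    (hr' : ∀ᶠ t in 𝓝[<] (1 : ℝ), 0 < G t) : ∀ z ∈ Ioo (-1 : ℝ) 1, 0 < G z := by
  intro z hz
  by_contra! hGz
  have hmaxQ : ∀ y ∈ Ioo (-1 : ℝ) 1, IsLocalMax G y → Q y ≤ 0 := by
    intro y hy hmax
    have := deriv2_nonpos_of_isLocalMax
      (Filter.mem_of_superset (Ioo_mem_nhds hy.1 hy.2) h1) (h2 y hy) hmax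
    exact nonpos_of_mul_nonpos_right this (hwt y hy)
  -- `G` vanishes at `-1`, is positive just after it and is nonpositive at `z`, so its maximum on
  -- `[-1, z]` is positive and interior.
  have hleft : ∃ y ∈ Ioo (-1 : ℝ) z, 0 < G y ∧ Q y ≤ 0 := by
    obtain ⟨t, ht, htz⟩ := (hl'.and (Ioo_mem_nhdsGT hz.1)).exists
    obtain ⟨y, hy, hymax⟩ := isCompact_Icc.exists_isMaxOn (nonempty_Icc.2 hz.1.le)
      (hc.mono (Icc_subset_Icc_right hz.2.le))
    have hGy : 0 < G y := ht.trans_le (hymax ⟨htz.1.le, htz.2.le⟩)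
    have hy1 : y ≠ -1 := by rintro rfl; linarith
    have hy2 : y ≠ z := by rintro rfl; linarith
    have hyI : y ∈ Ioo (-1) z := ⟨lt_of_le_of_ne hy.1 hy1.symm, lt_of_le_of_ne hy.2 hy2⟩
    exact ⟨y, hyI, hGy, hmaxQ y ⟨hyI.1, hyI.2.trans hz.2⟩
      (hymax.isLocalMax (Icc_mem_nhds hyI.1 hyI.2))⟩
  have hright : ∃ y ∈ Ioo z (1 : ℝ), 0 < G y ∧ Q y ≤ 0 := by
    obtain ⟨t, ht, htz⟩ := (hr'.and (Ioo_mem_nhdsLT hz.2)).exists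
    obtain ⟨y, hy, hymax⟩ := isCompact_Icc.exists_isMaxOn (nonempty_Icc.2 hz.2.le)
      (hc.mono (Icc_subset_Icc_left hz.1.le))
    have hGy : 0 < G y := ht.trans_le (hymax ⟨htz.1.le, htz.2.le⟩)
    have hy1 : y ≠ z := by rintro rfl; linarith
    have hy2 : y ≠ 1 := by rintro rfl; linarith
    have hyI : y ∈ Ioo z 1 := ⟨lt_of_le_of_ne hy.1 hy1.symm, lt_of_le_of_ne hy.2 hy2⟩
    exact ⟨y, hyI, hGy, hmaxQ y ⟨hz.1.trans hyI.1, hyI.2⟩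
      (hymax.isLocalMax (Icc_mem_nhds hyI.1 hyI.2))⟩
  obtain ⟨u, hu, hGu, hQu⟩ := hleft
  obtain ⟨v, hv, hGv, hQv⟩ := hright
  have hsub : Icc u v ⊆ Ioo (-1 : ℝ) 1 := fun t ht =>
    ⟨hu.1.trans_le ht.1, ht.2.trans_lt hv.2⟩
  have huv : u ≤ v := (hu.2.trans hv.1).le
  -- A convex function that is nonpositive at `u` and `v` is nonpositive between them. Concavity
  -- then bounds `G z` below by the smaller of the positive values `G u` and `G v`.
  have hconc : ConcaveOn ℝ (Icc u v) G := by
    refine concaveOn_of_hasDerivWithinAt2_nonpos (convex_Icc u v)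
      (hc.mono fun t ht => Ioo_subset_Icc_self (hsub ht)) (f' := G') (f'' := fun t => wt t * Q t)
      ?_ ?_ ?_
    · intro t ht
      exact (h1 t (hsub (interior_subset ht))).hasDerivWithinAt
    · intro t ht
      exact (h2 t (hsub (interior_subset ht))).hasDerivWithinAt
    · intro t ht
      have htm := interior_subset ht
      have hle := hQ.le_max_of_mem_Icc (hsub (left_mem_Icc.2 huv)) (hsub (right_mem_Icc.2 huv)) htm
      exact mul_nonpos_of_nonneg_of_nonpos (hwt t (hsub htm)).le (hle.trans (max_le hQu hQv))
  have := hconc.min_le_of_mem_Icc (left_mem_Icc.2 huv) (right_mem_Icc.2 huv)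
    (⟨hu.2.le, hv.1.le⟩ : z ∈ Icc u v)
  have : 0 < min (G u) (G v) := lt_min hGu hGv
  linarith

/-- A square over a positive affine function is convex: after clearing denominators the convexity
gap is `l m` times the square of `(t + a) (1 + x u) - (u + a) (1 + x t)`. -/
theorem convexOn_sq_div_affine {a x : ℝ} {s : Set ℝ} (hs : Convex ℝ s)
    (hpos : ∀ t ∈ s, 0 < 1 + x * t) : ConvexOn ℝ s fun t => (t + a) ^ 2 / (1 + x * t) := by
  refine ⟨hs, fun t ht u hu l m hl hm hlm => ?_⟩
  have h1 := hpos t ht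
  have h2 := hpos u hu
  have h3 := hpos _ (hs ht hu hl hm hlm)
  simp only [smul_eq_mul] at h3 ⊢
  rw [div_le_iff₀ h3, mul_div_assoc', mul_div_assoc', div_add_div _ _ h1.ne' h2.ne',
    div_mul_eq_mul_div, le_div_iff₀ (by positivity)]
  have e1 : l * t + m * u + a = l * (t + a) + m * (u + a) := by linear_combination (-a) * hlm
  have e2 : 1 + x * (l * t + m * u) = l * (1 + x * t) + m * (1 + x * u) := by
    linear_combination -hlm
  rw [e1, e2]
  have key := mul_nonneg (mul_nonneg hl hm)
    (sq_nonneg ((t + a) * (1 + x * u) - (u + a) * (1 + x * t)))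
  nlinarith [key]

end Convexity

/-! ### Weighted projection onto affine functions. -/

section Projection

variable (m n : ℕ)

/-- Moments with respect to the weight `(1 + t)^m (1 - t)^n`. -/
def moment (k : ℕ) (g : ℝ → ℝ) : ℝ := ∫ t in (-1 : ℝ)..1, t ^ k * (endWeight m n t * g t)

variable {m n}

theorem integrable_moment (k : ℕ) {g : ℝ → ℝ} (hg : Continuous g) :
    IntervalIntegrable (fun t => t ^ k * (endWeight m n t * g t)) volume (-1) 1 :=
  ((continuous_pow k).mul (continuous_endWeight_mul hg)).intervalIntegrable _ _

/-- The Gram determinant of `1, t`. -/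
def momentDet (m n : ℕ) (w : ℝ → ℝ) : ℝ :=
  moment m n 0 w * moment m n 2 w - moment m n 1 w ^ 2

/-- The coefficients of the affine function `α t + β` whose multiple by `w` has the same first
moments as `R`. -/
def projSlope (m n : ℕ) (R w : ℝ → ℝ) : ℝ :=
  (moment m n 0 w * moment m n 1 R - moment m n 1 w * moment m n 0 R) / momentDet m n w

/-- The constant coefficient of the affine function of `projSlope`. -/
def projConst (m n : ℕ) (R w : ℝ → ℝ) : ℝ :=
  (moment m n 2 w * moment m n 0 R - moment m n 1 w * moment m n 1 R) / momentDet m n w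

theorem moment_pos {w : ℝ → ℝ} (hw : Continuous w) (hpos : ∀ t ∈ Ioo (-1 : ℝ) 1, 0 < w t) :
    0 < moment m n 0 w := by
  refine intervalIntegral.intervalIntegral_pos_of_pos_on (integrable_moment 0 hw)
    (fun t ht => ?_) (by norm_num)
  have := endWeight_pos (m := m) (n := n) ht
  have := hpos t ht
  positivity

/-- Strict Cauchy–Schwarz: with `c` the barycentre of the weight, the determinant is the zeroth
moment times the integral of `(t - c)²`, which is positive as the weight is not concentrated at a
point. -/
theorem momentDet_pos {w : ℝ → ℝ} (hw : Continuous w) (hpos : ∀ t ∈ Ioo (-1 : ℝ) 1, 0 < w t) :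
    0 < momentDet m n w := by
  have h0 := moment_pos (m := m) (n := n) hw hpos
  set c := moment m n 1 w / moment m n 0 w with hc
  have hcont : Continuous fun t => (t - c) ^ 2 * (endWeight m n t * w t) := by
    have := continuous_endWeight_mul (m := m) (n := n) hw
    fun_prop
  have hint : 0 < ∫ t in (-1 : ℝ)..1, (t - c) ^ 2 * (endWeight m n t * w t) := by
    obtain ⟨s, hs, hsc⟩ : ∃ s ∈ Ioo (-1 : ℝ) 1, s ≠ c := by
      by_cases h : c = 0
      · exact ⟨1 / 2, by norm_num, by rw [h]; norm_num⟩
      · exact ⟨0, by norm_num, fun h' => h h'.symm⟩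
    have hle : ∀ t ∈ Icc (-1 : ℝ) 1, 0 ≤ (t - c) ^ 2 * (endWeight m n t * w t) := by
      have hcl : IsClosed {t | 0 ≤ (t - c) ^ 2 * (endWeight m n t * w t)} :=
        isClosed_le continuous_const hcont
      have : Ioo (-1 : ℝ) 1 ⊆ {t | 0 ≤ (t - c) ^ 2 * (endWeight m n t * w t)} := by
        intro t ht
        have := endWeight_pos (m := m) (n := n) ht
        have := hpos t ht
        simp only [Set.mem_ofPred_eq]
        positivity
      have h2 := closure_minimal this hcl
      rw [closure_Ioo (by norm_num)] at h2
      exact h2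
    refine intervalIntegral.integral_pos (by norm_num) hcont.continuousOn
      (fun t ht => hle t ⟨ht.1.le, ht.2⟩) ⟨s, Ioo_subset_Icc_self hs, ?_⟩
    have := endWeight_pos (m := m) (n := n) hs
    have := hpos s hs
    have : 0 < (s - c) ^ 2 := by
      have : s - c ≠ 0 := sub_ne_zero.2 hsc
      positivity
    positivity
  have hexp : ∫ t in (-1 : ℝ)..1, (t - c) ^ 2 * (endWeight m n t * w t) =
      moment m n 2 w - 2 * c * moment m n 1 w + c ^ 2 * moment m n 0 w := by
    simp only [moment]
    rw [← intervalIntegral.integral_const_mul, ← intervalIntegral.integral_const_mul,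
      ← intervalIntegral.integral_sub, ← intervalIntegral.integral_add]
    · refine integral_congr fun t _ => ?_
      ring
    · exact (integrable_moment 2 hw).sub ((integrable_moment 1 hw).const_mul _)
    · exact (integrable_moment 0 hw).const_mul _
    · exact integrable_moment 2 hw
    · exact (integrable_moment 1 hw).const_mul _
  rw [hexp, hc] at hint
  have : momentDet m n w = moment m n 0 w * (moment m n 2 w
      - 2 * (moment m n 1 w / moment m n 0 w) * moment m n 1 w
      + (moment m n 1 w / moment m n 0 w) ^ 2 * moment m n 0 w) := by
    rw [momentDet]; field_simp; ring
  rw [this]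
  exact mul_pos h0 hint

/-- The residual of the projection. -/
def residual (m n : ℕ) (R w : ℝ → ℝ) (t : ℝ) : ℝ :=
  R t - w t * (projSlope m n R w * t + projConst m n R w)

/-- The slope and constant come from Cramer's rule for exactly these two linear equations. -/
theorem moment_residual {R w : ℝ → ℝ} (hR : Continuous R) (hw : Continuous w)
    (hpos : ∀ t ∈ Ioo (-1 : ℝ) 1, 0 < w t) :
    moment m n 0 (residual m n R w) = 0 ∧ moment m n 1 (residual m n R w) = 0 := by
  have hdet := (momentDet_pos (m := m) (n := n) hw hpos).ne'
  have key : ∀ k, moment m n k (residual m n R w) = moment m n k R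
      - (projSlope m n R w * moment m n (k + 1) w + projConst m n R w * moment m n k w) := by
    intro k
    simp only [moment]
    rw [← intervalIntegral.integral_const_mul, ← intervalIntegral.integral_const_mul,
      ← intervalIntegral.integral_add, ← intervalIntegral.integral_sub]
    · refine integral_congr fun t _ => ?_
      simp only [residual]
      ring
    · exact integrable_moment k hR
    · exact ((integrable_moment (k + 1) hw).const_mul _).add ((integrable_moment k hw).const_mul _)
    · exact (integrable_moment (k + 1) hw).const_mul _
    · exact (integrable_moment k hw).const_mul _
  rw [key, key]
  simp only [projSlope, projConst, zero_add, one_add_one_eq_two]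
  constructor
  · field_simp
    rw [momentDet]; ring
  · field_simp
    rw [momentDet]; ring

theorem continuous_moment {X : Type*} [TopologicalSpace X] {g : X → ℝ → ℝ}
    (hg : Continuous fun q : X × ℝ => g q.1 q.2) (k : ℕ) :
    Continuous fun x => moment m n k (g x) := by
  refine continuous_parametric_intervalIntegral_of_continuous' ?_ _ _
  have := (contDiff_endWeight m n (k := 0)).continuous
  change Continuous fun q : X × ℝ => q.2 ^ k * (endWeight m n q.2 * g q.1 q.2)
  fun_prop

/-- The residual depends continuously on parameters. -/
theorem continuousAt_residual {X : Type*} [TopologicalSpace X] {R w : X → ℝ → ℝ}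
    (hR : Continuous fun q : X × ℝ => R q.1 q.2) (hw : Continuous fun q : X × ℝ => w q.1 q.2)
    {x : X} (hpos : ∀ t ∈ Ioo (-1 : ℝ) 1, 0 < w x t) (t : ℝ) :
    ContinuousAt (fun q : X × ℝ => residual m n (R q.1) (w q.1) q.2) (x, t) := by
  have hwx : Continuous (w x) := hw.comp (Continuous.prodMk_right x)
  have hdet := (momentDet_pos (m := m) (n := n) hwx hpos).ne'
  have hmw := fun k => continuous_moment (m := m) (n := n) hw k
  have hmR := fun k => continuous_moment (m := m) (n := n) hR k
  have hd : Continuous fun x => momentDet m n (w x) :=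
    ((hmw 0).mul (hmw 2)).sub ((hmw 1).pow 2)
  have hs : ContinuousAt (fun q : X × ℝ => projSlope m n (R q.1) (w q.1)) (x, t) := by
    have : ContinuousAt (fun x => projSlope m n (R x) (w x)) x :=
      (((hmw 0).mul (hmR 1)).sub ((hmw 1).mul (hmR 0))).continuousAt.div hd.continuousAt hdet
    exact this.comp (x := (x, t)) continuousAt_fst
  have hk : ContinuousAt (fun q : X × ℝ => projConst m n (R q.1) (w q.1)) (x, t) := by
    have : ContinuousAt (fun x => projConst m n (R x) (w x)) x :=
      (((hmw 2).mul (hmR 0)).sub ((hmw 1).mul (hmR 1))).continuousAt.div hd.continuousAt hdet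
    exact this.comp (x := (x, t)) continuousAt_fst
  exact hR.continuousAt.sub (hw.continuousAt.mul ((hs.mul continuousAt_snd).add hk))

end Projection

end WeightedExtremal
end


noncomputable section

namespace WeightedExtremal

open Filter Topology Set intervalIntegral MeasureTheory

/-! ### The linear differential equation for the weighted extremal profile. -/

section WeightedEquation

variable (m n : ℕ) (p : ℝ) (f u u' u'' s : ℝ → ℝ)

/-- The quotient by `endWeight m n` of the derivative of `(1 - t²) u endWeight m n`. -/
def endDeriv (t : ℝ) : ℝ :=
  ((m + 1) * (1 - t) - (n + 1) * (1 + t)) * u t + (1 - t ^ 2) * u' t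

/-- The quotient by `endWeight m n` of `σ u endWeight m n` minus the second derivative of
`(1 - t²) u endWeight m n`, where
`σ = s / u + 2 m (m + 1) / (1 + t) + 2 n (n + 1) / (1 - t)`. -/
def endScal (t : ℝ) : ℝ :=
  s t + (m + n) * (m + n + 2) * u t + (n * (1 + t) - m * (1 - t)) * u' t
    - ((-(m + 1) - (n + 1)) * u t + ((m + 1) * (1 - t) - (n + 1) * (1 + t)) * u' t
      - 2 * t * u' t + (1 - t ^ 2) * u'' t)

/-- The weighted scalar curvature of the canonical profile, times a weight. -/
def odeSource (t : ℝ) : ℝ :=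
  f t ^ (-1 - p) * (f t ^ 2 * endScal m n u u' u'' s t + 2 * (p - 1) * f t * endDeriv m n u u' t
    - p * (p - 1) * (1 - t ^ 2) * u t)

/-- The weight of the projection to affine functions. -/
def odeWeight (t : ℝ) : ℝ := f t ^ (-1 - p) * u t

/-- The second derivative of the correction to the canonical profile, up to a weight. -/
def odeRemainder : ℝ → ℝ := residual m n (odeSource m n p f u u' u'' s) (odeWeight p f u)

/-- The solution of the weighted equation, times a weight. -/
def odeSolution (t : ℝ) : ℝ :=
  (1 - t ^ 2) * (u t * endWeight m n t) * f t ^ (1 - p)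
    + secondPrimitive m n (odeRemainder m n p f u u' u'' s) t

/-- The right hand side `σ P`. -/
def endScalTerm (t : ℝ) : ℝ :=
  (s t + (2 * m * (m + 1) / (1 + t) + 2 * n * (n + 1) / (1 - t)) * u t) * endWeight m n t

variable {m n p f u u' u'' s}

theorem hasDerivAt_endWeight {t : ℝ} (ht : t ∈ Ioo (-1 : ℝ) 1) :
    HasDerivAt (endWeight m n) (endWeight m n t * (m / (1 + t) - n / (1 - t))) t := by
  have h1 : 1 + t ≠ 0 := by linarith [ht.1]
  have h2 : 1 - t ≠ 0 := by linarith [ht.2]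
  have e1 := ((hasDerivAt_id t).const_add 1).pow m
  have e2 := ((hasDerivAt_id t).const_sub 1).pow n
  refine (e1.mul e2).congr_deriv ?_
  simp only [id, endWeight, Pi.pow_apply]
  rcases m with _ | m <;> rcases n with _ | n <;> simp <;> field_simp <;> ring

theorem hasDerivAt_canonical (hu : ∀ t, HasDerivAt u (u' t) t) {t : ℝ} (ht : t ∈ Ioo (-1 : ℝ) 1) :
    HasDerivAt (fun t => (1 - t ^ 2) * (u t * endWeight m n t))
      (endDeriv m n u u' t * endWeight m n t) t := by
  have h1 : 1 + t ≠ 0 := by linarith [ht.1]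
  have h2 : 1 - t ≠ 0 := by linarith [ht.2]
  have e1 := ((hasDerivAt_id t).pow 2).const_sub 1
  refine (e1.mul ((hu t).mul (hasDerivAt_endWeight ht))).congr_deriv ?_
  simp only [id, endDeriv, Pi.pow_apply, Pi.mul_apply]
  field_simp
  push_cast
  ring

/-- Near `-1` the leading part of `(1 - t²) (1 + t)^m` has second derivative `2 m (m + 1) (1 + t)^{m
- 1}`, and similarly at `1`. These are the poles contributed to `σ` by the Fubini–Study fibres, so
the difference `endScal` is pole-free. -/
theorem hasDerivAt_canonical_deriv (hu : ∀ t, HasDerivAt u (u' t) t)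
    (hu' : ∀ t, HasDerivAt u' (u'' t) t) {t : ℝ} (ht : t ∈ Ioo (-1 : ℝ) 1) :
    HasDerivAt (fun t => endDeriv m n u u' t * endWeight m n t)
      (endScalTerm m n u s t - endScal m n u u' u'' s t * endWeight m n t) t := by
  have h1 : 1 + t ≠ 0 := by linarith [ht.1]
  have h2 : 1 - t ≠ 0 := by linarith [ht.2]
  have e1 := ((hasDerivAt_id t).pow 2).const_sub 1
  have e2 := ((hasDerivAt_id t).const_sub 1).const_mul ((m : ℝ) + 1)
  have e3 := ((hasDerivAt_id t).const_add 1).const_mul ((n : ℝ) + 1)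
  have e4 := ((e2.sub e3).mul (hu t)).add (e1.mul (hu' t))
  refine (e4.mul (hasDerivAt_endWeight ht)).congr_deriv ?_
  simp only [id, endScal, endScalTerm, Pi.pow_apply, Pi.mul_apply, Pi.add_apply,
    Pi.sub_apply]
  field_simp
  push_cast
  ring

/-- The data of the weighted equation. -/
structure IsOdeData (a : ℝ) (f u u' u'' s : ℝ → ℝ) : Prop where
  lt : 1 < a
  weight_smooth : ContDiff ℝ ∞ f
  weight_pos : ∀ t, 0 < f t
  weight_eq : ∀ t ∈ Icc (-1 : ℝ) 1, f t = t + a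
  smooth : ContDiff ℝ ∞ u
  hasDeriv : ∀ t, HasDerivAt u (u' t) t
  hasDeriv' : ∀ t, HasDerivAt u' (u'' t) t
  smooth' : ContDiff ℝ ∞ u'
  smooth'' : ContDiff ℝ ∞ u''
  scal_smooth : ContDiff ℝ ∞ s
  pos : ∀ t ∈ Icc (-1 : ℝ) 1, 0 < u t

variable {a : ℝ}

namespace IsOdeData

theorem contDiff_source (h : IsOdeData a f u u' u'' s) :
    ContDiff ℝ ∞ (odeSource m n p f u u' u'' s) := by
  have h1 := h.smooth
  have h2 := h.smooth'
  have h3 := h.smooth''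
  have h4 := h.scal_smooth
  have h5 := h.weight_smooth
  have h6 : ContDiff ℝ ∞ fun t => f t ^ (-1 - p) :=
    h5.rpow_const_of_ne fun t => (h.weight_pos t).ne'
  unfold odeSource endScal endDeriv
  fun_prop

theorem contDiff_weight (h : IsOdeData a f u u' u'' s) : ContDiff ℝ ∞ (odeWeight p f u) :=
  (h.weight_smooth.rpow_const_of_ne fun t => (h.weight_pos t).ne').mul h.smooth

theorem weight_pos_on (h : IsOdeData a f u u' u'' s) : ∀ t ∈ Ioo (-1 : ℝ) 1, 0 < odeWeight p f u t :=
  fun t ht => mul_pos (Real.rpow_pos_of_pos (h.weight_pos t) _) (h.pos t (Ioo_subset_Icc_self ht))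

theorem contDiff_remainder (h : IsOdeData a f u u' u'' s) :
    ContDiff ℝ ∞ (odeRemainder m n p f u u' u'' s) := by
  have h1 := h.contDiff_source (m := m) (n := n) (p := p)
  have h2 := h.contDiff_weight (p := p)
  unfold odeRemainder residual
  fun_prop

theorem moments (h : IsOdeData a f u u' u'' s) :
    (∫ t in (-1 : ℝ)..1, endWeight m n t * odeRemainder m n p f u u' u'' s t) = 0 ∧
    (∫ t in (-1 : ℝ)..1, t * (endWeight m n t * odeRemainder m n p f u u' u'' s t)) = 0 := by
  have := moment_residual (m := m) (n := n) (h.contDiff_source (m := m) (n := n) (p := p)).continuous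
    (h.contDiff_weight (p := p)).continuous h.weight_pos_on
  simpa [moment, odeRemainder] using this

/-- The second derivative of the solution. -/
theorem hasDerivAt_solution (h : IsOdeData a f u u' u'' s) : ∃ G' : ℝ → ℝ,
    (∀ t ∈ Ioo (-1 : ℝ) 1, HasDerivAt (odeSolution m n p f u u' u'' s) (G' t) t) ∧
    ∀ t ∈ Ioo (-1 : ℝ) 1, HasDerivAt G' ((t + a) ^ (-1 - p) *
      ((t + a) ^ 2 * endScalTerm m n u s t - u t * endWeight m n t *
        (projSlope m n (odeSource m n p f u u' u'' s) (odeWeight p f u) * t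
          + projConst m n (odeSource m n p f u u' u'' s) (odeWeight p f u)))) t := by
  set e := odeRemainder m n p f u u' u'' s
  have hec := (h.contDiff_remainder (m := m) (n := n) (p := p)).continuous
  have hpos : ∀ t ∈ Ioo (-1 : ℝ) 1, 0 < t + a := fun t ht => by linarith [ht.1, h.lt]
  have hr : ∀ r, ∀ t ∈ Ioo (-1 : ℝ) 1,
      HasDerivAt (fun t => (t + a) ^ r) (r * (t + a) ^ (r - 1)) t := by
    intro r t ht
    have := ((hasDerivAt_id t).add_const a).rpow_const (p := r) (Or.inl (hpos t ht).ne')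
    simpa using this
  have hloc : ∀ t ∈ Ioo (-1 : ℝ) 1, odeSolution m n p f u u' u'' s =ᶠ[𝓝 t]
      fun t => (1 - t ^ 2) * (u t * endWeight m n t) * (t + a) ^ (1 - p)
        + secondPrimitive m n e t := by
    intro t ht
    filter_upwards [Ioo_mem_nhds ht.1 ht.2] with y hy
    rw [odeSolution, h.weight_eq y (Ioo_subset_Icc_self hy)]
  refine ⟨fun t => endDeriv m n u u' t * endWeight m n t * (t + a) ^ (1 - p)
    + (1 - t ^ 2) * (u t * endWeight m n t) * ((1 - p) * (t + a) ^ (1 - p - 1))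
    + ∫ r in (-1 : ℝ)..t, endWeight m n r * e r, fun t ht => ?_, fun t ht => ?_⟩
  · refine HasDerivAt.congr_of_eventuallyEq ?_ (hloc t ht)
    exact ((hasDerivAt_canonical h.hasDeriv ht).mul (hr _ t ht)).add
      (hasDerivAt_secondPrimitive hec t)
  · have d1 := hasDerivAt_canonical (m := m) (n := n) h.hasDeriv ht
    have d2 := hasDerivAt_canonical_deriv (m := m) (n := n) (s := s) h.hasDeriv h.hasDeriv' ht
    have d3 := (d2.mul (hr (1 - p) t ht)).add (d1.mul ((hr (1 - p - 1) t ht).const_mul (1 - p)))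
    refine (d3.add (hasDerivAt_firstPrimitive hec t)).congr_deriv ?_
    have hp := hpos t ht
    have x1 : (t + a) ^ (1 - p) = (t + a) ^ (-1 - p) * (t + a) ^ 2 := by
      rw [← Real.rpow_natCast, ← Real.rpow_add hp]; congr 1; push_cast; ring
    have x2 : (t + a) ^ (1 - p - 1) = (t + a) ^ (-1 - p) * (t + a) := by
      nth_rewrite 3 [← Real.rpow_one (t + a)]
      rw [← Real.rpow_add hp]; congr 1; ring
    have x3 : (t + a) ^ (1 - p - 1 - 1) = (t + a) ^ (-1 - p) := by congr 1; ring
    -- The source inside the remainder was defined so as to cancel every derivative of the canonical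
    -- part. Only `σ P` and the affine term survive.
    rw [x1, x2, x3, odeRemainder, residual, odeSource, odeWeight,
      h.weight_eq t (Ioo_subset_Icc_self ht)]
    ring

/-- The solution solves the weighted equation. -/
theorem equation (h : IsOdeData a f u u' u'' s) {Q : ℝ → ℝ}
    (hQ : ∀ t ∈ Ioo (-1 : ℝ) 1, Q t = odeSolution m n p f u u' u'' s t * (t + a) ^ (p - 1))
    {t : ℝ} (ht : t ∈ Ioo (-1 : ℝ) 1) :
    (t + a) ^ 2 * (endScalTerm m n u s t - deriv (deriv Q) t)
      + 2 * (p - 1) * (t + a) * deriv Q t - p * (p - 1) * Q t =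
      u t * endWeight m n t *
        (projSlope m n (odeSource m n p f u u' u'' s) (odeWeight p f u) * t
          + projConst m n (odeSource m n p f u u' u'' s) (odeWeight p f u)) := by
  obtain ⟨G', h1, h2⟩ := h.hasDerivAt_solution (m := m) (n := n) (p := p)
  have hpos : ∀ t ∈ Ioo (-1 : ℝ) 1, 0 < t + a := fun t ht => by linarith [ht.1, h.lt]
  have hr : ∀ r, ∀ t ∈ Ioo (-1 : ℝ) 1,
      HasDerivAt (fun t => (t + a) ^ r) (r * (t + a) ^ (r - 1)) t := by
    intro r t ht
    have := ((hasDerivAt_id t).add_const a).rpow_const (p := r) (Or.inl (hpos t ht).ne')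
    simpa using this
  have hQ1 : ∀ t ∈ Ioo (-1 : ℝ) 1, HasDerivAt Q (G' t * (t + a) ^ (p - 1)
      + odeSolution m n p f u u' u'' s t * ((p - 1) * (t + a) ^ (p - 1 - 1))) t := by
    intro t ht
    refine HasDerivAt.congr_of_eventuallyEq ((h1 t ht).mul (hr _ t ht)) ?_
    filter_upwards [Ioo_mem_nhds ht.1 ht.2] with y hy using hQ y hy
  have hQ2 : deriv Q =ᶠ[𝓝 t] fun t => G' t * (t + a) ^ (p - 1)
      + odeSolution m n p f u u' u'' s t * ((p - 1) * (t + a) ^ (p - 1 - 1)) := by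
    filter_upwards [Ioo_mem_nhds ht.1 ht.2] with y hy using (hQ1 y hy).deriv
  have hQ3 := ((h2 t ht).mul (hr (p - 1) t ht)).add
    ((h1 t ht).mul ((hr (p - 1 - 1) t ht).const_mul (p - 1)))
  have e2 := hQ2.deriv_eq.trans hQ3.deriv
  rw [e2, (hQ1 t ht).deriv, hQ t ht]
  have hp := hpos t ht
  have x1 : (t + a) ^ (p - 1) = (t + a) ^ (p - 1 - 1 - 1) * (t + a) ^ 2 := by
    rw [← Real.rpow_natCast, ← Real.rpow_add hp]; congr 1; push_cast; ring
  have x2 : (t + a) ^ (p - 1 - 1) = (t + a) ^ (p - 1 - 1 - 1) * (t + a) := by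
    nth_rewrite 3 [← Real.rpow_one (t + a)]
    rw [← Real.rpow_add hp]; congr 1; ring
  -- The exponents `p - 3`, `-1 - p` and `4` add up to zero; this is the only relation between real
  -- powers that the final identity uses.
  have x3 : (t + a) ^ (p - 1 - 1 - 1) * (t + a) ^ (-1 - p) * (t + a) ^ 4 = 1 := by
    rw [← Real.rpow_natCast, ← Real.rpow_add hp, ← Real.rpow_add hp]
    refine Eq.trans ?_ (Real.rpow_zero (t + a))
    congr 1; push_cast; ring
  rw [x1, x2]
  linear_combination (-((t + a) ^ 2 * endScalTerm m n u s t - u t * endWeight m n t *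
        (projSlope m n (odeSource m n p f u u' u'' s) (odeWeight p f u) * t
          + projConst m n (odeSource m n p f u u' u'' s) (odeWeight p f u)))) * x3

end IsOdeData

end WeightedEquation

end WeightedExtremal
end


noncomputable section

namespace WeightedExtremal

open Filter Topology Set intervalIntegral MeasureTheory

/-! ### Positivity of the solution and the resulting profile. -/

section Positivity

variable {m n : ℕ} {p a : ℝ} {f u u' u'' s : ℝ → ℝ}

namespace IsOdeData

/-- The solution divided by `(1 - t²) endWeight m n`. -/
theorem exists_quotient (h : IsOdeData a f u u' u'' s) (m n : ℕ) (p : ℝ) :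
    ∃ η₀ : ℝ → ℝ, ContDiff ℝ ∞ η₀ ∧ (∀ t, secondPrimitive m n (odeRemainder m n p f u u' u'' s) t =
        (1 - t ^ 2) ^ 2 * endWeight m n t * η₀ t) ∧ ∀ t, odeSolution m n p f u u' u'' s t =
      (1 - t ^ 2) * endWeight m n t * (u t * f t ^ (1 - p) + (1 - t ^ 2) * η₀ t) := by
  obtain ⟨η₀, h1, h2⟩ := secondPrimitive_divisible (h.contDiff_remainder (m := m) (n := n) (p := p))
    h.moments.1 h.moments.2
  refine ⟨η₀, h1, h2, fun t => ?_⟩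
  rw [odeSolution, h2]
  ring

theorem quotient_end_pos (h : IsOdeData a f u u' u'' s) {η₀ : ℝ → ℝ} {t : ℝ}
    (ht : t ∈ Icc (-1 : ℝ) 1) (ht2 : 1 - t ^ 2 = 0) :
    0 < u t * f t ^ (1 - p) + (1 - t ^ 2) * η₀ t := by
  rw [ht2, zero_mul, add_zero]
  exact mul_pos (h.pos t ht) (Real.rpow_pos_of_pos (h.weight_pos t) _)

/-- Dividing by `(1 - t²) * endWeight` moves positivity from the open interval to the compact one,
where it is uniform. At the ends the quotient is `u f^{1 - p}`, positive in any case. -/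
theorem quotient_pos_iff (h : IsOdeData a f u u' u'' s) {η₀ : ℝ → ℝ}
    (hη : ∀ t, odeSolution m n p f u u' u'' s t =
      (1 - t ^ 2) * endWeight m n t * (u t * f t ^ (1 - p) + (1 - t ^ 2) * η₀ t)) :
    (∀ t ∈ Ioo (-1 : ℝ) 1, 0 < odeSolution m n p f u u' u'' s t) ↔
      ∀ t ∈ Icc (-1 : ℝ) 1, 0 < u t * f t ^ (1 - p) + (1 - t ^ 2) * η₀ t := by
  have hp : ∀ t ∈ Ioo (-1 : ℝ) 1, 0 < (1 - t ^ 2) * endWeight m n t := fun t ht =>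
    mul_pos (by nlinarith [ht.1, ht.2]) (endWeight_pos ht)
  constructor
  · intro hs t ht
    by_cases ht2 : 1 - t ^ 2 = 0
    · exact h.quotient_end_pos ht ht2
    · have ht' : t ∈ Ioo (-1 : ℝ) 1 := by
        refine ⟨lt_of_le_of_ne ht.1 ?_, lt_of_le_of_ne ht.2 ?_⟩ <;> rintro rfl <;> norm_num at ht2
      have := hs t ht'
      rw [hη] at this
      exact pos_of_mul_pos_right this (hp t ht').le
  · intro hs t ht
    rw [hη]
    exact mul_pos (hp t ht) (hs t (Ioo_subset_Icc_self ht))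

theorem solution_pos_of_convex (h : IsOdeData a f u u' u'' s)
    (hconv : ConvexOn ℝ (Ioo (-1 : ℝ) 1) fun t => (t + a) ^ 2 * (s t / u t)) :
    ∀ t ∈ Ioo (-1 : ℝ) 1, 0 < odeSolution m n p f u u' u'' s t := by
  obtain ⟨η₀, h1, -, hη⟩ := h.exists_quotient m n p
  obtain ⟨G', d1, d2⟩ := h.hasDerivAt_solution (m := m) (n := n) (p := p)
  set α := projSlope m n (odeSource m n p f u u' u'' s) (odeWeight p f u)
  set β := projConst m n (odeSource m n p f u u' u'' s) (odeWeight p f u)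
  have hfs : ContDiff ℝ ∞ fun t => f t ^ (1 - p) :=
    h.weight_smooth.rpow_const_of_ne fun t => (h.weight_pos t).ne'
  have hbr : Continuous fun t => u t * f t ^ (1 - p) + (1 - t ^ 2) * η₀ t := by
    have := h.smooth.continuous
    have := h1.continuous
    have := hfs.continuous
    fun_prop
  have hcont : Continuous (odeSolution m n p f u u' u'' s) := by
    rw [funext hη]
    have := (contDiff_endWeight m n (k := 0)).continuous
    fun_prop
  have hp : ∀ t ∈ Ioo (-1 : ℝ) 1, 0 < (1 - t ^ 2) * endWeight m n t := fun t ht =>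
    mul_pos (by nlinarith [ht.1, ht.2]) (endWeight_pos ht)
  -- The three convex contributions are the base, convex by hypothesis, the two projective fibres,
  -- each a nonnegative multiple of a square over an affine function, and the affine function to be
  -- subtracted.
  let Q : ℝ → ℝ := fun t => (t + a) ^ 2 * (s t / u t)
    + 2 * m * (m + 1) * ((t + a) ^ 2 / (1 + 1 * t)) + 2 * n * (n + 1) * ((t + a) ^ 2 / (1 + -1 * t))
    + (-α * t + -β)
  have hQ : ConvexOn ℝ (Ioo (-1) 1) Q := by
    have c1 := (convexOn_sq_div_affine (a := a) (x := 1) (convex_Ioo (-1 : ℝ) 1)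
      (fun t ht => by linarith [ht.1])).smul (show (0 : ℝ) ≤ 2 * m * (m + 1) by positivity)
    have c2 := (convexOn_sq_div_affine (a := a) (x := -1) (convex_Ioo (-1 : ℝ) 1)
      (fun t ht => by linarith [ht.2])).smul (show (0 : ℝ) ≤ 2 * n * (n + 1) by positivity)
    have c3 : ConvexOn ℝ (Ioo (-1 : ℝ) 1) fun t => -α * t + -β := by
      refine ⟨convex_Ioo _ _, fun x _ y _ l k _ _ hlk => le_of_eq ?_⟩
      simp only [smul_eq_mul]
      linear_combination (β) * hlk
    exact ((hconv.add c1).add c2).add c3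
  refine pos_of_deriv2_convex (Q := Q)
    (wt := fun t => (t + a) ^ (-1 - p) * (u t * endWeight m n t)) hcont.continuousOn d1 ?_ ?_ hQ
    ?_ ?_ ?_ ?_
  · intro t ht
    refine (d2 t ht).congr_deriv ?_
    have e1 : 1 + t ≠ 0 := by linarith [ht.1]
    have e2 : 1 - t ≠ 0 := by linarith [ht.2]
    have e3 := (h.pos t (Ioo_subset_Icc_self ht)).ne'
    simp only [Q, endScalTerm, one_mul, neg_one_mul, ← sub_eq_add_neg]
    field_simp
    ring
  · intro t ht
    have := h.pos t (Ioo_subset_Icc_self ht)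
    have := endWeight_pos (m := m) (n := n) ht
    have : 0 < t + a := by linarith [ht.1, h.lt]
    positivity
  · rw [hη]; norm_num
  · rw [hη]; norm_num
  · have : ∀ᶠ t in 𝓝 (-1 : ℝ), 0 < u t * f t ^ (1 - p) + (1 - t ^ 2) * η₀ t :=
      hbr.continuousAt.eventually_const_lt
        (h.quotient_end_pos (η₀ := η₀) (p := p) (t := -1) (by norm_num) (by norm_num))
    filter_upwards [nhdsWithin_le_nhds this, Ioo_mem_nhdsGT (show (-1 : ℝ) < 1 by norm_num)]
      with t ht ht'
    rw [hη]
    exact mul_pos (hp t ht') ht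
  · have : ∀ᶠ t in 𝓝 (1 : ℝ), 0 < u t * f t ^ (1 - p) + (1 - t ^ 2) * η₀ t :=
      hbr.continuousAt.eventually_const_lt
        (h.quotient_end_pos (η₀ := η₀) (p := p) (t := 1) (by norm_num) (by norm_num))
    filter_upwards [nhdsWithin_le_nhds this, Ioo_mem_nhdsLT (show (-1 : ℝ) < 1 by norm_num)]
      with t ht ht'
    rw [hη]
    exact mul_pos (hp t ht') ht

/-- The quotient by `(1 - t²) * endWeight` has a positive minimum on `[-1, 1]`. Perturbing the
canonical part and the remainder changes this quotient uniformly little, thanks to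
`abs_secondPrimitive_le`. -/
theorem solution_pos_of_close (h : IsOdeData a f u u' u'' s)
    (hpos : ∀ t ∈ Ioo (-1 : ℝ) 1, 0 < odeSolution m n p f u u' u'' s t) :
    ∃ ε > 0, ∀ v v' v'' r : ℝ → ℝ, IsOdeData a f v v' v'' r →
      (∀ t ∈ Icc (-1 : ℝ) 1, |v t * f t ^ (1 - p) - u t * f t ^ (1 - p)| < ε) →
      (∀ t ∈ Icc (-1 : ℝ) 1,
        |odeRemainder m n p f v v' v'' r t - odeRemainder m n p f u u' u'' s t| < ε) →
      ∀ t ∈ Ioo (-1 : ℝ) 1, 0 < odeSolution m n p f v v' v'' r t := by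
  obtain ⟨η₀, h1, h2, hη⟩ := h.exists_quotient m n p
  have hfs : ContDiff ℝ ∞ fun t => f t ^ (1 - p) :=
    h.weight_smooth.rpow_const_of_ne fun t => (h.weight_pos t).ne'
  have hbr : Continuous fun t => u t * f t ^ (1 - p) + (1 - t ^ 2) * η₀ t := by
    have := h.smooth.continuous
    have := h1.continuous
    have := hfs.continuous
    fun_prop
  obtain ⟨t₀, ht₀, hmin⟩ := (isCompact_Icc (a := (-1 : ℝ)) (b := 1)).exists_isMinOn
    (nonempty_Icc.2 (by norm_num)) hbr.continuousOn
  set μ := u t₀ * f t₀ ^ (1 - p) + (1 - t₀ ^ 2) * η₀ t₀ with hμ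
  have hμ0 : 0 < μ := (h.quotient_pos_iff hη).1 hpos t₀ ht₀
  have hK : (0 : ℝ) < 2 ^ (m + n + 1) + 1 := by positivity
  -- The canonical part loses less than `ε` and the second primitive at most `2 ^ (m + n + 1) * ε`;
  -- together they lose less than the minimum `μ`.
  refine ⟨μ / (2 ^ (m + n + 1) + 1), by positivity, fun v v' v'' r hv hc1 hc2 t ht => ?_⟩
  set ε := μ / (2 ^ (m + n + 1) + 1) with hε
  have hεμ : ε * (2 ^ (m + n + 1) + 1) = μ := by rw [hε]; field_simp
  obtain ⟨ξ₀, -, g2, gξ⟩ := hv.exists_quotient m n p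
  have hw : 0 < (1 - t ^ 2) * endWeight m n t :=
    mul_pos (by nlinarith [ht.1, ht.2]) (endWeight_pos ht)
  have hct := Ioo_subset_Icc_self ht
  have ce := (h.contDiff_remainder (m := m) (n := n) (p := p)).continuous
  have cr := (hv.contDiff_remainder (m := m) (n := n) (p := p)).continuous
  have hsub := abs_secondPrimitive_le (m := m) (n := n) (cr.sub ce) (by
      have := (hv.moments (m := m) (n := n) (p := p)).1
      have h' := (h.moments (m := m) (n := n) (p := p)).1
      simp only [Pi.sub_apply, mul_sub]
      rw [intervalIntegral.integral_sub, this, h', sub_zero]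
      · exact (continuous_endWeight_mul cr).intervalIntegrable _ _
      · exact (continuous_endWeight_mul ce).intervalIntegrable _ _) (by
      have := (hv.moments (m := m) (n := n) (p := p)).2
      have h' := (h.moments (m := m) (n := n) (p := p)).2
      simp only [Pi.sub_apply, mul_sub]
      rw [intervalIntegral.integral_sub, this, h', sub_zero]
      · exact (continuous_id.mul (continuous_endWeight_mul cr)).intervalIntegrable _ _
      · exact (continuous_id.mul (continuous_endWeight_mul ce)).intervalIntegrable _ _)
    (fun t ht => (hc2 t ht).le) hct
  rw [show (odeRemainder m n p f v v' v'' r - odeRemainder m n p f u u' u'' s) = fun t =>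
    odeRemainder m n p f v v' v'' r t - odeRemainder m n p f u u' u'' s t from rfl,
    secondPrimitive_sub cr ce, g2, h2] at hsub
  rw [gξ]
  refine mul_pos hw ?_
  have e1 : (1 - t ^ 2) ^ 2 * endWeight m n t * ξ₀ t - (1 - t ^ 2) ^ 2 * endWeight m n t * η₀ t =
      ((1 - t ^ 2) * endWeight m n t) * ((1 - t ^ 2) * ξ₀ t - (1 - t ^ 2) * η₀ t) := by ring
  rw [e1, abs_mul, abs_of_pos hw, mul_comm, mul_le_mul_iff_left₀ hw] at hsub
  have h3 := (abs_lt.1 (hc1 t hct)).1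
  have h4 := (abs_le.1 hsub).1
  have h5 : μ ≤ u t * f t ^ (1 - p) + (1 - t ^ 2) * η₀ t := hmin hct
  nlinarith

/-- The profile determined by a positive solution. -/
theorem exists_profile (h : IsOdeData a f u u' u'' s)
    (hpos : ∀ t ∈ Ioo (-1 : ℝ) 1, 0 < odeSolution m n p f u u' u'' s t) :
    ∃ (α β : ℝ) (η : ℝ → ℝ) (O : Set ℝ), IsOpen O ∧ Icc (-1 : ℝ) 1 ⊆ O ∧ ContDiffOn ℝ ∞ η O ∧
      (∀ t ∈ Icc (-1 : ℝ) 1, 0 < 1 + (1 - t ^ 2) * η t) ∧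
      ∀ Q : ℝ → ℝ, (∀ t ∈ Ioo (-1 : ℝ) 1, Q t =
          ((1 - t ^ 2) * (1 + (1 - t ^ 2) * η t)) * (u t * endWeight m n t)) →
        ∀ t ∈ Ioo (-1 : ℝ) 1, (t + a) ^ 2 * (s t / u t + (2 * m * (m + 1) / (1 + t)
          + 2 * n * (n + 1) / (1 - t)) - deriv (deriv Q) t / (u t * endWeight m n t))
          + 2 * (p - 1) * (t + a) * (deriv Q t / (u t * endWeight m n t))
          - p * (p - 1) * ((1 - t ^ 2) * (1 + (1 - t ^ 2) * η t)) = α * t + β := by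
  obtain ⟨η₀, h1, h2, hη⟩ := h.exists_quotient m n p
  have hfs : ContDiff ℝ ∞ fun t => f t ^ (1 - p) :=
    h.weight_smooth.rpow_const_of_ne fun t => (h.weight_pos t).ne'
  have hfp : ∀ t, 0 < f t ^ (1 - p) := fun t => Real.rpow_pos_of_pos (h.weight_pos t) _
  -- The profile is the solution divided by `f^{1 - p} u * endWeight`, that is `(1 - t²) (1 + (1 -
  -- t²) η)` with `η = η₀ / (u f^{1 - p})`, smooth wherever `u > 0`.
  refine ⟨projSlope m n (odeSource m n p f u u' u'' s) (odeWeight p f u),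
    projConst m n (odeSource m n p f u u' u'' s) (odeWeight p f u),
    fun t => η₀ t / (u t * f t ^ (1 - p)), {t | 0 < u t},
    isOpen_lt continuous_const h.smooth.continuous, h.pos, ?_, ?_, ?_⟩
  · exact h1.contDiffOn.div (h.smooth.mul hfs).contDiffOn
      fun t ht => (mul_pos ht (hfp t)).ne'
  · intro t ht
    have hb := (h.quotient_pos_iff hη).1 hpos t ht
    have hu := mul_pos (h.pos t ht) (hfp t)
    have e : 1 + (1 - t ^ 2) * (η₀ t / (u t * f t ^ (1 - p))) =
        (u t * f t ^ (1 - p) + (1 - t ^ 2) * η₀ t) / (u t * f t ^ (1 - p)) := by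
      rw [add_div, div_self hu.ne', mul_div_assoc]
    exact e ▸ div_pos hb hu
  · intro Q hQ t ht
    have hu := h.pos t (Ioo_subset_Icc_self ht)
    have hw := endWeight_pos (m := m) (n := n) ht
    have hQ' : ∀ t ∈ Ioo (-1 : ℝ) 1, Q t = odeSolution m n p f u u' u'' s t * (t + a) ^ (p - 1) := by
      intro t ht
      have hu := h.pos t (Ioo_subset_Icc_self ht)
      have ha : 0 < t + a := by linarith [ht.1, h.lt]
      have e : (t + a) ^ (p - 1) * (t + a) ^ (1 - p) = 1 := by
        rw [← Real.rpow_add ha]; refine Eq.trans ?_ (Real.rpow_zero (t + a)); congr 1; ring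
      have := hfp t
      rw [hQ t ht, hη, eq_inv_of_mul_eq_one_left e]
      beta_reduce
      rw [h.weight_eq t (Ioo_subset_Icc_self ht)] at this ⊢
      field_simp
    have heq := h.equation hQ' ht
    rw [hQ t ht, endScalTerm] at heq
    have e1 : 1 + t ≠ 0 := by linarith [ht.1]
    have e2 : 1 - t ≠ 0 := by linarith [ht.2]
    rw [← mul_left_cancel_iff_of_pos (mul_pos hu hw), ← heq]
    field_simp
    try ring

end IsOdeData

end Positivity

end WeightedExtremal
end


noncomputable section

namespace WeightedExtremal

open Filter Topology Set intervalIntegral MeasureTheory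

/-! ### Dependence on the admissible parameters and existence of positive solutions. -/

section Parameters

/-- A smooth function equal to the identity on `[-1, 1]` and bounded below by `-a`. -/
theorem exists_clamp {a : ℝ} (ha : 1 < a) : ∃ f : ℝ → ℝ, ContDiff ℝ ∞ f ∧ (∀ t, 0 < f t) ∧
    ∀ t ∈ Icc (-1 : ℝ) 1, f t = t + a := by
  -- With outer radius `a`, the bump is nonzero only for `|t| < a`, and being at most `1` it keeps
  -- `t * b t` above `-a`.
  let b : ContDiffBump (0 : ℝ) := ⟨1, a, one_pos, ha⟩
  refine ⟨fun t => t * b t + a, (contDiff_id.mul b.contDiff).add contDiff_const, fun t => ?_,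
    fun t ht => ?_⟩
  · by_cases h : t ∈ Metric.ball (0 : ℝ) a
    · rw [Metric.mem_ball, dist_zero_right, Real.norm_eq_abs, abs_lt] at h
      have h1 := b.nonneg (x := t)
      have h2 := b.le_one (x := t)
      nlinarith
    · beta_reduce
      rw [b.zero_of_le_dist (x := t) (by simpa using h)]
      linarith
  · beta_reduce
    rw [b.one_of_mem_closedBall (by simpa [abs_le] using ht), mul_one]

variable {X : Type*} [NormedAddCommGroup X] [NormedSpace ℝ X]

/-- The derivative in the last variable. -/
def lastDeriv (g : X × ℝ → ℝ) (q : X × ℝ) : ℝ := fderiv ℝ g q (0, 1)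

theorem contDiff_lastDeriv {g : X × ℝ → ℝ} (hg : ContDiff ℝ ∞ g) : ContDiff ℝ ∞ (lastDeriv g) :=
  (hg.fderiv_right (m := ∞) (by simp)).clm_apply contDiff_const

theorem hasDerivAt_lastDeriv {g : X × ℝ → ℝ} (hg : ContDiff ℝ ∞ g) (x : X) (t : ℝ) :
    HasDerivAt (fun t => g (x, t)) (lastDeriv g (x, t)) t := by
  have h1 := (hg.differentiable (by simp) (x, t)).hasFDerivAt
  have h2 : HasDerivAt (fun t : ℝ => (x, t)) ((0 : X), (1 : ℝ)) t :=
    (hasDerivAt_const t x).prodMk (hasDerivAt_id t)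
  exact h1.comp_hasDerivAt t h2

variable {A : Type*} [Fintype A] (d : A → ℕ) (m n : ℕ) {a : ℝ} {f : ℝ → ℝ}

/-- The volume density `∏ (1 + x_a t)^{d_a}` of the base. -/
def baseVol (q : ((A → ℝ) × (A → ℝ)) × ℝ) : ℝ := ∏ i, (1 + q.1.1 i * q.2) ^ d i

open Classical in
/-- The product of `baseVol` and `∑ γ_a / (1 + x_a t)`. -/
def baseScal (q : ((A → ℝ) × (A → ℝ)) × ℝ) : ℝ :=
  ∑ i, q.1.2 i * ((1 + q.1.1 i * q.2) ^ (d i - 1) * ∏ j ∈ Finset.univ.erase i,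
    (1 + q.1.1 j * q.2) ^ d j)

theorem contDiff_baseVol : ContDiff ℝ ∞ (baseVol d) := by
  unfold baseVol
  fun_prop

theorem contDiff_baseScal : ContDiff ℝ ∞ (baseScal d) := by
  unfold baseScal
  fun_prop

/-- Multiplying by `baseVol` makes the base curvature polynomial in the parameters and in `t`, so no
denominators interfere with continuity at `x = 0`. The exponent `d i - 1` is a genuine subtraction
because `d i ≥ 1`. -/
theorem baseScal_div {d : A → ℕ} (hd : ∀ i, 1 ≤ d i) {x γ : A → ℝ} {t : ℝ}
    (h : ∀ i, 0 < 1 + x i * t) :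
    baseScal d ((x, γ), t) / baseVol d ((x, γ), t) = ∑ i, γ i / (1 + x i * t) := by
  classical
  have hne : baseVol d ((x, γ), t) ≠ 0 := Finset.prod_ne_zero_iff.2 fun i _ =>
    pow_ne_zero _ (h i).ne'
  rw [div_eq_iff hne, Finset.sum_mul, baseScal]
  refine Finset.sum_congr rfl fun i _ => ?_
  rw [baseVol, ← Finset.mul_prod_erase _ _ (Finset.mem_univ i)]
  dsimp only
  have e : (1 + x i * t) ^ d i = (1 + x i * t) * (1 + x i * t) ^ (d i - 1) := by
    rw [← pow_succ', Nat.sub_add_cancel (hd i)]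
  rw [e]
  have := (h i).ne'
  field_simp

theorem isOdeData_base (ha : 1 < a) (hf : ContDiff ℝ ∞ f) (hf0 : ∀ t, 0 < f t)
    (hf1 : ∀ t ∈ Icc (-1 : ℝ) 1, f t = t + a) {y : (A → ℝ) × (A → ℝ)} (hy : ∀ i, |y.1 i| < 1) :
    IsOdeData a f (fun t => baseVol d (y, t)) (fun t => lastDeriv (baseVol d) (y, t))
      (fun t => lastDeriv (lastDeriv (baseVol d)) (y, t)) (fun t => baseScal d (y, t)) := by
  have h := contDiff_baseVol d
  have h' := contDiff_lastDeriv h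
  have h'' := contDiff_lastDeriv h'
  have hi : ContDiff ℝ ∞ fun t : ℝ => (y, t) := contDiff_const.prodMk contDiff_id
  refine ⟨ha, hf, hf0, hf1, h.comp hi, hasDerivAt_lastDeriv h y, hasDerivAt_lastDeriv h' y,
    h'.comp hi, h''.comp hi, (contDiff_baseScal d).comp hi, fun t ht => ?_⟩
  refine Finset.prod_pos fun i _ => pow_pos ?_ _
  have h1 : |y.1 i * t| < 1 := by
    rw [abs_mul]
    calc |y.1 i| * |t| ≤ |y.1 i| * 1 := by gcongr; exact abs_le.2 ht
      _ < 1 := by rw [mul_one]; exact hy i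
  have h2 := (abs_lt.1 h1).1
  show 0 < 1 + y.1 i * t
  linarith

/-- Existence of a positive solution of the weighted equation for nonnegative scalar curvatures. -/
theorem solution_pos_of_nonneg {d : A → ℕ} (hd : ∀ i, 1 ≤ d i) (p : ℝ) (ha : 1 < a)
    (hf : ContDiff ℝ ∞ f) (hf0 : ∀ t, 0 < f t)
    (hf1 : ∀ t ∈ Icc (-1 : ℝ) 1, f t = t + a) {y : (A → ℝ) × (A → ℝ)} (hy : ∀ i, |y.1 i| < 1)
    (hγ : ∀ i, 0 ≤ y.2 i) : ∀ t ∈ Ioo (-1 : ℝ) 1, 0 < odeSolution m n p f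
      (fun t => baseVol d (y, t)) (fun t => lastDeriv (baseVol d) (y, t))
      (fun t => lastDeriv (lastDeriv (baseVol d)) (y, t)) (fun t => baseScal d (y, t)) t := by
  refine (isOdeData_base d ha hf hf0 hf1 hy).solution_pos_of_convex ?_
  have hpos : ∀ t ∈ Ioo (-1 : ℝ) 1, ∀ i, 0 < 1 + y.1 i * t := fun t ht i =>
    one_add_mul_pos (hy i).le ht
  have hc : ConvexOn ℝ (Ioo (-1 : ℝ) 1) fun t => ∑ i, y.2 i * ((t + a) ^ 2 / (1 + y.1 i * t)) := by
    have : ∀ u : Finset A, ConvexOn ℝ (Ioo (-1 : ℝ) 1) fun t =>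
        ∑ i ∈ u, y.2 i * ((t + a) ^ 2 / (1 + y.1 i * t)) := by
      classical
      intro u
      induction u using Finset.induction_on with
      | empty => simpa using convexOn_const 0 (convex_Ioo (-1 : ℝ) 1)
      | insert i u hi ih =>
        simp only [Finset.sum_insert hi]
        exact ((convexOn_sq_div_affine (convex_Ioo _ _) fun t ht => hpos t ht i).smul (hγ i)).add ih
    exact this _
  refine hc.congr fun t ht => ?_
  simp only
  rw [show (y, t) = ((y.1, y.2), t) from rfl, baseScal_div hd (hpos t ht), Finset.mul_sum]
  refine Finset.sum_congr rfl fun i _ => ?_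
  ring

/-- Existence of a positive solution of the weighted equation for small parameters. -/
theorem solution_pos_of_small {d : A → ℕ} (hd : ∀ i, 1 ≤ d i) (p : ℝ) (ha : 1 < a)
    (hf : ContDiff ℝ ∞ f) (hf0 : ∀ t, 0 < f t) (hf1 : ∀ t ∈ Icc (-1 : ℝ) 1, f t = t + a) :
    ∀ᶠ y : (A → ℝ) × (A → ℝ) in 𝓝 0, (∀ i, |y.1 i| < 1) ∧
      ∀ t ∈ Ioo (-1 : ℝ) 1, 0 < odeSolution m n p f
      (fun t => baseVol d (y, t)) (fun t => lastDeriv (baseVol d) (y, t))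
      (fun t => lastDeriv (lastDeriv (baseVol d)) (y, t)) (fun t => baseScal d (y, t)) t := by
  have h0 : ∀ i, |(0 : (A → ℝ) × (A → ℝ)).1 i| < 1 := fun i => by simp
  -- At the origin the parameters and the curvature coefficients vanish, so the nonnegative case
  -- supplies the solution that is going to be perturbed.
  have hpos := solution_pos_of_nonneg m n hd p ha hf hf0 hf1 h0 fun i => le_rfl
  have hD := isOdeData_base d ha hf hf0 hf1 h0
  obtain ⟨ε, hε, H⟩ := hD.solution_pos_of_close hpos
  have c1 := (contDiff_baseVol d).continuous
  have c2 := (contDiff_lastDeriv (contDiff_baseVol d)).continuous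
  have c3 := (contDiff_lastDeriv (contDiff_lastDeriv (contDiff_baseVol d))).continuous
  have c4 := (contDiff_baseScal d).continuous
  have hfr : ∀ r : ℝ, Continuous fun t => f t ^ r := fun r =>
    hf.continuous.rpow_const fun t => Or.inl (hf0 t).ne'
  have cf := hf.continuous
  have hfp := hfr (1 - p)
  have hfq := hfr (-1 - p)
  have e0 : ∀ᶠ y : (A → ℝ) × (A → ℝ) in 𝓝 0, ∀ i, |y.1 i| < 1 := by
    rw [eventually_all]
    intro i
    exact (by fun_prop : Continuous fun y : (A → ℝ) × (A → ℝ) => |y.1 i|).continuousAt.eventually_lt_const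
      (h0 i)
  have e1 : ∀ᶠ y : (A → ℝ) × (A → ℝ) in 𝓝 0, ∀ t ∈ Icc (-1 : ℝ) 1,
      |baseVol d (y, t) * f t ^ (1 - p) - baseVol d (0, t) * f t ^ (1 - p)| < ε := by
    -- Joint continuity together with compactness of `[-1, 1]` makes the estimate uniform in `t`.
    refine isCompact_Icc.eventually_forall_of_forall_eventually fun t ht => ?_
    have hc : Continuous fun q : ((A → ℝ) × (A → ℝ)) × ℝ =>
        |baseVol d q * f q.2 ^ (1 - p) - baseVol d (0, q.2) * f q.2 ^ (1 - p)| := by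
      have hfp' : Continuous fun q : ((A → ℝ) × (A → ℝ)) × ℝ => f q.2 ^ (1 - p) :=
        hfp.comp continuous_snd
      have c5 : Continuous fun q : ((A → ℝ) × (A → ℝ)) × ℝ => baseVol d (0, q.2) := by fun_prop
      exact ((c1.mul hfp').sub (c5.mul hfp')).abs
    exact hc.continuousAt.eventually_lt_const (by simpa using hε)
  have cR : Continuous fun q : ((A → ℝ) × (A → ℝ)) × ℝ => odeSource m n p f
      (fun t => baseVol d (q.1, t)) (fun t => lastDeriv (baseVol d) (q.1, t))
      (fun t => lastDeriv (lastDeriv (baseVol d)) (q.1, t)) (fun t => baseScal d (q.1, t)) q.2 := by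
    unfold odeSource endScal endDeriv
    refine (hfq.comp continuous_snd).mul ?_
    fun_prop
  have cW : Continuous fun q : ((A → ℝ) × (A → ℝ)) × ℝ =>
      odeWeight p f (fun t => baseVol d (q.1, t)) q.2 := by
    unfold odeWeight
    refine (hfq.comp continuous_snd).mul ?_
    fun_prop
  have e2 : ∀ᶠ y : (A → ℝ) × (A → ℝ) in 𝓝 0, ∀ t ∈ Icc (-1 : ℝ) 1,
      |odeRemainder m n p f (fun t => baseVol d (y, t)) (fun t => lastDeriv (baseVol d) (y, t))
      (fun t => lastDeriv (lastDeriv (baseVol d)) (y, t)) (fun t => baseScal d (y, t)) t -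
      odeRemainder m n p f (fun t => baseVol d (0, t)) (fun t => lastDeriv (baseVol d) (0, t))
      (fun t => lastDeriv (lastDeriv (baseVol d)) (0, t)) (fun t => baseScal d (0, t)) t| < ε := by
    refine isCompact_Icc.eventually_forall_of_forall_eventually fun t ht => ?_
    have h1 := continuousAt_residual (m := m) (n := n) (R := fun y => odeSource m n p f
      (fun t => baseVol d (y, t)) (fun t => lastDeriv (baseVol d) (y, t))
      (fun t => lastDeriv (lastDeriv (baseVol d)) (y, t)) (fun t => baseScal d (y, t)))
      (w := fun y => odeWeight p f (fun t => baseVol d (y, t))) cR cW hD.weight_pos_on t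
    have h2 : ContinuousAt (fun q : ((A → ℝ) × (A → ℝ)) × ℝ => odeRemainder m n p f
      (fun t => baseVol d (0, t)) (fun t => lastDeriv (baseVol d) (0, t))
      (fun t => lastDeriv (lastDeriv (baseVol d)) (0, t)) (fun t => baseScal d (0, t)) q.2) (0, t) :=
      hD.contDiff_remainder.continuous.continuousAt.comp (x := ((0 : (A → ℝ) × (A → ℝ)), t))
        continuousAt_snd
    exact (h1.sub h2).abs.eventually_lt_const (by
      simp only [Pi.sub_apply, odeRemainder, sub_self, abs_zero]
      exact hε)
  filter_upwards [e0, e1, e2] with y hy0 hy1 hy2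
  exact ⟨hy0, H _ _ _ _ (isOdeData_base d ha hf hf0 hf1 hy0) hy1 hy2⟩

/-- A profile together with the weighted equation it satisfies. -/
def HasWeightedProfile (d : A → ℕ) (m n : ℕ) (a p : ℝ) (x γ : A → ℝ) : Prop :=
  ∃ (α β : ℝ) (η : ℝ → ℝ) (O : Set ℝ), IsOpen O ∧ Icc (-1 : ℝ) 1 ⊆ O ∧ ContDiffOn ℝ ∞ η O ∧
    (∀ t ∈ Icc (-1 : ℝ) 1, 0 < 1 + (1 - t ^ 2) * η t) ∧
    ∀ P Q : ℝ → ℝ, (∀ t, P t = (∏ i, (1 + x i * t) ^ d i) * ((1 + 1 * t) ^ m * (1 + -1 * t) ^ n)) →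
      (∀ t ∈ Ioo (-1 : ℝ) 1, Q t = ((1 - t ^ 2) * (1 + (1 - t ^ 2) * η t)) * P t) →
      ∀ t ∈ Ioo (-1 : ℝ) 1, (t + a) ^ 2 * ((∑ i, γ i / (1 + x i * t) + (2 * m * (m + 1) / (1 + 1 * t)
        + 2 * n * (n + 1) / (1 + -1 * t))) - deriv (deriv Q) t / P t)
        + 2 * (p - 1) * (t + a) * (deriv Q t / P t)
        - p * (p - 1) * ((1 - t ^ 2) * (1 + (1 - t ^ 2) * η t)) = α * t + β

theorem hasWeightedProfile_of_pos {d : A → ℕ} (hd : ∀ i, 1 ≤ d i) {p : ℝ} (ha : 1 < a)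
    (hf : ContDiff ℝ ∞ f) (hf0 : ∀ t, 0 < f t)
    (hf1 : ∀ t ∈ Icc (-1 : ℝ) 1, f t = t + a) {x γ : A → ℝ} (hx : ∀ i, |x i| < 1)
    (h : ∀ t ∈ Ioo (-1 : ℝ) 1, 0 < odeSolution m n p f
      (fun t => baseVol d ((x, γ), t)) (fun t => lastDeriv (baseVol d) ((x, γ), t))
      (fun t => lastDeriv (lastDeriv (baseVol d)) ((x, γ), t)) (fun t => baseScal d ((x, γ), t)) t) :
    HasWeightedProfile d m n a p x γ := by
  obtain ⟨α, β, η, O, h1, h2, h3, h4, h5⟩ :=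
    (isOdeData_base d (y := (x, γ)) ha hf hf0 hf1 hx).exists_profile h
  refine ⟨α, β, η, O, h1, h2, h3, h4, fun P Q hP hQ t ht => ?_⟩
  have hP' : ∀ t, P t = baseVol d ((x, γ), t) * endWeight m n t := by
    intro t
    rw [hP, baseVol, endWeight]
    ring
  have := h5 Q (fun t ht => by rw [hQ t ht, hP']) t ht
  rw [← this, baseScal_div hd fun i => one_add_mul_pos (hx i).le ht, hP' t,
    one_mul, neg_one_mul, ← sub_eq_add_neg]

theorem hasWeightedProfile_of_nonneg {d : A → ℕ} (hd : ∀ i, 1 ≤ d i) (ha : 1 < a) (p : ℝ)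
    {x γ : A → ℝ} (hx : ∀ i, |x i| < 1) (hγ : ∀ i, 0 ≤ γ i) : HasWeightedProfile d m n a p x γ := by
  obtain ⟨f, hf, hf0, hf1⟩ := exists_clamp ha
  exact hasWeightedProfile_of_pos m n hd ha hf hf0 hf1 hx
    (solution_pos_of_nonneg m n (y := (x, γ)) hd p ha hf hf0 hf1 hx hγ)

/-- The coefficients `|x_a| c_a` of the base curvature tend to `0` with `x` whatever the signs of
the `c_a`, so `(x, |x| c)` enters the neighbourhood of the origin where positivity holds. -/
theorem hasWeightedProfile_of_small {d : A → ℕ} (hd : ∀ i, 1 ≤ d i) (ha : 1 < a) (p : ℝ)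
    (c : A → ℝ) : ∃ δ > 0, ∀ x : A → ℝ, (∀ i, |x i| < δ) →
      HasWeightedProfile d m n a p x fun i => |x i| * c i := by
  obtain ⟨f, hf, hf0, hf1⟩ := exists_clamp ha
  have hc : Continuous fun x : A → ℝ => (x, fun i => |x i| * c i) := by fun_prop
  have hs := solution_pos_of_small m n hd p ha hf hf0 hf1
  rw [show (0 : (A → ℝ) × (A → ℝ)) = ((0 : A → ℝ), fun i => |(0 : A → ℝ) i| * c i) from
    Prod.ext rfl (funext fun i => by simp)] at hs
  have h := hc.continuousAt.eventually hs
  obtain ⟨δ, hδ, H⟩ := Metric.eventually_nhds_iff.1 h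
  refine ⟨δ, hδ, fun x hx => ?_⟩
  have := H (y := x) (by rw [dist_zero_right]; exact (pi_norm_lt_iff hδ).2 hx)
  exact hasWeightedProfile_of_pos m n hd ha hf hf0 hf1 this.1 this.2

end Parameters

end WeightedExtremal
end


noncomputable section

namespace WeightedExtremal

open Filter Topology Set intervalIntegral MeasureTheory

/-! ### From a profile to the momentum and the relative potential as functions of the canonical
momentum. -/

section Profile

/-- A smooth function near `[-1, 1]` agrees on `[-1, 1]` with a globally smooth function. -/
theorem exists_contDiff_extension {g : ℝ → ℝ} {O : Set ℝ} (hO : IsOpen O)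
    (hsub : Icc (-1 : ℝ) 1 ⊆ O) (hg : ContDiffOn ℝ ∞ g O) :
    ∃ g' : ℝ → ℝ, ContDiff ℝ ∞ g' ∧ ∀ t ∈ Icc (-1 : ℝ) 1, g' t = g t := by
  obtain ⟨δ, hδ, hδO⟩ := (isCompact_Icc (a := (-1 : ℝ)) (b := 1)).exists_cthickening_subset_open hO hsub
  have hball : Metric.closedBall (0 : ℝ) (1 + δ) ⊆ O := by
    refine Subset.trans ?_ hδO
    rw [show Icc (-1 : ℝ) 1 = Metric.closedBall 0 1 by rw [Real.closedBall_eq_Icc]; norm_num,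
      cthickening_closedBall hδ.le zero_le_one, add_comm]
  let b : ContDiffBump (0 : ℝ) := ⟨1, 1 + δ, one_pos, by linarith⟩
  refine ⟨fun t => b t * g t, ?_, fun t ht => ?_⟩
  · rw [contDiff_iff_contDiffAt]
    intro t
    by_cases ht : t ∈ O
    · exact b.contDiff.contDiffAt.mul (hg.contDiffAt (hO.mem_nhds ht))
    · have hc : ∀ᶠ y in 𝓝 t, y ∉ Metric.closedBall (0 : ℝ) (1 + δ) :=
        Metric.isClosed_closedBall.isOpen_compl.mem_nhds fun h => ht (hball h)
      refine contDiffAt_const (c := (0 : ℝ)) |>.congr_of_eventuallyEq ?_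
      filter_upwards [hc] with y hy
      rw [b.zero_of_le_dist (x := y) (le_of_lt (by simpa using hy)), zero_mul]
  · beta_reduce
    rw [b.one_of_mem_closedBall (by simpa [abs_le] using ht), one_mul]

/-- A momentum profile `Θ`, with the momentum `Z` and the relative potential `u` as functions of
the canonical momentum. -/
structure IsMomentProfile (Θ Z u : ℝ → ℝ) : Prop where
  smooth : ContDiffOn ℝ ∞ Θ (Icc (-1) 1)
  pos : ∀ t ∈ Ioo (-1 : ℝ) 1, 0 < Θ t
  left : Θ (-1) = 0
  right : Θ 1 = 0
  deriv_left : HasDerivWithinAt Θ 2 (Icc (-1) 1) (-1)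
  deriv_right : HasDerivWithinAt Θ (-2) (Icc (-1) 1) 1
  smooth_moment : ∀ y ∈ Icc (-1 : ℝ) 1, ContDiffAt ℝ ∞ Z y
  smooth_potential : ∀ y ∈ Icc (-1 : ℝ) 1, ContDiffAt ℝ ∞ u y
  mem : ∀ y ∈ Ioo (-1 : ℝ) 1, Z y ∈ Ioo (-1 : ℝ) 1
  mem_Icc : ∀ y ∈ Icc (-1 : ℝ) 1, Z y ∈ Icc (-1 : ℝ) 1
  deriv_moment : ∀ y ∈ Ioo (-1 : ℝ) 1, HasDerivAt Z (Θ (Z y) / (1 - y ^ 2)) y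
  deriv_potential : ∀ y ∈ Ioo (-1 : ℝ) 1, HasDerivAt u ((Z y - y) / (1 - y ^ 2)) y
  potential_right : 0 < 1 - 2 * deriv u 1
  potential_left : 0 < 1 + 2 * deriv u (-1)

theorem isMomentProfile_canonical : IsMomentProfile (fun t => 1 - t ^ 2) id fun _ => 0 := by
  have h : ∀ y ∈ Ioo (-1 : ℝ) 1, 1 - y ^ 2 ≠ 0 := fun y hy => by nlinarith [hy.1, hy.2]
  have hd : ∀ t : ℝ, HasDerivAt (fun t : ℝ => 1 - t ^ 2) (-(2 * t)) t := fun t => by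
    simpa using (hasDerivAt_pow 2 t).const_sub 1
  exact
  { smooth := by fun_prop
    pos := fun t ht => by nlinarith [ht.1, ht.2]
    left := by norm_num
    right := by norm_num
    deriv_left := (hd (-1)).hasDerivWithinAt.congr_deriv (by norm_num)
    deriv_right := (hd 1).hasDerivWithinAt.congr_deriv (by norm_num)
    smooth_moment := fun _ _ => contDiffAt_id
    smooth_potential := fun _ _ => contDiffAt_const
    mem := fun _ h => h
    mem_Icc := fun _ h => h
    deriv_moment := fun y hy => (hasDerivAt_id y).congr_deriv (by
      simp only [id]; rw [div_self (h y hy)])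
    deriv_potential := fun y _ => by simpa using hasDerivAt_const y (0 : ℝ)
    potential_right := by simp
    potential_left := by simp }

/-- Every profile of the form `(1 - t²) (1 + (1 - t²) η)` with the right sign comes from a
momentum. -/
theorem exists_isMomentProfile {η : ℝ → ℝ} {O : Set ℝ} (hO : IsOpen O)
    (hsub : Icc (-1 : ℝ) 1 ⊆ O) (hη : ContDiffOn ℝ ∞ η O)
    (hpos : ∀ t ∈ Icc (-1 : ℝ) 1, 0 < 1 + (1 - t ^ 2) * η t) :
    ∃ Z u : ℝ → ℝ, IsMomentProfile (fun t => (1 - t ^ 2) * (1 + (1 - t ^ 2) * η t)) Z u := by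
  set Φ : ℝ → ℝ := fun t => 1 + (1 - t ^ 2) * η t with hΦ
  obtain ⟨η₁, hη₁, hη₁e⟩ := exists_contDiff_extension hO hsub hη
  set Φ₁ : ℝ → ℝ := fun t => 1 + (1 - t ^ 2) * η₁ t with hΦ₁
  have hΦ₁s : ContDiff ℝ ∞ Φ₁ := by fun_prop
  have hΦe : ∀ t ∈ Icc (-1 : ℝ) 1, Φ₁ t = Φ t := fun t ht => by simp only [hΦ₁, hΦ, hη₁e t ht]
  have hΦ₁p : ∀ t ∈ Icc (-1 : ℝ) 1, 0 < Φ₁ t := fun t ht => by rw [hΦe t ht]; exact hpos t ht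
  -- The equation to solve is `dz / ((1 - z²) Φ) = dy / (1 - y²)`, and `1 / ((1 - z²) Φ) = 1 / (1 -
  -- z²) - η / Φ`. Hence `artanh y = artanh z + k(z)`, where `k' = -η / Φ` is smooth up to the ends;
  -- `κ` extends it to the line.
  obtain ⟨κ, hκ, hκe⟩ := exists_contDiff_extension (g := fun t => -η₁ t / Φ₁ t)
    (isOpen_lt continuous_const hΦ₁s.continuous) hΦ₁p
    (hη₁.neg.contDiffOn.div hΦ₁s.contDiffOn fun t ht => ne_of_gt ht)
  have primitive : ∀ g : ℝ → ℝ, ContDiff ℝ ∞ g → ∀ c b : ℝ, ContDiff ℝ ∞ (fun z => c + ∫ t in b..z, g t) ∧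
      ∀ z, HasDerivAt (fun z => c + ∫ t in b..z, g t) (g z) z := by
    intro g hg c b
    have hd : ∀ z, HasDerivAt (fun z => c + ∫ t in b..z, g t) (g z) z := fun z =>
      (integral_hasDerivAt_right (hg.continuous.intervalIntegrable _ _)
        hg.continuous.stronglyMeasurable.stronglyMeasurableAtFilter
        hg.continuous.continuousAt).const_add c
    refine ⟨?_, hd⟩
    rw [contDiff_infty_iff_deriv]
    refine ⟨fun z => (hd z).differentiableAt, ?_⟩
    rwa [show deriv (fun z => c + ∫ t in b..z, g t) = g from funext fun z => (hd z).deriv]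
  obtain ⟨hk, hkd⟩ := primitive κ hκ 0 0
  set k : ℝ → ℝ := fun z => 0 + ∫ t in (0 : ℝ)..z, κ t
  set q : ℝ → ℝ := fun z => Real.exp (2 * k z) with hq
  have hqs : ContDiff ℝ ∞ q := (contDiff_const.mul hk).exp
  have hqp : ∀ z, 0 < q z := fun z => Real.exp_pos _
  have hqd : ∀ z, HasDerivAt q (q z * (2 * κ z)) z := fun z => ((hkd z).const_mul 2).exp
  -- Exponentiating twice the relation between `y` and `z` gives `y = (q (1 + z) - (1 - z)) / Dn`,
  -- an expression without singularities at `z = ±1`.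
  set Dn : ℝ → ℝ := fun z => q z * (1 + z) + (1 - z) with hDn
  have hDs : ContDiff ℝ ∞ Dn := by fun_prop
  have hDp : ∀ t ∈ Icc (-1 : ℝ) 1, 0 < Dn t := by
    intro t ht
    have := hqp t
    rcases ht.1.eq_or_lt with h | h
    · rw [hDn, ← h]; norm_num
    · exact add_pos_of_pos_of_nonneg (mul_pos this (by linarith)) (by linarith [ht.2])
  have hOD : IsOpen {t | 0 < Dn t ∧ 0 < Φ₁ t} :=
    (isOpen_lt continuous_const hDs.continuous).inter (isOpen_lt continuous_const hΦ₁s.continuous)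
  have hsubD : Icc (-1 : ℝ) 1 ⊆ {t | 0 < Dn t ∧ 0 < Φ₁ t} := fun t ht => ⟨hDp t ht, hΦ₁p t ht⟩
  have hGp : ∀ t ∈ {t | 0 < Dn t ∧ 0 < Φ₁ t}, 0 < 4 * q t / (Dn t ^ 2 * Φ₁ t) := fun t ht => by
    have := hqp t
    have := ht.1
    have := ht.2
    positivity
  have hGs : ContDiffOn ℝ ∞ (fun t => 4 * q t / (Dn t ^ 2 * Φ₁ t)) {t | 0 < Dn t ∧ 0 < Φ₁ t} :=
    (contDiff_const.mul hqs).contDiffOn.div ((hDs.pow 2).mul hΦ₁s).contDiffOn fun t ht => by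
      have := ht.1
      have := ht.2
      positivity
  -- The derivative of `y` in `z` is `4 q / (Dn² Φ)`. Its logarithm is what gets extended, so that
  -- the extension stays positive and its primitive `Y` is strictly increasing on the whole line.
  obtain ⟨lg, hlg, hlge⟩ := exists_contDiff_extension hOD hsubD
    (hGs.log fun t ht => (hGp t ht).ne')
  set G : ℝ → ℝ := fun t => Real.exp (lg t) with hG
  have hGe : ∀ t ∈ Icc (-1 : ℝ) 1, G t = 4 * q t / (Dn t ^ 2 * Φ₁ t) := fun t ht => by
    rw [hG]; beta_reduce; rw [hlge t ht, Real.exp_log (hGp t (hsubD ht))]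
  -- From `z - y = (1 - z²) (1 - q) / Dn` and `1 - y² = 4 q (1 - z²) / Dn²`, the derivative of the
  -- potential with respect to `z` is `(1 - q) / (Dn Φ)`, again regular at the ends.
  obtain ⟨v, hv, hve⟩ := exists_contDiff_extension (g := fun t => (1 - q t) / (Dn t * Φ₁ t)) hOD hsubD
    ((contDiff_const.sub hqs).contDiffOn.div (hDs.mul hΦ₁s).contDiffOn fun t ht => by
      have := ht.1
      have := ht.2
      positivity)
  obtain ⟨hYs, hYd⟩ := primitive G hlg.exp (-1) (-1)
  set Y : ℝ → ℝ := fun z => -1 + ∫ t in (-1 : ℝ)..z, G t with hY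
  obtain ⟨hus, hud⟩ := primitive v hv 0 0
  set uz : ℝ → ℝ := fun z => 0 + ∫ t in (0 : ℝ)..z, v t
  have hYmono : StrictMono Y := strictMono_of_deriv_pos fun z => by
    rw [(hYd z).deriv]; exact Real.exp_pos _
  -- Both sides are primitives of `G` on `[-1, 1]` with value `-1` at `-1`.
  have hYe : ∀ z ∈ Icc (-1 : ℝ) 1, Y z = (q z * (1 + z) - (1 - z)) / Dn z := by
    have hfd : ∀ z ∈ Icc (-1 : ℝ) 1,
        HasDerivAt (fun z => (q z * (1 + z) - (1 - z)) / Dn z) (G z) z := by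
      intro z hz
      have e1 := ((hqd z).mul ((hasDerivAt_id z).const_add 1))
      have e2 := (hasDerivAt_id z).const_sub 1
      have hD := (hDp z hz).ne'
      have hP := (hΦ₁p z hz).ne'
      refine ((e1.sub e2).div (e1.add e2) hD).congr_deriv ?_
      rw [hGe z hz, hκe z hz]
      simp only [Pi.add_apply, Pi.mul_apply, Pi.sub_apply, id]
      change _ / Dn z ^ 2 = _
      rw [div_eq_div_iff (pow_ne_zero 2 hD) (mul_ne_zero (pow_ne_zero 2 hD) hP)]
      field_simp
      simp only [hΦ₁]
      ring
    intro z hz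
    have hd1 : DifferentiableOn ℝ Y (Icc (-1) 1) :=
      fun z _ => (hYd z).differentiableAt.differentiableWithinAt
    have hd2 : DifferentiableOn ℝ (fun z => (q z * (1 + z) - (1 - z)) / Dn z) (Icc (-1) 1) :=
      fun z hz => (hfd z hz).differentiableAt.differentiableWithinAt
    refine eq_of_derivWithin_eq hd1 hd2 ?_ ?_ z hz
    · intro z hz
      have hu := (uniqueDiffOn_Icc (show (-1 : ℝ) < 1 by norm_num)) z (Ico_subset_Icc_self hz)
      rw [(hYd z).hasDerivWithinAt.derivWithin hu,
        (hfd z (Ico_subset_Icc_self hz)).hasDerivWithinAt.derivWithin hu]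
    · simp only [hY, hDn, integral_same]
      norm_num
  have hYl : Y (-1) = -1 := by simp [hY]
  have hYr : Y 1 = 1 := by
    rw [hYe 1 (by norm_num), div_eq_one_iff_eq (hDp 1 (by norm_num)).ne', hDn]
    ring
  set Z : ℝ → ℝ := Function.invFun Y with hZ
  have hZY : ∀ z, Z (Y z) = z := Function.leftInverse_invFun hYmono.injective
  have hsurj : ∀ y ∈ Icc (-1 : ℝ) 1, ∃ z ∈ Icc (-1 : ℝ) 1, Y z = y := by
    intro y hy
    have := intermediate_value_Icc (show (-1 : ℝ) ≤ 1 by norm_num)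
      (hYs.continuous.continuousOn (s := Icc (-1 : ℝ) 1))
    rw [hYl, hYr] at this
    exact this hy
  have hZs : ∀ z, ContDiffAt ℝ ∞ Z (Y z) := by
    intro z
    have hf' : HasFDerivAt Y ((ContinuousLinearEquiv.unitsEquivAut ℝ
        (Units.mk0 (G z) (Real.exp_pos _).ne') : ℝ ≃L[ℝ] ℝ) : ℝ →L[ℝ] ℝ) z := by
      refine (hYd z).hasFDerivAt.congr_fderiv ?_
      ext
      simp
    have hl := hYs.contDiffAt.to_localInverse (a := z) hf' (by simp)
    refine hl.congr_of_eventuallyEq ?_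
    -- The local inverse given by the inverse function theorem is a right inverse of `Y`, and `Z` is
    -- a left inverse, so the two coincide near `Y z`.
    have hr := (hYs.contDiffAt.hasStrictFDerivAt' hf' (by simp)).eventually_right_inverse
    filter_upwards [hr] with y hy
    have : Z (Y (ContDiffAt.localInverse hYs.contDiffAt hf' (by simp) y)) =
      ContDiffAt.localInverse hYs.contDiffAt hf' (by simp) y := hZY _
    rw [← this]
    congr 1
    exact hy.symm
  have hZd : ∀ z, HasDerivAt Z (G z)⁻¹ (Y z) := by
    intro z
    have h := ((hZs z).differentiableAt (by simp)).hasDerivAt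
    have h2 : HasDerivAt (fun z => Z (Y z)) (deriv Z (Y z) * G z) z := h.comp z (hYd z)
    have h3 : HasDerivAt (fun z => Z (Y z)) 1 z := by
      rw [funext hZY]; exact hasDerivAt_id z
    have h4 := h2.unique h3
    rwa [eq_inv_of_mul_eq_one_left h4] at h
  have hmem : ∀ y ∈ Icc (-1 : ℝ) 1, Z y ∈ Icc (-1 : ℝ) 1 := by
    intro y hy
    obtain ⟨z, hz, rfl⟩ := hsurj y hy
    rwa [hZY]
  have hmem' : ∀ y ∈ Ioo (-1 : ℝ) 1, ∃ z ∈ Ioo (-1 : ℝ) 1, Y z = y := by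
    intro y hy
    obtain ⟨z, hz, rfl⟩ := hsurj y (Ioo_subset_Icc_self hy)
    refine ⟨z, ⟨lt_of_le_of_ne hz.1 ?_, lt_of_le_of_ne hz.2 ?_⟩, rfl⟩
    · rintro rfl; rw [hYl] at hy; exact lt_irrefl _ hy.1
    · rintro rfl; rw [hYr] at hy; exact lt_irrefl _ hy.2
  have hθd : ∀ z ∈ Icc (-1 : ℝ) 1, z ^ 2 = 1 → HasDerivWithinAt
      (fun t => (1 - t ^ 2) * (1 + (1 - t ^ 2) * η t)) (-(2 * z)) (Icc (-1) 1) z := by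
    intro z hz hz2
    have hd : HasDerivAt (fun t : ℝ => (1 - t ^ 2) * (1 + (1 - t ^ 2) * η₁ t)) (-(2 * z)) z := by
      have e1 : HasDerivAt (fun t : ℝ => 1 - t ^ 2) (-(2 * z)) z := by
        simpa using (hasDerivAt_pow 2 z).const_sub 1
      have e2 : HasDerivAt η₁ (deriv η₁ z) z := (hη₁.differentiable (by simp) z).hasDerivAt
      refine (e1.mul ((e1.mul e2).const_add 1)).congr_deriv ?_
      simp only [Pi.mul_apply]
      rw [hz2]
      ring
    refine hd.hasDerivWithinAt.congr (fun t ht => ?_) ?_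
    · rw [hη₁e t ht]
    · rw [hη₁e z hz]
  refine ⟨Z, fun y => uz (Z y), ?_⟩
  exact
  { smooth := by
      have := hη.mono hsub
      fun_prop
    pos := fun t ht => mul_pos (by nlinarith [ht.1, ht.2]) (hpos t (Ioo_subset_Icc_self ht))
    left := by norm_num
    right := by norm_num
    deriv_left := (hθd (-1) (by norm_num) (by norm_num)).congr_deriv (by norm_num)
    deriv_right := (hθd 1 (by norm_num) (by norm_num)).congr_deriv (by norm_num)
    smooth_moment := fun y hy => by
      obtain ⟨z, hz, rfl⟩ := hsurj y hy
      exact hZs z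
    smooth_potential := fun y hy => by
      obtain ⟨z, hz, rfl⟩ := hsurj y hy
      exact hus.contDiffAt.comp _ (hZs z)
    mem := fun y hy => by
      obtain ⟨z, hz, rfl⟩ := hmem' y hy
      rwa [hZY]
    mem_Icc := hmem
    deriv_moment := fun y hy => by
      obtain ⟨z, hz, rfl⟩ := hmem' y hy
      have hc := Ioo_subset_Icc_self hz
      refine (hZd z).congr_deriv ?_
      have hD := (hDp z hc).ne'
      have hP := (hΦ₁p z hc).ne'
      have hQ := (hqp z).ne'
      have h1 : 1 - z ^ 2 ≠ 0 := by nlinarith [hz.1, hz.2]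
      have e : 1 - Y z ^ 2 = 4 * q z * (1 - z ^ 2) / Dn z ^ 2 := by
        rw [hYe z hc]
        field_simp
        simp only [hDn]
        ring
      rw [hZY, hGe z hc, e, ← hη₁e z hc]
      change _ = (1 - z ^ 2) * Φ₁ z / _
      field_simp
    deriv_potential := fun y hy => by
      obtain ⟨z, hz, rfl⟩ := hmem' y hy
      have hc := Ioo_subset_Icc_self hz
      have hd := (hud (Z (Y z))).comp (Y z) (hZd z)
      refine hd.congr_deriv ?_
      have hD := (hDp z hc).ne'
      have hP := (hΦ₁p z hc).ne'
      have hQ := (hqp z).ne'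
      have h1 : 1 - z ^ 2 ≠ 0 := by nlinarith [hz.1, hz.2]
      have e : 1 - Y z ^ 2 = 4 * q z * (1 - z ^ 2) / Dn z ^ 2 := by
        rw [hYe z hc]
        field_simp
        simp only [hDn]
        ring
      have e' : z - Y z = (1 - z ^ 2) * (1 - q z) / Dn z := by
        rw [hYe z hc]
        field_simp
        simp only [hDn]
        ring
      rw [hZY, e, e', hve z hc, hGe z hc]
      field_simp
    -- The quantity is `q 1`, and the one at the other end is `1 / q (-1)`; both are positive
    -- because `q` is an exponential.
    potential_right := by
      have hd := (hud (Z (Y 1))).comp (Y 1) (hZd 1)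
      have e : deriv (fun y => uz (Z y)) 1 = v 1 * (G 1)⁻¹ := by
        rw [hZY, hYr] at hd
        exact hd.deriv
      have hQ := hqp 1
      rw [e, hve 1 (by norm_num), hGe 1 (by norm_num), hDn, hΦ₁]
      norm_num
      have : 1 - 2 * ((1 - q 1) / (q 1 * 2) * ((q 1 * 2) ^ 2 / (4 * q 1))) = q 1 := by
        field_simp
        ring
      linarith
    potential_left := by
      have hd := (hud (Z (Y (-1)))).comp (Y (-1)) (hZd (-1))
      have e : deriv (fun y => uz (Z y)) (-1) = v (-1) * (G (-1))⁻¹ := by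
        rw [hZY, hYl] at hd
        exact hd.deriv
      have hQ := hqp (-1)
      rw [e, hve (-1) (by norm_num), hGe (-1) (by norm_num), hDn, hΦ₁]
      norm_num
      have : 1 + 2 * ((1 - q (-1)) / 2 * (q (-1))⁻¹) = 1 / q (-1) := by
        field_simp
        ring
      have h2 : 0 < 1 / q (-1) := by positivity
      linarith }

end Profile

end WeightedExtremal
end


noncomputable section

namespace WeightedExtremal

open Module Filter Topology Set

set_option linter.unusedSectionVars false

/-! ### The local potential of an admissible metric in projectively flat frames. -/

section Potential

variable {N F₀ F₁ V : Type*} [NormedAddCommGroup N] [NormedSpace ℂ N]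
  [NormedAddCommGroup F₀] [InnerProductSpace ℂ F₀] [NormedAddCommGroup F₁] [InnerProductSpace ℂ F₁]
  [NormedAddCommGroup V] [NormedSpace ℂ V]

/-- The squared norm of the first component, in a projectively flat frame of weight `ψ`. -/
def normSq₀ (ψ : N → ℝ) (l : N × (F₀ × F₁)) : ℝ := Real.exp (-ψ l.1) * ‖l.2.1‖ ^ 2

/-- The squared norm of the second component, in a projectively flat frame of weight `ψ`. -/
def normSq₁ (ψ : N → ℝ) (l : N × (F₀ × F₁)) : ℝ := Real.exp (-ψ l.1) * ‖l.2.2‖ ^ 2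

/-- The canonical momentum. -/
def canonMoment (ψ₀ ψ₁ : N → ℝ) (l : N × (F₀ × F₁)) : ℝ :=
  (normSq₀ ψ₀ l - normSq₁ ψ₁ l) / (normSq₀ ψ₀ l + normSq₁ ψ₁ l)

/-- The local potential of the admissible metrics, relative to the base. -/
def admPot (ψ₀ ψ₁ : N → ℝ) (u : ℝ → ℝ) (l : N × (F₀ × F₁)) : ℝ :=
  1 / 2 * (ψ₀ l.1 + ψ₁ l.1) + (Real.log (normSq₀ ψ₀ l + normSq₁ ψ₁ l) + u (canonMoment ψ₀ ψ₁ l))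

variable {ψ₀ ψ₁ : N → ℝ} {u : ℝ → ℝ} {l : N × (F₀ × F₁)}

theorem normSq₀_nonneg (ψ : N → ℝ) (l : N × (F₀ × F₁)) : 0 ≤ normSq₀ ψ l := by
  unfold normSq₀; positivity

theorem normSq₁_nonneg (ψ : N → ℝ) (l : N × (F₀ × F₁)) : 0 ≤ normSq₁ ψ l := by
  unfold normSq₁; positivity

theorem normSq₀_pos (ψ : N → ℝ) (h : l.2.1 ≠ 0) : 0 < normSq₀ ψ l := by
  unfold normSq₀; positivity

theorem normSq₁_pos (ψ : N → ℝ) (h : l.2.2 ≠ 0) : 0 < normSq₁ ψ l := by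
  unfold normSq₁; positivity

theorem normSq_add_pos (h : l.2 ≠ 0) : 0 < normSq₀ ψ₀ l + normSq₁ ψ₁ l := by
  by_cases h0 : l.2.1 = 0
  · exact add_pos_of_nonneg_of_pos (normSq₀_nonneg _ _)
      (normSq₁_pos _ fun h1 => h (Prod.ext h0 h1))
  · exact add_pos_of_pos_of_nonneg (normSq₀_pos _ h0) (normSq₁_nonneg _ _)

theorem canonMoment_mem_Icc (h : l.2 ≠ 0) : canonMoment ψ₀ ψ₁ l ∈ Icc (-1 : ℝ) 1 := by
  have h0 := normSq₀_nonneg ψ₀ l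
  have h1 := normSq₁_nonneg ψ₁ l
  have h2 := normSq_add_pos (ψ₀ := ψ₀) (ψ₁ := ψ₁) h
  unfold canonMoment
  constructor
  · rw [le_div_iff₀ h2]; linarith
  · rw [div_le_iff₀ h2]; linarith

theorem normSq₀_smul (ψ : N → ℝ) (l : N × (F₀ × F₁)) (c : ℂ) :
    normSq₀ ψ (l.1, c • l.2) = ‖c‖ ^ 2 * normSq₀ ψ l := by
  simp only [normSq₀, Prod.smul_fst, norm_smul]; ring

theorem normSq₁_smul (ψ : N → ℝ) (l : N × (F₀ × F₁)) (c : ℂ) :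
    normSq₁ ψ (l.1, c • l.2) = ‖c‖ ^ 2 * normSq₁ ψ l := by
  simp only [normSq₁, Prod.smul_snd, norm_smul]; ring

theorem canonMoment_smul (l : N × (F₀ × F₁)) {c : ℂ} (hc : c ≠ 0) :
    canonMoment ψ₀ ψ₁ (l.1, c • l.2) = canonMoment ψ₀ ψ₁ l := by
  have : ‖c‖ ^ 2 ≠ 0 := by positivity
  rw [canonMoment, normSq₀_smul, normSq₁_smul, ← mul_sub, ← mul_add, mul_div_mul_left _ _ this,
    canonMoment]

/-- The momentum is invariant under scaling and the logarithm picks up `log |c|²`. As `log |c|` is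
pluriharmonic for holomorphic `c`, the form `dd^c` of the potential descends to the
projectivization. -/
theorem admPot_smul (h : l.2 ≠ 0) {c : ℂ} (hc : c ≠ 0) :
    admPot ψ₀ ψ₁ u (l.1, c • l.2) = admPot ψ₀ ψ₁ u l + 2 * Real.log ‖c‖ := by
  have : ‖c‖ ^ 2 ≠ 0 := by positivity
  rw [admPot, canonMoment_smul l hc, normSq₀_smul, normSq₁_smul, ← mul_add,
    Real.log_mul this (normSq_add_pos h).ne', Real.log_pow, admPot]
  push_cast
  ring

theorem contDiffAt_normSq₀ {ψ : N → ℝ} (h : ContDiffAt ℝ ∞ ψ l.1) :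
    ContDiffAt ℝ ∞ (normSq₀ (F₀ := F₀) (F₁ := F₁) ψ) l := by
  have h1 : ContDiffAt ℝ ∞ (fun l : N × (F₀ × F₁) => ψ l.1) l := h.comp l contDiffAt_fst
  have h2 : ContDiff ℝ ∞ fun v : F₀ => ‖v‖ ^ 2 := contDiff_norm_sq ℂ
  have h3 : ContDiffAt ℝ ∞ (fun l : N × (F₀ × F₁) => l.2.1) l := by fun_prop
  exact h1.neg.exp.mul (h2.contDiffAt.comp l h3)

theorem contDiffAt_normSq₁ {ψ : N → ℝ} (h : ContDiffAt ℝ ∞ ψ l.1) :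
    ContDiffAt ℝ ∞ (normSq₁ (F₀ := F₀) (F₁ := F₁) ψ) l := by
  have h1 : ContDiffAt ℝ ∞ (fun l : N × (F₀ × F₁) => ψ l.1) l := h.comp l contDiffAt_fst
  have h2 : ContDiff ℝ ∞ fun v : F₁ => ‖v‖ ^ 2 := contDiff_norm_sq ℂ
  have h3 : ContDiffAt ℝ ∞ (fun l : N × (F₀ × F₁) => l.2.2) l := by fun_prop
  exact h1.neg.exp.mul (h2.contDiffAt.comp l h3)

theorem contDiffAt_canonMoment (h₀ : ContDiffAt ℝ ∞ ψ₀ l.1) (h₁ : ContDiffAt ℝ ∞ ψ₁ l.1)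
    (h : l.2 ≠ 0) : ContDiffAt ℝ ∞ (canonMoment (F₀ := F₀) (F₁ := F₁) ψ₀ ψ₁) l :=
  ((contDiffAt_normSq₀ h₀).sub (contDiffAt_normSq₁ h₁)).div
    ((contDiffAt_normSq₀ h₀).add (contDiffAt_normSq₁ h₁)) (normSq_add_pos h).ne'

theorem contDiffAt_admPot (h₀ : ContDiffAt ℝ ∞ ψ₀ l.1) (h₁ : ContDiffAt ℝ ∞ ψ₁ l.1)
    (h : l.2 ≠ 0) (hu : ∀ y ∈ Icc (-1 : ℝ) 1, ContDiffAt ℝ ∞ u y) :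
    ContDiffAt ℝ ∞ (admPot (F₀ := F₀) (F₁ := F₁) ψ₀ ψ₁ u) l := by
  have e0 : ContDiffAt ℝ ∞ (fun l : N × (F₀ × F₁) => ψ₀ l.1) l := h₀.comp l contDiffAt_fst
  have e1 : ContDiffAt ℝ ∞ (fun l : N × (F₀ × F₁) => ψ₁ l.1) l := h₁.comp l contDiffAt_fst
  have e2 := ((contDiffAt_normSq₀ (F₀ := F₀) (F₁ := F₁) h₀).add (contDiffAt_normSq₁ h₁)).log
    (normSq_add_pos h).ne'
  have e3 := (hu _ (canonMoment_mem_Icc h)).comp l (contDiffAt_canonMoment h₀ h₁ h)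
  exact (contDiffAt_const.mul (e0.add e1)).add (e2.add e3)

end Potential

/-! ### Tensors on a projectivization computed through local holomorphic sections. -/

section LocalSection

variable {N F V : Type*} [NormedAddCommGroup N] [NormedSpace ℂ N]
  [NormedAddCommGroup F] [NormedSpace ℂ F] [NormedAddCommGroup V] [NormedSpace ℂ V]

/-- Local holomorphic sections of a projectivization, in coordinates: `ϖ` is the quotient map and
`k` a section. -/
structure IsLocalSection (k : V → N × F) (ϖ : N × F → V) (U : Set V) (O : Set (N × F)) : Prop where
  isOpen_base : IsOpen U
  isOpen_total : IsOpen O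
  smooth_section : ∀ u ∈ U, ContDiffAt ℂ ω k u
  smooth_quotient : ∀ l ∈ O, ContDiffAt ℂ ω ϖ l
  mapsTo : ∀ u ∈ U, k u ∈ O
  left_inv : ∀ u ∈ U, ϖ (k u) = u
  ne_zero : ∀ l ∈ O, l.2 ≠ 0
  scale : ∀ l ∈ O, ∀ c : ℂ, (l.1, c • l.2) ∈ O → ϖ (l.1, c • l.2) = ϖ l
  fibre : ∀ l ∈ O, ϖ l ∈ U → ∃ c : ℂ, k (ϖ l) = (l.1, c • l.2)

/-- The tensor on the base of a projectivization with base part `Q` and potential `P`. -/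
def secMetric (Q : N → Bil N) (P : N × F → ℝ) (k : V → N × F) (u : V) : Bil V :=
  pull (Q (k u).1) (fderiv ℂ (fun u => (k u).1) u) + ddcFlat (fun u => P (k u)) u

/-- Rescaling a section changes a logarithmic potential by a pluriharmonic function. -/
theorem ddcFlat_scale {P : N × F → ℝ} {k k' : V → N × F} {u : V} [FiniteDimensional ℂ F]
    (hP : ∀ l : N × F, l.2 ≠ 0 → ∀ c : ℂ, c ≠ 0 → P (l.1, c • l.2) = P l + 2 * Real.log ‖c‖)
    (hPs : ContDiffAt ℝ 2 P (k u)) (hk : ContDiffAt ℂ ω k u) (hk' : ContDiffAt ℂ ω k' u)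
    (hne : (k u).2 ≠ 0) (hne' : (k' u).2 ≠ 0)
    (h : ∀ᶠ y in 𝓝 u, ∃ c : ℂ, k' y = ((k y).1, c • (k y).2)) :
    ddcFlat (fun y => P (k' y)) u = ddcFlat (fun y => P (k y)) u := by
  -- The scale factor between the sections is only assumed to exist pointwise. A functional `ℓ` that
  -- does not vanish on the section recovers its modulus as a quotient of moduli of holomorphic
  -- functions.
  obtain ⟨ℓ, hℓ⟩ : ∃ ℓ : F →L[ℂ] ℂ, ℓ (k u).2 ≠ 0 :=
    SeparatingDual.exists_ne_zero (R := ℂ) hne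
  have hsnd : ContDiffAt ℂ ω (fun y => ℓ (k y).2) u := ℓ.contDiff.contDiffAt.comp u (hk.snd)
  have hsnd' : ContDiffAt ℂ ω (fun y => ℓ (k' y).2) u := ℓ.contDiff.contDiffAt.comp u (hk'.snd)
  have hℓ' : ℓ (k' u).2 ≠ 0 := by
    obtain ⟨c, hc⟩ := h.self_of_nhds
    rw [hc] at hne' ⊢
    have hc0 : c ≠ 0 := by rintro rfl; simp at hne'
    simpa using ⟨hc0, hℓ⟩
  have hlog : ∀ {f : V → ℂ}, ContDiffAt ℂ ω f u → f u ≠ 0 →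
      ContDiffAt ℝ 2 (fun y => Real.log ‖f y‖) u := fun hf h0 =>
    ((ContDiffAt.real_of_hol hf).norm ℂ h0).log (norm_ne_zero_iff.2 h0)
  have hev : (fun y => P (k' y)) =ᶠ[𝓝 u] fun y =>
      P (k y) + 2 * (Real.log ‖ℓ (k' y).2‖ - Real.log ‖ℓ (k y).2‖) := by
    filter_upwards [h, hsnd.continuousAt.eventually_ne hℓ, hsnd'.continuousAt.eventually_ne hℓ']
      with y hy h1 h2
    obtain ⟨c, hc⟩ := hy
    have hk0 : (k y).2 ≠ 0 := fun h => h1 (by rw [h, map_zero])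
    have hc0 : c ≠ 0 := by rintro rfl; rw [hc] at h2; simp at h2
    rw [hc, hP _ hk0 c hc0]
    simp only [map_smul, smul_eq_mul, norm_mul]
    rw [Real.log_mul (norm_ne_zero_iff.2 hc0) (norm_ne_zero_iff.2 h1)]
    ring
  have d1 := hlog hsnd' hℓ'
  have d2 := hlog hsnd hℓ
  have hPk : ContDiffAt ℝ 2 (fun y => P (k y)) u := hPs.comp u (ContDiffAt.real_of_hol hk)
  rw [ddcFlat_congr hev, ddcFlat_add hPk (contDiffAt_const.mul (d1.sub d2)), ddcFlat_const_mul (d1.sub d2), ddcFlat_sub d1 d2,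
    ddcFlat_log_norm hsnd' hℓ', ddcFlat_log_norm hsnd hℓ]
  simp

variable {Q : N → Bil N} {P : N × F → ℝ} {k : V → N × F} {ϖ : N × F → V} {U : Set V}
  {O : Set (N × F)} {u : V}

namespace IsLocalSection

/-- The tensor on the base pulls back to the tensor on the total space. -/
theorem pull_secMetric [FiniteDimensional ℂ F] (h : IsLocalSection k ϖ U O)
    (hP : ∀ l : N × F, l.2 ≠ 0 → ∀ c : ℂ, c ≠ 0 → P (l.1, c • l.2) = P l + 2 * Real.log ‖c‖)
    {l : N × F} (hl : l ∈ O) (hlU : ϖ l ∈ U) (hPs : ContDiffAt ℝ 2 P l)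
    (hPs' : ContDiffAt ℝ 2 P (k (ϖ l))) :
    pull (secMetric Q P k (ϖ l)) (fderiv ℂ ϖ l) =
      pull (Q l.1) (ContinuousLinearMap.fst ℂ N F) + ddcFlat P l := by
  have hϖ := h.smooth_quotient l hl
  have hk := h.smooth_section _ hlU
  have hev : ∀ᶠ y in 𝓝 l, ∃ c : ℂ, k (ϖ y) = (y.1, c • y.2) := by
    filter_upwards [h.isOpen_total.mem_nhds hl,
      hϖ.continuousAt.preimage_mem_nhds (h.isOpen_base.mem_nhds hlU)] with y h1 h2
    exact h.fibre y h1 h2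
  have hfst : ContDiffAt ℂ ω (fun u => (k u).1) (ϖ l) := hk.fst
  have e1 : (fun y => (k (ϖ y)).1) =ᶠ[𝓝 l] fun y => y.1 :=
    hev.mono fun y ⟨c, hc⟩ => by
      change (k (ϖ y)).1 = y.1
      rw [hc]
  have e2 : fderiv ℂ (fun y => (k (ϖ y)).1) l =
      (fderiv ℂ (fun u => (k u).1) (ϖ l)).comp (fderiv ℂ ϖ l) :=
    fderiv_comp (g := fun u => (k u).1) l (ContDiffAt.differentiableAt_hol hfst)
      (ContDiffAt.differentiableAt_hol hϖ)
  rw [e1.fderiv_eq, fderiv_fst] at e2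
  have hkϖ : ContDiffAt ℂ ω (fun y => k (ϖ y)) l := hk.comp l hϖ
  -- The identity of the total space and `k ∘ ϖ` differ by a rescaling of the fibre coordinate, so
  -- they pull the potential back to functions with the same `dd^c`.
  have e3 := ddcFlat_scale (k := id) hP hPs contDiffAt_id hkϖ (h.ne_zero l hl)
    (h.ne_zero _ (h.mapsTo _ hlU)) hev
  rw [secMetric, pull_add, pull_pull, ← e2, show (k (ϖ l)).1 = l.1 from e1.self_of_nhds]
  congr 1
  have e4 := ddcFlat_comp_hol (F := fun u => P (k u)) (h := ϖ) (u := l)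
    (hPs'.comp _ (ContDiffAt.real_of_hol hk)) hϖ
  exact e4.symm.trans e3

end IsLocalSection

theorem contDiffAt_secMetric (hQ : ContDiffAt ℝ ∞ Q (k u).1) (hP : ContDiffAt ℝ ∞ P (k u))
    (hk : ContDiffAt ℂ ω k u) : ContDiffAt ℝ ∞ (secMetric Q P k) u := by
  have hfst : ContDiffAt ℂ ω (fun u => (k u).1) u := hk.fst
  refine (contDiffAt_pull (hQ.comp u (ContDiffAt.real_of_hol hfst))
    (ContDiffAt.real_of_hol (ContDiffAt.fderiv_hol hfst))).add ?_
  exact contDiffAt_ddcFlat (hP.comp u (ContDiffAt.real_of_hol hk))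

theorem secMetric_symm (hQ : ∀ v w, Q (k u).1 v w = Q (k u).1 w v) (hP : ContDiffAt ℝ ∞ P (k u))
    (hk : ContDiffAt ℂ ω k u) (v w : V) : secMetric Q P k u v w = secMetric Q P k u w v := by
  have h2 : ContDiffAt ℝ 2 (fun u => P (k u)) u :=
    (hP.comp u (ContDiffAt.real_of_hol hk)).of_le (by norm_cast)
  simp only [secMetric, _root_.add_apply, pull_apply]
  rw [hQ, ddcFlat_symm h2]

theorem secMetric_invariant (hQ : ∀ v w, Q (k u).1 (Complex.I • v) (Complex.I • w) = Q (k u).1 v w)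
    (v w : V) : secMetric Q P k u (Complex.I • v) (Complex.I • w) = secMetric Q P k u v w := by
  simp only [secMetric, _root_.add_apply, pull_apply, map_smul, hQ, ddcFlat_invariant]

theorem closedAt_secMetric (hQs : ContDiffAt ℝ ∞ Q (k u).1)
    (hQ : ∀ v w, Q (k u).1 v w = Q (k u).1 w v)
    (hQi : ∀ v w, Q (k u).1 (Complex.I • v) (Complex.I • w) = Q (k u).1 v w)
    (hQc : ClosedAt Q (k u).1) (hP : ContDiffAt ℝ ∞ P (k u)) (hk : ContDiffAt ℂ ω k u) :
    ClosedAt (secMetric Q P k) u := by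
  have hfst : ContDiffAt ℂ ω (fun u => (k u).1) u := hk.fst
  have hPk : ContDiffAt ℝ ∞ (fun u => P (k u)) u := hP.comp u (ContDiffAt.real_of_hol hk)
  have hQd : DifferentiableAt ℝ Q (k u).1 := hQs.differentiableAt (by simp)
  exact (hQc.pull_comp (h := fun u => (k u).1) hQd hQ hQi hfst).add (closedAt_ddcFlat hPk)
    (differentiableAt_pull_comp (h := fun u => (k u).1) hQd hfst)
    ((contDiffAt_ddcFlat hPk).differentiableAt (by simp))

end LocalSection

end WeightedExtremal
end


noncomputable section

namespace WeightedExtremal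

open Module Filter Topology Set

set_option linter.unusedSectionVars false

/-! ### The logarithm of the ratio of norms as a coordinate. -/

section HyperbolicCoordinates

/-- The potential as a function of the logarithm of the ratio of the norms. -/
def flowPot (u : ℝ → ℝ) (t : ℝ) : ℝ := Real.log (2 * Real.cosh t) + u (Real.tanh t)

theorem exp_add_exp_eq (s t : ℝ) :
    Real.exp (2 * s) + Real.exp (2 * t) = Real.exp (s + t) * (2 * Real.cosh (s - t)) := by
  rw [Real.cosh_eq, mul_div_cancel₀ _ two_ne_zero, mul_add, ← Real.exp_add, ← Real.exp_add]
  congr 2 <;> ring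

theorem exp_sub_exp_eq (s t : ℝ) :
    Real.exp (2 * s) - Real.exp (2 * t) = Real.exp (s + t) * (2 * Real.sinh (s - t)) := by
  rw [Real.sinh_eq, mul_div_cancel₀ _ two_ne_zero, mul_sub, ← Real.exp_add, ← Real.exp_add]
  congr 2 <;> ring

theorem exp_quotient_eq_tanh (s t : ℝ) :
    (Real.exp (2 * s) - Real.exp (2 * t)) / (Real.exp (2 * s) + Real.exp (2 * t)) =
      Real.tanh (s - t) := by
  have := (Real.cosh_pos (s - t)).ne'
  rw [exp_add_exp_eq, exp_sub_exp_eq, Real.tanh_eq_sinh_div_cosh]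
  field_simp

/-- With `r_0 = e^s` and `r_∞ = e^t`, the potential `log (r_0² + r_∞²)` splits into `log r_0 + log
r_∞` and a function of the ratio alone. -/
theorem log_exp_add_exp (s t : ℝ) :
    Real.log (Real.exp (2 * s) + Real.exp (2 * t)) = s + t + Real.log (2 * Real.cosh (s - t)) := by
  have := Real.cosh_pos (s - t)
  rw [exp_add_exp_eq, Real.log_mul (by positivity) (by positivity), Real.log_exp]

theorem hasDerivAt_tanh (t : ℝ) : HasDerivAt Real.tanh (1 - Real.tanh t ^ 2) t := by
  have h := (Real.hasDerivAt_sinh t).div (Real.hasDerivAt_cosh t) (Real.cosh_pos t).ne'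
  have e : Real.tanh = fun t => Real.sinh t / Real.cosh t := funext Real.tanh_eq_sinh_div_cosh
  have hc := (Real.cosh_pos t).ne'
  rw [e]
  refine h.congr_deriv ?_
  field_simp

theorem contDiff_tanh : ContDiff ℝ ∞ Real.tanh := by
  have e : Real.tanh = fun t => Real.sinh t / Real.cosh t := funext Real.tanh_eq_sinh_div_cosh
  rw [e]
  exact Real.contDiff_sinh.div Real.contDiff_cosh fun t => (Real.cosh_pos t).ne'

theorem tanh_mem (t : ℝ) : Real.tanh t ∈ Ioo (-1 : ℝ) 1 :=
  ⟨Real.neg_one_lt_tanh t, Real.tanh_lt_one t⟩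

namespace IsMomentProfile

variable {Θ Z u : ℝ → ℝ}

/-- The derivative `1 - y²` of `y = tanh t` cancels the denominator in the derivative of `Z`,
leaving the autonomous equation `z' = Θ(z)`. -/
theorem hasDerivAt_moment_tanh (h : IsMomentProfile Θ Z u) (t : ℝ) :
    HasDerivAt (fun t => Z (Real.tanh t)) (Θ (Z (Real.tanh t))) t := by
  have hm := tanh_mem t
  have h1 : 1 - Real.tanh t ^ 2 ≠ 0 := by nlinarith [hm.1, hm.2]
  refine ((h.deriv_moment _ hm).comp t (hasDerivAt_tanh t)).congr_deriv ?_
  field_simp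

theorem isProfileFlow (h : IsMomentProfile Θ Z u) : IsProfileFlow Θ fun t => Z (Real.tanh t) where
  mem t := h.mem _ (tanh_mem t)
  hasDeriv := h.hasDerivAt_moment_tanh
  smooth := contDiff_iff_contDiffAt.2 fun t =>
    (h.smooth_moment _ (Ioo_subset_Icc_self (tanh_mem t))).comp t contDiff_tanh.contDiffAt
  profile_pos := h.pos
  profile_smooth _ ht := h.smooth.contDiffAt (Icc_mem_nhds ht.1 ht.2)

/-- The logarithm contributes the canonical momentum `y = tanh t`, and `u` contributes `Z y - y`. -/
theorem hasDerivAt_flowPot (h : IsMomentProfile Θ Z u) (t : ℝ) : HasDerivAt (flowPot u) (Z (Real.tanh t)) t := by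
  have hm := tanh_mem t
  have h1 : 1 - Real.tanh t ^ 2 ≠ 0 := by nlinarith [hm.1, hm.2]
  have hc := Real.cosh_pos t
  have e1 := ((Real.hasDerivAt_cosh t).const_mul 2).log (by positivity)
  have e2 := (h.deriv_potential _ hm).comp t (hasDerivAt_tanh t)
  refine (e1.add e2).congr_deriv ?_
  rw [mul_div_mul_left _ _ two_ne_zero, ← Real.tanh_eq_sinh_div_cosh]
  field_simp
  ring

theorem contDiff_flowPot (h : IsMomentProfile Θ Z u) : ContDiff ℝ ∞ (flowPot u) := by
  rw [contDiff_infty_iff_deriv]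
  refine ⟨fun t => (h.hasDerivAt_flowPot t).differentiableAt, ?_⟩
  rw [show deriv (flowPot u) = _ from funext fun t => (h.hasDerivAt_flowPot t).deriv]
  exact h.isProfileFlow.smooth

theorem deriv_flowPot (h : IsMomentProfile Θ Z u) : deriv (flowPot u) = fun t => Z (Real.tanh t) :=
  funext fun t => (h.hasDerivAt_flowPot t).deriv

theorem deriv_deriv_flowPot (h : IsMomentProfile Θ Z u) : deriv (deriv (flowPot u)) = fun t => Θ (Z (Real.tanh t)) := by
  rw [h.deriv_flowPot]
  exact funext fun t => (h.hasDerivAt_moment_tanh t).deriv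

/-- The momentum construction: a potential of the form `s + t + H(s - t)`. -/
theorem ddcFlat_flowPot (h : IsMomentProfile Θ Z u) {X : Type*} [NormedAddCommGroup X] [NormedSpace ℂ X] {τ : X → ℝ} {x : X}
    (hτ : ContDiffAt ℝ 2 τ x) : ddcFlat (fun y => flowPot u (τ y)) x =
      Z (Real.tanh (τ x)) • ddcFlat τ x + Θ (Z (Real.tanh (τ x))) •
        (sq (fderiv ℝ τ x) + sq (jmul (fderiv ℝ τ x))) := by
  rw [ddcFlat_real_comp (h.contDiff_flowPot.contDiffAt.of_le (by norm_cast)) hτ,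
    h.deriv_deriv_flowPot, h.deriv_flowPot]

end IsMomentProfile

end HyperbolicCoordinates

/-! ### Affine and logarithmic coordinates around a point with both components nonzero. -/

section AffineCoordinates

variable {F : Type*} [NormedAddCommGroup F] [InnerProductSpace ℂ F]

/-- The linear functional equal to `1` at `v` and vanishing on the orthogonal complement. -/
def lineCoord (v : F) : F →L[ℂ] ℂ := ((‖v‖ ^ 2 : ℝ) : ℂ)⁻¹ • innerSL ℂ v

theorem lineCoord_apply (v w : F) : lineCoord v w = ((‖v‖ ^ 2 : ℝ) : ℂ)⁻¹ * inner ℂ v w := rfl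

theorem lineCoord_self {v : F} (hv : v ≠ 0) : lineCoord v v = 1 := by
  have : ((‖v‖ ^ 2 : ℝ) : ℂ) ≠ 0 := by
    rw [Complex.ofReal_ne_zero]; positivity
  rw [lineCoord_apply, inner_self_eq_norm_sq_to_K]
  push_cast at this ⊢
  exact inv_mul_cancel₀ this

theorem lineCoord_perp {v : F} (w : (ℂ ∙ v)ᗮ) : lineCoord v (w : F) = 0 := by
  rw [lineCoord_apply, Submodule.mem_orthogonal_singleton_iff_inner_right.1 w.2, mul_zero]

/-- The projection to the orthogonal complement. -/
def perpCoord (v : F) : F →L[ℂ] (ℂ ∙ v)ᗮ :=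
  (ContinuousLinearMap.id ℂ F - (lineCoord v).smulRight v).codRestrict _ fun w => by
    rw [Submodule.mem_orthogonal_singleton_iff_inner_right]
    by_cases hv : v = 0
    · simp [hv]
    · have : ((‖v‖ ^ 2 : ℝ) : ℂ) ≠ 0 := by
        rw [Complex.ofReal_ne_zero]; positivity
      simp only [_root_.sub_apply, ContinuousLinearMap.id_apply,
        ContinuousLinearMap.smulRight_apply, inner_sub_right, inner_smul_right, lineCoord_apply,
        inner_self_eq_norm_sq_to_K]
      push_cast at this ⊢
      change inner ℂ v w - ((‖v‖ : ℂ) ^ 2)⁻¹ * inner ℂ v w * (‖v‖ : ℂ) ^ 2 = 0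
      have hv' : (‖v‖ : ℂ) ≠ 0 := by simpa using hv
      rw [mul_right_comm, inv_mul_cancel₀ (pow_ne_zero 2 hv'), one_mul, sub_self]

theorem perpCoord_coe (v w : F) : (perpCoord v w : F) = w - lineCoord v w • v := rfl

theorem perpCoord_self {v : F} (hv : v ≠ 0) : perpCoord v v = 0 := by
  ext; rw [perpCoord_coe, lineCoord_self hv]; simp

theorem perpCoord_perp {v : F} (w : (ℂ ∙ v)ᗮ) : perpCoord v (w : F) = w := by
  ext; rw [perpCoord_coe, lineCoord_perp]; simp

theorem norm_add_perp_sq {v : F} (w : (ℂ ∙ v)ᗮ) : ‖v + (w : F)‖ ^ 2 = ‖v‖ ^ 2 + ‖w‖ ^ 2 := by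
  have h := norm_add_sq_eq_norm_sq_add_norm_sq_of_inner_eq_zero v (w : F)
    (Submodule.mem_orthogonal_singleton_iff_inner_right.1 w.2)
  rw [pow_two, h, pow_two, pow_two]
  rfl

variable {N F₀ F₁ : Type*} [NormedAddCommGroup N] [NormedSpace ℂ N]
  [NormedAddCommGroup F₀] [InnerProductSpace ℂ F₀] [NormedAddCommGroup F₁] [InnerProductSpace ℂ F₁]

/-- Affine and logarithmic coordinates on a projective bundle. -/
def toModel (v₀ : F₀) (v₁ : F₁) (l : N × (F₀ × F₁)) : (N × ((ℂ ∙ v₀)ᗮ × (ℂ ∙ v₁)ᗮ)) × ℂ :=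
  ((l.1, (perpCoord v₀ ((lineCoord v₀ l.2.1)⁻¹ • l.2.1), perpCoord v₁ ((lineCoord v₁ l.2.2)⁻¹ • l.2.2))),
    Complex.log (lineCoord v₁ l.2.2 / lineCoord v₀ l.2.1))

/-- The section of a projective bundle attached to affine and logarithmic coordinates. -/
def ofModel (v₀ : F₀) (v₁ : F₁) (x : (N × ((ℂ ∙ v₀)ᗮ × (ℂ ∙ v₁)ᗮ)) × ℂ) : N × (F₀ × F₁) :=
  (x.1.1, (v₀ + (x.1.2.1 : F₀), Complex.exp x.2 • (v₁ + (x.1.2.2 : F₁))))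

variable {v₀ : F₀} {v₁ : F₁}

theorem add_perpCoord_smul {v w : F} (hw : lineCoord v w ≠ 0) :
    v + (perpCoord v ((lineCoord v w)⁻¹ • w) : F) = (lineCoord v w)⁻¹ • w := by
  rw [perpCoord_coe, map_smul, smul_eq_mul, inv_mul_cancel₀ hw, one_smul, add_sub_cancel]

/-- The section picks on each line the vector whose first component has `v₀`-coordinate `1`; the
logarithmic coordinate records the relative scale of the second component. -/
theorem ofModel_toModel {l : N × (F₀ × F₁)}
    (h0 : lineCoord v₀ l.2.1 ≠ 0) (h1 : lineCoord v₁ l.2.2 ≠ 0) :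
    ofModel v₀ v₁ (toModel v₀ v₁ l) = (l.1, (lineCoord v₀ l.2.1)⁻¹ • l.2) := by
  simp only [ofModel, toModel]
  rw [add_perpCoord_smul h0, add_perpCoord_smul h1, Complex.exp_log (div_ne_zero h1 h0),
    smul_smul]
  ext
  · rfl
  · rfl
  · change _ = (lineCoord v₀ l.2.1)⁻¹ • l.2.2
    field_simp

/-- The condition on the imaginary part is the strip on which the principal logarithm inverts the
exponential. -/
theorem toModel_ofModel (hv₀ : v₀ ≠ 0) (hv₁ : v₁ ≠ 0) {x : (N × ((ℂ ∙ v₀)ᗮ × (ℂ ∙ v₁)ᗮ)) × ℂ}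
    (hx : x.2.im ∈ Ioo (-Real.pi) Real.pi) : toModel v₀ v₁ (ofModel v₀ v₁ x) = x := by
  have e0 : lineCoord v₀ (v₀ + (x.1.2.1 : F₀)) = 1 := by
    rw [map_add, lineCoord_self hv₀, lineCoord_perp, add_zero]
  have e1 : lineCoord v₁ (v₁ + (x.1.2.2 : F₁)) = 1 := by
    rw [map_add, lineCoord_self hv₁, lineCoord_perp, add_zero]
  have he := Complex.exp_ne_zero x.2
  simp only [toModel, ofModel]
  rw [e0, (lineCoord v₁).map_smul, e1, smul_eq_mul, mul_one, div_one, Complex.log_exp hx.1 hx.2.le, inv_one,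
    one_smul, inv_smul_smul₀ he, map_add, map_add, perpCoord_self hv₀, perpCoord_self hv₁,
    perpCoord_perp, perpCoord_perp, zero_add, zero_add]

theorem toModel_smul {l : N × (F₀ × F₁)} {c : ℂ} (hc : c ≠ 0) :
    toModel v₀ v₁ (l.1, c • l.2) = toModel v₀ v₁ l := by
  simp only [toModel, Prod.smul_fst, Prod.smul_snd, map_smul, smul_eq_mul, mul_inv, smul_smul]
  have e : ∀ d : ℂ, c⁻¹ * d * c = d := fun d => by field_simp
  rw [mul_div_mul_left _ _ hc, e, e]

theorem toModel_base (hv₀ : v₀ ≠ 0) (hv₁ : v₁ ≠ 0) (n : N) :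
    toModel v₀ v₁ (n, (v₀, v₁)) = ((n, 0), 0) := by
  simp only [toModel, lineCoord_self hv₀, lineCoord_self hv₁, inv_one, one_smul,
    perpCoord_self hv₀, perpCoord_self hv₁, div_one, Complex.log_one]
  rfl

theorem contDiffAt_toModel {l : N × (F₀ × F₁)} (h0 : lineCoord v₀ l.2.1 ≠ 0)
    (h1 : lineCoord v₁ l.2.2 ≠ 0)
    (hs : lineCoord v₁ l.2.2 / lineCoord v₀ l.2.1 ∈ Complex.slitPlane) :
    ContDiffAt ℂ ω (toModel v₀ v₁) l := by
  have c0 : ContDiffAt ℂ ω (fun l : N × (F₀ × F₁) => lineCoord v₀ l.2.1) l := by fun_prop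
  have c1 : ContDiffAt ℂ ω (fun l : N × (F₀ × F₁) => lineCoord v₁ l.2.2) l := by fun_prop
  have d0 : ContDiffAt ℂ ω (fun l : N × (F₀ × F₁) => l.2.1) l := by fun_prop
  have d1 : ContDiffAt ℂ ω (fun l : N × (F₀ × F₁) => l.2.2) l := by fun_prop
  have hq : ContDiffAt ℂ ω (fun l : N × (F₀ × F₁) => lineCoord v₁ l.2.2 / lineCoord v₀ l.2.1) l := by
    simp only [div_eq_mul_inv]
    exact c1.mul (c0.inv h0)
  refine (contDiffAt_fst.prodMk (((perpCoord v₀).contDiff.contDiffAt.comp l ((c0.inv h0).smul d0)).prodMk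
    ((perpCoord v₁).contDiff.contDiffAt.comp l ((c1.inv h1).smul d1)))).prodMk ?_
  exact (hq.analyticAt.clog hs).contDiffAt

theorem contDiff_ofModel : ContDiff ℂ ω (ofModel (N := N) v₀ v₁) := by
  have a0 : ContDiff ℂ ω fun x : (N × ((ℂ ∙ v₀)ᗮ × (ℂ ∙ v₁)ᗮ)) × ℂ => (x.1.2.1 : F₀) :=
    ((ℂ ∙ v₀)ᗮ.subtypeL).contDiff.comp (by fun_prop)
  have a1 : ContDiff ℂ ω fun x : (N × ((ℂ ∙ v₀)ᗮ × (ℂ ∙ v₁)ᗮ)) × ℂ => (x.1.2.2 : F₁) :=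
    ((ℂ ∙ v₁)ᗮ.subtypeL).contDiff.comp (by fun_prop)
  have a2 : ContDiff ℂ ω fun x : (N × ((ℂ ∙ v₀)ᗮ × (ℂ ∙ v₁)ᗮ)) × ℂ => Complex.exp x.2 :=
    contDiff_snd.cexp
  exact (contDiff_fst.comp contDiff_fst).prodMk
    ((contDiff_const.add a0).prodMk (a2.smul (contDiff_const.add a1)))

end AffineCoordinates

end WeightedExtremal
end


noncomputable section

namespace WeightedExtremal

open Module Filter Topology Set

set_option linter.unusedSectionVars false

/-! ### The potential of an admissible metric is that of a Calabi ansatz. -/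

section ModelPotential

variable {N F₀ F₁ V : Type*} [NormedAddCommGroup N] [NormedSpace ℂ N] [FiniteDimensional ℂ N]
  [NormedAddCommGroup F₀] [InnerProductSpace ℂ F₀] [FiniteDimensional ℂ F₀]
  [NormedAddCommGroup F₁] [InnerProductSpace ℂ F₁] [FiniteDimensional ℂ F₁]
  [NormedAddCommGroup V] [NormedSpace ℂ V]

/-- The base tensor `Q` and the curvature tensor `K` of an admissible bundle near a point, in
coordinates. -/
structure IsBundleData (Q K : N → Bil N) (ψ₀ ψ₁ : N → ℝ) (n : N) : Prop where
  smooth₀ : ContDiffAt ℝ ∞ ψ₀ n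
  smooth₁ : ContDiffAt ℝ ∞ ψ₁ n
  smooth_base : ContDiffAt ℝ ∞ Q n
  symm : ∀ v w, Q n v w = Q n w v
  invariant : ∀ v w, Q n (Complex.I • v) (Complex.I • w) = Q n v w
  closed : ClosedAt Q n
  curvature : K n = ddcFlat (fun n => 1 / 2 * (ψ₁ n - ψ₀ n)) n
  pos_sub : ∀ v, v ≠ 0 → 0 < Q n v v - K n v v
  pos_add : ∀ v, v ≠ 0 → 0 < Q n v v + K n v v

/-- The moment potential of the model. -/
def modelChi (ψ₀ ψ₁ : N → ℝ) (v₀ : F₀) (v₁ : F₁) (y : N × ((ℂ ∙ v₀)ᗮ × (ℂ ∙ v₁)ᗮ)) : ℝ :=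
  1 / 2 * (ψ₁ y.1 - ψ₀ y.1) + (1 / 2 * Real.log (‖v₀‖ ^ 2 + ‖y.2.1‖ ^ 2)
    + -1 / 2 * Real.log (‖v₁‖ ^ 2 + ‖y.2.2‖ ^ 2))

/-- The base metric of the model. -/
def modelBase (Q : N → Bil N) (v₀ : F₀) (v₁ : F₁) (y : N × ((ℂ ∙ v₀)ᗮ × (ℂ ∙ v₁)ᗮ)) :
    Bil (N × ((ℂ ∙ v₀)ᗮ × (ℂ ∙ v₁)ᗮ)) :=
  prodBil (Q y.1) (prodBil (fsBil (‖v₀‖ ^ 2) y.2.1) (fsBil (‖v₁‖ ^ 2) y.2.2))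

/-- The curvature form of the model. -/
def modelForm (K : N → Bil N) (v₀ : F₀) (v₁ : F₁) (y : N × ((ℂ ∙ v₀)ᗮ × (ℂ ∙ v₁)ᗮ)) :
    Bil (N × ((ℂ ∙ v₀)ᗮ × (ℂ ∙ v₁)ᗮ)) :=
  prodBil (K y.1) (prodBil ((1 : ℝ) • fsBil (‖v₀‖ ^ 2) y.2.1) ((-1 : ℝ) • fsBil (‖v₁‖ ^ 2) y.2.2))

variable {Q K : N → Bil N} {ψ₀ ψ₁ : N → ℝ} {v₀ : F₀} {v₁ : F₁} {u : ℝ → ℝ}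

/-- Pythagoras gives `|v + w|² = |v|² + |w|²` for `w` orthogonal to `v`. Exponential form separates
the Fubini–Study potentials from the weights and from the modulus of `e^ζ`. -/
theorem normSq_ofModel (hv₀ : v₀ ≠ 0) (hv₁ : v₁ ≠ 0) (x : (N × ((ℂ ∙ v₀)ᗮ × (ℂ ∙ v₁)ᗮ)) × ℂ) :
    normSq₀ ψ₀ (ofModel v₀ v₁ x) =
      Real.exp (2 * (1 / 2 * -ψ₀ x.1.1 + 1 / 2 * Real.log (‖v₀‖ ^ 2 + ‖x.1.2.1‖ ^ 2))) ∧
    normSq₁ ψ₁ (ofModel v₀ v₁ x) =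
      Real.exp (2 * (1 / 2 * -ψ₁ x.1.1 + 1 / 2 * Real.log (‖v₁‖ ^ 2 + ‖x.1.2.2‖ ^ 2) + x.2.re)) := by
  have h0 := const_add_norm_sq_pos (F := (ℂ ∙ v₀)ᗮ) (show 0 < ‖v₀‖ ^ 2 by positivity) x.1.2.1
  have h1 := const_add_norm_sq_pos (F := (ℂ ∙ v₁)ᗮ) (show 0 < ‖v₁‖ ^ 2 by positivity) x.1.2.2
  constructor
  · rw [normSq₀, ofModel]
    dsimp only
    rw [norm_add_perp_sq, ← Real.exp_log h0, ← Real.exp_add, Real.log_exp]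
    congr 1
    ring
  · rw [normSq₁, ofModel]
    dsimp only
    rw [norm_smul, mul_pow, norm_add_perp_sq, Complex.norm_exp, ← Real.exp_nat_mul,
      ← Real.exp_log h1, ← Real.exp_add, ← Real.exp_add, Real.log_exp]
    congr 1
    push_cast
    ring

/-- The function `modelTau` attached to `modelChi` is `log r_0 - log r_∞` along the section, and the
canonical momentum is its hyperbolic tangent. -/
theorem canonMoment_ofModel (hv₀ : v₀ ≠ 0) (hv₁ : v₁ ≠ 0)
    (x : (N × ((ℂ ∙ v₀)ᗮ × (ℂ ∙ v₁)ᗮ)) × ℂ) : canonMoment ψ₀ ψ₁ (ofModel v₀ v₁ x) =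
      Real.tanh (modelTau (modelChi ψ₀ ψ₁ v₀ v₁) x) := by
  obtain ⟨h0, h1⟩ := normSq_ofModel (ψ₀ := ψ₀) (ψ₁ := ψ₁) hv₀ hv₁ x
  rw [canonMoment, h0, h1, exp_quotient_eq_tanh, modelTau, modelChi]
  congr 1
  ring

theorem admPot_ofModel (hv₀ : v₀ ≠ 0) (hv₁ : v₁ ≠ 0)
    (x : (N × ((ℂ ∙ v₀)ᗮ × (ℂ ∙ v₁)ᗮ)) × ℂ) : admPot ψ₀ ψ₁ u (ofModel v₀ v₁ x) =
      ((1 / 2 * Real.log (‖v₀‖ ^ 2 + ‖x.1.2.1‖ ^ 2)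
        + 1 / 2 * Real.log (‖v₁‖ ^ 2 + ‖x.1.2.2‖ ^ 2)) + x.2.re)
        + flowPot u (modelTau (modelChi ψ₀ ψ₁ v₀ v₁) x) := by
  obtain ⟨h0, h1⟩ := normSq_ofModel (ψ₀ := ψ₀) (ψ₁ := ψ₁) hv₀ hv₁ x
  have e : 1 / 2 * -ψ₀ x.1.1 + 1 / 2 * Real.log (‖v₀‖ ^ 2 + ‖x.1.2.1‖ ^ 2) -
      (1 / 2 * -ψ₁ x.1.1 + 1 / 2 * Real.log (‖v₁‖ ^ 2 + ‖x.1.2.2‖ ^ 2) + x.2.re) =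
      modelTau (modelChi ψ₀ ψ₁ v₀ v₁) x := by
    rw [modelTau, modelChi]; ring
  rw [admPot, canonMoment_ofModel hv₀ hv₁, h0, h1, log_exp_add_exp, e, flowPot]
  change 1 / 2 * (ψ₀ x.1.1 + ψ₁ x.1.1) + _ = _
  ring

theorem contDiff_half_log {F : Type*} [NormedAddCommGroup F] [InnerProductSpace ℂ F] {c : ℝ}
    (hc : 0 < c) (b : ℝ) {n : WithTop ℕ∞} :
    ContDiff ℝ n fun v : F => b * Real.log (c + ‖v‖ ^ 2) :=
  contDiff_const.mul (contDiff_log_const_add_norm_sq hc)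

theorem ddcFlat_half_log {F : Type*} [NormedAddCommGroup F] [InnerProductSpace ℂ F] {c : ℝ}
    (hc : 0 < c) (b : ℝ) (v : F) :
    ddcFlat (fun v : F => b / 2 * Real.log (c + ‖v‖ ^ 2)) v = b • fsBil c v := by
  rw [ddcFlat_const_mul (contDiff_log_const_add_norm_sq hc).contDiffAt, fsBil, smul_smul]
  congr 1
  ring

theorem contDiffAt_modelChi (hv₀ : v₀ ≠ 0) (hv₁ : v₁ ≠ 0) {y : N × ((ℂ ∙ v₀)ᗮ × (ℂ ∙ v₁)ᗮ)}
    (h : IsBundleData Q K ψ₀ ψ₁ y.1) : ContDiffAt ℝ ∞ (modelChi ψ₀ ψ₁ v₀ v₁) y := by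
  have a0 : ContDiffAt ℝ ∞ (fun y : N × ((ℂ ∙ v₀)ᗮ × (ℂ ∙ v₁)ᗮ) => ψ₀ y.1) y :=
    h.smooth₀.comp y contDiffAt_fst
  have a1 : ContDiffAt ℝ ∞ (fun y : N × ((ℂ ∙ v₀)ᗮ × (ℂ ∙ v₁)ᗮ) => ψ₁ y.1) y :=
    h.smooth₁.comp y contDiffAt_fst
  have b0 := (contDiff_half_log (F := (ℂ ∙ v₀)ᗮ) (n := ∞) (show 0 < ‖v₀‖ ^ 2 by positivity)
    (1 / 2)).comp (contDiff_fst.comp contDiff_snd : ContDiff ℝ ∞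
      fun y : N × ((ℂ ∙ v₀)ᗮ × (ℂ ∙ v₁)ᗮ) => y.2.1)
  have b1 := (contDiff_half_log (F := (ℂ ∙ v₁)ᗮ) (n := ∞) (show 0 < ‖v₁‖ ^ 2 by positivity)
    (-1 / 2)).comp (contDiff_snd.comp contDiff_snd : ContDiff ℝ ∞
      fun y : N × ((ℂ ∙ v₀)ᗮ × (ℂ ∙ v₁)ᗮ) => y.2.2)
  exact (contDiffAt_const.mul (a1.sub a0)).add (b0.contDiffAt.add b1.contDiffAt)

theorem modelForm_eq (hv₀ : v₀ ≠ 0) (hv₁ : v₁ ≠ 0) {y : N × ((ℂ ∙ v₀)ᗮ × (ℂ ∙ v₁)ᗮ)}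
    (h : IsBundleData Q K ψ₀ ψ₁ y.1) :
    modelForm K v₀ v₁ y = ddcFlat (modelChi ψ₀ ψ₁ v₀ v₁) y := by
  have c0 : 0 < ‖v₀‖ ^ 2 := by positivity
  have c1 : 0 < ‖v₁‖ ^ 2 := by positivity
  have s : ContDiffAt ℝ 2 (fun n => 1 / 2 * (ψ₁ n - ψ₀ n)) y.1 :=
    (contDiffAt_const.mul (h.smooth₁.sub h.smooth₀)).of_le (by norm_cast)
  have s0 := (contDiff_half_log (F := (ℂ ∙ v₀)ᗮ) (n := 2) c0 (1 / 2))
  have s1 := (contDiff_half_log (F := (ℂ ∙ v₁)ᗮ) (n := 2) c1 (-1 / 2))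
  have s' : ContDiffAt ℝ 2 (fun w : (ℂ ∙ v₀)ᗮ × (ℂ ∙ v₁)ᗮ => 1 / 2 * Real.log (‖v₀‖ ^ 2 + ‖w.1‖ ^ 2)
      + -1 / 2 * Real.log (‖v₁‖ ^ 2 + ‖w.2‖ ^ 2)) y.2 :=
    ((s0.comp contDiff_fst).add (s1.comp contDiff_snd)).contDiffAt
  have e := ddcFlat_prod (u := y) s s'
  rw [ddcFlat_prod (u := y.2) s0.contDiffAt s1.contDiffAt, ddcFlat_half_log c0, ddcFlat_half_log c1,
    ← h.curvature] at e
  exact e.symm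

/-- In model coordinates the potential is the sum of the Fubini–Study potentials, of `Re ζ`, which
is pluriharmonic, and of `H(τ)` with `H' = z` and `H'' = Θ(z)`. The last gives `z dd^c τ`, the
`z`-linear part of the pencil, and the vertical squares. -/
theorem ddcFlat_admPot_ofModel (hv₀ : v₀ ≠ 0) (hv₁ : v₁ ≠ 0) {Θ Z : ℝ → ℝ}
    (hp : IsMomentProfile Θ Z u) {x : (N × ((ℂ ∙ v₀)ᗮ × (ℂ ∙ v₁)ᗮ)) × ℂ}
    (h : IsBundleData Q K ψ₀ ψ₁ x.1.1) :
    modelMetric (modelBase Q v₀ v₁) (modelForm K v₀ v₁) (modelChi ψ₀ ψ₁ v₀ v₁) Θ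
      (fun t => Z (Real.tanh t)) x =
    pull (Q x.1.1) ((ContinuousLinearMap.fst ℂ N ((ℂ ∙ v₀)ᗮ × (ℂ ∙ v₁)ᗮ)).comp
      (ContinuousLinearMap.fst ℂ (N × ((ℂ ∙ v₀)ᗮ × (ℂ ∙ v₁)ᗮ)) ℂ))
      + ddcFlat (fun x => admPot ψ₀ ψ₁ u (ofModel v₀ v₁ x)) x := by
  have c0 : 0 < ‖v₀‖ ^ 2 := by positivity
  have c1 : 0 < ‖v₁‖ ^ 2 := by positivity
  have hχ := contDiffAt_modelChi hv₀ hv₁ h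
  have hχ2 : ContDiffAt ℝ 2 (modelChi ψ₀ ψ₁ v₀ v₁) x.1 := hχ.of_le (by norm_cast)
  have s0 := (contDiff_half_log (F := (ℂ ∙ v₀)ᗮ) (n := 2) c0 (1 / 2))
  have s1 := (contDiff_half_log (F := (ℂ ∙ v₁)ᗮ) (n := 2) c1 (1 / 2))
  let A : N × ((ℂ ∙ v₀)ᗮ × (ℂ ∙ v₁)ᗮ) → ℝ := fun y => (fun _ => 0) y.1 +
    (fun w : (ℂ ∙ v₀)ᗮ × (ℂ ∙ v₁)ᗮ => 1 / 2 * Real.log (‖v₀‖ ^ 2 + ‖w.1‖ ^ 2)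
      + 1 / 2 * Real.log (‖v₁‖ ^ 2 + ‖w.2‖ ^ 2)) y.2
  have s' : ContDiff ℝ 2 (fun w : (ℂ ∙ v₀)ᗮ × (ℂ ∙ v₁)ᗮ => 1 / 2 * Real.log (‖v₀‖ ^ 2 + ‖w.1‖ ^ 2)
      + 1 / 2 * Real.log (‖v₁‖ ^ 2 + ‖w.2‖ ^ 2)) :=
    (s0.comp contDiff_fst).add (s1.comp contDiff_snd)
  have hA : ContDiff ℝ 2 A := contDiff_const.add (s'.comp contDiff_snd)
  have eA : ddcFlat A x.1 =
      prodBil 0 (prodBil (fsBil (‖v₀‖ ^ 2) x.1.2.1) (fsBil (‖v₁‖ ^ 2) x.1.2.2)) := by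
    have e := ddcFlat_prod (u := x.1) (ε := fun _ => 0) contDiffAt_const s'.contDiffAt
    rw [ddcFlat_prod (u := x.1.2) s0.contDiffAt s1.contDiffAt, ddcFlat_half_log c0,
      ddcFlat_half_log c1, ddcFlat_const, one_smul, one_smul] at e
    exact e
  have hre : ContDiffAt ℝ 2 (fun x : (N × ((ℂ ∙ v₀)ᗮ × (ℂ ∙ v₁)ᗮ)) × ℂ => x.2.re) x :=
    Complex.reCLM.contDiff.contDiffAt.comp x contDiffAt_snd
  have hAx : ContDiffAt ℝ 2 (fun x : (N × ((ℂ ∙ v₀)ᗮ × (ℂ ∙ v₁)ᗮ)) × ℂ => A x.1) x :=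
    hA.contDiffAt.comp x contDiffAt_fst
  have hτ : ContDiffAt ℝ 2 (modelTau (modelChi ψ₀ ψ₁ v₀ v₁)) x := modelTau_smooth hχ2
  have hH : ContDiffAt ℝ 2 (fun x => flowPot u (modelTau (modelChi ψ₀ ψ₁ v₀ v₁) x)) x :=
    (hp.contDiff_flowPot.contDiffAt.of_le (by norm_cast)).comp x hτ
  have ef : (fun x => admPot ψ₀ ψ₁ u (ofModel v₀ v₁ x)) = fun x : (N × ((ℂ ∙ v₀)ᗮ × (ℂ ∙ v₁)ᗮ)) × ℂ =>
      (A x.1 + x.2.re) + flowPot u (modelTau (modelChi ψ₀ ψ₁ v₀ v₁) x) := by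
    ext x
    rw [admPot_ofModel hv₀ hv₁]
    simp only [A, zero_add]
  have eτ : ddcFlat (modelTau (modelChi ψ₀ ψ₁ v₀ v₁)) x = pull (modelForm K v₀ v₁ x.1)
      (ContinuousLinearMap.fst ℂ (N × ((ℂ ∙ v₀)ᗮ × (ℂ ∙ v₁)ᗮ)) ℂ) := by
    have h1 : ContDiffAt ℝ 2 (fun p : (N × ((ℂ ∙ v₀)ᗮ × (ℂ ∙ v₁)ᗮ)) × ℂ =>
        modelChi ψ₀ ψ₁ v₀ v₁ p.1) x := hχ2.comp x contDiffAt_fst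
    have h3 := ddcFlat_sub h1 hre
    rw [ddcFlat_re_comp contDiffAt_snd, sub_zero, ddcFlat_comp_hol hχ2 contDiffAt_fst, fderiv_fst,
      ← modelForm_eq hv₀ hv₁ h] at h3
    exact h3
  rw [ef, ddcFlat_add (hAx.add hre) hH, ddcFlat_add hAx hre, ddcFlat_re_comp contDiffAt_snd,
    add_zero, ddcFlat_comp_hol hA.contDiffAt contDiffAt_fst, fderiv_fst, eA,
    hp.ddcFlat_flowPot hτ, eτ, modelMetric, pull_add, pull_smul, ← add_assoc, ← add_assoc,
    ← pull_pull, ← pull_add]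
  congr 3
  rw [modelBase]
  refine ContinuousLinearMap.ext fun v => ContinuousLinearMap.ext fun w => ?_
  simp [prodBil]

end ModelPotential

/-! ### Comparison of coordinates on `M₀` with the Calabi model. -/

section LocalModel

variable {N F₀ F₁ V : Type*} [NormedAddCommGroup N] [NormedSpace ℂ N] [FiniteDimensional ℂ N]
  [NormedAddCommGroup F₀] [InnerProductSpace ℂ F₀] [FiniteDimensional ℂ F₀]
  [NormedAddCommGroup F₁] [InnerProductSpace ℂ F₁] [FiniteDimensional ℂ F₁]
  [NormedAddCommGroup V] [NormedSpace ℂ V]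
  {Q K : N → Bil N} {ψ₀ ψ₁ : N → ℝ} {v₀ : F₀} {v₁ : F₁} {pot Θ Z : ℝ → ℝ} {n : N}
  {k : V → N × (F₀ × F₁)} {ϖ : N × (F₀ × F₁) → V} {U : Set V} {O : Set (N × (F₀ × F₁))} {u : V}

theorem toModel_fst_fst (l : N × (F₀ × F₁)) : (toModel v₀ v₁ l).1.1 = l.1 := rfl

theorem fderiv_section_base {y : V}
    (h : DifferentiableAt ℂ (fun y => toModel v₀ v₁ (k y)) y) :
    fderiv ℂ (fun u => (k u).1) y = ((ContinuousLinearMap.fst ℂ N ((ℂ ∙ v₀)ᗮ × (ℂ ∙ v₁)ᗮ)).comp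
      (ContinuousLinearMap.fst ℂ (N × ((ℂ ∙ v₀)ᗮ × (ℂ ∙ v₁)ᗮ)) ℂ)).comp
      (fderiv ℂ (fun y => toModel v₀ v₁ (k y)) y) := by
  have e : (fun u => (k u).1) = fun y => (toModel v₀ v₁ (k y)).1.1 := rfl
  rw [e, fderiv.fst h.fst, fderiv.fst h]
  rfl

namespace IsLocalSection

theorem eventually_lineCoord (hk : k u = (n, (v₀, v₁)))
    (hv₀ : v₀ ≠ 0) (hv₁ : v₁ ≠ 0) : ∀ᶠ l in 𝓝 (k u), lineCoord v₀ l.2.1 ≠ 0 ∧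
      lineCoord v₁ l.2.2 ≠ 0 ∧ lineCoord v₁ l.2.2 / lineCoord v₀ l.2.1 ∈ Complex.slitPlane := by
  have c0 : ContinuousAt (fun l : N × (F₀ × F₁) => lineCoord v₀ l.2.1) (k u) := by fun_prop
  have c1 : ContinuousAt (fun l : N × (F₀ × F₁) => lineCoord v₁ l.2.2) (k u) := by fun_prop
  have e0 : lineCoord v₀ (k u).2.1 = 1 := by rw [hk]; exact lineCoord_self hv₀
  have e1 : lineCoord v₁ (k u).2.2 = 1 := by rw [hk]; exact lineCoord_self hv₁
  have n0 : lineCoord v₀ (k u).2.1 ≠ 0 := by rw [e0]; exact one_ne_zero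
  have n1 : lineCoord v₁ (k u).2.2 ≠ 0 := by rw [e1]; exact one_ne_zero
  filter_upwards [c0.eventually_ne n0, c1.eventually_ne n1,
    (c1.div c0 n0).eventually (Complex.isOpen_slitPlane.mem_nhds (by
      change lineCoord v₁ (k u).2.2 / lineCoord v₀ (k u).2.1 ∈ _
      rw [e0, e1]; simp))]
    with l h1 h2 h3 using ⟨h1, h2, h3⟩

theorem toModel_section (h : IsLocalSection k ϖ U O) (hu : u ∈ U) (hk : k u = (n, (v₀, v₁)))
    (hv₀ : v₀ ≠ 0) (hv₁ : v₁ ≠ 0) : ContDiffAt ℂ ω (fun y => toModel v₀ v₁ (k y)) u := by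
  obtain ⟨h0, h1, h2⟩ := (eventually_lineCoord hk hv₀ hv₁).self_of_nhds
  exact (contDiffAt_toModel h0 h1 h2).comp u (h.smooth_section u hu)

theorem eventually_ofModel_toModel (h : IsLocalSection k ϖ U O) (hu : u ∈ U)
    (hk : k u = (n, (v₀, v₁))) (hv₀ : v₀ ≠ 0) (hv₁ : v₁ ≠ 0) : ∀ᶠ y in 𝓝 u,
      ∃ c : ℂ, c ≠ 0 ∧ ofModel v₀ v₁ (toModel v₀ v₁ (k y)) = ((k y).1, c • (k y).2) := by
  filter_upwards [(h.smooth_section u hu).continuousAt.eventually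
    (eventually_lineCoord hk hv₀ hv₁)] with y hy
  exact ⟨_, inv_ne_zero hy.1, ofModel_toModel hy.1 hy.2.1⟩

theorem eventually_canonMoment (h : IsLocalSection k ϖ U O) (hu : u ∈ U)
    (hk : k u = (n, (v₀, v₁))) (hv₀ : v₀ ≠ 0) (hv₁ : v₁ ≠ 0) : ∀ᶠ y in 𝓝 u,
      canonMoment ψ₀ ψ₁ (k y) =
        Real.tanh (modelTau (modelChi ψ₀ ψ₁ v₀ v₁) (toModel v₀ v₁ (k y))) := by
  filter_upwards [h.eventually_ofModel_toModel hu hk hv₀ hv₁] with y ⟨c, hc, hy⟩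
  rw [← canonMoment_ofModel hv₀ hv₁, hy, canonMoment_smul _ hc]

/-- On the open set where both components are nonzero, the metric is the Calabi model. -/
theorem eventually_secMetric (h : IsLocalSection k ϖ U O) (hu : u ∈ U)
    (hk : k u = (n, (v₀, v₁))) (hv₀ : v₀ ≠ 0) (hv₁ : v₁ ≠ 0) (hp : IsMomentProfile Θ Z pot)
    (hB : ∀ l ∈ O, IsBundleData Q K ψ₀ ψ₁ l.1) : ∀ᶠ y in 𝓝 u,
      secMetric Q (admPot ψ₀ ψ₁ pot) k y = pull (modelMetric (modelBase Q v₀ v₁) (modelForm K v₀ v₁)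
        (modelChi ψ₀ ψ₁ v₀ v₁) Θ (fun t => Z (Real.tanh t)) (toModel v₀ v₁ (k y)))
        (fderiv ℂ (fun y => toModel v₀ v₁ (k y)) y) := by
  filter_upwards [(h.eventually_ofModel_toModel hu hk hv₀ hv₁).eventually_nhds,
    ContDiffAt.eventually_hol (h.toModel_section hu hk hv₀ hv₁), h.isOpen_base.mem_nhds hu]
    with y hy hs hyU
  have hO := h.mapsTo y hyU
  have hBy := hB _ hO
  have hky := h.smooth_section y hyU
  have hfst : ContDiffAt ℂ ω (fun y => (toModel v₀ v₁ (k y)).1) y := hs.fst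
  have hBy' : IsBundleData Q K ψ₀ ψ₁ (toModel v₀ v₁ (k y)).1.1 := hBy
  have e1 := fderiv_section_base (v₀ := v₀) (v₁ := v₁) (ContDiffAt.differentiableAt_hol hs)
  obtain ⟨c, hc, hcy⟩ := hy.self_of_nhds
  have hne := h.ne_zero _ hO
  have hne' : (ofModel v₀ v₁ (toModel v₀ v₁ (k y))).2 ≠ 0 := by
    rw [hcy]; exact smul_ne_zero hc hne
  have hps : ContDiffAt ℝ 2 (admPot (F₀ := F₀) (F₁ := F₁) ψ₀ ψ₁ pot) (k y) :=
    (contDiffAt_admPot hBy.smooth₀ hBy.smooth₁ hne hp.smooth_potential).of_le (by norm_cast)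
  have hof : ContDiffAt ℂ ω (fun y => ofModel v₀ v₁ (toModel v₀ v₁ (k y))) y :=
    contDiff_ofModel.contDiffAt.comp y hs
  have hev : ∀ᶠ y in 𝓝 y, ∃ c : ℂ, ofModel v₀ v₁ (toModel v₀ v₁ (k y)) = ((k y).1, c • (k y).2) :=
    hy.mono fun y h => h.imp fun c hc => hc.2
  have e2 : ddcFlat (fun y => admPot ψ₀ ψ₁ pot (ofModel v₀ v₁ (toModel v₀ v₁ (k y)))) y =
      ddcFlat (fun y => admPot ψ₀ ψ₁ pot (k y)) y :=
    ddcFlat_scale (P := admPot ψ₀ ψ₁ pot) (k := k)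
      (k' := fun y => ofModel v₀ v₁ (toModel v₀ v₁ (k y)))
      (fun l hl c hc => admPot_smul hl hc) hps hky hof hne hne' hev
  have hBo : IsBundleData Q K ψ₀ ψ₁ (ofModel v₀ v₁ (toModel v₀ v₁ (k y))).1 := hBy
  have hps' : ContDiffAt ℝ 2 (fun x => admPot ψ₀ ψ₁ pot (ofModel v₀ v₁ x)) (toModel v₀ v₁ (k y)) :=
    ((contDiffAt_admPot hBo.smooth₀ hBo.smooth₁ hne' hp.smooth_potential).of_le
      (by norm_cast)).comp _ (ContDiffAt.real_of_hol contDiff_ofModel.contDiffAt)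
  have e3 := ddcFlat_comp_hol (F := fun x => admPot ψ₀ ψ₁ pot (ofModel v₀ v₁ x))
    (h := fun y => toModel v₀ v₁ (k y)) hps' hs
  rw [secMetric, e1, ← e2, e3, ddcFlat_admPot_ofModel hv₀ hv₁ hp hBy', pull_add, pull_pull]
  rw [toModel_fst_fst]

/-- Near a point where both components are nonzero, the model coordinates are coordinates. -/
theorem model_inverse (h : IsLocalSection k ϖ U O) (hu : u ∈ U)
    (hk : k u = (n, (v₀, v₁))) (hv₀ : v₀ ≠ 0) (hv₁ : v₁ ≠ 0) :
    (∀ᶠ y in 𝓝 u, ϖ (ofModel v₀ v₁ (toModel v₀ v₁ (k y))) = y) ∧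
    (∀ᶠ x in 𝓝 (toModel v₀ v₁ (k u)), toModel v₀ v₁ (k (ϖ (ofModel v₀ v₁ x))) = x) ∧
    ContDiffAt ℂ ω (fun x => ϖ (ofModel v₀ v₁ x)) (toModel v₀ v₁ (k u)) := by
  have hbase : toModel v₀ v₁ (k u) = ((n, 0), 0) := by rw [hk]; exact toModel_base hv₀ hv₁ n
  have hof : ofModel v₀ v₁ (toModel v₀ v₁ (k u)) = k u := by
    rw [hbase, hk]
    simp [ofModel]
  have hkU := h.mapsTo u hu
  have hs := h.toModel_section hu hk hv₀ hv₁
  have ho : ContinuousAt (ofModel (N := N) v₀ v₁) (toModel v₀ v₁ (k u)) :=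
    contDiff_ofModel.continuous.continuousAt
  have hO : ∀ᶠ x in 𝓝 (toModel v₀ v₁ (k u)), ofModel v₀ v₁ x ∈ O :=
    ho.eventually (h.isOpen_total.mem_nhds (by rw [hof]; exact hkU))
  have hw : ContDiffAt ℂ ω (fun x => ϖ (ofModel v₀ v₁ x)) (toModel v₀ v₁ (k u)) :=
    (h.smooth_quotient _ (by rw [hof]; exact hkU)).comp _ contDiff_ofModel.contDiffAt
  refine ⟨?_, ?_, hw⟩
  · filter_upwards [h.eventually_ofModel_toModel hu hk hv₀ hv₁, h.isOpen_base.mem_nhds hu,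
      hs.continuousAt.eventually hO] with y ⟨c, _, hy⟩ hyU hyO
    rw [hy] at hyO ⊢
    rw [h.scale _ (h.mapsTo y hyU) c hyO, h.left_inv y hyU]
  · have hwU : ∀ᶠ x in 𝓝 (toModel v₀ v₁ (k u)), ϖ (ofModel v₀ v₁ x) ∈ U :=
      hw.continuousAt.eventually (h.isOpen_base.mem_nhds (by
        change ϖ (ofModel v₀ v₁ (toModel v₀ v₁ (k u))) ∈ U
        rw [hof, h.left_inv u hu]; exact hu))
    have him : ∀ᶠ x in 𝓝 (toModel v₀ v₁ (k u)), x.2.im ∈ Ioo (-Real.pi) Real.pi := by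
      have : ContinuousAt (fun x : (N × ((ℂ ∙ v₀)ᗮ × (ℂ ∙ v₁)ᗮ)) × ℂ => x.2.im)
        (toModel v₀ v₁ (k u)) := by fun_prop
      refine this.eventually (Ioo_mem_nhds ?_ ?_) <;> rw [hbase] <;> simp [Real.pi_pos]
    filter_upwards [hO, hwU, him] with x hx hxU hxi
    obtain ⟨c, hc⟩ := h.fibre _ hx hxU
    have hc0 : c ≠ 0 := by
      rintro rfl
      have := h.ne_zero _ (h.mapsTo _ hxU)
      rw [hc] at this
      simp at this
    rw [hc, toModel_smul hc0, toModel_ofModel hv₀ hv₁ hxi]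

/-- Differentiating the two local identities of `model_inverse` gives mutually inverse linear maps.
-/
theorem exists_model_equiv (h : IsLocalSection k ϖ U O) (hu : u ∈ U)
    (hk : k u = (n, (v₀, v₁))) (hv₀ : v₀ ≠ 0) (hv₁ : v₁ ≠ 0) :
    ∃ e : V ≃L[ℂ] ((N × ((ℂ ∙ v₀)ᗮ × (ℂ ∙ v₁)ᗮ)) × ℂ),
      (e : V →L[ℂ] ((N × ((ℂ ∙ v₀)ᗮ × (ℂ ∙ v₁)ᗮ)) × ℂ)) =
        fderiv ℂ (fun y => toModel v₀ v₁ (k y)) u := by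
  obtain ⟨h1, h2, h3⟩ := h.model_inverse hu hk hv₀ hv₁
  have hs := h.toModel_section hu hk hv₀ hv₁
  have d1 := (ContDiffAt.differentiableAt_hol hs).hasFDerivAt
  have d2 := (ContDiffAt.differentiableAt_hol h3).hasFDerivAt
  have c1 : HasFDerivAt (fun y => ϖ (ofModel v₀ v₁ (toModel v₀ v₁ (k y)))) _ u :=
    HasFDerivAt.comp (g := fun x => ϖ (ofModel v₀ v₁ x)) u d2 d1
  have e1 := c1.congr_of_eventuallyEq (f₁ := id) (h1.mono fun y hy => hy.symm)
  have d1' : HasFDerivAt (fun y => toModel v₀ v₁ (k y)) (fderiv ℂ (fun y => toModel v₀ v₁ (k y)) u)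
      (ϖ (ofModel v₀ v₁ (toModel v₀ v₁ (k u)))) := by
    rw [h1.self_of_nhds]; exact d1
  have c2 : HasFDerivAt (fun x => toModel v₀ v₁ (k (ϖ (ofModel v₀ v₁ x)))) _
      (toModel v₀ v₁ (k u)) := HasFDerivAt.comp (g := fun y => toModel v₀ v₁ (k y))
        (toModel v₀ v₁ (k u)) d1' d2
  have e2 := c2.congr_of_eventuallyEq (f₁ := id) (h2.mono fun y hy => hy.symm)
  have e1' := e1.unique (hasFDerivAt_id u)
  have e2' := e2.unique (hasFDerivAt_id _)
  exact ⟨ContinuousLinearEquiv.equivOfInverse _ _ (fun v => DFunLike.congr_fun e1' v)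
    (fun v => DFunLike.congr_fun e2' v), rfl⟩

end IsLocalSection

end LocalModel

end WeightedExtremal
end


noncomputable section

namespace WeightedExtremal

open Module Filter Topology Set

set_option linter.unusedSectionVars false

/-! ### Positivity of the metric where one of the components vanishes. -/

section Positivity

variable {N F F' V : Type*} [NormedAddCommGroup N] [NormedSpace ℂ N]
  [NormedAddCommGroup F] [InnerProductSpace ℂ F] [NormedAddCommGroup F'] [InnerProductSpace ℂ F']
  [NormedAddCommGroup V] [NormedSpace ℂ V]

/-- The second derivative of a product whose second factor vanishes to second order. -/
theorem ddcFlat_mul_of_vanishing {s g : V → ℝ} {u : V} (hs : ContDiffAt ℝ 2 s u)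
    (hg : ContDiffAt ℝ 2 g u) (h0 : g u = 0) (h1 : fderiv ℝ g u = 0) :
    fderiv ℝ (fun y => s y * g y) u = 0 ∧
      ddcFlat (fun y => s y * g y) u = s u • ddcFlat g u := by
  have hds := hs.differentiableAt (by norm_num)
  have hdg := hg.differentiableAt (by norm_num)
  have e : fderiv ℝ (fun y => s y * g y) =ᶠ[𝓝 u] fun y => s y • fderiv ℝ g y + g y • fderiv ℝ s y := by
    filter_upwards [ContDiffAt.eventually_differentiableAt hs,
      ContDiffAt.eventually_differentiableAt hg] with y h h'
    exact fderiv_fun_mul h h'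
  have e1 : fderiv ℝ (fderiv ℝ fun y => s y * g y) u = s u • fderiv ℝ (fderiv ℝ g) u := by
    rw [e.fderiv_eq, fderiv_fun_add (hds.fun_smul (ContDiffAt.differentiableAt_fderiv hg))
      (hdg.fun_smul (ContDiffAt.differentiableAt_fderiv hs)),
      fderiv_fun_smul hds (ContDiffAt.differentiableAt_fderiv hg),
      fderiv_fun_smul hdg (ContDiffAt.differentiableAt_fderiv hs), h0, h1]
    ext v w
    simp
  refine ⟨by rw [e.self_of_nhds]; beta_reduce; rw [h0, h1]; simp, ?_⟩
  rw [ddcFlat, ddcFlat, e1, pull_smul, smul_add]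

/-- Positivity of the metric at a point where the second component vanishes. -/
theorem pos_of_vanishing {Q : N → Bil N} {f : N → ℝ} {n : V → N} {a : V → F} {b : V → F'}
    {s P : V → ℝ} {H : ℝ → ℝ} {u : V} (hn : ContDiffAt ℂ ω n u) (ha : ContDiffAt ℂ ω a u)
    (hb : ContDiffAt ℂ ω b u) (ha0 : a u ≠ 0) (hb0 : b u = 0) (hf : ContDiffAt ℝ 2 f (n u))
    (hs : ContDiffAt ℝ 2 s u) (hs0 : 0 < s u) (hH : ContDiffAt ℝ 2 H 0) (hH0 : 0 < deriv H 0)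
    (hQ : ∀ v, v ≠ 0 → 0 < Q (n u) v v + ddcFlat f (n u) v v)
    (hP : P =ᶠ[𝓝 u] fun y => (f (n y) + Real.log (0 + ‖a y‖ ^ 2)) + H (s y * (0 + ‖b y‖ ^ 2)))
    (hker : ∀ (v : V) (c : ℂ), fderiv ℂ n u v = 0 → fderiv ℂ a u v = c • a u →
      fderiv ℂ b u v = 0 → v = 0) {v : V} (hv : v ≠ 0) :
    0 < pull (Q (n u)) (fderiv ℂ n u) v v + ddcFlat P u v v := by
  have ha0' : 0 < 0 + ‖a u‖ ^ 2 := by positivity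
  have hla : ContDiffAt ℝ 2 (fun w : F => Real.log (0 + ‖w‖ ^ 2)) (a u) :=
    (contDiff_const_add_norm_sq (F := F) 0).contDiffAt.log ha0'.ne'
  have hnb : ContDiffAt ℝ 2 (fun w : F' => 0 + ‖w‖ ^ 2) (b u) :=
    (contDiff_const_add_norm_sq (F := F') 0).contDiffAt
  have hlb : ContDiffAt ℝ 2 (fun y => 0 + ‖b y‖ ^ 2) u :=
    hnb.comp u (ContDiffAt.real_of_hol hb)
  have hdb : fderiv ℝ (fun y => 0 + ‖b y‖ ^ 2) u = 0 := by
    have h1 := fderiv_comp (𝕜 := ℝ) (g := fun w : F' => 0 + ‖w‖ ^ 2) (f := b) u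
      (hnb.differentiableAt (by norm_num)) ((ContDiffAt.differentiableAt_hol hb).restrictScalars ℝ)
    rw [fderiv_const_add_norm_sq, hb0] at h1
    beta_reduce at h1
    rw [map_zero, ContinuousLinearMap.zero_comp] at h1
    exact h1
  have hb00 : 0 + ‖b u‖ ^ 2 = 0 := by rw [hb0]; simp
  obtain ⟨m1, m2⟩ := ddcFlat_mul_of_vanishing hs hlb hb00 hdb
  have hsb : ContDiffAt ℝ 2 (fun y => s y * (0 + ‖b y‖ ^ 2)) u := hs.mul hlb
  have hz : s u * (0 + ‖b u‖ ^ 2) = 0 := by rw [hb00, mul_zero]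
  have hHc : ContDiffAt ℝ 2 H (s u * (0 + ‖b u‖ ^ 2)) := by rw [hz]; exact hH
  have hfn : ContDiffAt ℝ 2 (fun y => f (n y)) u := hf.comp u (ContDiffAt.real_of_hol hn)
  have hlan : ContDiffAt ℝ 2 (fun y => Real.log (0 + ‖a y‖ ^ 2)) u :=
    hla.comp u (ContDiffAt.real_of_hol ha)
  have hHn : ContDiffAt ℝ 2 (fun y => H (s y * (0 + ‖b y‖ ^ 2))) u := hHc.comp u hsb
  -- At a point with `b = 0` the contributions decouple: a base term, the degenerate Fubini–Study
  -- term along `a`, and a normal term with coefficient `H'(0)`, since `|b|²` vanishes to second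
  -- order.
  have e : ddcFlat P u v v = ddcFlat f (n u) (fderiv ℂ n u v) (fderiv ℂ n u v)
      + 4 * (‖a u‖ ^ 2 * ‖fderiv ℂ a u v‖ ^ 2 - ‖(inner ℂ (a u) (fderiv ℂ a u v) : ℂ)‖ ^ 2)
          / (‖a u‖ ^ 2) ^ 2
      + deriv H 0 * (s u * (4 * ‖fderiv ℂ b u v‖ ^ 2)) := by
    rw [ddcFlat_congr hP, ddcFlat_add (hfn.add hlan) hHn, ddcFlat_add hfn hlan,
      ddcFlat_real_comp (τ := fun y => s y * (0 + ‖b y‖ ^ 2)) hHc hsb, m1, m2, hz, ddcFlat_comp_hol hf hn, ddcFlat_comp_hol hla ha,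
      ddcFlat_comp_hol hnb hb]
    simp only [_root_.add_apply, _root_.smul_apply, smul_eq_mul, pull_apply,
      ddcFlat_log_self ha0', ddcFlat_const_add_norm_sq]
    rw [inner_self_eq_norm_sq_to_K]
    simp [sq, jmul, ← Complex.ofReal_pow]
  rw [e, pull_apply]
  have hcs := norm_inner_sq_le (a u) (fderiv ℂ a u v)
  have h2 : 0 ≤ 4 * (‖a u‖ ^ 2 * ‖fderiv ℂ a u v‖ ^ 2 - ‖(inner ℂ (a u) (fderiv ℂ a u v) : ℂ)‖ ^ 2)
          / (‖a u‖ ^ 2) ^ 2 := by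
    apply div_nonneg _ (by positivity)
    linarith
  have h3 : 0 ≤ deriv H 0 * (s u * (4 * ‖fderiv ℂ b u v‖ ^ 2)) := by positivity
  by_cases hN : fderiv ℂ n u v = 0
  · by_cases hB : fderiv ℂ b u v = 0
    -- If all three terms vanished, equality in Cauchy–Schwarz would make the derivative of `a`
    -- proportional to `a`. Such a vector moves the point only along its own line and is excluded by
    -- `hker`.
    · have hA : ‖a u‖ ^ 2 * ‖fderiv ℂ a u v‖ ^ 2 - ‖(inner ℂ (a u) (fderiv ℂ a u v) : ℂ)‖ ^ 2 ≠ 0 := by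
        intro h0
        have h4 : ‖(inner ℂ (a u) (fderiv ℂ a u v) : ℂ)‖ = ‖a u‖ * ‖fderiv ℂ a u v‖ := by
          rw [← pow_left_inj₀ (norm_nonneg _) (by positivity) two_ne_zero, mul_pow]
          linarith
        by_cases hav : fderiv ℂ a u v = 0
        · exact hv (hker v 0 hN (by rw [hav, zero_smul]) hB)
        · obtain ⟨c, hc, hcv⟩ := (norm_inner_eq_norm_iff ha0 hav).1 h4
          exact hv (hker v c hN hcv hB)
      have h4 : 0 < 4 * (‖a u‖ ^ 2 * ‖fderiv ℂ a u v‖ ^ 2 - ‖(inner ℂ (a u) (fderiv ℂ a u v) : ℂ)‖ ^ 2)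
          / (‖a u‖ ^ 2) ^ 2 := by
        apply div_pos _ (by positivity)
        have := lt_of_le_of_ne (sub_nonneg.2 hcs) hA.symm
        linarith
      rw [hN]
      simp only [map_zero]
      linarith
    · have h5 : 0 < deriv H 0 * (s u * (4 * ‖fderiv ℂ b u v‖ ^ 2)) := by positivity
      rw [hN]
      simp only [map_zero]
      linarith
  · have := hQ _ hN
    linarith

end Positivity

/-! ### Density of `M₀` and the kernel of the quotient map. -/

section Density

variable {N F₀ F₁ V : Type*} [NormedAddCommGroup N] [NormedSpace ℂ N]
  [NormedAddCommGroup F₀] [InnerProductSpace ℂ F₀]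
  [NormedAddCommGroup F₁] [InnerProductSpace ℂ F₁]
  [NormedAddCommGroup V] [NormedSpace ℂ V]
  {k : V → N × (F₀ × F₁)} {ϖ : N × (F₀ × F₁) → V} {U : Set V} {O : Set (N × (F₀ × F₁))} {u : V}

theorem exists_ne_zero_path {F : Type*} [NormedAddCommGroup F] [NormedSpace ℂ F] [Nontrivial F]
    (v : F) : ∃ e : F, ∀ t : ℝ, t ≠ 0 → v + t • e ≠ 0 := by
  by_cases hv : v = 0
  · obtain ⟨e, he⟩ := exists_ne (0 : F)
    exact ⟨e, fun t ht => by rw [hv, zero_add]; exact smul_ne_zero ht he⟩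
  · exact ⟨0, fun t _ => by simpa using hv⟩

namespace IsLocalSection

/-- The points where both components are nonzero are dense. -/
theorem mem_closure [Nontrivial F₀] [Nontrivial F₁] (h : IsLocalSection k ϖ U O) (hu : u ∈ U) :
    u ∈ closure {y | y ∈ U ∧ (k y).2.1 ≠ 0 ∧ (k y).2.2 ≠ 0} := by
  obtain ⟨e₀, h₀⟩ := exists_ne_zero_path (k u).2.1
  obtain ⟨e₁, h₁⟩ := exists_ne_zero_path (k u).2.2
  -- Both fibre components are pushed off zero along a straight line, which is then projected by
  -- `ϖ`. The section at the projected point differs from `γ t` by a scalar only, so its components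
  -- remain nonzero.
  let γ : ℝ → N × (F₀ × F₁) := fun t => ((k u).1, ((k u).2.1 + t • e₀, (k u).2.2 + t • e₁))
  have hγ : Continuous γ := by fun_prop
  have hγ0 : γ 0 = k u := by simp [γ]
  have hO : ∀ᶠ t in 𝓝 0, γ t ∈ O :=
    hγ.continuousAt.eventually (h.isOpen_total.mem_nhds (by rw [hγ0]; exact h.mapsTo u hu))
  have hc : ContinuousAt (fun t => ϖ (γ t)) 0 := by
    have : ContinuousAt ϖ (γ 0) := by
      rw [hγ0]; exact (h.smooth_quotient _ (h.mapsTo u hu)).continuousAt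
    exact this.comp hγ.continuousAt
  have e0 : ϖ (γ 0) = u := by rw [hγ0, h.left_inv u hu]
  have hU : ∀ᶠ t in 𝓝 0, ϖ (γ t) ∈ U :=
    hc.eventually (h.isOpen_base.mem_nhds (by change ϖ (γ 0) ∈ U; rw [e0]; exact hu))
  have ht : Tendsto (fun t => ϖ (γ t)) (𝓝[≠] 0) (𝓝 u) := by
    have := hc.tendsto
    rw [e0] at this
    exact this.mono_left nhdsWithin_le_nhds
  refine mem_closure_of_tendsto ht ?_
  filter_upwards [hO.filter_mono nhdsWithin_le_nhds, hU.filter_mono nhdsWithin_le_nhds,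
    self_mem_nhdsWithin] with t htO htU ht0
  obtain ⟨c, hc⟩ := h.fibre _ htO htU
  have hc0 : c ≠ 0 := by
    rintro rfl
    have := h.ne_zero _ (h.mapsTo _ htU)
    rw [hc] at this
    simp at this
  refine ⟨htU, ?_, ?_⟩
  · rw [hc]; exact smul_ne_zero hc0 (h₀ t ht0)
  · rw [hc]; exact smul_ne_zero hc0 (h₁ t ht0)

/-- The kernel of the differential of the quotient map contains the line. -/
theorem ker_section (h : IsLocalSection k ϖ U O) (hu : u ∈ U) {v : V} {c : ℂ}
    (hv : fderiv ℂ k u v = (0, c • (k u).2)) : v = 0 := by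
  have hO := h.mapsTo u hu
  have hk := (ContDiffAt.differentiableAt_hol (h.smooth_section u hu)).hasFDerivAt
  have hϖ := (ContDiffAt.differentiableAt_hol (h.smooth_quotient _ hO)).hasFDerivAt
  have e1 : HasFDerivAt (fun y => ϖ (k y)) _ u := hϖ.comp u hk
  have e2 := (e1.congr_of_eventuallyEq (f₁ := id) (by
    filter_upwards [h.isOpen_base.mem_nhds hu] with y hy using (h.left_inv y hy).symm)).unique
    (hasFDerivAt_id u)
  have e3 := DFunLike.congr_fun e2 v
  simp only [ContinuousLinearMap.comp_apply, hv, ContinuousLinearMap.id_apply] at e3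
  rw [← e3]
  -- On this curve inside the line of `k u` the quotient map is constant, so its differential kills
  -- the velocity. By `ϖ ∘ k = id` that image is `v`.
  let γ : ℂ → N × (F₀ × F₁) := fun t => ((k u).1, (1 + t * c) • (k u).2)
  have hγ0 : γ 0 = k u := by simp [γ]
  have hγ : HasDerivAt γ ((0 : N), c • (k u).2) 0 := by
    refine (hasDerivAt_const (0 : ℂ) (k u).1).prodMk ?_
    have : HasDerivAt (fun t : ℂ => 1 + t * c) c 0 := by
      simpa using ((hasDerivAt_id (0 : ℂ)).mul_const c).const_add 1
    exact this.smul_const _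
  have hϖ' : HasFDerivAt ϖ (fderiv ℂ ϖ (k u)) (γ 0) := by rw [hγ0]; exact hϖ
  have d1 := hϖ'.comp_hasDerivAt (0 : ℂ) hγ
  have d2 : (ϖ ∘ γ) =ᶠ[𝓝 0] fun _ => ϖ (k u) := by
    filter_upwards [hγ.continuousAt.eventually
      (h.isOpen_total.mem_nhds (show γ 0 ∈ O by rw [hγ0]; exact hO))] with t ht
    exact h.scale _ hO _ ht
  exact (d1.unique ((hasDerivAt_const _ _).congr_of_eventuallyEq d2))

end IsLocalSection

end Density

end WeightedExtremal
end


noncomputable section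

namespace WeightedExtremal

open Module Filter Topology Set

set_option linter.unusedSectionVars false

/-! ### The relative potential near the zero and infinity sections. -/

section EndPotential

/-- The relative potential near the zero section, as a function of the ratio of the squared
norms. -/
def endPot (u : ℝ → ℝ) (b : ℝ) : ℝ := Real.log (1 + b) + u ((1 - b) / (1 + b))

theorem contDiffAt_endPot {u : ℝ → ℝ} (hu : ContDiffAt ℝ ∞ u 1) : ContDiffAt ℝ 2 (endPot u) 0 := by
  have h1 : ContDiffAt ℝ 2 (fun b : ℝ => 1 + b) 0 := by fun_prop
  have h2 : ContDiffAt ℝ 2 (fun b : ℝ => 1 - b) 0 := by fun_prop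
  have h3 : ContDiffAt ℝ 2 (fun b : ℝ => (1 - b) / (1 + b)) 0 := h2.div h1 (by norm_num)
  have hu' : ContDiffAt ℝ 2 u ((fun b : ℝ => (1 - b) / (1 + b)) 0) := by
    simpa using hu.of_le (by norm_cast)
  exact (h1.log (by norm_num)).add (hu'.comp 0 h3)

theorem deriv_endPot {u : ℝ → ℝ} (hu : DifferentiableAt ℝ u 1) :
    deriv (endPot u) 0 = 1 - 2 * deriv u 1 := by
  have h1 : HasDerivAt (fun b : ℝ => 1 + b) 1 0 := by simpa using (hasDerivAt_id (0 : ℝ)).const_add 1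
  have h2 : HasDerivAt (fun b : ℝ => 1 - b) (-1) 0 := by
    simpa using (hasDerivAt_id (0 : ℝ)).const_sub 1
  have h3 := h2.fun_div h1 (by norm_num)
  have hu' : HasDerivAt u (deriv u 1) ((1 - 0) / (1 + 0)) := by simpa using hu.hasDerivAt
  have h4 := (h1.log (by norm_num)).add (hu'.comp (0 : ℝ) h3)
  rw [show deriv (endPot u) 0 = _ from h4.deriv]
  norm_num
  ring

/-- Factoring `r_0²` out of `r_0² + r_∞²` leaves `1 + b` with `b = r_∞² / r_0²`, and the canonical
momentum is `(1 - b) / (1 + b)`. The weights combine to half their difference, a potential of the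
curvature form. -/
theorem admPot_eq_endPot (u : ℝ → ℝ) (p₀ p₁ : ℝ) {A B : ℝ} (hA : 0 < A) (hB : 0 ≤ B) :
    1 / 2 * (p₀ + p₁) + (Real.log (Real.exp (-p₀) * A + Real.exp (-p₁) * B)
      + u ((Real.exp (-p₀) * A - Real.exp (-p₁) * B) / (Real.exp (-p₀) * A + Real.exp (-p₁) * B))) =
    (1 / 2 * (p₁ - p₀) + Real.log (0 + A)) + endPot u (Real.exp (p₀ - p₁) / A * (0 + B)) := by
  have e : Real.exp (-p₁) * B = Real.exp (-p₀) * A * (Real.exp (p₀ - p₁) / A * B) := by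
    rw [show -p₁ = -p₀ + (p₀ - p₁) by ring, Real.exp_add]
    field_simp
  have h0 : 0 < Real.exp (-p₀) * A := by positivity
  rw [zero_add, zero_add, e]
  set b := Real.exp (p₀ - p₁) / A * B with hb
  have hb0 : 0 ≤ b := by positivity
  rw [show Real.exp (-p₀) * A + Real.exp (-p₀) * A * b = Real.exp (-p₀) * A * (1 + b) by ring,
    show Real.exp (-p₀) * A - Real.exp (-p₀) * A * b = Real.exp (-p₀) * A * (1 - b) by ring,
    mul_div_mul_left _ _ h0.ne', Real.log_mul h0.ne' (by positivity),
    Real.log_mul (Real.exp_pos _).ne' hA.ne', Real.log_exp, endPot]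
  ring

end EndPotential

/-! ### Local models of admissible metrics are Kähler. -/

section LocalModel

variable {N F₀ F₁ V : Type*} [NormedAddCommGroup N] [NormedSpace ℂ N] [FiniteDimensional ℂ N]
  [NormedAddCommGroup F₀] [InnerProductSpace ℂ F₀] [FiniteDimensional ℂ F₀]
  [NormedAddCommGroup F₁] [InnerProductSpace ℂ F₁] [FiniteDimensional ℂ F₁]
  [NormedAddCommGroup V] [NormedSpace ℂ V]
  {Q K : N → Bil N} {ψ₀ ψ₁ : N → ℝ} {pot Θ Z P₀ σ₀ : ℝ → ℝ}
  {k : V → N × (F₀ × F₁)} {ϖ : N × (F₀ × F₁) → V} {U : Set V} {O : Set (N × (F₀ × F₁))} {u : V}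

/-- The data describing an admissible metric in a coordinate chart of an admissible manifold. -/
structure IsLocalModel (k : V → N × (F₀ × F₁)) (ϖ : N × (F₀ × F₁) → V) (U : Set V)
    (O : Set (N × (F₀ × F₁))) (Q K : N → Bil N) (ψ₀ ψ₁ : N → ℝ) (Θ Z pot P₀ σ₀ : ℝ → ℝ) :
    Prop where
  localSection : IsLocalSection k ϖ U O
  profile : IsMomentProfile Θ Z pot
  bundle : ∀ l ∈ O, IsBundleData Q K ψ₀ ψ₁ l.1
  base : ∀ l ∈ O, ∃ ε, IsCalabiBase Q K ε P₀ σ₀ l.1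

theorem finrank_perp {F : Type*} [NormedAddCommGroup F] [InnerProductSpace ℂ F]
    [FiniteDimensional ℂ F] {v : F} (hv : v ≠ 0) : finrank ℂ (ℂ ∙ v)ᗮ = finrank ℂ F - 1 := by
  have h : 0 < finrank ℂ F := finrank_pos_iff_exists_ne_zero.2 ⟨v, hv⟩
  have := (ℂ ∙ v).finrank_add_finrank_orthogonal
  rw [finrank_span_singleton hv] at this
  omega

namespace IsLocalModel

variable {n : N} {v₀ : F₀} {v₁ : F₁}

/-- The base of the Calabi model. -/
theorem isCalabiBase_model (h : IsLocalModel k ϖ U O Q K ψ₀ ψ₁ Θ Z pot P₀ σ₀) {l : N × (F₀ × F₁)}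
    (hl : l ∈ O) (hv₀ : v₀ ≠ 0) (hv₁ : v₁ ≠ 0) :
    ∃ ε, IsCalabiBase (modelBase Q v₀ v₁) (modelForm K v₀ v₁) ε
      (fun z => P₀ z * ((1 + 1 * z) ^ (finrank ℂ F₀ - 1) * (1 + -1 * z) ^ (finrank ℂ F₁ - 1)))
      (fun z => σ₀ z + (2 * (finrank ℂ F₀ - 1 : ℕ) * ((finrank ℂ F₀ - 1 : ℕ) + 1) / (1 + 1 * z)
        + 2 * (finrank ℂ F₁ - 1 : ℕ) * ((finrank ℂ F₁ - 1 : ℕ) + 1) / (1 + -1 * z)))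
      (l.1, (0, 0)) := by
  obtain ⟨ε, hε⟩ := h.base l hl
  obtain ⟨ε₀, h₀⟩ := isCalabiBase_fsBil (F := (ℂ ∙ v₀)ᗮ) (s := 1)
    (show 0 < ‖v₀‖ ^ 2 by positivity) (Or.inl rfl)
  obtain ⟨ε₁, h₁⟩ := isCalabiBase_fsBil (F := (ℂ ∙ v₁)ᗮ) (s := -1)
    (show 0 < ‖v₁‖ ^ 2 by positivity) (Or.inr rfl)
  obtain ⟨c, hc⟩ := h₀.prod h₁
  obtain ⟨c', hc'⟩ := hε.prod hc
  rw [finrank_perp hv₀, finrank_perp hv₁] at hc'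
  exact ⟨_, hc'⟩

theorem pos_of_ne_zero (h : IsLocalModel k ϖ U O Q K ψ₀ ψ₁ Θ Z pot P₀ σ₀) (hu : u ∈ U)
    (h₀ : (k u).2.1 ≠ 0) (h₁ : (k u).2.2 ≠ 0) {v : V} (hv : v ≠ 0) :
    0 < secMetric Q (admPot ψ₀ ψ₁ pot) k u v v := by
  have hO := h.localSection.mapsTo u hu
  have hk : k u = ((k u).1, ((k u).2.1, (k u).2.2)) := rfl
  obtain ⟨e, he⟩ := h.localSection.exists_model_equiv hu hk h₀ h₁
  obtain ⟨ε, hε⟩ := h.isCalabiBase_model hO h₀ h₁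
  rw [(h.localSection.eventually_secMetric hu hk h₀ h₁ h.profile h.bundle).self_of_nhds, ← he]
  -- Affine coordinates centred at the point itself place it at the origin, the only point where the
  -- base data of the Fubini–Study factors are recorded.
  have hb : toModel (k u).2.1 (k u).2.2 (k u) = (((k u).1, 0), 0) := toModel_base h₀ h₁ _
  rw [show ((k u).1, ((0 : (ℂ ∙ (k u).2.1)ᗮ), (0 : (ℂ ∙ (k u).2.2)ᗮ))) =
    (toModel (k u).2.1 (k u).2.2 (k u)).1 by rw [hb]; rfl] at hε
  exact modelMetric_pos (p := toModel (k u).2.1 (k u).2.2 (k u)) hε h.profile.isProfileFlow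
    (contDiffAt_modelChi h₀ h₁ (h.bundle _ hO)) (e.map_ne_zero_iff.2 hv)

/-- Where both components are nonzero the metric is a Calabi model. Where one vanishes the
horizontal part is `Q + K` or `Q - K`, definite because `|x_a| < 1`, and the normal coefficient is
positive by the end conditions of `IsMomentProfile`. -/
theorem pos (h : IsLocalModel k ϖ U O Q K ψ₀ ψ₁ Θ Z pot P₀ σ₀) (hu : u ∈ U) {v : V} (hv : v ≠ 0) :
    0 < secMetric Q (admPot ψ₀ ψ₁ pot) k u v v := by
  have hO := h.localSection.mapsTo u hu
  have hB := h.bundle _ hO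
  have hk := h.localSection.smooth_section u hu
  have hn : ContDiffAt ℂ ω (fun y => (k y).1) u := hk.fst
  have ha : ContDiffAt ℂ ω (fun y => (k y).2.1) u := hk.snd.fst
  have hb : ContDiffAt ℂ ω (fun y => (k y).2.2) u := hk.snd.snd
  have hkd := ContDiffAt.differentiableAt_hol hk
  have e1 : fderiv ℂ (fun y => (k y).1) u = (ContinuousLinearMap.fst ℂ _ _).comp (fderiv ℂ k u) :=
    fderiv.fst hkd
  have e2 : fderiv ℂ (fun y => (k y).2) u = (ContinuousLinearMap.snd ℂ _ _).comp (fderiv ℂ k u) :=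
    fderiv.snd hkd
  have e3 : fderiv ℂ (fun y => (k y).2.1) u =
      (ContinuousLinearMap.fst ℂ _ _).comp ((ContinuousLinearMap.snd ℂ _ _).comp (fderiv ℂ k u)) := by
    rw [← e2]; exact fderiv.fst hkd.snd
  have e4 : fderiv ℂ (fun y => (k y).2.2) u =
      (ContinuousLinearMap.snd ℂ _ _).comp ((ContinuousLinearMap.snd ℂ _ _).comp (fderiv ℂ k u)) := by
    rw [← e2]; exact fderiv.snd hkd.snd
  have hψ₀ : ContDiffAt ℝ 2 ψ₀ (k u).1 := hB.smooth₀.of_le (by norm_cast)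
  have hψ₁ : ContDiffAt ℝ 2 ψ₁ (k u).1 := hB.smooth₁.of_le (by norm_cast)
  have hψ₀' : ContDiffAt ℝ 2 (fun y => ψ₀ (k y).1) u := hψ₀.comp u (ContDiffAt.real_of_hol hn)
  have hψ₁' : ContDiffAt ℝ 2 (fun y => ψ₁ (k y).1) u := hψ₁.comp u (ContDiffAt.real_of_hol hn)
  by_cases h₀ : (k u).2.1 = 0
  · have h₁ : (k u).2.2 ≠ 0 := fun h1 => h.localSection.ne_zero _ hO (Prod.ext h₀ h1)
    have hN : ContDiffAt ℝ 2 (fun y => ‖(k y).2.2‖ ^ 2) u :=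
      (contDiff_norm_sq ℂ).contDiffAt.comp u (ContDiffAt.real_of_hol hb)
    -- Exchanging the two bundles changes the sign of the canonical momentum and of the curvature
    -- form; the reflected potential reduces this end to the other one.
    have hpot : ContDiffAt ℝ ∞ (fun y => pot (-y)) 1 :=
      ContDiffAt.comp (g := pot) (1 : ℝ) (h.profile.smooth_potential (-1) (by norm_num)) contDiff_neg.contDiffAt
    refine pos_of_vanishing (f := fun n => 1 / 2 * (ψ₀ n - ψ₁ n)) (H := endPot fun y => pot (-y))
      (s := fun y => Real.exp (ψ₁ (k y).1 - ψ₀ (k y).1) / ‖(k y).2.2‖ ^ 2) hn hb ha h₁ h₀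
      (contDiffAt_const.mul (hψ₀.sub hψ₁)) ((hψ₁'.sub hψ₀').exp.div hN (by positivity))
      (by positivity) (contDiffAt_endPot hpot) ?_ ?_ ?_ ?_ hv
    · rw [deriv_endPot (hpot.differentiableAt (by simp)), deriv_comp_neg]
      have := h.profile.potential_left
      linarith
    · intro w hw
      have e5 : (fun n => 1 / 2 * (ψ₀ n - ψ₁ n)) = fun n => -1 * (1 / 2 * (ψ₁ n - ψ₀ n)) := by
        ext n; ring
      rw [e5, ddcFlat_const_mul (contDiffAt_const.mul (hψ₁.sub hψ₀)), ← hB.curvature]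
      have := hB.pos_sub w hw
      simp only [_root_.smul_apply, smul_eq_mul]
      linarith
    · filter_upwards [hb.continuousAt.eventually_ne h₁] with y hy
      rw [← admPot_eq_endPot _ _ _ (by positivity) (by positivity), admPot, canonMoment, normSq₀,
        normSq₁, ← neg_div, neg_sub, add_comm (ψ₀ _), add_comm (Real.exp (-ψ₀ (k y).1) * _)]
    · intro w c h1 h2 h3
      rw [e1] at h1
      rw [e3] at h3
      rw [e4] at h2
      refine h.localSection.ker_section hu (c := c) (Prod.ext h1 (Prod.ext ?_ h2))
      change _ = c • (k u).2.1
      rw [h₀, smul_zero]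
      exact h3
  · by_cases h₁ : (k u).2.2 = 0
    · have hN : ContDiffAt ℝ 2 (fun y => ‖(k y).2.1‖ ^ 2) u :=
        (contDiff_norm_sq ℂ).contDiffAt.comp u (ContDiffAt.real_of_hol ha)
      have hpot := h.profile.smooth_potential 1 (by norm_num)
      refine pos_of_vanishing (f := fun n => 1 / 2 * (ψ₁ n - ψ₀ n)) (H := endPot pot)
        (s := fun y => Real.exp (ψ₀ (k y).1 - ψ₁ (k y).1) / ‖(k y).2.1‖ ^ 2) hn ha hb h₀ h₁
        (contDiffAt_const.mul (hψ₁.sub hψ₀)) ((hψ₀'.sub hψ₁').exp.div hN (by positivity))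
        (by positivity) (contDiffAt_endPot hpot) ?_ ?_ ?_ ?_ hv
      · rw [deriv_endPot (hpot.differentiableAt (by simp))]
        exact h.profile.potential_right
      · intro w hw
        rw [← hB.curvature]
        exact hB.pos_add w hw
      · filter_upwards [ha.continuousAt.eventually_ne h₀] with y hy
        rw [← admPot_eq_endPot _ _ _ (by positivity) (by positivity), admPot, canonMoment, normSq₀,
          normSq₁]
      · intro w c h1 h2 h3
        rw [e1] at h1
        rw [e3] at h2
        rw [e4] at h3
        refine h.localSection.ker_section hu (c := c) (Prod.ext h1 (Prod.ext h2 ?_))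
        change _ = c • (k u).2.2
        rw [h₁, smul_zero]
        exact h3
    · exact h.pos_of_ne_zero hu h₀ h₁ hv

theorem contDiffAt_potential (h : IsLocalModel k ϖ U O Q K ψ₀ ψ₁ Θ Z pot P₀ σ₀) (hu : u ∈ U) :
    ContDiffAt ℝ ∞ (admPot (F₀ := F₀) (F₁ := F₁) ψ₀ ψ₁ pot) (k u) := by
  have hO := h.localSection.mapsTo u hu
  exact contDiffAt_admPot (h.bundle _ hO).smooth₀ (h.bundle _ hO).smooth₁
    (h.localSection.ne_zero _ hO) h.profile.smooth_potential

theorem contDiffAt_metric (h : IsLocalModel k ϖ U O Q K ψ₀ ψ₁ Θ Z pot P₀ σ₀) (hu : u ∈ U) :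
    ContDiffAt ℝ ∞ (secMetric Q (admPot ψ₀ ψ₁ pot) k) u :=
  contDiffAt_secMetric (h.bundle _ (h.localSection.mapsTo u hu)).smooth_base
    (h.contDiffAt_potential hu) (h.localSection.smooth_section u hu)

/-- The metrics of a local model are Kähler. -/
theorem isKahlerOn (h : IsLocalModel k ϖ U O Q K ψ₀ ψ₁ Θ Z pot P₀ σ₀) :
    IsKahlerOn (secMetric Q (admPot ψ₀ ψ₁ pot) k) U where
  smooth u hu := (h.contDiffAt_metric hu).contDiffWithinAt
  symm u hu v w := secMetric_symm (h.bundle _ (h.localSection.mapsTo u hu)).symm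
    (h.contDiffAt_potential hu) (h.localSection.smooth_section u hu) v w
  invariant u hu v w := secMetric_invariant (h.bundle _ (h.localSection.mapsTo u hu)).invariant v w
  pos u hu v hv := h.pos hu hv
  closed u hu := by
    have hB := h.bundle _ (h.localSection.mapsTo u hu)
    exact closedAt_secMetric hB.smooth_base hB.symm hB.invariant hB.closed
      (h.contDiffAt_potential hu) (h.localSection.smooth_section u hu)

theorem contDiffAt_moment (h : IsLocalModel k ϖ U O Q K ψ₀ ψ₁ Θ Z pot P₀ σ₀) (hu : u ∈ U) :
    ContDiffAt ℝ ∞ (fun y => Z (canonMoment ψ₀ ψ₁ (k y))) u := by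
  have hO := h.localSection.mapsTo u hu
  have h1 := contDiffAt_canonMoment (h.bundle _ hO).smooth₀ (h.bundle _ hO).smooth₁
    (h.localSection.ne_zero _ hO)
  have h2 : ContDiffAt ℝ ∞ (fun y => canonMoment ψ₀ ψ₁ (k y)) u :=
    h1.comp u (ContDiffAt.real_of_hol (h.localSection.smooth_section u hu))
  exact (h.profile.smooth_moment _ (canonMoment_mem_Icc (h.localSection.ne_zero _ hO))).comp u h2

end IsLocalModel

end LocalModel

end WeightedExtremal
end


noncomputable section

namespace WeightedExtremal

open Module Filter Topology Set

set_option linter.unusedSectionVars false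

/-! ### The weighted scalar curvature of a local model. -/

section LocalModel

variable {N F₀ F₁ V : Type*} [NormedAddCommGroup N] [NormedSpace ℂ N] [FiniteDimensional ℂ N]
  [NormedAddCommGroup F₀] [InnerProductSpace ℂ F₀] [FiniteDimensional ℂ F₀]
  [NormedAddCommGroup F₁] [InnerProductSpace ℂ F₁] [FiniteDimensional ℂ F₁]
  [NormedAddCommGroup V] [NormedSpace ℂ V]
  {Q K : N → Bil N} {ψ₀ ψ₁ : N → ℝ} {pot Θ Z P₀ σ₀ : ℝ → ℝ}
  {k : V → N × (F₀ × F₁)} {ϖ : N × (F₀ × F₁) → V} {U : Set V} {O : Set (N × (F₀ × F₁))} {u : V}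

/-- The `(f, p)`-scalar curvature on an open subset of a complex vector space. -/
def weightedScalFlat [FiniteDimensional ℂ V] (f : V → ℝ) (p : ℝ) (G : V → Bil V) (u : V) : ℝ :=
  f u ^ 2 * scalFlat G u - 2 * (p - 1) * f u * (-(1 / 2) * traceWrt (G u) (ddcFlat f u))
    - p * (p - 1) * traceWrt (G u) (sq (fderiv ℝ f u))

theorem weightedScalFlat_congr [FiniteDimensional ℂ V] {f f' : V → ℝ} {p : ℝ} {G G' : V → Bil V}
    (hf : f =ᶠ[𝓝 u] f') (hG : G =ᶠ[𝓝 u] G') :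
    weightedScalFlat f p G u = weightedScalFlat f' p G' u := by
  rw [weightedScalFlat, weightedScalFlat, hf.self_of_nhds, hG.self_of_nhds, scalFlat_congr hG,
    ddcFlat_congr hf, hf.fderiv_eq]

theorem continuousAt_weightedScalFlat [FiniteDimensional ℂ V] {f : V → ℝ} {p : ℝ} {G : V → Bil V}
    (hf : ContDiffAt ℝ ∞ f u) (hG : ContDiffAt ℝ ∞ G u) (h0 : 0 < gdet (G u)) :
    ContinuousAt (weightedScalFlat f p G) u := by
  have hg : ContDiffAt ℝ ∞ (fun y => 1 / 2 * Real.log (gdet (G y))) u :=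
    contDiffAt_const.mul ((contDiff_gdet.contDiffAt.comp u hG).log h0.ne')
  have h1 : ContinuousAt (scalFlat G) u := by
    rw [show scalFlat G = _ from funext (scalFlat_eq G)]
    exact continuousAt_const.mul
      (continuousAt_traceWrt hG.continuousAt (contDiffAt_ddcFlat hg).continuousAt h0.ne')
  have h2 := continuousAt_traceWrt hG.continuousAt (contDiffAt_ddcFlat hf).continuousAt h0.ne'
  have h3 : ContinuousAt (fun y => sq (fderiv ℝ f y)) u := by
    have h4 : ContinuousAt (fderiv ℝ f) u :=
      (hf.fderiv_right (m := ∞) (by simp)).continuousAt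
    have h5 : Continuous fun α : V →L[ℝ] ℝ => sq α :=
      ((ContinuousLinearMap.smulRightL ℝ V (V →L[ℝ] ℝ)).continuous.clm_apply continuous_id)
    exact h5.continuousAt.comp h4
  have h6 := continuousAt_traceWrt hG.continuousAt h3 h0.ne'
  exact (((hf.continuousAt.pow 2).mul h1).sub ((continuousAt_const.mul hf.continuousAt).mul
    (continuousAt_const.mul h2))).sub (continuousAt_const.mul h6)

theorem ddcFlat_add_const {f : V → ℝ} (hf : ContDiffAt ℝ 2 f u) (a : ℝ) :
    ddcFlat (fun y => f y + a) u = ddcFlat f u := by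
  rw [ddcFlat_add hf contDiffAt_const, ddcFlat_const, add_zero]

/-- The weighted scalar curvature is invariant under local biholomorphisms. -/
theorem weightedScalFlat_pull {V' : Type*} [NormedAddCommGroup V'] [NormedSpace ℂ V']
    [FiniteDimensional ℂ V] [FiniteDimensional ℂ V'] {h : V → V'} {G : V → Bil V} {G' : V' → Bil V'}
    {f : V → ℝ} {f' : V' → ℝ} {p : ℝ}
    (hh : ContDiffAt ℂ ω h u) (e : V ≃L[ℂ] V') (he : (e : V →L[ℂ] V') = fderiv ℂ h u)
    (hG' : ContDiffAt ℝ ∞ G' (h u)) (hdet : 0 < gdet (G' (h u))) (hf' : ContDiffAt ℝ 2 f' (h u))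
    (hG : G =ᶠ[𝓝 u] fun y => pull (G' (h y)) (fderiv ℂ h y)) (hf : f =ᶠ[𝓝 u] fun y => f' (h y)) :
    weightedScalFlat f p G u = weightedScalFlat f' p G' (h u) := by
  have e3 : fderiv ℝ (fun y => f' (h y)) u =
      (fderiv ℝ f' (h u)).comp ((fderiv ℂ h u).restrictScalars ℝ) := by
    rw [← fderiv_real_eq (ContDiffAt.differentiableAt_hol hh)]
    exact fderiv_comp (𝕜 := ℝ) (g := f') u (hf'.differentiableAt (by norm_num))
      ((ContDiffAt.differentiableAt_hol hh).restrictScalars ℝ)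
  rw [weightedScalFlat, weightedScalFlat, scalFlat_pull hh e he hG' hdet hG, ddcFlat_congr hf,
    ddcFlat_comp_hol hf' hh, hf.fderiv_eq, e3, ← pull_sq, hG.self_of_nhds, hf.self_of_nhds]
  beta_reduce
  rw [← he, traceWrt_pull, traceWrt_pull]

theorem weightedScalFlat_modelMetric {G₀ K : N → Bil N} {ε χ : N → ℝ} {P σ zf : ℝ → ℝ} {x : N × ℂ}
    (h : IsCalabiBase G₀ K ε P σ x.1) (hz : IsProfileFlow Θ zf)
    (hχ : ContDiffAt ℝ ∞ χ x.1) (hK : K x.1 = ddcFlat χ x.1) {a p : ℝ} :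
    weightedScalFlat (fun x => zf (modelTau χ x) + a) p (modelMetric G₀ K χ Θ zf) x =
      (zf (modelTau χ x) + a) ^ 2 * (σ (zf (modelTau χ x))
        - deriv (deriv fun t => Θ t * P t) (zf (modelTau χ x)) / P (zf (modelTau χ x)))
        + 2 * (p - 1) * (zf (modelTau χ x) + a)
          * (deriv (fun t => Θ t * P t) (zf (modelTau χ x)) / P (zf (modelTau χ x)))
        - p * (p - 1) * Θ (zf (modelTau χ x)) := by
  have hτ : ContDiffAt ℝ 2 (modelTau χ) x := (modelTau_smooth hχ).of_le (by norm_cast)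
  have hzτ : ContDiffAt ℝ 2 (fun x => zf (modelTau χ x)) x :=
    (hz.smooth.contDiffAt.of_le (by norm_cast)).comp _ hτ
  rw [weightedScalFlat, ddcFlat_add_const hzτ, fderiv_add_const, scalFlat_modelMetric h hz hχ hK,
    laplacian_modelMetric h hz hχ hK, traceWrt_modelMetric_sq h hz hχ]
  ring

namespace IsLocalModel

/-- Smoothness is read off from the expression by a potential: the curvature form `K` is known only
through its values, whereas `Q` and the weights are smooth. -/
theorem contDiffAt_modelMetric (h : IsLocalModel k ϖ U O Q K ψ₀ ψ₁ Θ Z pot P₀ σ₀)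
    {v₀ : F₀} {v₁ : F₁} (hv₀ : v₀ ≠ 0) (hv₁ : v₁ ≠ 0) {x : (N × ((ℂ ∙ v₀)ᗮ × (ℂ ∙ v₁)ᗮ)) × ℂ}
    (hx : ofModel v₀ v₁ x ∈ O) :
    ContDiffAt ℝ ∞ (modelMetric (modelBase Q v₀ v₁) (modelForm K v₀ v₁) (modelChi ψ₀ ψ₁ v₀ v₁) Θ
      (fun t => Z (Real.tanh t))) x := by
  have ho : ContDiff ℂ ω (ofModel (N := N) v₀ v₁) := contDiff_ofModel
  have hev : ∀ᶠ y in 𝓝 x, ofModel v₀ v₁ y ∈ O :=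
    ho.continuous.continuousAt.eventually (h.localSection.isOpen_total.mem_nhds hx)
  have hB := h.bundle _ hx
  have hP : ContDiffAt ℝ ∞ (fun y => admPot ψ₀ ψ₁ pot (ofModel v₀ v₁ y)) x :=
    (contDiffAt_admPot hB.smooth₀ hB.smooth₁ (h.localSection.ne_zero _ hx)
      h.profile.smooth_potential).comp x (ContDiffAt.real_of_hol ho.contDiffAt)
  have hf : ContDiffAt ℝ ∞ (fun x : (N × ((ℂ ∙ v₀)ᗮ × (ℂ ∙ v₁)ᗮ)) × ℂ => x.1.1) x := by fun_prop
  have hQ : ContDiffAt ℝ ∞ (fun x : (N × ((ℂ ∙ v₀)ᗮ × (ℂ ∙ v₁)ᗮ)) × ℂ => Q x.1.1) x :=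
    hB.smooth_base.comp x hf
  refine ContDiffAt.congr_of_eventuallyEq ((contDiffAt_pull hQ (contDiffAt_const
    (c := (ContinuousLinearMap.fst ℂ N ((ℂ ∙ v₀)ᗮ × (ℂ ∙ v₁)ᗮ)).comp
      (ContinuousLinearMap.fst ℂ (N × ((ℂ ∙ v₀)ᗮ × (ℂ ∙ v₁)ᗮ)) ℂ)))).add
    (contDiffAt_ddcFlat hP)) ?_
  filter_upwards [hev] with y hy
  exact ddcFlat_admPot_ofModel hv₀ hv₁ h.profile (h.bundle _ hy)

/-- Where both components are nonzero, the weighted scalar curvature is given by the profile. -/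
theorem weightedScalFlat_eq [FiniteDimensional ℂ V]
    (h : IsLocalModel k ϖ U O Q K ψ₀ ψ₁ Θ Z pot P₀ σ₀) (hu : u ∈ U)
    {n : N} {v₀ : F₀} {v₁ : F₁} (hk : k u = (n, (v₀, v₁))) (h₀ : v₀ ≠ 0) (h₁ : v₁ ≠ 0) {P σ : ℝ → ℝ}
    (hP : P = fun z => P₀ z *
      ((1 + 1 * z) ^ (finrank ℂ F₀ - 1) * (1 + -1 * z) ^ (finrank ℂ F₁ - 1)))
    (hσ : σ = fun z => σ₀ z + (2 * (finrank ℂ F₀ - 1 : ℕ) * ((finrank ℂ F₀ - 1 : ℕ) + 1) / (1 + 1 * z)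
        + 2 * (finrank ℂ F₁ - 1 : ℕ) * ((finrank ℂ F₁ - 1 : ℕ) + 1) / (1 + -1 * z)))
    {a p α β : ℝ} (hE : ∀ t ∈ Ioo (-1 : ℝ) 1,
      (t + a) ^ 2 * (σ t - deriv (deriv fun t => Θ t * P t) t / P t)
        + 2 * (p - 1) * (t + a) * (deriv (fun t => Θ t * P t) t / P t) - p * (p - 1) * Θ t
      = α * t + β) :
    weightedScalFlat (fun y => Z (canonMoment ψ₀ ψ₁ (k y)) + a) p (secMetric Q (admPot ψ₀ ψ₁ pot) k) u
      = α * Z (canonMoment ψ₀ ψ₁ (k u)) + β := by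
  subst hP hσ
  have hO := h.localSection.mapsTo u hu
  obtain ⟨e, he⟩ := h.localSection.exists_model_equiv hu hk h₀ h₁
  obtain ⟨ε, hε⟩ := h.isCalabiBase_model hO h₀ h₁
  have hb : toModel v₀ v₁ (k u) = (((k u).1, 0), 0) := by rw [hk]; exact toModel_base h₀ h₁ _
  have hof : ofModel v₀ v₁ (toModel v₀ v₁ (k u)) = k u := by
    rw [hb, hk]; simp [ofModel]
  rw [show ((k u).1, ((0 : (ℂ ∙ v₀)ᗮ), (0 : (ℂ ∙ v₁)ᗮ))) = (toModel v₀ v₁ (k u)).1 by rw [hb]; rfl] at hε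
  have hG := h.localSection.eventually_secMetric hu hk h₀ h₁ h.profile h.bundle
  have hf : (fun y => Z (canonMoment ψ₀ ψ₁ (k y))) =ᶠ[𝓝 u] fun y =>
      Z (Real.tanh (modelTau (modelChi ψ₀ ψ₁ v₀ v₁) (toModel v₀ v₁ (k y)))) :=
    (h.localSection.eventually_canonMoment hu hk h₀ h₁).mono fun y hy => congrArg Z hy
  have hh := h.localSection.toModel_section hu hk h₀ h₁
  have hm := h.contDiffAt_modelMetric h₀ h₁ (x := toModel v₀ v₁ (k u)) (by rw [hof]; exact hO)
  have hχ : ContDiffAt ℝ ∞ (modelChi ψ₀ ψ₁ v₀ v₁) (toModel v₀ v₁ (k u)).1 :=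
    contDiffAt_modelChi h₀ h₁ (h.bundle _ hO)
  have hK : modelForm K v₀ v₁ (toModel v₀ v₁ (k u)).1 =
      ddcFlat (modelChi ψ₀ ψ₁ v₀ v₁) (toModel v₀ v₁ (k u)).1 :=
    modelForm_eq h₀ h₁ (h.bundle _ hO)
  have hz := h.profile.isProfileFlow
  have hsymm : ∀ v w, modelMetric (modelBase Q v₀ v₁) (modelForm K v₀ v₁) (modelChi ψ₀ ψ₁ v₀ v₁) Θ
      (fun t => Z (Real.tanh t)) (toModel v₀ v₁ (k u)) v w = modelMetric (modelBase Q v₀ v₁)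
      (modelForm K v₀ v₁) (modelChi ψ₀ ψ₁ v₀ v₁) Θ (fun t => Z (Real.tanh t)) (toModel v₀ v₁ (k u)) w v := by
    intro v w
    have := h.isKahlerOn.symm u hu (e.symm v) (e.symm w)
    rw [hG.self_of_nhds, ← he] at this
    simpa using this
  have hdet := gdet_pos hsymm fun v hv => modelMetric_pos hε hz hχ hv
  have hτ : ContDiffAt ℝ 2 (modelTau (modelChi ψ₀ ψ₁ v₀ v₁)) (toModel v₀ v₁ (k u)) :=
    (modelTau_smooth hχ).of_le (by norm_cast)
  have hzτ : ContDiffAt ℝ 2 (fun x => Z (Real.tanh (modelTau (modelChi ψ₀ ψ₁ v₀ v₁) x)) + a)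
      (toModel v₀ v₁ (k u)) :=
    ((hz.smooth.contDiffAt.of_le (by norm_cast)).comp _ hτ).add contDiffAt_const
  rw [weightedScalFlat_pull hh e he hm hdet hzτ hG (hf.mono fun y hy => congrArg (· + a) hy),
    weightedScalFlat_modelMetric hε hz hχ hK,
    show Z (canonMoment ψ₀ ψ₁ (k u)) = _ from hf.self_of_nhds]
  exact hE _ (hz.mem (modelTau (modelChi ψ₀ ψ₁ v₀ v₁) (toModel v₀ v₁ (k u))))

/-- Both sides are continuous on the whole chart and agree on the dense set where the two components
are nonzero. -/
theorem weightedScalFlat_eq_affine [FiniteDimensional ℂ V] [Nontrivial F₀] [Nontrivial F₁]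
    (h : IsLocalModel k ϖ U O Q K ψ₀ ψ₁ Θ Z pot P₀ σ₀) (hu : u ∈ U) {P σ : ℝ → ℝ}
    (hP : P = fun z => P₀ z *
      ((1 + 1 * z) ^ (finrank ℂ F₀ - 1) * (1 + -1 * z) ^ (finrank ℂ F₁ - 1)))
    (hσ : σ = fun z => σ₀ z + (2 * (finrank ℂ F₀ - 1 : ℕ) * ((finrank ℂ F₀ - 1 : ℕ) + 1) / (1 + 1 * z)
        + 2 * (finrank ℂ F₁ - 1 : ℕ) * ((finrank ℂ F₁ - 1 : ℕ) + 1) / (1 + -1 * z)))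
    {a p α β : ℝ} (hE : ∀ t ∈ Ioo (-1 : ℝ) 1,
      (t + a) ^ 2 * (σ t - deriv (deriv fun t => Θ t * P t) t / P t)
        + 2 * (p - 1) * (t + a) * (deriv (fun t => Θ t * P t) t / P t) - p * (p - 1) * Θ t
      = α * t + β) :
    weightedScalFlat (fun y => Z (canonMoment ψ₀ ψ₁ (k y)) + a) p (secMetric Q (admPot ψ₀ ψ₁ pot) k) u
      = α * Z (canonMoment ψ₀ ψ₁ (k u)) + β := by
  have hc := h.localSection.mem_closure hu
  have c1 := continuousAt_weightedScalFlat (p := p) ((h.contDiffAt_moment hu).add contDiffAt_const)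
    (h.contDiffAt_metric hu) (gdet_pos (h.isKahlerOn.symm u hu) (h.isKahlerOn.pos u hu))
    (f := fun y => Z (canonMoment ψ₀ ψ₁ (k y)) + a)
  have c2 : ContinuousAt (fun u => α * Z (canonMoment ψ₀ ψ₁ (k u)) + β) u :=
    (continuousAt_const.mul (h.contDiffAt_moment hu).continuousAt).add continuousAt_const
  have : (𝓝[{y | y ∈ U ∧ (k y).2.1 ≠ 0 ∧ (k y).2.2 ≠ 0}] u).NeBot := mem_closure_iff_nhdsWithin_neBot.1 hc
  refine tendsto_nhds_unique (l := 𝓝[{y | y ∈ U ∧ (k y).2.1 ≠ 0 ∧ (k y).2.2 ≠ 0}] u) (c1.tendsto.mono_left nhdsWithin_le_nhds)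
    ((c2.tendsto.mono_left nhdsWithin_le_nhds).congr' ?_)
  filter_upwards [self_mem_nhdsWithin] with y hy
  exact (h.weightedScalFlat_eq hy.1 rfl hy.2.1 hy.2.2 hP hσ hE).symm

end IsLocalModel

end LocalModel

end WeightedExtremal
end


noncomputable section

namespace WeightedExtremal

open Module Filter Topology Set

set_option linter.unusedSectionVars false

/-! ### Hamiltonian fields and Lie derivatives of tensors. -/

section KillingField

variable {V V' : Type*} [NormedAddCommGroup V] [NormedSpace ℂ V] [FiniteDimensional ℂ V]
  [NormedAddCommGroup V'] [NormedSpace ℂ V'] {G : V → Bil V} {f : V → ℝ} {u : V}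

/-- The field `X` with `G(X, ·) = - df ∘ J`. -/
def killingField (G : V → Bil V) (f : V → ℝ) (u : V) : V := (G u).inverse (jmul (fderiv ℝ f u))

/-- A definite form is injective into the dual, hence an isomorphism by dimension. This gives
meaning to the `inverse` in `killingField`, which is `0` on non-invertible maps, and makes it
smooth. -/
theorem exists_equiv_of_pos {b : Bil V} (hp : ∀ v, v ≠ 0 → 0 < b v v) :
    ∃ e : V ≃L[ℝ] (V →L[ℝ] ℝ), (e : V →L[ℝ] (V →L[ℝ] ℝ)) = b := by
  have : FiniteDimensional ℝ V := FiniteDimensional.complexToReal V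
  have hinj : Function.Injective (b : V →ₗ[ℝ] (V →L[ℝ] ℝ)) := by
    rw [injective_iff_map_eq_zero]
    intro v hv
    by_contra h0
    have h1 : b v = 0 := hv
    have := hp v h0
    rw [h1] at this
    simp at this
  have hrank : finrank ℝ V = finrank ℝ (V →L[ℝ] ℝ) := by
    rw [← (LinearMap.toContinuousLinearMap (𝕜 := ℝ) (E := V) (F' := ℝ)).finrank_eq]
    exact (Subspace.dual_finrank_eq (K := ℝ) (V := V)).symm
  exact ⟨(LinearEquiv.ofInjectiveOfFinrankEq (b : V →ₗ[ℝ] (V →L[ℝ] ℝ)) hinj hrank).toContinuousLinearEquiv,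
    ContinuousLinearMap.ext fun v => rfl⟩

theorem killingField_apply (hp : ∀ v, v ≠ 0 → 0 < G u v v) :
    G u (killingField G f u) = jmul (fderiv ℝ f u) := by
  obtain ⟨e, he⟩ := exists_equiv_of_pos hp
  rw [killingField, ← he, ContinuousLinearMap.inverse_equiv]
  exact e.apply_symm_apply _

theorem killingField_congr {G' : V → Bil V} {f' : V → ℝ} (hG : G =ᶠ[𝓝 u] G') (hf : f =ᶠ[𝓝 u] f') :
    killingField G f =ᶠ[𝓝 u] killingField G' f' := by
  filter_upwards [hG.eventually_nhds, hf.eventually_nhds] with y h1 h2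
  rw [killingField, killingField, h1.self_of_nhds, Filter.EventuallyEq.fderiv_eq h2]

theorem contDiffAt_killingField (hp : ∀ v, v ≠ 0 → 0 < G u v v) (hG : ContDiffAt ℝ ∞ G u)
    (hf : ContDiffAt ℝ ∞ f u) : ContDiffAt ℝ ∞ (killingField G f) u := by
  obtain ⟨e, he⟩ := exists_equiv_of_pos hp
  have : FiniteDimensional ℝ V := FiniteDimensional.complexToReal V
  have : CompleteSpace V := FiniteDimensional.complete ℝ V
  have h1 : ContDiffAt ℝ ∞ (fun y => (G y).inverse) u := by
    have h2 : ContDiffAt ℝ ∞ (ContinuousLinearMap.inverse : Bil V → _) (G u) := by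
      rw [← he]; exact contDiffAt_map_inverse e
    exact h2.comp u hG
  have h3 : ContDiffAt ℝ ∞ (fun y => jmul (fderiv ℝ f y)) u :=
    ((hf.fderiv_right (m := ∞) (by simp)).clm_comp contDiffAt_const).neg
  exact h1.clm_apply h3

/-- The Lie derivative of a tensor along a vector field. -/
def lieBil (X : V → V) (G : V → Bil V) (u : V) (v w : V) : ℝ :=
  fderiv ℝ G u (X u) v w + G u (fderiv ℝ X u v) w + G u v (fderiv ℝ X u w)

theorem continuousAt_lieBil {X : V → V} (hX : ContDiffAt ℝ ∞ X u) (hG : ContDiffAt ℝ ∞ G u)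
    (v w : V) : ContinuousAt (fun y => lieBil X G y v w) u := by
  have h1 := (hG.fderiv_right (m := ∞) (by simp)).continuousAt
  have h2 := (hX.fderiv_right (m := ∞) (by simp)).continuousAt
  have h3 := hX.continuousAt
  have h4 := hG.continuousAt
  exact ((((h1.clm_apply h3).clm_apply continuousAt_const).clm_apply continuousAt_const).add
    ((h4.clm_apply (h2.clm_apply continuousAt_const)).clm_apply continuousAt_const)).add
    ((h4.clm_apply continuousAt_const).clm_apply (h2.clm_apply continuousAt_const))

theorem lieBil_congr {X X' : V → V} {G' : V → Bil V} (hX : X =ᶠ[𝓝 u] X') (hG : G =ᶠ[𝓝 u] G')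
    (v w : V) : lieBil X G u v w = lieBil X' G' u v w := by
  rw [lieBil, lieBil, hX.fderiv_eq, hG.fderiv_eq, hX.self_of_nhds, hG.self_of_nhds]

/-- A field which is related by a local biholomorphism to a constant field preserving a metric
preserves the pulled back metric. -/
theorem lieBil_eq_zero {X : V → V} {h : V → V'} {G' : V' → Bil V'} {ξ : V'}
    (hh : ContDiffAt ℂ ω h u) (hG' : DifferentiableAt ℝ G' (h u))
    (hG : G =ᶠ[𝓝 u] fun y => pull (G' (h y)) (fderiv ℂ h y)) (hX : DifferentiableAt ℝ X u)
    (hξ : ∀ᶠ y in 𝓝 u, fderiv ℂ h y (X y) = ξ) (hinv : fderiv ℝ G' (h u) ξ = 0) (v w : V) :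
    lieBil X G u v w = 0 := by
  have hd := ContDiffAt.differentiableAt_hol (ContDiffAt.fderiv_hol hh)
  have hd' : HasFDerivAt (fun y => (fderiv ℂ h y).restrictScalars ℝ)
      ((ContinuousLinearMap.restrictScalarsL ℂ V V' ℝ ℝ).comp
        ((fderiv ℂ (fderiv ℂ h) u).restrictScalars ℝ)) u :=
    (ContinuousLinearMap.restrictScalarsL ℂ V V' ℝ ℝ).hasFDerivAt.comp u
      (hd.hasFDerivAt.restrictScalars ℝ)
  -- This is the derivative of the identity `Dh(X) = ξ`. It turns the derivatives of `X` in the Lie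
  -- derivative into second derivatives of `h`, which cancel those from the pull-back.
  have e1 : ∀ v, fderiv ℂ (fderiv ℂ h) u v (X u) + fderiv ℂ h u (fderiv ℝ X u v) = 0 := by
    intro v
    have h1 : HasFDerivAt (fun y => fderiv ℂ h y (X y)) _ u := hd'.clm_apply hX.hasFDerivAt
    have h2 := h1.unique ((hasFDerivAt_const ξ u).congr_of_eventuallyEq hξ)
    have h3 := DFunLike.congr_fun h2 v
    simpa [add_comm] using h3
  have hsymm : ∀ v w, fderiv ℂ (fderiv ℂ h) u v w = fderiv ℂ (fderiv ℂ h) u w v := fun v w =>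
    (hh.isSymmSndFDerivAt (by simp)).eq v w
  rw [lieBil, hG.fderiv_eq, fderiv_pull_comp hG' hh, hG.self_of_nhds]
  simp only [pull_apply]
  rw [hξ.self_of_nhds, hinv, hsymm (X u) v, hsymm (X u) w, eq_neg_of_add_eq_zero_right (e1 v),
    eq_neg_of_add_eq_zero_right (e1 w)]
  simp

end KillingField

/-! ### The Killing field of the Calabi model. -/

section ModelKilling

variable {N : Type*} [NormedAddCommGroup N] [NormedSpace ℂ N] [FiniteDimensional ℂ N]
  {G₀ K : N → Bil N} {χ : N → ℝ} {Θ zf : ℝ → ℝ} {p : N × ℂ}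

/-- The Calabi model is invariant under imaginary translations. -/
theorem modelMetric_translate (t : ℝ) :
    modelMetric G₀ K χ Θ zf (p + t • ((0 : N), -Complex.I)) = modelMetric G₀ K χ Θ zf p := by
  have e1 : ∀ p : N × ℂ, modelTau χ (p + t • ((0 : N), -Complex.I)) = modelTau χ p := fun p => by
    simp [modelTau]
  have e2 : fderiv ℝ (modelTau χ) (p + t • ((0 : N), -Complex.I)) = fderiv ℝ (modelTau χ) p := by
    rw [← fderiv_comp_add_right]
    congr 1
    exact funext e1
  rw [modelMetric, modelMetric, e1, e2]
  simp

theorem fderiv_modelMetric_translate (h : DifferentiableAt ℝ (modelMetric G₀ K χ Θ zf) p) :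
    fderiv ℝ (modelMetric G₀ K χ Θ zf) p ((0 : N), -Complex.I) = 0 := by
  have h1 : HasDerivAt (fun t : ℝ => p + t • ((0 : N), -Complex.I)) ((0 : N), -Complex.I) 0 := by
    simpa using ((hasDerivAt_id (0 : ℝ)).smul_const ((0 : N), -Complex.I)).const_add p
  have h2 : HasFDerivAt (modelMetric G₀ K χ Θ zf) (fderiv ℝ (modelMetric G₀ K χ Θ zf) p)
      (p + (0 : ℝ) • ((0 : N), -Complex.I)) := by
    rw [zero_smul, add_zero]; exact h.hasFDerivAt
  have h3 := h2.comp_hasDerivAt (0 : ℝ) h1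
  refine h3.unique ((hasDerivAt_const (0 : ℝ) (modelMetric G₀ K χ Θ zf p)).congr_of_eventuallyEq ?_)
  exact Eventually.of_forall fun t => modelMetric_translate t

/-- On the vector `(0, -i)` the form `dτ` vanishes and `J dτ` equals `1`, so the metric returns `Θ J
dτ`, which is `J dz`. -/
theorem modelMetric_killing (hz : IsProfileFlow Θ zf) (hχ : DifferentiableAt ℝ χ p.1) :
    modelMetric G₀ K χ Θ zf p ((0 : N), -Complex.I) =
      jmul (fderiv ℝ (fun p => zf (modelTau χ p)) p) := by
  have hτ : DifferentiableAt ℝ (modelTau χ) p :=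
    (hχ.comp p differentiableAt_fst).sub (Complex.reCLM.differentiableAt.comp p differentiableAt_snd)
  have e : fderiv ℝ (fun p => zf (modelTau χ p)) p = Θ (zf (modelTau χ p)) • fderiv ℝ (modelTau χ) p :=
    ((hz.hasDeriv _).comp_hasFDerivAt p hτ.hasFDerivAt).fderiv
  refine ContinuousLinearMap.ext fun w => ?_
  rw [e, jmul_apply]
  simp only [modelMetric, _root_.add_apply, _root_.smul_apply, pull_apply, sq_apply,
    fderiv_modelTau hχ, jmul_fderiv_modelTau hχ, shear_apply, smul_eq_mul]
  simp [holPart_apply]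
  ring

end ModelKilling

/-! ### The momentum of a local model is a Killing potential. -/

section LocalModel

variable {N F₀ F₁ V : Type*} [NormedAddCommGroup N] [NormedSpace ℂ N] [FiniteDimensional ℂ N]
  [NormedAddCommGroup F₀] [InnerProductSpace ℂ F₀] [FiniteDimensional ℂ F₀]
  [NormedAddCommGroup F₁] [InnerProductSpace ℂ F₁] [FiniteDimensional ℂ F₁]
  [NormedAddCommGroup V] [NormedSpace ℂ V] [FiniteDimensional ℂ V]
  {Q K : N → Bil N} {ψ₀ ψ₁ : N → ℝ} {pot Θ Z P₀ σ₀ : ℝ → ℝ}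
  {k : V → N × (F₀ × F₁)} {ϖ : N × (F₀ × F₁) → V} {U : Set V} {O : Set (N × (F₀ × F₁))} {u : V}

namespace IsLocalModel

/-- In model coordinates the field of the momentum is the constant field `-i` in the logarithmic
coordinate, that is, the infinitesimal rotation of one component, and the ansatz does not depend on
the imaginary part of that coordinate. -/
theorem lieBil_killingField_of_ne_zero (h : IsLocalModel k ϖ U O Q K ψ₀ ψ₁ Θ Z pot P₀ σ₀)
    (hu : u ∈ U) {n : N} {v₀ : F₀} {v₁ : F₁} (hk : k u = (n, (v₀, v₁))) (h₀ : v₀ ≠ 0) (h₁ : v₁ ≠ 0)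
    (v w : V) : lieBil (killingField (secMetric Q (admPot ψ₀ ψ₁ pot) k)
      fun y => Z (canonMoment ψ₀ ψ₁ (k y))) (secMetric Q (admPot ψ₀ ψ₁ pot) k) u v w = 0 := by
  have hO := h.localSection.mapsTo u hu
  have hb : toModel v₀ v₁ (k u) = (((k u).1, 0), 0) := by rw [hk]; exact toModel_base h₀ h₁ _
  have hof : ofModel v₀ v₁ (toModel v₀ v₁ (k u)) = k u := by
    rw [hb, hk]; simp [ofModel]
  have hG := h.localSection.eventually_secMetric hu hk h₀ h₁ h.profile h.bundle
  have hf : (fun y => Z (canonMoment ψ₀ ψ₁ (k y))) =ᶠ[𝓝 u] fun y =>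
      Z (Real.tanh (modelTau (modelChi ψ₀ ψ₁ v₀ v₁) (toModel v₀ v₁ (k y)))) :=
    (h.localSection.eventually_canonMoment hu hk h₀ h₁).mono fun y hy => congrArg Z hy
  have hh := h.localSection.toModel_section hu hk h₀ h₁
  have hm := h.contDiffAt_modelMetric h₀ h₁ (x := toModel v₀ v₁ (k u)) (by rw [hof]; exact hO)
  have hm' := hm.differentiableAt (by simp)
  have hz := h.profile.isProfileFlow
  obtain ⟨e, he⟩ := h.localSection.exists_model_equiv hu hk h₀ h₁
  have hX : DifferentiableAt ℝ (killingField (secMetric Q (admPot ψ₀ ψ₁ pot) k)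
      fun y => Z (canonMoment ψ₀ ψ₁ (k y))) u :=
    (contDiffAt_killingField (h.isKahlerOn.pos u hu) (h.contDiffAt_metric hu)
      (h.contDiffAt_moment hu)).differentiableAt (by simp)
  refine lieBil_eq_zero (ξ := ((0 : N × ((ℂ ∙ v₀)ᗮ × (ℂ ∙ v₁)ᗮ)), -Complex.I)) hh hm' hG hX ?_
    (fderiv_modelMetric_translate hm') v w
  obtain ⟨hi1, hi2, hi3⟩ := h.localSection.model_inverse hu hk h₀ h₁
  -- The constant field must be lifted at all nearby points and not only at `u`, since the Lie
  -- derivative involves first derivatives of the field.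
  have hinv : ∀ᶠ y in 𝓝 u, ∀ x, ∃ v, fderiv ℂ (fun y => toModel v₀ v₁ (k y)) y v = x := by
    have h1 : ∀ᶠ y in 𝓝 u, ∀ᶠ x in 𝓝 (toModel v₀ v₁ (k y)),
        toModel v₀ v₁ (k (ϖ (ofModel v₀ v₁ x))) = x := hh.continuousAt.eventually hi2.eventually_nhds
    have h2 : ∀ᶠ y in 𝓝 u, ContDiffAt ℂ ω (fun x => ϖ (ofModel v₀ v₁ x)) (toModel v₀ v₁ (k y)) :=
      hh.continuousAt.eventually (ContDiffAt.eventually_hol hi3)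
    filter_upwards [h1, h2, hi1, ContDiffAt.eventually_hol hh] with y h1 h2 h3 h4 x
    have d1 : HasFDerivAt (fun y => toModel v₀ v₁ (k y)) (fderiv ℂ (fun y => toModel v₀ v₁ (k y)) y)
        (ϖ (ofModel v₀ v₁ (toModel v₀ v₁ (k y)))) := by
      rw [h3]; exact (ContDiffAt.differentiableAt_hol h4).hasFDerivAt
    have c2 : HasFDerivAt (fun x => toModel v₀ v₁ (k (ϖ (ofModel v₀ v₁ x)))) _
      (toModel v₀ v₁ (k y)) := HasFDerivAt.comp (g := fun y => toModel v₀ v₁ (k y))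
        (toModel v₀ v₁ (k y)) d1 (ContDiffAt.differentiableAt_hol h2).hasFDerivAt
    have e2 := (c2.congr_of_eventuallyEq (f₁ := id) (h1.mono fun y hy => hy.symm)).unique
      (hasFDerivAt_id _)
    exact ⟨_, DFunLike.congr_fun e2 x⟩
  have hO' : ∀ᶠ y in 𝓝 u, k y ∈ O := (h.localSection.smooth_section u hu).continuousAt.eventually
    (h.localSection.isOpen_total.mem_nhds hO)
  filter_upwards [hinv, hG, hf.eventually_nhds, hO', h.localSection.isOpen_base.mem_nhds hu,
    ContDiffAt.eventually_hol hh, hi1] with y y1 y2 y3 y4 y5 y6 y7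
  set X := killingField (secMetric Q (admPot ψ₀ ψ₁ pot) k) (fun y => Z (canonMoment ψ₀ ψ₁ (k y))) y
  have hX : secMetric Q (admPot ψ₀ ψ₁ pot) k y X = jmul (fderiv ℝ (fun y => Z (canonMoment ψ₀ ψ₁ (k y))) y) :=
    killingField_apply (h.isKahlerOn.pos y y5)
  have hχ : ContDiffAt ℝ ∞ (modelChi ψ₀ ψ₁ v₀ v₁) (toModel v₀ v₁ (k y)).1 :=
    contDiffAt_modelChi h₀ h₁ (h.bundle _ y4)
  have hτ : ContDiffAt ℝ ∞ (modelTau (modelChi ψ₀ ψ₁ v₀ v₁)) (toModel v₀ v₁ (k y)) :=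
    modelTau_smooth hχ
  have hzτ : ContDiffAt ℝ ∞ (fun x => Z (Real.tanh (modelTau (modelChi ψ₀ ψ₁ v₀ v₁) x)))
      (toModel v₀ v₁ (k y)) := hz.smooth.contDiffAt.comp _ hτ
  have e3 : fderiv ℝ (fun y => Z (canonMoment ψ₀ ψ₁ (k y))) y =
      (fderiv ℝ (fun x => Z (Real.tanh (modelTau (modelChi ψ₀ ψ₁ v₀ v₁) x)))
        (toModel v₀ v₁ (k y))).comp
        ((fderiv ℂ (fun y => toModel v₀ v₁ (k y)) y).restrictScalars ℝ) := by
    rw [Filter.EventuallyEq.fderiv_eq y3, ← fderiv_real_eq (ContDiffAt.differentiableAt_hol y6)]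
    exact fderiv_comp (𝕜 := ℝ) (g := fun x => Z (Real.tanh (modelTau (modelChi ψ₀ ψ₁ v₀ v₁) x)))
      (f := fun y => toModel v₀ v₁ (k y)) y (hzτ.differentiableAt (by simp))
      ((ContDiffAt.differentiableAt_hol y6).restrictScalars ℝ)
  rw [e3, jmul_comp, ← modelMetric_killing (G₀ := modelBase Q v₀ v₁) (K := modelForm K v₀ v₁) hz
    (hχ.differentiableAt (by simp)), y2] at hX
  obtain ⟨X', hX'⟩ := y1 (((0 : N × ((ℂ ∙ v₀)ᗮ × (ℂ ∙ v₁)ᗮ)), -Complex.I))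
  -- The lift of the constant field satisfies the equation that defines the Killing field, and
  -- definiteness of the metric identifies the two.
  have hXX : secMetric Q (admPot ψ₀ ψ₁ pot) k y (X - X') = 0 := by
    rw [map_sub, sub_eq_zero, y2, hX]
    ext w
    rw [pull_apply, hX']
    rfl
  have : X - X' = 0 := by
    by_contra hne
    have := h.isKahlerOn.pos y y5 _ hne
    rw [hXX] at this
    simp at this
  rw [sub_eq_zero.1 this, hX']

/-- The momentum is a Killing potential. -/
theorem lieBil_killingField [Nontrivial F₀] [Nontrivial F₁]
    (h : IsLocalModel k ϖ U O Q K ψ₀ ψ₁ Θ Z pot P₀ σ₀)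
    (hu : u ∈ U) (v w : V) : lieBil (killingField (secMetric Q (admPot ψ₀ ψ₁ pot) k)
      fun y => Z (canonMoment ψ₀ ψ₁ (k y))) (secMetric Q (admPot ψ₀ ψ₁ pot) k) u v w = 0 := by
  have hc := h.localSection.mem_closure hu
  have hX := contDiffAt_killingField (h.isKahlerOn.pos u hu) (h.contDiffAt_metric hu)
      (h.contDiffAt_moment hu)
  have c1 := continuousAt_lieBil hX (h.contDiffAt_metric hu) v w
  have : (𝓝[{y | y ∈ U ∧ (k y).2.1 ≠ 0 ∧ (k y).2.2 ≠ 0}] u).NeBot :=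
    mem_closure_iff_nhdsWithin_neBot.1 hc
  refine tendsto_nhds_unique (l := 𝓝[{y | y ∈ U ∧ (k y).2.1 ≠ 0 ∧ (k y).2.2 ≠ 0}] u)
    (c1.tendsto.mono_left nhdsWithin_le_nhds) (tendsto_const_nhds.congr' ?_)
  filter_upwards [self_mem_nhdsWithin] with y hy
  exact (h.lieBil_killingField_of_ne_zero hy.1 rfl hy.2.1 hy.2.2 v w).symm

end IsLocalModel

end LocalModel

end WeightedExtremal
end


noncomputable section

namespace WeightedExtremal

open Module Filter Topology Set

set_option linter.unusedSectionVars false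

/-! ### Naturality of differentials and of `dd^c` on manifolds; sections of submersions. -/

section ManifoldCalculus

variable {V H X : Type*} [NormedAddCommGroup V] [NormedSpace ℂ V] [TopologicalSpace H]
  {I : ModelWithCorners ℂ V H} [I.Boundaryless] [TopologicalSpace X] [ChartedSpace H X]
  {L : Type*} [NormedAddCommGroup L] [NormedSpace ℂ L] {w : X}

theorem eventually_chart_symm {p : X → Prop} (h : ∀ᶠ y in 𝓝 w, p y) :
    ∀ᶠ u in 𝓝 (extChartAt I w w), p ((extChartAt I w).symm u) := by
  have hc := continuousAt_extChartAt_symm (I := I) w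
  rw [ContinuousAt, extChartAt_to_inv] at hc
  exact hc h

theorem ddc_congr {f f' : X → ℝ} (h : f =ᶠ[𝓝 w] f') : ddc I f w = ddc I f' w :=
  ddcFlat_congr (eventually_chart_symm h)

theorem dReal_congr {f f' : X → ℝ} (h : f =ᶠ[𝓝 w] f') : dReal I f w = dReal I f' w :=
  Filter.EventuallyEq.fderiv_eq (eventually_chart_symm h)

theorem contDiffAt_chart {Λ : X → L} {n : WithTop ℕ∞} (h : ContMDiffAt I 𝓘(ℂ, L) n Λ w) :
    ContDiffAt ℂ n (fun u => Λ ((extChartAt I w).symm u)) (extChartAt I w w) := by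
  have := (contMDiffAt_iff.1 h).2
  rw [I.range_eq_univ, contDiffWithinAt_univ] at this
  exact this

theorem mdiff_eq_fderiv {Λ : X → L} (h : ContMDiffAt I 𝓘(ℂ, L) ω Λ w) :
    mdiff I 𝓘(ℂ, L) Λ w = fderiv ℂ (fun u => Λ ((extChartAt I w).symm u)) (extChartAt I w w) := by
  rw [mdiff, (h.mdifferentiableAt (by simp)).mfderiv, I.range_eq_univ, fderivWithin_univ]
  rfl

/-- The tensor of `dd^c` is natural for holomorphic maps to a vector space. -/
theorem ddc_comp {Λ : X → L} {F : L → ℝ} (hF : ContDiffAt ℝ 2 F (Λ w))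
    (h : ContMDiffAt I 𝓘(ℂ, L) ω Λ w) :
    ddc I (fun y => F (Λ y)) w = pull (ddcFlat F (Λ w)) (mdiff I 𝓘(ℂ, L) Λ w) := by
  have e : Λ ((extChartAt I w).symm (extChartAt I w w)) = Λ w := by rw [extChartAt_to_inv]
  rw [mdiff_eq_fderiv h, ← e]
  exact ddcFlat_comp_hol (F := F) (h := fun u => Λ ((extChartAt I w).symm u)) (by rw [e]; exact hF)
    (contDiffAt_chart h)

theorem contDiffAt_chart_comp {Λ : X → L} {F : L → ℝ} {n : WithTop ℕ∞} (hF : ContDiffAt ℝ n F (Λ w))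
    (h : ContMDiffAt I 𝓘(ℂ, L) ω Λ w) :
    ContDiffAt ℝ n (fun u => F (Λ ((extChartAt I w).symm u))) (extChartAt I w w) := by
  have e : Λ ((extChartAt I w).symm (extChartAt I w w)) = Λ w := by rw [extChartAt_to_inv]
  refine ContDiffAt.comp (g := F) _ ?_ (ContDiffAt.real_of_hol (contDiffAt_chart h))
  rw [e]; exact hF

theorem mdiff_comp {X' H' V' : Type*} [NormedAddCommGroup V'] [NormedSpace ℂ V'] [TopologicalSpace H']
    {I' : ModelWithCorners ℂ V' H'} [TopologicalSpace X'] [ChartedSpace H' X'] {g : X' → L} {f : X → X'}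
    (hg : ContMDiffAt I' 𝓘(ℂ, L) ω g (f w)) (hf : ContMDiffAt I I' ω f w) :
    mdiff I 𝓘(ℂ, L) (fun y => g (f y)) w = (mdiff I' 𝓘(ℂ, L) g (f w)).comp (mdiff I I' f w) :=
  mfderiv_comp w (hg.mdifferentiableAt (by simp)) (hf.mdifferentiableAt (by simp))

theorem mdiff_congr {Λ Λ' : X → L} (h : Λ =ᶠ[𝓝 w] Λ') :
    mdiff I 𝓘(ℂ, L) Λ w = mdiff I 𝓘(ℂ, L) Λ' w := h.mfderiv_eq

theorem mdiff_eq_fderiv_flat {L' : Type*} [NormedAddCommGroup L'] [NormedSpace ℂ L'] (g : L → L')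
    (l : L) : mdiff 𝓘(ℂ, L) 𝓘(ℂ, L') g l = fderiv ℂ g l := mfderiv_eq_fderiv

/-- Submersions have local holomorphic sections. -/
theorem exists_section {M : Type*} [TopologicalSpace M] [ChartedSpace L M] [IsManifold 𝓘(ℂ, L) ω M]
    [IsManifold I ω X] {q : X → M} (h : Manifold.IsSubmersionAt I 𝓘(ℂ, L) ω q w) :
    ∃ s : M → X, s (q w) = w ∧ ContMDiffAt 𝓘(ℂ, L) I ω s (q w) ∧ ∀ᶠ m in 𝓝 (q w), q (s m) = m := by
  let φ := h.domChart.extend I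
  let φ' := h.codChart.extend 𝓘(ℂ, L)
  -- In adapted charts the submersion is the first projection of a product, and a section is
  -- obtained by freezing the second coordinate at its value at `w`.
  let c := (h.equiv (φ w)).2
  have hw : w ∈ φ.source := by
    simpa only [φ, OpenPartialHomeomorph.extend_source] using h.mem_domChart_source
  have hq : q w ∈ φ'.source := by
    simpa only [φ', OpenPartialHomeomorph.extend_source] using h.mem_codChart_source
  have hwt : φ w ∈ φ.target := φ.map_source hw
  have e1 : (h.equiv (φ w)).1 = φ' (q w) := by
    have := h.writtenInCharts hwt
    simp only [Function.comp_apply] at this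
    rw [← this]
    exact congrArg (fun x => φ' (q x)) (φ.left_inv hw)
  have e2 : h.equiv.symm (φ' (q w), c) = φ w := by
    rw [← e1]; exact h.equiv.symm_apply_apply _
  have hφ' : ContMDiffAt 𝓘(ℂ, L) 𝓘(ℂ, L) ω φ' (q w) :=
    (OpenPartialHomeomorph.contMDiffOn_extend h.codChart_mem_maximalAtlas).contMDiffAt
      (h.codChart.open_source.mem_nhds h.mem_codChart_source)
  have ht : IsOpen φ.target := h.domChart.isOpen_extend_target
  have hφ : ContMDiffAt 𝓘(ℂ, V) I ω φ.symm (φ w) := by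
    have := contMDiffOn_extend_symm (I := I) (n := ω) h.domChart_mem_maximalAtlas
    rw [← OpenPartialHomeomorph.extend_target'] at this
    exact this.contMDiffAt (ht.mem_nhds hwt)
  have hL : ContMDiffAt 𝓘(ℂ, L) 𝓘(ℂ, V) ω (fun x : L => h.equiv.symm (x, c)) (φ' (q w)) :=
    (h.equiv.symm.contDiff.comp (contDiff_id.prodMk contDiff_const)).contMDiff.contMDiffAt
  have hin : ContMDiffAt 𝓘(ℂ, L) 𝓘(ℂ, V) ω (fun m => h.equiv.symm (φ' m, c)) (q w) :=
    hL.comp (q w) hφ'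
  refine ⟨fun m => φ.symm (h.equiv.symm (φ' m, c)), ?_, ?_, ?_⟩
  · beta_reduce
    rw [e2, φ.left_inv hw]
  · refine ContMDiffAt.comp (g := φ.symm) (q w) ?_ hin
    rw [e2]; exact hφ
  · have hm : ∀ᶠ m in 𝓝 (q w), h.equiv.symm (φ' m, c) ∈ φ.target :=
      hin.continuousAt.eventually (ht.mem_nhds (by
        change h.equiv.symm (φ' (q w), c) ∈ φ.target
        rw [e2]; exact hwt))
    filter_upwards [hm, h.codChart.open_source.mem_nhds h.mem_codChart_source] with m hm hmc
    have e3 := h.writtenInCharts hm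
    simp only [Function.comp_apply, ContinuousLinearEquiv.apply_symm_apply] at e3
    have hms : φ.symm (h.equiv.symm (φ' m, c)) ∈ h.domChart.source := by
      have := φ.map_target hm
      simpa only [φ, OpenPartialHomeomorph.extend_source] using this
    have hms' := h.source_subset_preimage_source hms
    have hs : φ'.source = h.codChart.source := OpenPartialHomeomorph.extend_source _
    exact φ'.injOn (hs ▸ hms') (hs ▸ hmc) e3

end ManifoldCalculus

/-! ### Preferred charts: smoothness, Killing potentials and Kähler metrics. -/

section Charts

variable {V M : Type*} [NormedAddCommGroup V] [NormedSpace ℂ V] [TopologicalSpace M] [ChartedSpace V M]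

/-- A function is smooth if its expressions in the preferred charts are. -/
theorem smoothOn_of_chart {f : M → ℝ} (h : ∀ x, ContDiffAt ℝ ∞
    (f ∘ (extChartAt 𝓘(ℂ, V) x).symm) (extChartAt 𝓘(ℂ, V) x x)) : SmoothOn (V := V) f univ := by
  intro x _
  rw [contMDiffWithinAt_univ, contMDiffAt_iff]
  refine ⟨?_, (h x).contDiffWithinAt⟩
  have h1 : ContinuousAt (fun y => (f ∘ (extChartAt 𝓘(ℂ, V) x).symm) (extChartAt 𝓘(ℂ, V) x y)) x :=
    (h x).continuousAt.comp (continuousAt_extChartAt x)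
  refine h1.congr ?_
  filter_upwards [extChartAt_source_mem_nhds (I := 𝓘(ℂ, V)) x] with y hy
  simp only [Function.comp_apply]
  rw [(extChartAt 𝓘(ℂ, V) x).left_inv hy]

theorem contDiffAt_of_smoothOn {f : M → ℝ} {s : Set M} (hs : IsOpen s)
    (h : SmoothOn (V := V) f s) {x : M} (hx : x ∈ s) : ContDiffAt ℝ ∞
    (fun u => f ((extChartAt 𝓘(ℂ, V) x).symm u)) (extChartAt 𝓘(ℂ, V) x x) := by
  have h1 := (contMDiffAt_iff.1 (h.contMDiffAt (hs.mem_nhds hx))).2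
  rw [ModelWithCorners.range_eq_univ, contDiffWithinAt_univ] at h1
  exact h1

variable [IsManifold 𝓘(ℂ, V) ω M]

theorem tangentCoordChange_refl {x y : M} (h : y ∈ (extChartAt 𝓘(ℂ, V) x).source) :
    tangentCoordChange 𝓘(ℂ, V) x x y = ContinuousLinearMap.id ℂ V :=
  ContinuousLinearMap.ext fun _ => tangentCoordChange_self h

theorem inChart_self (g : M → Bil V) (x : M) : inChart g x (extChartAt 𝓘(ℂ, V) x x) = g x := by
  rw [inChart, extChartAt_to_inv, tangentCoordChange_refl (mem_extChartAt_source x), pull_id]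

theorem mdiff_extChartAt {x m : M} (hm : m ∈ (extChartAt 𝓘(ℂ, V) x).source) :
    mdiff 𝓘(ℂ, V) 𝓘(ℂ, V) (extChartAt 𝓘(ℂ, V) x) m = tangentCoordChange 𝓘(ℂ, V) m x m := by
  rw [mdiff_eq_fderiv ((contMDiffOn_extChartAt (n := ω)).contMDiffAt
    ((chartAt V x).open_source.mem_nhds (by simpa using hm)))]
  exact ((hasFDerivWithinAt_tangentCoordChange (I := 𝓘(ℂ, V)) ⟨mem_extChartAt_source m, hm⟩).hasFDerivAt
    (by simp)).fderiv

theorem weightedScal_eq [FiniteDimensional ℂ V] (f : M → ℝ) (p : ℝ) (g : M → Bil V) (x : M) :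
    weightedScal f p g x = weightedScalFlat (f ∘ (extChartAt 𝓘(ℂ, V) x).symm) p (inChart g x)
      (extChartAt 𝓘(ℂ, V) x x) := by
  rw [weightedScalFlat, inChart_self, Function.comp_apply, extChartAt_to_inv]
  rfl

/-- The associated field is multiplied by `α`, and the Killing equation is linear in it. This is why
an affine weighted scalar curvature is enough. -/
theorem isKillingPotential_affine {g : M → Bil V} {f : M → ℝ} (h : IsKillingPotential g f)
    (α β : ℝ) : IsKillingPotential g (fun m => α * f m + β) := by
  refine ⟨?_, fun x => ?_⟩
  · have h1 : ContMDiffOn 𝓘(ℝ, ℝ) 𝓘(ℝ, ℝ) ∞ (fun t : ℝ => α * t + β) univ :=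
      (contDiff_const.mul contDiff_id |>.add contDiff_const).contMDiff.contMDiffOn
    exact h1.comp h.1 fun _ _ => mem_univ _
  · obtain ⟨X, hX⟩ := h.2 x
    refine ⟨fun u => α • X u, fun u hu => ⟨fun v => ?_, fun v w => ?_⟩⟩
    · have e : ((fun m => α * f m + β) ∘ (extChartAt 𝓘(ℂ, V) x).symm) =
          fun u => α * (f ∘ (extChartAt 𝓘(ℂ, V) x).symm) u + β := rfl
      rw [e, fderiv_add_const, map_smul, _root_.smul_apply,
        (hX u hu).1 v]
      have e2 := congrFun (fderiv_const_smul_field (𝕜 := ℝ) (f := f ∘ (extChartAt 𝓘(ℂ, V) x).symm) α) u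
      rw [show (fun u => α * (f ∘ (extChartAt 𝓘(ℂ, V) x).symm) u) =
        α • (f ∘ (extChartAt 𝓘(ℂ, V) x).symm) from rfl, e2]
      simp
    · have := (hX u hu).2 v w
      have e2 := congrFun (fderiv_const_smul_field (𝕜 := ℝ) (f := X) α) u
      rw [show (fun u => α • X u) = α • X from rfl, e2]
      simp only [map_smul, _root_.smul_apply, smul_eq_mul, Pi.smul_apply]
      linear_combination α * this

theorem isKahlerOn_of_local {G : V → Bil V} {U : Set V}
    (h : ∀ u ∈ U, ∃ (G' : V → Bil V) (U' : Set V), IsOpen U' ∧ u ∈ U' ∧ IsKahlerOn G' U' ∧ G =ᶠ[𝓝 u] G') :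
    IsKahlerOn G U where
  smooth u hu := by
    obtain ⟨G', U', ho, hu', hk, he⟩ := h u hu
    exact ((hk.smooth.contDiffAt (ho.mem_nhds hu')).congr_of_eventuallyEq he).contDiffWithinAt
  symm u hu := by
    obtain ⟨G', U', ho, hu', hk, he⟩ := h u hu
    rw [he.self_of_nhds]; exact hk.symm u hu'
  invariant u hu := by
    obtain ⟨G', U', ho, hu', hk, he⟩ := h u hu
    rw [he.self_of_nhds]; exact hk.invariant u hu'
  pos u hu := by
    obtain ⟨G', U', ho, hu', hk, he⟩ := h u hu
    rw [he.self_of_nhds]; exact hk.pos u hu'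
  closed u hu := by
    obtain ⟨G', U', ho, hu', hk, he⟩ := h u hu
    rw [he.fderiv_eq]; exact hk.closed u hu'

end Charts

end WeightedExtremal
end


noncomputable section

namespace WeightedExtremal

open Module Filter Topology Set

set_option linter.unusedSectionVars false

/-! ### Base tensors of a local product. -/

section BaseTensors

variable {A : Type*} [Fintype A] {W : A → Type*} [∀ a, NormedAddCommGroup (W a)]
  [∀ a, NormedSpace ℂ (W a)]

/-- The tensor `∑ a, x_a⁻¹ g_a` of a local product. -/
def baseTensor (sign x : A → ℝ) (k : ∀ a, W a → Bil (W a)) (n : ∀ a, W a) : Bil (∀ a, W a) :=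
  piBil fun a => (sign a / x a) • k a (n a)

/-- The tensor `∑ a, g_a` of a local product. -/
def baseForm (sign : A → ℝ) (k : ∀ a, W a → Bil (W a)) (n : ∀ a, W a) : Bil (∀ a, W a) :=
  piBil fun a => sign a • k a (n a)

variable {sign x c : A → ℝ} {k : ∀ a, W a → Bil (W a)} {t : Set (∀ a, W a)} {n : ∀ a, W a}
  {ψ₀ ψ₁ : (∀ a, W a) → ℝ}

theorem isOpen_image_apply (ht : IsOpen t) (a : A) : IsOpen ((fun u : ∀ a, W a => u a) '' t) :=
  isOpenMap_eval a t ht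

theorem IsKahlerOn.contDiffAt {V : Type*} [NormedAddCommGroup V] [NormedSpace ℂ V]
    {G : V → Bil V} {U : Set V} (h : IsKahlerOn G U) (hU : IsOpen U) {u : V} (hu : u ∈ U) :
    ContDiffAt ℝ ∞ G u := h.smooth.contDiffAt (hU.mem_nhds hu)

variable [∀ a, FiniteDimensional ℂ (W a)]

theorem isBundleData_pi (hsign : ∀ a, sign a = 1 ∨ sign a = -1)
    (hx : ∀ a, |x a| < 1 ∧ 0 < sign a * x a) (ht : IsOpen t)
    (hk : ∀ a, IsKahlerOn (k a) ((fun u => u a) '' t)) (hn : n ∈ t) (h₀ : ContDiffAt ℝ ∞ ψ₀ n)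
    (h₁ : ContDiffAt ℝ ∞ ψ₁ n)
    (hc : baseForm sign k n = ddcFlat (fun n => 1 / 2 * (ψ₁ n - ψ₀ n)) n) :
    IsBundleData (baseTensor sign x k) (baseForm sign k) ψ₀ ψ₁ n := by
  have hmem : ∀ a, n a ∈ (fun u : ∀ a, W a => u a) '' t := fun a => mem_image_of_mem _ hn
  have hsm : ∀ a, ContDiffAt ℝ ∞ (k a) (n a) := fun a =>
    (hk a).contDiffAt (isOpen_image_apply ht a) (hmem a)
  have hsm' : ∀ a, ContDiffAt ℝ ∞ (fun u : ∀ a, W a => pull (k a (u a))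
      (fderiv ℂ (fun u : ∀ a, W a => u a) u)) n := fun a =>
    contDiffAt_pull ((hsm a).comp n (ContDiffAt.real_of_hol (contDiffAt_apply_hol a n)))
      (ContDiffAt.real_of_hol (ContDiffAt.fderiv_hol (contDiffAt_apply_hol a n)))
  have hQ : baseTensor sign x k = fun u => ∑ a, (sign a / x a) • pull (k a (u a))
      (fderiv ℂ (fun u : ∀ a, W a => u a) u) := by
    ext1 u
    simp only [baseTensor, piBil, pull_smul]
    exact Finset.sum_congr rfl fun a _ => by rw [fderiv_apply_hol]
  have coef : ∀ a, 0 < sign a / x a - sign a ∧ 0 < sign a / x a + sign a := fun a => by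
    obtain ⟨h1, h2⟩ := hx a
    rw [abs_lt] at h1
    rcases hsign a with h | h <;> rw [h] at h2 ⊢
    · have h3 : 0 < x a := by linarith
      have : 1 < 1 / x a := by rw [lt_div_iff₀ h3]; linarith
      constructor <;> linarith
    · have h3 : 0 < -x a := by linarith
      have : 1 < -1 / x a := by rw [← neg_div_neg_eq, neg_neg, lt_div_iff₀ h3]; linarith
      constructor <;> linarith
  have hpos : ∀ v : ∀ a, W a, v ≠ 0 → ∀ C : A → ℝ, (∀ a, 0 < C a) →
      0 < ∑ a, C a * k a (n a) (v a) (v a) := fun v hv C hC => by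
    obtain ⟨b, hb⟩ := Function.ne_iff.1 hv
    refine Finset.sum_pos' (fun a _ => ?_) ⟨b, Finset.mem_univ _,
      mul_pos (hC b) ((hk b).pos _ (hmem b) _ hb)⟩
    rcases eq_or_ne (v a) 0 with h | h
    · simp [h]
    · exact (mul_pos (hC a) ((hk a).pos _ (hmem a) _ h)).le
  refine ⟨h₀, h₁, ?_, fun v w => ?_, fun v w => ?_, ?_, hc, fun v hv => ?_, fun v hv => ?_⟩
  · rw [hQ]
    exact ContDiffAt.sum fun a _ => (hsm' a).const_smul (sign a / x a)
  · simp only [baseTensor, piBil_apply, _root_.smul_apply]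
    exact Finset.sum_congr rfl fun a _ => by rw [(hk a).symm _ (hmem a)]
  · simp only [baseTensor, piBil_apply, _root_.smul_apply, Pi.smul_apply]
    exact Finset.sum_congr rfl fun a _ => by rw [(hk a).invariant _ (hmem a)]
  · rw [hQ]
    refine ClosedAt.sum (fun a _ => ClosedAt.const_smul ?_ ((hsm' a).differentiableAt (by simp)) _)
      fun a _ => ((hsm' a).const_smul (sign a / x a)).differentiableAt (by simp)
    exact ClosedAt.pull_comp ((hk a).closed _ (hmem a)) ((hsm a).differentiableAt (by simp))
      ((hk a).symm _ (hmem a)) ((hk a).invariant _ (hmem a)) (contDiffAt_apply_hol a n)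
  · have := hpos v hv _ fun a => (coef a).1
    simp only [sub_mul, Finset.sum_sub_distrib] at this
    simpa [baseTensor, baseForm, piBil_apply] using this
  · have := hpos v hv _ fun a => (coef a).2
    simp only [add_mul, Finset.sum_add_distrib] at this
    simpa [baseTensor, baseForm, piBil_apply] using this

theorem exists_isCalabiBase_pi (hsign : ∀ a, sign a = 1 ∨ sign a = -1)
    (hx : ∀ a, |x a| < 1 ∧ 0 < sign a * x a) (ht : IsOpen t)
    (hk : ∀ a, IsKahlerOn (k a) ((fun u => u a) '' t))
    (hc : ∀ a, ∀ u ∈ (fun u : ∀ a, W a => u a) '' t, scalFlat (k a) u = c a) (hn : n ∈ t) :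
    ∃ ε, IsCalabiBase (baseTensor sign x k) (baseForm sign k) ε
      (fun z => ∏ a, (1 + x a * z) ^ finrank ℂ (W a))
      (fun z => ∑ a, |x a| * c a / (1 + x a * z)) n := by
  have hmem : ∀ a, n a ∈ (fun u : ∀ a, W a => u a) '' t := fun a => mem_image_of_mem _ hn
  obtain ⟨C, hC⟩ := isCalabiBase_pi (u₀ := n) fun a =>
    isCalabiBase_factor (hsign a) (hx a).1.le (hx a).2
      ((hk a).contDiffAt (isOpen_image_apply ht a) (hmem a))
      (Filter.mem_of_superset ((isOpen_image_apply ht a).mem_nhds (hmem a)) (hk a).symm)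
      (Filter.mem_of_superset ((isOpen_image_apply ht a).mem_nhds (hmem a)) (hk a).pos)
      (hc a _ (hmem a))
  exact ⟨_, hC⟩

end BaseTensors

end WeightedExtremal
end


noncomputable section

namespace WeightedExtremal

open Module Filter Topology Set

set_option linter.unusedSectionVars false

/-! ### Holomorphic maps into and out of the Whitney sum. -/

section WhitneySum

variable {A : Type*} [Fintype A] {W : A → Type*} [∀ a, NormedAddCommGroup (W a)]
  [∀ a, NormedSpace ℂ (W a)] [∀ a, FiniteDimensional ℂ (W a)]
  {B : Type*} [NormedAddCommGroup B] [NormedSpace ℂ B]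
  {S : Type*} [TopologicalSpace S] [ChartedSpace B S]
  {F₀ : Type*} [NormedAddCommGroup F₀] [InnerProductSpace ℂ F₀]
  {E₀ : S → Type*} [TopologicalSpace (TotalSpace F₀ E₀)] [∀ x, TopologicalSpace (E₀ x)]
  [∀ x, AddCommGroup (E₀ x)] [∀ x, Module ℂ (E₀ x)] [FiberBundle F₀ E₀]
  {F₁ : Type*} [NormedAddCommGroup F₁] [InnerProductSpace ℂ F₁]
  {E₁ : S → Type*} [TopologicalSpace (TotalSpace F₁ E₁)] [∀ x, TopologicalSpace (E₁ x)]
  [∀ x, AddCommGroup (E₁ x)] [∀ x, Module ℂ (E₁ x)] [FiberBundle F₁ E₁]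
  {V H X : Type*} [NormedAddCommGroup V] [NormedSpace ℂ V] [TopologicalSpace H]
  {I : ModelWithCorners ℂ V H} [TopologicalSpace X] [ChartedSpace H X]
  {N : Type*} [NormedAddCommGroup N] [NormedSpace ℂ N]

/-- Maps to a Whitney sum are holomorphic if and only if their components are. -/
theorem contMDiffAt_whitneySum_iff {f : X → TotalSpace (F₀ × F₁) (E₀ ×ᵇ E₁)} {x : X} :
    ContMDiffAt I (𝓘(ℂ, B).prod 𝓘(ℂ, F₀ × F₁)) ω f x ↔
      ContMDiffAt I (𝓘(ℂ, B).prod 𝓘(ℂ, F₀)) ω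
        (fun y => (⟨(f y).proj, (f y).2.1⟩ : TotalSpace F₀ E₀)) x ∧
      ContMDiffAt I (𝓘(ℂ, B).prod 𝓘(ℂ, F₁)) ω
        (fun y => (⟨(f y).proj, (f y).2.2⟩ : TotalSpace F₁ E₁)) x := by
  rw [contMDiffAt_totalSpace, contMDiffAt_totalSpace, contMDiffAt_totalSpace]
  have e : (fun y => (trivializationAt (F₀ × F₁) (E₀ ×ᵇ E₁) (f x).proj (f y)).2) = fun y =>
      ((trivializationAt F₀ E₀ (f x).proj ⟨(f y).proj, (f y).2.1⟩).2,
        (trivializationAt F₁ E₁ (f x).proj ⟨(f y).proj, (f y).2.2⟩).2) := rfl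
  rw [e, contMDiffAt_prod_module_iff]
  tauto

/-- Smooth functions composed with holomorphic maps from a vector space are smooth. -/
theorem contDiffAt_smoothOn_comp {f : S → ℝ} {s : Set S} (hs : IsOpen s) (hf : SmoothOn (V := B) f s)
    {g : N → S} {l : N} (hg : ContMDiffAt 𝓘(ℂ, N) 𝓘(ℂ, B) ω g l) (hl : g l ∈ s) :
    ContDiffAt ℝ ∞ (fun y => f (g y)) l := by
  have h1 := contDiffAt_of_smoothOn hs hf hl
  have h2 := (contMDiffAt_iff.1 hg).2
  rw [ModelWithCorners.range_eq_univ, contDiffWithinAt_univ] at h2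
  have h3 := ContDiffAt.comp (g := fun u => f ((extChartAt 𝓘(ℂ, B) (g l)).symm u))
    (f := fun y => extChartAt 𝓘(ℂ, B) (g l) (g y)) l h1 (ContDiffAt.real_of_hol h2)
  refine h3.congr_of_eventuallyEq ?_
  filter_upwards [hg.continuousAt.eventually
    (extChartAt_source_mem_nhds (I := 𝓘(ℂ, B)) (g l))] with y hy
  simp only [Function.comp_apply]
  rw [(extChartAt 𝓘(ℂ, B) (g l)).left_inv hy]

/-- The map to coordinates induced by coordinates on the base and frames. -/
def frameMap (Φ : S → N) (e₀ : Trivialization F₀ (TotalSpace.proj : TotalSpace F₀ E₀ → S))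
    (e₁ : Trivialization F₁ (TotalSpace.proj : TotalSpace F₁ E₁ → S))
    (w : TotalSpace (F₀ × F₁) (E₀ ×ᵇ E₁)) : N × (F₀ × F₁) :=
  (Φ w.proj, ((e₀ ⟨w.proj, w.2.1⟩).2, (e₁ ⟨w.proj, w.2.2⟩).2))

/-- The inverse of the map to coordinates. -/
def frameInv (Φ' : N → S) (e₀ : Trivialization F₀ (TotalSpace.proj : TotalSpace F₀ E₀ → S))
    (e₁ : Trivialization F₁ (TotalSpace.proj : TotalSpace F₁ E₁ → S)) (l : N × (F₀ × F₁)) :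
    TotalSpace (F₀ × F₁) (E₀ ×ᵇ E₁) :=
  ⟨Φ' l.1, (e₀.symm (Φ' l.1) l.2.1, e₁.symm (Φ' l.1) l.2.2)⟩

variable {Φ : S → N} {Φ' : N → S}
  {e₀ : Trivialization F₀ (TotalSpace.proj : TotalSpace F₀ E₀ → S)}
  {e₁ : Trivialization F₁ (TotalSpace.proj : TotalSpace F₁ E₁ → S)}

theorem contMDiffAt_trivialization {G : S → Type*} {F : Type*} [NormedAddCommGroup F]
    [NormedSpace ℂ F] [TopologicalSpace (TotalSpace F G)] [∀ x, TopologicalSpace (G x)]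
    [FiberBundle F G] {e : Trivialization F (TotalSpace.proj : TotalSpace F G → S)}
    (h : ContMDiffOn (𝓘(ℂ, B).prod 𝓘(ℂ, F)) (𝓘(ℂ, B).prod 𝓘(ℂ, F)) ω e e.source) {f : X → TotalSpace F G}
    {x : X} (hf : ContMDiffAt I (𝓘(ℂ, B).prod 𝓘(ℂ, F)) ω f x) (hx : (f x).proj ∈ e.baseSet) :
    ContMDiffAt I 𝓘(ℂ, F) ω (fun y => (e (f y)).2) x := by
  have h1 := (h.contMDiffAt (e.open_source.mem_nhds (e.mem_source.2 hx))).comp x hf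
  exact contMDiffAt_snd.comp x h1

theorem contMDiffAt_frameMap {w : TotalSpace (F₀ × F₁) (E₀ ×ᵇ E₁)}
    (hΦ : ContMDiffAt 𝓘(ℂ, B) 𝓘(ℂ, N) ω Φ w.proj)
    (h₀ : ContMDiffOn (𝓘(ℂ, B).prod 𝓘(ℂ, F₀)) (𝓘(ℂ, B).prod 𝓘(ℂ, F₀)) ω e₀ e₀.source)
    (h₁ : ContMDiffOn (𝓘(ℂ, B).prod 𝓘(ℂ, F₁)) (𝓘(ℂ, B).prod 𝓘(ℂ, F₁)) ω e₁ e₁.source)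
    (hw₀ : w.proj ∈ e₀.baseSet) (hw₁ : w.proj ∈ e₁.baseSet) :
    ContMDiffAt (𝓘(ℂ, B).prod 𝓘(ℂ, F₀ × F₁)) 𝓘(ℂ, N × (F₀ × F₁)) ω (frameMap Φ e₀ e₁) w := by
  obtain ⟨h2, h3⟩ := contMDiffAt_whitneySum_iff.1
    (contMDiffAt_id : ContMDiffAt (𝓘(ℂ, B).prod 𝓘(ℂ, F₀ × F₁)) (𝓘(ℂ, B).prod 𝓘(ℂ, F₀ × F₁)) ω id w)
  exact (hΦ.comp w (contMDiffAt_proj (E₀ ×ᵇ E₁))).prodMk_space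
    ((contMDiffAt_trivialization h₀ h2 hw₀).prodMk_space (contMDiffAt_trivialization h₁ h3 hw₁))

theorem contMDiffAt_symm_trivialization {G : S → Type*} {F : Type*} [NormedAddCommGroup F]
    [NormedSpace ℂ F] [TopologicalSpace (TotalSpace F G)] [∀ x, TopologicalSpace (G x)]
    [∀ x, Zero (G x)]
    [FiberBundle F G] {e : Trivialization F (TotalSpace.proj : TotalSpace F G → S)}
    (h : ContMDiffOn (𝓘(ℂ, B).prod 𝓘(ℂ, F)) (𝓘(ℂ, B).prod 𝓘(ℂ, F)) ω
      e.toOpenPartialHomeomorph.symm e.target) {b : X → S} {f : X → F}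
    {x : X} (hb : ContMDiffAt I 𝓘(ℂ, B) ω b x) (hf : ContMDiffAt I 𝓘(ℂ, F) ω f x)
    (hx : b x ∈ e.baseSet) :
    ContMDiffAt I (𝓘(ℂ, B).prod 𝓘(ℂ, F)) ω (fun y => (⟨b y, e.symm (b y) (f y)⟩ : TotalSpace F G)) x := by
  have h1 := ContMDiffAt.comp x (h.contMDiffAt (e.open_target.mem_nhds
    (e.mem_target.2 hx : (b x, f x) ∈ e.target))) (hb.prodMk hf)
  refine h1.congr_of_eventuallyEq ?_
  filter_upwards [hb.continuousAt.eventually (e.open_baseSet.mem_nhds hx)] with y hy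
  exact e.mk_symm hy _

theorem contMDiffAt_frameInv {l : N × (F₀ × F₁)}
    (hΦ : ContMDiffAt 𝓘(ℂ, N) 𝓘(ℂ, B) ω Φ' l.1)
    (h₀ : ContMDiffOn (𝓘(ℂ, B).prod 𝓘(ℂ, F₀)) (𝓘(ℂ, B).prod 𝓘(ℂ, F₀)) ω
      e₀.toOpenPartialHomeomorph.symm e₀.target)
    (h₁ : ContMDiffOn (𝓘(ℂ, B).prod 𝓘(ℂ, F₁)) (𝓘(ℂ, B).prod 𝓘(ℂ, F₁)) ω
      e₁.toOpenPartialHomeomorph.symm e₁.target)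
    (hw₀ : Φ' l.1 ∈ e₀.baseSet) (hw₁ : Φ' l.1 ∈ e₁.baseSet) :
    ContMDiffAt 𝓘(ℂ, N × (F₀ × F₁)) (𝓘(ℂ, B).prod 𝓘(ℂ, F₀ × F₁)) ω (frameInv Φ' e₀ e₁) l := by
  have hb : ContMDiffAt 𝓘(ℂ, N × (F₀ × F₁)) 𝓘(ℂ, B) ω (fun l : N × (F₀ × F₁) => Φ' l.1) l :=
    ContMDiffAt.comp (g := Φ') l hΦ contDiff_fst.contMDiff.contMDiffAt
  rw [contMDiffAt_whitneySum_iff]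
  exact ⟨contMDiffAt_symm_trivialization h₀ hb
      (contDiff_fst.comp contDiff_snd).contMDiff.contMDiffAt hw₀,
    contMDiffAt_symm_trivialization h₁ hb
      (contDiff_snd.comp contDiff_snd).contMDiff.contMDiffAt hw₁⟩

end WhitneySum

end WeightedExtremal
end


noncomputable section

namespace WeightedExtremal

open Module Filter Topology Set

set_option linter.unusedSectionVars false

/-! ### Coordinates on the total space of `E_0 ⊕ E_∞` from projectively flat frames. -/

section LocalFrame

variable {A : Type*} [Fintype A] {W : A → Type*} [∀ a, NormedAddCommGroup (W a)]
  [∀ a, NormedSpace ℂ (W a)] [∀ a, FiniteDimensional ℂ (W a)]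
  {B : Type*} [NormedAddCommGroup B] [NormedSpace ℂ B]
  {S : Type*} [TopologicalSpace S] [ChartedSpace B S]
  {F₀ : Type*} [NormedAddCommGroup F₀] [InnerProductSpace ℂ F₀]
  {E₀ : S → Type*} [TopologicalSpace (TotalSpace F₀ E₀)] [∀ x, TopologicalSpace (E₀ x)]
  [∀ x, AddCommGroup (E₀ x)] [∀ x, Module ℂ (E₀ x)] [FiberBundle F₀ E₀]
  {F₁ : Type*} [NormedAddCommGroup F₁] [InnerProductSpace ℂ F₁]
  {E₁ : S → Type*} [TopologicalSpace (TotalSpace F₁ E₁)] [∀ x, TopologicalSpace (E₁ x)]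
  [∀ x, AddCommGroup (E₁ x)] [∀ x, Module ℂ (E₁ x)] [FiberBundle F₁ E₁]
  {V : Type*} [NormedAddCommGroup V] [NormedSpace ℂ V]
  {M : Type*} [TopologicalSpace M] [ChartedSpace V M]

/-- Local coordinates on the total space of `E₀ ⊕ E_∞` given by coordinates on the base and
projectively parallel frames. -/
structure IsLocalFrame (D : AdmissibleManifold A W B F₀ E₀ F₁ E₁ V M) (x : A → ℝ) (S₀ : Set S)
    (O : Set ((∀ a, W a) × (F₀ × F₁)))
    (Λ : TotalSpace (F₀ × F₁) (E₀ ×ᵇ E₁) → (∀ a, W a) × (F₀ × F₁))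
    (Λ' : (∀ a, W a) × (F₀ × F₁) → TotalSpace (F₀ × F₁) (E₀ ×ᵇ E₁))
    (Q K : (∀ a, W a) → Bil (∀ a, W a)) (ψ₀ ψ₁ : (∀ a, W a) → ℝ) : Prop where
  isOpen_base : IsOpen S₀
  isOpen_total : IsOpen O
  hol : ∀ w, w.proj ∈ S₀ →
    ContMDiffAt (𝓘(ℂ, B).prod 𝓘(ℂ, F₀ × F₁)) 𝓘(ℂ, (∀ a, W a) × (F₀ × F₁)) ω Λ w
  hol_inv : ∀ l ∈ O,
    ContMDiffAt 𝓘(ℂ, (∀ a, W a) × (F₀ × F₁)) (𝓘(ℂ, B).prod 𝓘(ℂ, F₀ × F₁)) ω Λ' l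
  mapsTo : ∀ w, w.proj ∈ S₀ → Λ w ∈ O
  mapsTo_inv : ∀ l ∈ O, (Λ' l).proj ∈ S₀
  left_inv : ∀ w, w.proj ∈ S₀ → Λ' (Λ w) = w
  right_inv : ∀ l ∈ O, Λ (Λ' l) = l
  smul : ∀ w, w.proj ∈ S₀ → ∀ c : ℂ, Λ ⟨w.proj, c • w.2⟩ = ((Λ w).1, c • (Λ w).2)
  eq_zero₀ : ∀ w, w.proj ∈ S₀ → ((Λ w).2.1 = 0 ↔ w.2.1 = 0)
  eq_zero₁ : ∀ w, w.proj ∈ S₀ → ((Λ w).2.2 = 0 ↔ w.2.2 = 0)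
  rsq₀ : ∀ w, w.proj ∈ S₀ → D.rsq₀ w = normSq₀ ψ₀ (Λ w)
  rsq₁ : ∀ w, w.proj ∈ S₀ → D.rsq₁ w = normSq₁ ψ₁ (Λ w)
  bundle : ∀ l ∈ O, IsBundleData Q K ψ₀ ψ₁ l.1
  base : ∀ l ∈ O, ∃ ε, IsCalabiBase Q K ε (fun z => ∏ a, (1 + x a * z) ^ finrank ℂ (W a))
      (fun z => ∑ a, |x a| * D.c a / (1 + x a * z)) l.1
  tensor : ∀ w, w.proj ∈ S₀ → ∑ a, (x a)⁻¹ • pull (D.g a w.proj) (D.dProj w) =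
    pull (Q (Λ w).1) ((ContinuousLinearMap.fst ℂ _ _).comp
      (mdiff (𝓘(ℂ, B).prod 𝓘(ℂ, F₀ × F₁)) 𝓘(ℂ, (∀ a, W a) × (F₀ × F₁)) Λ w))
  curv₀ : ∀ w, w.proj ∈ S₀ → pull (D.Ω₀ w.proj) (D.dProj w) =
    pull ((1 / 2 : ℝ) • ddcFlat ψ₀ (Λ w).1) ((ContinuousLinearMap.fst ℂ _ _).comp
      (mdiff (𝓘(ℂ, B).prod 𝓘(ℂ, F₀ × F₁)) 𝓘(ℂ, (∀ a, W a) × (F₀ × F₁)) Λ w))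
  curv₁ : ∀ w, w.proj ∈ S₀ → pull (D.Ω₁ w.proj) (D.dProj w) =
    pull ((1 / 2 : ℝ) • ddcFlat ψ₁ (Λ w).1) ((ContinuousLinearMap.fst ℂ _ _).comp
      (mdiff (𝓘(ℂ, B).prod 𝓘(ℂ, F₀ × F₁)) 𝓘(ℂ, (∀ a, W a) × (F₀ × F₁)) Λ w))

variable (D : AdmissibleManifold A W B F₀ E₀ F₁ E₁ V M) {x : A → ℝ}

theorem ddc_eq_pull_chart {ψ : S → ℝ} {s : Set S} (hs : IsOpen s) (hψ : SmoothOn (V := B) ψ s)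
    {Φ : OpenPartialHomeomorph S (∀ a, W a)}
    (hΦ : ContMDiffOn 𝓘(ℂ, B) 𝓘(ℂ, ∀ a, W a) ω Φ Φ.source)
    (hΦ' : ContMDiffOn 𝓘(ℂ, ∀ a, W a) 𝓘(ℂ, B) ω Φ.symm Φ.target) {y : S} (hy : y ∈ Φ.source)
    (hys : y ∈ s) : ddc 𝓘(ℂ, B) ψ y =
      pull (ddcFlat (fun n => ψ (Φ.symm n)) (Φ y)) (mdiff 𝓘(ℂ, B) 𝓘(ℂ, ∀ a, W a) Φ y) := by
  have h1 : ContDiffAt ℝ ∞ (fun n => ψ (Φ.symm n)) (Φ y) :=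
    contDiffAt_smoothOn_comp hs hψ
      (hΦ'.contMDiffAt (Φ.open_target.mem_nhds (Φ.map_source hy))) (by rwa [Φ.left_inv hy])
  rw [← ddc_comp (F := fun n => ψ (Φ.symm n)) (h1.of_le (by norm_cast)) (hΦ.contMDiffAt (Φ.open_source.mem_nhds hy))]
  refine ddc_congr ?_
  filter_upwards [Φ.open_source.mem_nhds hy] with y' hy'
  rw [Φ.left_inv hy']

/-- Every point of the base lies in the domain of a local frame. -/
theorem exists_isLocalFrame (hx : D.IsParameter x) (s₀ : S) :
    ∃ S₀ O Λ Λ' Q K ψ₀ ψ₁, s₀ ∈ S₀ ∧ IsLocalFrame D x S₀ O Λ Λ' Q K ψ₀ ψ₁ := by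
  obtain ⟨Φ, hs, hΦ, hΦ', hk⟩ := D.localProduct s₀
  choose k hk hkc hkg using hk
  obtain ⟨e₀, ψ₀, hs₀, hl₀, he₀, he₀', hψ₀, hh₀, hΩ₀⟩ := D.flat₀ s₀
  obtain ⟨e₁, ψ₁, hs₁, hl₁, he₁, he₁', hψ₁, hh₁, hΩ₁⟩ := D.flat₁ s₀
  have hΦa : ∀ y ∈ Φ.source, ContMDiffAt 𝓘(ℂ, B) 𝓘(ℂ, ∀ a, W a) ω Φ y := fun y hy =>
    hΦ.contMDiffAt (Φ.open_source.mem_nhds hy)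
  have hΦa' : ∀ n ∈ Φ.target, ContMDiffAt 𝓘(ℂ, ∀ a, W a) 𝓘(ℂ, B) ω Φ.symm n := fun n hn =>
    hΦ'.contMDiffAt (Φ.open_target.mem_nhds hn)
  -- The first coordinate of the frame map is the base chart after projection. Tensors pulled back
  -- from `S` can thus be rewritten as pull-backs from the coordinate space.
  have hfst : ∀ w : TotalSpace (F₀ × F₁) (E₀ ×ᵇ E₁), w.proj ∈ Φ.source → w.proj ∈ e₀.baseSet →
      w.proj ∈ e₁.baseSet → (mdiff 𝓘(ℂ, B) 𝓘(ℂ, ∀ a, W a) Φ w.proj).comp (D.dProj w) =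
      (ContinuousLinearMap.fst ℂ _ _).comp (mdiff (𝓘(ℂ, B).prod 𝓘(ℂ, F₀ × F₁))
        𝓘(ℂ, (∀ a, W a) × (F₀ × F₁)) (frameMap Φ e₀ e₁) w) := fun w hw hw₀ hw₁ => by
    have h1 := mdiff_comp (hΦa _ hw) (contMDiffAt_proj (E₀ ×ᵇ E₁) (n := ω) (IB := 𝓘(ℂ, B)) (p := w))
    have h2 := mdiff_comp (g := (Prod.fst : (∀ a, W a) × (F₀ × F₁) → ∀ a, W a))
      contDiff_fst.contMDiff.contMDiffAt (contMDiffAt_frameMap (hΦa _ hw) he₀ he₁ hw₀ hw₁)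
    rw [mdiff_eq_fderiv_flat, fderiv_fst] at h2
    exact h1.symm.trans h2
  have hcurv : ∀ n ∈ Φ.target, Φ.symm n ∈ e₀.baseSet → Φ.symm n ∈ e₁.baseSet →
      ContDiffAt ℝ ∞ (fun n => ψ₀ (Φ.symm n)) n ∧ ContDiffAt ℝ ∞ (fun n => ψ₁ (Φ.symm n)) n ∧
      baseForm D.sign k n = ddcFlat (fun n => 1 / 2 * (ψ₁ (Φ.symm n) - ψ₀ (Φ.symm n))) n := by
    intro n hn hn₀ hn₁
    have s0 := contDiffAt_smoothOn_comp e₀.open_baseSet hψ₀ (hΦa' n hn) hn₀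
    have s1 := contDiffAt_smoothOn_comp e₁.open_baseSet hψ₁ (hΦa' n hn) hn₁
    refine ⟨s0, s1, ?_⟩
    have hy := Φ.map_target hn
    have h1 := D.curvature (Φ.symm n)
    rw [hΩ₀ _ hn₀, hΩ₁ _ hn₁, ddc_eq_pull_chart e₀.open_baseSet hψ₀ hΦ hΦ' hy hn₀,
      ddc_eq_pull_chart e₁.open_baseSet hψ₁ hΦ hΦ' hy hn₁, Finset.sum_congr rfl fun a _ => hkg a _ hy,
      Φ.right_inv hn] at h1
    -- The curvature identity is known after pull-back by the differential of the chart; pulling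
    -- back once more by the inverse chart removes it.
    have h2 : (mdiff 𝓘(ℂ, B) 𝓘(ℂ, ∀ a, W a) Φ (Φ.symm n)).comp
        (mdiff 𝓘(ℂ, ∀ a, W a) 𝓘(ℂ, B) Φ.symm n) = ContinuousLinearMap.id ℂ _ := by
      rw [← mdiff_comp (hΦa _ hy) (hΦa' n hn)]
      have : (fun y => Φ (Φ.symm y)) =ᶠ[𝓝 n] id := by
        filter_upwards [Φ.open_target.mem_nhds hn] with y hy
        exact Φ.right_inv hy
      rw [mdiff_congr this, mdiff_eq_fderiv_flat, fderiv_id]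
    rw [ddcFlat_const_mul ((s1.sub s0).of_le (by norm_cast)), ddcFlat_sub (s1.of_le (by norm_cast)) (s0.of_le (by norm_cast))]
    have h3 := congrArg (fun b => pull b (mdiff 𝓘(ℂ, ∀ a, W a) 𝓘(ℂ, B) Φ.symm n)) h1
    simp only [pull_sub, pull_smul, pull_sum, pull_pull, h2, pull_id, ContinuousLinearMap.comp_assoc,
      ContinuousLinearMap.comp_id] at h3
    rw [smul_sub, h3, baseForm, piBil]
    rfl
  have hsymm : ∀ l : (∀ a, W a) × (F₀ × F₁), l.1 ∈ Φ.target → Φ.symm l.1 ∈ e₀.baseSet →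
      Φ.symm l.1 ∈ e₁.baseSet → frameMap Φ e₀ e₁ (frameInv Φ.symm e₀ e₁ l) = l := fun l hl h0 h1 => by
    simp only [frameMap, frameInv, e₀.apply_mk_symm h0, e₁.apply_mk_symm h1, Φ.right_inv hl]
  refine ⟨Φ.source ∩ (e₀.baseSet ∩ e₁.baseSet),
    {l | l.1 ∈ Φ.target ∩ Φ.symm ⁻¹' (e₀.baseSet ∩ e₁.baseSet)}, frameMap Φ e₀ e₁,
    frameInv Φ.symm e₀ e₁, baseTensor D.sign x k, baseForm D.sign k, fun n => ψ₀ (Φ.symm n),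
    fun n => ψ₁ (Φ.symm n), ⟨hs, hs₀, hs₁⟩, ?_⟩
  exact
  { isOpen_base := Φ.open_source.inter (e₀.open_baseSet.inter e₁.open_baseSet)
    isOpen_total := (Φ.symm.isOpen_inter_preimage (e₀.open_baseSet.inter e₁.open_baseSet)).preimage
      continuous_fst
    hol := fun w hw => contMDiffAt_frameMap (hΦa _ hw.1) he₀ he₁ hw.2.1 hw.2.2
    hol_inv := fun l hl => contMDiffAt_frameInv (hΦa' _ hl.1) he₀' he₁' hl.2.1 hl.2.2
    mapsTo := fun w hw => ⟨Φ.map_source hw.1, by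
      rw [mem_preimage, frameMap, Φ.left_inv hw.1]; exact hw.2⟩
    mapsTo_inv := fun l hl => ⟨Φ.map_target hl.1, hl.2⟩
    left_inv := fun w hw => by
      obtain ⟨b, w₀, w₁⟩ := w
      have e := Φ.left_inv hw.1
      simp only [frameMap, frameInv]
      rw [e, e₀.symm_apply_apply_mk hw.2.1, e₁.symm_apply_apply_mk hw.2.2]
    right_inv := fun l hl => hsymm l hl.1 hl.2.1 hl.2.2
    smul := fun w hw c => by
      simp only [frameMap]
      rw [show (c • w.2).1 = c • w.2.1 from rfl, show (c • w.2).2 = c • w.2.2 from rfl,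
        (hl₀.linear w.proj hw.2.1).map_smul, (hl₁.linear w.proj hw.2.2).map_smul]
      rfl
    eq_zero₀ := fun w hw => by
      have h := (hl₀.linear w.proj hw.2.1).map_zero
      refine ⟨fun h0 => ?_, fun h0 => ?_⟩
      · rw [← e₀.symm_apply_apply_mk hw.2.1 w.2.1, ← e₀.symm_apply_apply_mk hw.2.1 0, h]
        exact congrArg _ h0
      · simp only [frameMap]
        rw [h0]; exact h
    eq_zero₁ := fun w hw => by
      have h := (hl₁.linear w.proj hw.2.2).map_zero
      refine ⟨fun h0 => ?_, fun h0 => ?_⟩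
      · rw [← e₁.symm_apply_apply_mk hw.2.2 w.2.2, ← e₁.symm_apply_apply_mk hw.2.2 0, h]
        exact congrArg _ h0
      · simp only [frameMap]
        rw [h0]; exact h
    rsq₀ := fun w hw => by
      rw [AdmissibleManifold.rsq₀, hh₀ _ hw.2.1, normSq₀, frameMap, Φ.left_inv hw.1]
    rsq₁ := fun w hw => by
      rw [AdmissibleManifold.rsq₁, hh₁ _ hw.2.2, normSq₁, frameMap, Φ.left_inv hw.1]
    bundle := fun l hl => by
      obtain ⟨s0, s1, h⟩ := hcurv l.1 hl.1 hl.2.1 hl.2.2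
      exact isBundleData_pi D.sign_eq hx Φ.open_target hk hl.1 s0 s1 h
    base := fun l hl => exists_isCalabiBase_pi D.sign_eq hx Φ.open_target hk hkc hl.1
    tensor := fun w hw => by
      rw [← hfst w hw.1 hw.2.1 hw.2.2, ← pull_pull, frameMap, baseTensor, piBil, pull_sum, pull_sum]
      refine Finset.sum_congr rfl fun a _ => ?_
      rw [hkg a _ hw.1, pull_smul, pull_smul, pull_pull, pull_smul, smul_smul, mul_comm, div_eq_mul_inv]
      rfl
    curv₀ := fun w hw => by
      rw [← hfst w hw.1 hw.2.1 hw.2.2, ← pull_pull, hΩ₀ _ hw.2.1,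
        ddc_eq_pull_chart e₀.open_baseSet hψ₀ hΦ hΦ' hw.1 hw.2.1]
      rfl
    curv₁ := fun w hw => by
      rw [← hfst w hw.1 hw.2.1 hw.2.2, ← pull_pull, hΩ₁ _ hw.2.2,
        ddc_eq_pull_chart e₁.open_baseSet hψ₁ hΦ hΦ' hw.1 hw.2.2]
      rfl }

end LocalFrame

end WeightedExtremal
end


noncomputable section

namespace WeightedExtremal

open Module Filter Topology Set

set_option linter.unusedSectionVars false

/-! ### Local coordinates of `M` and lifts of its charts to the total space. -/

section LocalChart

variable {A : Type*} [Fintype A] {W : A → Type*} [∀ a, NormedAddCommGroup (W a)]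
  [∀ a, NormedSpace ℂ (W a)] [∀ a, FiniteDimensional ℂ (W a)]
  {B : Type*} [NormedAddCommGroup B] [NormedSpace ℂ B]
  {S : Type*} [TopologicalSpace S] [ChartedSpace B S] [IsManifold 𝓘(ℂ, B) ω S]
  {F₀ : Type*} [NormedAddCommGroup F₀] [InnerProductSpace ℂ F₀] [FiniteDimensional ℂ F₀]
  {E₀ : S → Type*} [TopologicalSpace (TotalSpace F₀ E₀)] [∀ x, TopologicalSpace (E₀ x)]
  [∀ x, AddCommGroup (E₀ x)] [∀ x, Module ℂ (E₀ x)] [FiberBundle F₀ E₀]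
  [VectorBundle ℂ F₀ E₀] [ContMDiffVectorBundle ω F₀ E₀ 𝓘(ℂ, B)]
  {F₁ : Type*} [NormedAddCommGroup F₁] [InnerProductSpace ℂ F₁] [FiniteDimensional ℂ F₁]
  {E₁ : S → Type*} [TopologicalSpace (TotalSpace F₁ E₁)] [∀ x, TopologicalSpace (E₁ x)]
  [∀ x, AddCommGroup (E₁ x)] [∀ x, Module ℂ (E₁ x)] [FiberBundle F₁ E₁]
  [VectorBundle ℂ F₁ E₁] [ContMDiffVectorBundle ω F₁ E₁ 𝓘(ℂ, B)]
  {V : Type*} [NormedAddCommGroup V] [NormedSpace ℂ V]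
  {M : Type*} [TopologicalSpace M] [ChartedSpace V M] [IsManifold 𝓘(ℂ, V) ω M]

/-- The function `(r₀² - r_∞²) / (r₀² + r_∞²)` on the total space of `E₀ ⊕ E_∞`. -/
def totMoment (D : AdmissibleManifold A W B F₀ E₀ F₁ E₁ V M)
    (w : TotalSpace (F₀ × F₁) (E₀ ×ᵇ E₁)) : ℝ :=
  (D.rsq₀ w - D.rsq₁ w) / (D.rsq₀ w + D.rsq₁ w)

/-- The potential `log (r₀² + r_∞²) + pot` on the total space of `E₀ ⊕ E_∞`. -/
def totPot (D : AdmissibleManifold A W B F₀ E₀ F₁ E₁ V M) (pot : ℝ → ℝ)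
    (w : TotalSpace (F₀ × F₁) (E₀ ×ᵇ E₁)) : ℝ :=
  Real.log (D.rsq₀ w + D.rsq₁ w) + pot (totMoment D w)

/-- The pull-back of an admissible metric to the total space of `E₀ ⊕ E_∞`. -/
def totTensor (D : AdmissibleManifold A W B F₀ E₀ F₁ E₁ V M) (x : A → ℝ) (pot : ℝ → ℝ)
    (w : TotalSpace (F₀ × F₁) (E₀ ×ᵇ E₁)) : Bil (B × (F₀ × F₁)) :=
  ∑ a, (x a)⁻¹ • pull (D.g a w.proj) (D.dProj w)
    + (pull (D.Ω₀ w.proj) (D.dProj w) + pull (D.Ω₁ w.proj) (D.dProj w))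
    + ddc (𝓘(ℂ, B).prod 𝓘(ℂ, F₀ × F₁)) (totPot D pot) w

variable {D : AdmissibleManifold A W B F₀ E₀ F₁ E₁ V M} {x : A → ℝ} {S₀ : Set S}
  {O : Set ((∀ a, W a) × (F₀ × F₁))}
  {Λ : TotalSpace (F₀ × F₁) (E₀ ×ᵇ E₁) → (∀ a, W a) × (F₀ × F₁)}
  {Λ' : (∀ a, W a) × (F₀ × F₁) → TotalSpace (F₀ × F₁) (E₀ ×ᵇ E₁)}
  {Q K : (∀ a, W a) → Bil (∀ a, W a)} {ψ₀ ψ₁ : (∀ a, W a) → ℝ} {pot : ℝ → ℝ}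
  {w : TotalSpace (F₀ × F₁) (E₀ ×ᵇ E₁)}

namespace IsLocalFrame

theorem eventually_proj_mem (h : IsLocalFrame D x S₀ O Λ Λ' Q K ψ₀ ψ₁) 
    (hw : w.proj ∈ S₀) : ∀ᶠ y in 𝓝 w, y.proj ∈ S₀ :=
  (FiberBundle.continuous_proj (F₀ × F₁) (E₀ ×ᵇ E₁)).continuousAt.eventually
    (h.isOpen_base.mem_nhds hw)

theorem ne_zero (h : IsLocalFrame D x S₀ O Λ Λ' Q K ψ₀ ψ₁) 
    (hw : w.proj ∈ S₀) (h0 : w.2 ≠ 0) : (Λ w).2 ≠ 0 := fun e =>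
  h0 (Prod.ext ((h.eq_zero₀ w hw).1 (congrArg Prod.fst e)) ((h.eq_zero₁ w hw).1 (congrArg Prod.snd e)))

theorem ne_zero_iff (h : IsLocalFrame D x S₀ O Λ Λ' Q K ψ₀ ψ₁) 
    (hw : w.proj ∈ S₀) : (Λ w).2 ≠ 0 ↔ w.2 ≠ 0 :=
  ⟨fun h0 e => h0 (Prod.ext ((h.eq_zero₀ w hw).2 (congrArg Prod.fst e))
    ((h.eq_zero₁ w hw).2 (congrArg Prod.snd e))), h.ne_zero hw⟩

theorem totMoment_eq (h : IsLocalFrame D x S₀ O Λ Λ' Q K ψ₀ ψ₁) 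
    (hw : w.proj ∈ S₀) : totMoment D w = canonMoment ψ₀ ψ₁ (Λ w) := by
  rw [totMoment, canonMoment, h.rsq₀ w hw, h.rsq₁ w hw]

theorem totPot_eq (h : IsLocalFrame D x S₀ O Λ Λ' Q K ψ₀ ψ₁) 
    (hw : w.proj ∈ S₀) : totPot D pot w =
    Real.log (normSq₀ ψ₀ (Λ w) + normSq₁ ψ₁ (Λ w)) + pot (canonMoment ψ₀ ψ₁ (Λ w)) := by
  rw [totPot, h.totMoment_eq hw, h.rsq₀ w hw, h.rsq₁ w hw]

/-- In the frame, `Ω_0 + Ω_∞` is `dd^c` of half the sum of the weights, precisely the summand by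
which `admPot` differs from `totPot`. -/
theorem totTensor_eq (h : IsLocalFrame D x S₀ O Λ Λ' Q K ψ₀ ψ₁) 
    (hw : w.proj ∈ S₀) (h0 : w.2 ≠ 0)
    (hu : ∀ y ∈ Icc (-1 : ℝ) 1, ContDiffAt ℝ ∞ pot y) : totTensor D x pot w =
    pull (pull (Q (Λ w).1) (ContinuousLinearMap.fst ℂ _ _) + ddcFlat (admPot ψ₀ ψ₁ pot) (Λ w))
      (mdiff (𝓘(ℂ, B).prod 𝓘(ℂ, F₀ × F₁)) 𝓘(ℂ, (∀ a, W a) × (F₀ × F₁)) Λ w) := by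
  have hB := h.bundle _ (h.mapsTo w hw)
  have hne := h.ne_zero hw h0
  have s0 : ContDiffAt ℝ 2 ψ₀ (Λ w).1 := hB.smooth₀.of_le (by norm_cast)
  have s1 : ContDiffAt ℝ 2 ψ₁ (Λ w).1 := hB.smooth₁.of_le (by norm_cast)
  have hadm : ContDiffAt ℝ 2 (admPot ψ₀ ψ₁ pot) (Λ w) :=
    (contDiffAt_admPot hB.smooth₀ hB.smooth₁ hne hu).of_le (by norm_cast)
  have hψ : ContDiffAt ℝ 2 (fun n => 1 / 2 * (ψ₀ n + ψ₁ n)) (Λ w).1 :=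
    contDiffAt_const.mul (s0.add s1)
  have hψ' : ContDiffAt ℝ 2 (fun l : (∀ a, W a) × (F₀ × F₁) => 1 / 2 * (ψ₀ l.1 + ψ₁ l.1)) (Λ w) :=
    ContDiffAt.comp (g := fun n => 1 / 2 * (ψ₀ n + ψ₁ n)) (Λ w) hψ contDiffAt_fst
  have hrest : ContDiffAt ℝ 2 (fun l : (∀ a, W a) × (F₀ × F₁) =>
      Real.log (normSq₀ ψ₀ l + normSq₁ ψ₁ l) + pot (canonMoment ψ₀ ψ₁ l)) (Λ w) := by
    refine (hadm.sub hψ').congr_of_eventuallyEq (Eventually.of_forall fun l => ?_)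
    simp [admPot]
  have e1 : ddcFlat (admPot ψ₀ ψ₁ pot) (Λ w) = pull ((1 / 2 : ℝ) • ddcFlat ψ₀ (Λ w).1 +
      (1 / 2 : ℝ) • ddcFlat ψ₁ (Λ w).1) (ContinuousLinearMap.fst ℂ _ _) +
      ddcFlat (fun l : (∀ a, W a) × (F₀ × F₁) =>
        Real.log (normSq₀ ψ₀ l + normSq₁ ψ₁ l) + pot (canonMoment ψ₀ ψ₁ l)) (Λ w) := by
    have e2 := ddcFlat_add hψ' hrest
    have e3 := ddcFlat_comp_hol (F := fun n => 1 / 2 * (ψ₀ n + ψ₁ n))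
      (h := (Prod.fst : (∀ a, W a) × (F₀ × F₁) → _)) (u := Λ w) hψ contDiffAt_fst
    rw [fderiv_fst, ddcFlat_const_mul (s0.add s1), ddcFlat_add s0 s1, smul_add] at e3
    rw [← e3, ← e2]
    rfl
  rw [totTensor, h.tensor w hw, h.curv₀ w hw, h.curv₁ w hw, e1, pull_add, pull_add, pull_pull, pull_pull,
    pull_add, ← ddc_comp hrest (h.hol w hw), add_assoc]
  congr 2
  refine ddc_congr ?_
  filter_upwards [h.eventually_proj_mem hw] with y hy
  exact h.totPot_eq hy

end IsLocalFrame

/-- The data describing the admissible metrics in coordinates of `M` near a point. -/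
structure IsLocalChart (D : AdmissibleManifold A W B F₀ E₀ F₁ E₁ V M) (x : A → ℝ) (m : M)
    (k : V → (∀ a, W a) × (F₀ × F₁)) (ϖ : (∀ a, W a) × (F₀ × F₁) → V) (U : Set V)
    (O : Set ((∀ a, W a) × (F₀ × F₁))) (Q K : (∀ a, W a) → Bil (∀ a, W a))
    (ψ₀ ψ₁ : (∀ a, W a) → ℝ) : Prop where
  localSection : IsLocalSection k ϖ U O
  bundle : ∀ l ∈ O, IsBundleData Q K ψ₀ ψ₁ l.1
  base : ∀ l ∈ O, ∃ ε, IsCalabiBase Q K ε (fun z => ∏ a, (1 + x a * z) ^ finrank ℂ (W a))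
      (fun z => ∑ a, |x a| * D.c a / (1 + x a * z)) l.1
  subset : U ⊆ (extChartAt 𝓘(ℂ, V) m).target
  moment : ∀ u ∈ U, ∀ w : TotalSpace (F₀ × F₁) (E₀ ×ᵇ E₁), w.2 ≠ 0 →
    D.q w = (extChartAt 𝓘(ℂ, V) m).symm u → totMoment D w = canonMoment ψ₀ ψ₁ (k u)
  tensor : ∀ pot : ℝ → ℝ, (∀ y ∈ Icc (-1 : ℝ) 1, ContDiffAt ℝ ∞ pot y) → ∀ u ∈ U,
    ∀ w : TotalSpace (F₀ × F₁) (E₀ ×ᵇ E₁), w.2 ≠ 0 → D.q w = (extChartAt 𝓘(ℂ, V) m).symm u →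
    pull (secMetric Q (admPot ψ₀ ψ₁ pot) k u) (mdiff (𝓘(ℂ, B).prod 𝓘(ℂ, F₀ × F₁)) 𝓘(ℂ, V)
      (fun y => extChartAt 𝓘(ℂ, V) m (D.q y)) w) = totTensor D x pot w

variable (D)

/-- A local holomorphic section of the submersion `q`, read in a local frame, lifts the chart of `M`
to the coordinate space; composing `q` with the inverse frame gives the quotient map. -/
theorem exists_isLocalChart (hx : D.IsParameter x) (m : M) {u₀ : V}
    (hu₀ : u₀ ∈ (extChartAt 𝓘(ℂ, V) m).target) :
    ∃ k ϖ U O Q K ψ₀ ψ₁, u₀ ∈ U ∧ IsLocalChart D x m k ϖ U O Q K ψ₀ ψ₁ := by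
  set φ := extChartAt 𝓘(ℂ, V) m with hφ
  obtain ⟨v, hv0, hv⟩ := D.projectivization.surjective (φ.symm u₀)
  obtain ⟨s, hsv, hs, hsq⟩ := exists_section (D.projectivization.submersion v hv0)
  obtain ⟨S₀, O, Λ, Λ', Q, K, ψ₀, ψ₁, hvS, h⟩ := exists_isLocalFrame D hx v.proj
  rw [hv] at hsv hs hsq
  have hφs : ∀ u ∈ φ.target, ContMDiffAt 𝓘(ℂ, V) 𝓘(ℂ, V) ω φ.symm u := fun u hu =>
    (contMDiffOn_extChartAt_symm m).contMDiffAt ((isOpen_extChartAt_target m).mem_nhds hu)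
  have hφa : ∀ m' ∈ φ.source, ContMDiffAt 𝓘(ℂ, V) 𝓘(ℂ, V) ω φ m' := fun m' hm' =>
    (contMDiffOn_extChartAt (n := ω)).contMDiffAt
      ((chartAt V m).open_source.mem_nhds (by simpa [hφ] using hm'))
  have hq : ∀ w : TotalSpace (F₀ × F₁) (E₀ ×ᵇ E₁), w.2 ≠ 0 →
      ContMDiffAt (𝓘(ℂ, B).prod 𝓘(ℂ, F₀ × F₁)) 𝓘(ℂ, V) ω D.q w := fun w hw =>
    (D.projectivization.submersion w hw).contMDiffAt
  have hsS : ∀ᶠ m' in 𝓝 (φ.symm u₀), (s m').proj ∈ S₀ :=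
    hs.continuousAt.eventually (by rw [hsv]; exact h.eventually_proj_mem hvS)
  have hs0 : ∀ᶠ m' in 𝓝 (φ.symm u₀), (Λ (s m')).2 ≠ 0 := by
    have hc : ContinuousAt (fun m' => (Λ (s m')).2) (φ.symm u₀) :=
      continuousAt_snd.comp (ContinuousAt.comp (g := Λ) (by
        rw [hsv]; exact (h.hol v hvS).continuousAt) hs.continuousAt)
    exact hc.eventually_ne (by rw [hsv]; exact h.ne_zero hvS hv0)
  have hall : ∀ᶠ u in 𝓝 u₀, u ∈ φ.target ∧
      ContMDiffAt 𝓘(ℂ, V) (𝓘(ℂ, B).prod 𝓘(ℂ, F₀ × F₁)) ω s (φ.symm u) ∧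
      D.q (s (φ.symm u)) = φ.symm u ∧ (s (φ.symm u)).proj ∈ S₀ ∧ (s (φ.symm u)).2 ≠ 0 := by
    have hc := continuousAt_extChartAt_symm'' hu₀
    filter_upwards [(isOpen_extChartAt_target m).mem_nhds hu₀,
      hc.eventually ((contMDiffAt_iff_contMDiffAt_nhds (by simp)).1 hs), hc.eventually hsq,
      hc.eventually hsS, hc.eventually hs0] with u h1 h2 h3 h4 h5
    exact ⟨h1, h2, h3, h4, (h.ne_zero_iff h4).1 h5⟩
  obtain ⟨U, hU, hUo, hu₀U⟩ := mem_nhds_iff.1 hall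
  -- Any nonzero lift of a point differs from the chosen section by a nonzero scalar, because the
  -- fibres of `q` are punctured lines.
  have hsec : ∀ u ∈ U, ∀ w : TotalSpace (F₀ × F₁) (E₀ ×ᵇ E₁), w.2 ≠ 0 → D.q w = φ.symm u →
      w.proj ∈ S₀ ∧ ∃ c : ℂ, c ≠ 0 ∧ Λ (s (φ.symm u)) = ((Λ w).1, c • (Λ w).2) := by
    intro u hu w hw hqw
    obtain ⟨h1, h2, h3, h4, h5⟩ := hU hu
    obtain ⟨c, hc⟩ := (D.projectivization.fibres w (s (φ.symm u)) hw h5).1 (by rw [h3, hqw])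
    have hwS : w.proj ∈ S₀ := by rw [hc] at h4; exact h4
    refine ⟨hwS, c, ?_, ?_⟩
    · rintro rfl
      rw [hc, zero_smul] at h5; exact h5 rfl
    · rw [hc, h.smul w hwS]
  have hinv : ∀ l ∈ O, l.2 ≠ 0 → (Λ' l).2 ≠ 0 := fun l hl h0 => by
    rw [← h.ne_zero_iff (h.mapsTo_inv l hl), h.right_inv l hl]; exact h0
  have hquot : ∀ l ∈ O, l.2 ≠ 0 → ContMDiffAt 𝓘(ℂ, (∀ a, W a) × (F₀ × F₁)) 𝓘(ℂ, V) ω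
      (fun l => D.q (Λ' l)) l := fun l hl h0 =>
    ContMDiffAt.comp (g := D.q) l (hq _ (hinv l hl h0)) (h.hol_inv l hl)
  -- The domain is cut down to nonzero vectors whose image lies in the chart; only there is the
  -- coordinate form of the quotient map holomorphic.
  let O' : Set ((∀ a, W a) × (F₀ × F₁)) := {l | l ∈ O ∧ l.2 ≠ 0 ∧ D.q (Λ' l) ∈ φ.source}
  have hmap : ∀ w : TotalSpace (F₀ × F₁) (E₀ ×ᵇ E₁), w.proj ∈ S₀ → w.2 ≠ 0 → D.q w ∈ φ.source →
      Λ w ∈ O' := fun w hw h0 hs =>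
    ⟨h.mapsTo w hw, h.ne_zero hw h0, by rw [h.left_inv w hw]; exact hs⟩
  have hlocal : IsLocalSection (fun u => Λ (s (φ.symm u))) (fun l => φ (D.q (Λ' l))) U O' :=
  { isOpen_base := hUo
    isOpen_total := isOpen_iff_mem_nhds.2 fun l hl => by
      filter_upwards [h.isOpen_total.mem_nhds hl.1,
        continuousAt_snd.eventually_ne hl.2.1, (hquot l hl.1 hl.2.1).continuousAt.eventually
          ((isOpen_extChartAt_source m).mem_nhds hl.2.2)] with l' h1 h2 h3
      exact ⟨h1, h2, h3⟩
    smooth_section := fun u hu => by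
      obtain ⟨h1, h2, h3, h4, h5⟩ := hU hu
      exact ((h.hol _ h4).comp u (h2.comp u (hφs u h1))).contDiffAt
    smooth_quotient := fun l hl =>
      (ContMDiffAt.comp (g := φ) l (hφa _ hl.2.2) (hquot l hl.1 hl.2.1)).contDiffAt
    mapsTo := fun u hu => by
      obtain ⟨h1, h2, h3, h4, h5⟩ := hU hu
      exact hmap _ h4 h5 (by rw [h3]; exact φ.map_target h1)
    left_inv := fun u hu => by
      obtain ⟨h1, h2, h3, h4, h5⟩ := hU hu
      rw [h.left_inv _ h4, h3, φ.right_inv h1]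
    ne_zero := fun l hl => hl.2.1
    scale := fun l hl c hc => by
      have h1 := h.smul _ (h.mapsTo_inv l hl.1) c
      rw [h.right_inv l hl.1] at h1
      have h2 := h.left_inv ⟨(Λ' l).proj, c • (Λ' l).2⟩ (h.mapsTo_inv l hl.1)
      rw [h1] at h2
      have h3 := hinv _ hc.1 hc.2.1
      rw [(D.projectivization.fibres (Λ' l) (Λ' (l.1, c • l.2)) (hinv l hl.1 hl.2.1) h3).2 ⟨c, h2⟩]
    fibre := fun l hl hlU => by
      obtain ⟨-, c, -, hc⟩ := hsec _ hlU (Λ' l) (hinv l hl.1 hl.2.1) (φ.left_inv hl.2.2).symm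
      rw [h.right_inv l hl.1] at hc
      exact ⟨c, hc⟩ }
  refine ⟨_, _, U, O', Q, K, ψ₀, ψ₁, hu₀U, hlocal, fun l hl => h.bundle l hl.1,
    fun l hl => h.base l hl.1, fun u hu => (hU hu).1, fun u hu w hw hqw => ?_,
    fun pot hpot u hu w hw hqw => ?_⟩
  · obtain ⟨hwS, c, hc, e⟩ := hsec u hu w hw hqw
    rw [h.totMoment_eq hwS, e, canonMoment_smul _ hc]
  · obtain ⟨hwS, c, hc, e⟩ := hsec u hu w hw hqw
    have hwφ : D.q w ∈ φ.source := by rw [hqw]; exact φ.map_target (hU hu).1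
    have hl := hmap w hwS hw hwφ
    have hϖ : φ (D.q (Λ' (Λ w))) = u := by rw [h.left_inv w hwS, hqw, φ.right_inv (hU hu).1]
    have hsm : ∀ l ∈ O', ContDiffAt ℝ 2 (admPot ψ₀ ψ₁ pot) l := fun l hl =>
      (contDiffAt_admPot (h.bundle l hl.1).smooth₀ (h.bundle l hl.1).smooth₁ hl.2.1 hpot).of_le
        (by norm_cast)
    have h1 := hlocal.pull_secMetric (Q := Q) (P := admPot ψ₀ ψ₁ pot)
      (fun l hl c hc => admPot_smul hl hc) hl
      (by rw [hϖ]; exact hu) (hsm _ hl)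
      (hsm _ (hlocal.mapsTo _ (by rw [hϖ]; exact hu)))
    beta_reduce at h1
    rw [hϖ] at h1
    have h2 : mdiff (𝓘(ℂ, B).prod 𝓘(ℂ, F₀ × F₁)) 𝓘(ℂ, V) (fun y => φ (D.q y)) w =
        (fderiv ℂ (fun l => φ (D.q (Λ' l))) (Λ w)).comp
          (mdiff (𝓘(ℂ, B).prod 𝓘(ℂ, F₀ × F₁)) 𝓘(ℂ, (∀ a, W a) × (F₀ × F₁)) Λ w) := by
      rw [← mdiff_eq_fderiv_flat, ← mdiff_comp (hlocal.smooth_quotient _ hl).contMDiffAt (h.hol w hwS)]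
      refine mdiff_congr ?_
      filter_upwards [h.eventually_proj_mem hwS] with y hy
      rw [h.left_inv y hy]
    rw [h2, ← pull_pull, h1, h.totTensor_eq hwS hw hpot]

end LocalChart

end WeightedExtremal
end


noncomputable section

namespace WeightedExtremal

open Module Filter Topology Set

set_option linter.unusedSectionVars false

/-! ### The metric and its momentum on `M`. -/

section GlobalMetric

variable {A : Type*} [Fintype A] {W : A → Type*} [∀ a, NormedAddCommGroup (W a)]
  [∀ a, NormedSpace ℂ (W a)] [∀ a, FiniteDimensional ℂ (W a)]
  {B : Type*} [NormedAddCommGroup B] [NormedSpace ℂ B]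
  {S : Type*} [TopologicalSpace S] [ChartedSpace B S] [IsManifold 𝓘(ℂ, B) ω S]
  {F₀ : Type*} [NormedAddCommGroup F₀] [InnerProductSpace ℂ F₀] [FiniteDimensional ℂ F₀]
  {E₀ : S → Type*} [TopologicalSpace (TotalSpace F₀ E₀)] [∀ x, TopologicalSpace (E₀ x)]
  [∀ x, AddCommGroup (E₀ x)] [∀ x, Module ℂ (E₀ x)] [FiberBundle F₀ E₀]
  [VectorBundle ℂ F₀ E₀] [ContMDiffVectorBundle ω F₀ E₀ 𝓘(ℂ, B)]
  {F₁ : Type*} [NormedAddCommGroup F₁] [InnerProductSpace ℂ F₁] [FiniteDimensional ℂ F₁]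
  {E₁ : S → Type*} [TopologicalSpace (TotalSpace F₁ E₁)] [∀ x, TopologicalSpace (E₁ x)]
  [∀ x, AddCommGroup (E₁ x)] [∀ x, Module ℂ (E₁ x)] [FiberBundle F₁ E₁]
  [VectorBundle ℂ F₁ E₁] [ContMDiffVectorBundle ω F₁ E₁ 𝓘(ℂ, B)]
  {V : Type*} [NormedAddCommGroup V] [NormedSpace ℂ V]
  {M : Type*} [TopologicalSpace M] [ChartedSpace V M] [IsManifold 𝓘(ℂ, V) ω M]

/-- The function on `M` induced by `(r₀² - r_∞²) / (r₀² + r_∞²)`. -/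
def quotMoment (D : AdmissibleManifold A W B F₀ E₀ F₁ E₁ V M) (m : M) : ℝ :=
  totMoment D (Classical.choose (D.projectivization.surjective m))

/-- The admissible metric on `M` with parameters `x` and local potential `log (r₀² + r_∞²) + pot`. -/
def admMetric (D : AdmissibleManifold A W B F₀ E₀ F₁ E₁ V M) (x : A → ℝ) (pot : ℝ → ℝ) (m : M) : Bil V :=
  Classical.epsilon fun b : Bil V => ∀ w : TotalSpace (F₀ × F₁) (E₀ ×ᵇ E₁), w.2 ≠ 0 → D.q w = m →
    pull b (D.dq w) = totTensor D x pot w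

variable {D : AdmissibleManifold A W B F₀ E₀ F₁ E₁ V M} {x : A → ℝ} {pot Θ Z : ℝ → ℝ}

theorem pull_injective_of_surjective {V' : Type*} [NormedAddCommGroup V'] [NormedSpace ℂ V']
    {T : V' →L[ℂ] V} (hT : Function.Surjective T) {b b' : Bil V} (h : pull b T = pull b' T) : b = b' := by
  ext v w
  obtain ⟨v, rfl⟩ := hT v
  obtain ⟨w, rfl⟩ := hT w
  exact congrFun (congrArg DFunLike.coe (congrFun (congrArg DFunLike.coe h) v)) w

/-- A local holomorphic section through `w` provides a right inverse of the differential. Tensors on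
`M` are therefore determined by their pull-backs. -/
theorem dq_surjective {w : TotalSpace (F₀ × F₁) (E₀ ×ᵇ E₁)} (hw : w.2 ≠ 0) :
    Function.Surjective (D.dq w) := by
  have hsub := D.projectivization.submersion w hw
  obtain ⟨s, hsw, hs, hsq⟩ := exists_section hsub
  have h1 : mdiff 𝓘(ℂ, V) 𝓘(ℂ, V) (fun m => D.q (s m)) (D.q w) =
      (mdiff (𝓘(ℂ, B).prod 𝓘(ℂ, F₀ × F₁)) 𝓘(ℂ, V) D.q (s (D.q w))).comp
        (mdiff 𝓘(ℂ, V) (𝓘(ℂ, B).prod 𝓘(ℂ, F₀ × F₁)) s (D.q w)) :=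
    mfderiv_comp (g := D.q) (D.q w) (by rw [hsw]; exact hsub.contMDiffAt.mdifferentiableAt (by simp))
      (hs.mdifferentiableAt (by simp))
  have h2 : mdiff 𝓘(ℂ, V) 𝓘(ℂ, V) (fun m => D.q (s m)) (D.q w) = ContinuousLinearMap.id ℂ V := by
    have : (fun m => D.q (s m)) =ᶠ[𝓝 (D.q w)] id := hsq
    exact this.mfderiv_eq.trans mfderiv_id
  rw [hsw] at h1
  intro v
  exact ⟨_, (congrFun (congrArg DFunLike.coe (h1.symm.trans h2)) v)⟩

theorem mdiff_chart_q {m : M} {w : TotalSpace (F₀ × F₁) (E₀ ×ᵇ E₁)} (hw : w.2 ≠ 0)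
    (hm : D.q w ∈ (extChartAt 𝓘(ℂ, V) m).source) :
    mdiff (𝓘(ℂ, B).prod 𝓘(ℂ, F₀ × F₁)) 𝓘(ℂ, V) (fun y => extChartAt 𝓘(ℂ, V) m (D.q y)) w =
      (tangentCoordChange 𝓘(ℂ, V) (D.q w) m (D.q w)).comp (D.dq w) := by
  rw [← mdiff_extChartAt hm]
  exact mdiff_comp ((contMDiffOn_extChartAt (n := ω)).contMDiffAt
    ((chartAt V m).open_source.mem_nhds (by simpa using hm)))
    (D.projectivization.submersion w hw).contMDiffAt

variable {m : M} {k : V → (∀ a, W a) × (F₀ × F₁)} {ϖ : (∀ a, W a) × (F₀ × F₁) → V} {U : Set V}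
  {O : Set ((∀ a, W a) × (F₀ × F₁))} {Q K : (∀ a, W a) → Bil (∀ a, W a)} {ψ₀ ψ₁ : (∀ a, W a) → ℝ}
  {u : V}

/-- The chosen lift is immaterial, since `r_0²` and `r_∞²` are scaled by the same factor. -/
theorem quotMoment_q (hx : D.IsParameter x) {w : TotalSpace (F₀ × F₁) (E₀ ×ᵇ E₁)} (hw : w.2 ≠ 0) :
    quotMoment D (D.q w) = totMoment D w := by
  obtain ⟨k, ϖ, U, O, Q, K, ψ₀, ψ₁, hu, h⟩ := exists_isLocalChart D hx (D.q w)
    (mem_extChartAt_target (I := 𝓘(ℂ, V)) (D.q w))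
  obtain ⟨h0, h1⟩ := Classical.choose_spec (D.projectivization.surjective (D.q w))
  have e : (extChartAt 𝓘(ℂ, V) (D.q w)).symm (extChartAt 𝓘(ℂ, V) (D.q w) (D.q w)) = D.q w :=
    extChartAt_to_inv _
  rw [quotMoment, h.moment _ hu _ h0 (h1.trans e.symm), h.moment _ hu w hw e.symm]

namespace IsLocalChart

theorem quotMoment_eq (hx : D.IsParameter x) (h : IsLocalChart D x m k ϖ U O Q K ψ₀ ψ₁) (hu : u ∈ U) :
    quotMoment D ((extChartAt 𝓘(ℂ, V) m).symm u) = canonMoment ψ₀ ψ₁ (k u) := by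
  obtain ⟨w, hw, hqw⟩ := D.projectivization.surjective ((extChartAt 𝓘(ℂ, V) m).symm u)
  rw [← h.moment u hu w hw hqw, ← hqw, quotMoment_q hx hw]

theorem isLocalModel (h : IsLocalChart D x m k ϖ U O Q K ψ₀ ψ₁) (hp : IsMomentProfile Θ Z pot) :
    IsLocalModel k ϖ U O Q K ψ₀ ψ₁ Θ Z pot (fun z => ∏ a, (1 + x a * z) ^ finrank ℂ (W a))
      (fun z => ∑ a, |x a| * D.c a / (1 + x a * z)) :=
  ⟨h.localSection, hp, h.bundle, h.base⟩

theorem pull_dq (h : IsLocalChart D x m k ϖ U O Q K ψ₀ ψ₁)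
    (hp : ∀ y ∈ Icc (-1 : ℝ) 1, ContDiffAt ℝ ∞ pot y) (hu : u ∈ U)
    {w : TotalSpace (F₀ × F₁) (E₀ ×ᵇ E₁)} (hw : w.2 ≠ 0)
    (hqw : D.q w = (extChartAt 𝓘(ℂ, V) m).symm u) :
    pull (pull (secMetric Q (admPot ψ₀ ψ₁ pot) k u)
      (tangentCoordChange 𝓘(ℂ, V) (D.q w) m (D.q w))) (D.dq w) = totTensor D x pot w := by
  rw [pull_pull, ← mdiff_chart_q hw
    (by rw [hqw]; exact (extChartAt 𝓘(ℂ, V) m).map_target (h.subset hu))]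
  exact h.tensor pot hp u hu w hw hqw

end IsLocalChart

/-- The pull-back of the admissible metric to the total space. -/
theorem pull_admMetric (hx : D.IsParameter x) (hp : ∀ y ∈ Icc (-1 : ℝ) 1, ContDiffAt ℝ ∞ pot y)
    {w : TotalSpace (F₀ × F₁) (E₀ ×ᵇ E₁)} (hw : w.2 ≠ 0) :
    pull (admMetric D x pot (D.q w)) (D.dq w) = totTensor D x pot w := by
  obtain ⟨k, ϖ, U, O, Q, K, ψ₀, ψ₁, hu, h⟩ := exists_isLocalChart D hx (D.q w)
    (mem_extChartAt_target (I := 𝓘(ℂ, V)) (D.q w))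
  -- A single tensor compatible with all lifts of the point is enough, and the coordinate expression
  -- in a local chart provides it.
  refine Classical.epsilon_spec (p := fun b : Bil V => ∀ w' : TotalSpace (F₀ × F₁) (E₀ ×ᵇ E₁),
    w'.2 ≠ 0 → D.q w' = D.q w → pull b (D.dq w') = totTensor D x pot w')
    ⟨pull (secMetric Q (admPot ψ₀ ψ₁ pot) k (extChartAt 𝓘(ℂ, V) (D.q w) (D.q w)))
      (tangentCoordChange 𝓘(ℂ, V) (D.q w) (D.q w) (D.q w)), fun w' hw' hqw => ?_⟩ w hw rfl
  have := h.pull_dq hp hu hw' (hqw.trans (extChartAt_to_inv _).symm)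
  rwa [hqw] at this

/-- The two tensors have the same pull-back to the total space, where the differential of `q` is
surjective. All local results thereby apply to the global metric. -/
theorem IsLocalChart.inChart_admMetric (hx : D.IsParameter x)
    (hp : ∀ y ∈ Icc (-1 : ℝ) 1, ContDiffAt ℝ ∞ pot y)
    (h : IsLocalChart D x m k ϖ U O Q K ψ₀ ψ₁) (hu : u ∈ U) :
    inChart (admMetric D x pot) m u = secMetric Q (admPot ψ₀ ψ₁ pot) k u := by
  obtain ⟨w, hw, hqw⟩ := D.projectivization.surjective ((extChartAt 𝓘(ℂ, V) m).symm u)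
  have h1 := pull_injective_of_surjective (dq_surjective hw)
    ((h.pull_dq hp hu hw hqw).trans (pull_admMetric hx hp hw).symm)
  have hm := (extChartAt 𝓘(ℂ, V) m).map_target (h.subset hu)
  rw [inChart, ← hqw, ← h1, pull_pull]
  have e : (tangentCoordChange 𝓘(ℂ, V) (D.q w) m (D.q w)).comp
      (tangentCoordChange 𝓘(ℂ, V) m (D.q w) (D.q w)) = ContinuousLinearMap.id ℂ V := by
    rw [← hqw] at hm
    rw [← tangentCoordChange_refl hm]
    exact ContinuousLinearMap.ext fun v =>
      tangentCoordChange_comp ⟨⟨hm, mem_extChartAt_source _⟩, hm⟩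
  rw [e, pull_id]

theorem isKahlerMetric_admMetric (hx : D.IsParameter x) (hp : IsMomentProfile Θ Z pot) :
    IsKahlerMetric (admMetric D x pot) := fun m => isKahlerOn_of_local fun u hu => by
  obtain ⟨k, ϖ, U, O, Q, K, ψ₀, ψ₁, hu, h⟩ := exists_isLocalChart D hx m hu
  refine ⟨_, U, h.localSection.isOpen_base, hu, (h.isLocalModel hp).isKahlerOn, ?_⟩
  filter_upwards [h.localSection.isOpen_base.mem_nhds hu] with y hy
  exact h.inChart_admMetric hx hp.smooth_potential hy

theorem IsLocalChart.eventually_moment (hx : D.IsParameter x) (h : IsLocalChart D x m k ϖ U O Q K ψ₀ ψ₁)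
    (hu : u ∈ U) (f : ℝ → ℝ) : (fun m => f (quotMoment D m)) ∘ (extChartAt 𝓘(ℂ, V) m).symm =ᶠ[𝓝 u]
      fun y => f (canonMoment ψ₀ ψ₁ (k y)) := by
  filter_upwards [h.localSection.isOpen_base.mem_nhds hu] with y hy
  simp only [Function.comp_apply, h.quotMoment_eq hx hy]

theorem IsLocalChart.contDiffAt_moment (h : IsLocalChart D x m k ϖ U O Q K ψ₀ ψ₁) {f : ℝ → ℝ}
    (hf : ∀ y ∈ Icc (-1 : ℝ) 1, ContDiffAt ℝ ∞ f y) (hu : u ∈ U) :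
    ContDiffAt ℝ ∞ (fun u => f (canonMoment ψ₀ ψ₁ (k u))) u := by
  have hO := h.localSection.mapsTo u hu
  have hne := h.localSection.ne_zero _ hO
  have h1 : ContDiffAt ℝ ∞ (fun u => canonMoment ψ₀ ψ₁ (k u)) u :=
    (contDiffAt_canonMoment (h.bundle _ hO).smooth₀ (h.bundle _ hO).smooth₁ hne).comp u
      (ContDiffAt.real_of_hol (h.localSection.smooth_section u hu))
  exact ContDiffAt.comp (g := f) u (hf _ (canonMoment_mem_Icc hne)) h1

theorem smoothOn_moment (hx : D.IsParameter x) {f : ℝ → ℝ}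
    (hf : ∀ y ∈ Icc (-1 : ℝ) 1, ContDiffAt ℝ ∞ f y) :
    SmoothOn (V := V) (fun m => f (quotMoment D m)) univ := smoothOn_of_chart fun m => by
  obtain ⟨k, ϖ, U, O, Q, K, ψ₀, ψ₁, hu, h⟩ := exists_isLocalChart D hx m
    (mem_extChartAt_target (I := 𝓘(ℂ, V)) m)
  refine ContDiffAt.congr_of_eventuallyEq ?_ (h.eventually_moment hx hu f)
  exact h.contDiffAt_moment hf hu

/-- The momentum of an admissible metric is a Killing potential. -/
theorem isKillingPotential_moment [FiniteDimensional ℂ V] [Nontrivial F₀] [Nontrivial F₁]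
    (hx : D.IsParameter x) (hp : IsMomentProfile Θ Z pot) :
    IsKillingPotential (admMetric D x pot) (fun m => Z (quotMoment D m)) := by
  refine ⟨smoothOn_moment hx hp.smooth_moment, fun m => ⟨killingField (inChart (admMetric D x pot) m)
    ((fun m => Z (quotMoment D m)) ∘ (extChartAt 𝓘(ℂ, V) m).symm), fun u hu => ⟨fun v => ?_,
      fun v w => ?_⟩⟩⟩
  · rw [killingField_apply ((isKahlerMetric_admMetric hx hp m).pos u hu), jmul_apply]
  · obtain ⟨k, ϖ, U, O, Q, K, ψ₀, ψ₁, hu, h⟩ := exists_isLocalChart D hx m hu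
    have hG : inChart (admMetric D x pot) m =ᶠ[𝓝 u] secMetric Q (admPot ψ₀ ψ₁ pot) k := by
      filter_upwards [h.localSection.isOpen_base.mem_nhds hu] with y hy
      exact h.inChart_admMetric hx hp.smooth_potential hy
    exact (lieBil_congr (killingField_congr hG (h.eventually_moment hx hu Z)) hG v w).trans
      ((h.isLocalModel hp).lieBil_killingField hu v w)

/-- The weighted scalar curvature of an admissible metric whose profile solves the extremal
equation. -/
theorem weightedScal_admMetric [FiniteDimensional ℂ V] [Nontrivial F₀] [Nontrivial F₁]
    (hx : D.IsParameter x) (hp : IsMomentProfile Θ Z pot) {P σ : ℝ → ℝ}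
    (hP : P = fun z => (∏ a, (1 + x a * z) ^ finrank ℂ (W a)) *
      ((1 + 1 * z) ^ (finrank ℂ F₀ - 1) * (1 + -1 * z) ^ (finrank ℂ F₁ - 1)))
    (hσ : σ = fun z => (∑ a, |x a| * D.c a / (1 + x a * z)) +
      (2 * (finrank ℂ F₀ - 1 : ℕ) * ((finrank ℂ F₀ - 1 : ℕ) + 1) / (1 + 1 * z)
        + 2 * (finrank ℂ F₁ - 1 : ℕ) * ((finrank ℂ F₁ - 1 : ℕ) + 1) / (1 + -1 * z)))
    {a p α β : ℝ} (hE : ∀ t ∈ Ioo (-1 : ℝ) 1,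
      (t + a) ^ 2 * (σ t - deriv (deriv fun t => Θ t * P t) t / P t)
        + 2 * (p - 1) * (t + a) * (deriv (fun t => Θ t * P t) t / P t) - p * (p - 1) * Θ t
      = α * t + β) (m : M) :
    weightedScal (fun m => Z (quotMoment D m) + a) p (admMetric D x pot) m =
      α * Z (quotMoment D m) + β := by
  obtain ⟨k, ϖ, U, O, Q, K, ψ₀, ψ₁, hu, h⟩ := exists_isLocalChart D hx m
    (mem_extChartAt_target (I := 𝓘(ℂ, V)) m)
  have hG : inChart (admMetric D x pot) m =ᶠ[𝓝 (extChartAt 𝓘(ℂ, V) m m)]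
      secMetric Q (admPot ψ₀ ψ₁ pot) k := by
    filter_upwards [h.localSection.isOpen_base.mem_nhds hu] with y hy
    exact h.inChart_admMetric hx hp.smooth_potential hy
  have hm := h.quotMoment_eq hx hu
  rw [extChartAt_to_inv] at hm
  rw [weightedScal_eq, weightedScalFlat_congr (h.eventually_moment hx hu fun y => Z y + a) hG, hm]
  exact (h.isLocalModel hp).weightedScalFlat_eq_affine hu hP hσ hE

theorem moment_mem_Icc (hx : D.IsParameter x) (m : M) : quotMoment D m ∈ Icc (-1 : ℝ) 1 := by
  obtain ⟨k, ϖ, U, O, Q, K, ψ₀, ψ₁, hu, h⟩ := exists_isLocalChart D hx m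
    (mem_extChartAt_target (I := 𝓘(ℂ, V)) m)
  have hm := h.quotMoment_eq hx hu
  rw [extChartAt_to_inv] at hm
  rw [hm]
  exact canonMoment_mem_Icc (h.localSection.ne_zero _ (h.localSection.mapsTo _ hu))

/-- The admissible metrics with given parameters lie in the same class. -/
theorem admMetric_eq_add_ddc (hx : D.IsParameter x)
    (hp : ∀ y ∈ Icc (-1 : ℝ) 1, ContDiffAt ℝ ∞ pot y) (m : M) :
    admMetric D x pot m = admMetric D x (fun _ => 0) m + ddc 𝓘(ℂ, V) (fun m => pot (quotMoment D m)) m := by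
  obtain ⟨k, ϖ, U, O, Q, K, ψ₀, ψ₁, hu, h⟩ := exists_isLocalChart D hx m
    (mem_extChartAt_target (I := 𝓘(ℂ, V)) m)
  have e1 := h.inChart_admMetric hx hp hu
  have e0 := h.inChart_admMetric hx (pot := fun _ => 0) (fun _ _ => contDiffAt_const) hu
  rw [inChart_self] at e1 e0
  rw [e1, e0, ddc, ddcFlat_congr (h.eventually_moment hx hu pot), secMetric, secMetric, add_assoc]
  congr 1
  have hO := h.localSection.mapsTo _ hu
  have hne := h.localSection.ne_zero _ hO
  have hB := h.bundle _ hO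
  have hk := h.localSection.smooth_section _ hu
  have s0 : ContDiffAt ℝ 2 (fun u => admPot ψ₀ ψ₁ (fun _ => 0) (k u)) (extChartAt 𝓘(ℂ, V) m m) :=
    ((contDiffAt_admPot hB.smooth₀ hB.smooth₁ hne fun _ _ => contDiffAt_const).of_le
      (by norm_cast)).comp _ (ContDiffAt.real_of_hol hk)
  have s1 : ContDiffAt ℝ 2 (fun u => pot (canonMoment ψ₀ ψ₁ (k u))) (extChartAt 𝓘(ℂ, V) m m) :=
    (h.contDiffAt_moment hp hu).of_le (by norm_cast)
  rw [← ddcFlat_add s0 s1]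
  refine ddcFlat_congr (Eventually.of_forall fun y => ?_)
  simp only [admPot]
  ring

end GlobalMetric

end WeightedExtremal
end


noncomputable section

namespace WeightedExtremal

open Module Filter Topology Set

set_option linter.unusedSectionVars false

/-! ### The metric is admissible, lies in the class, and is weighted extremal. -/

section AdmissibleMetric

variable {A : Type*} [Fintype A] {W : A → Type*} [∀ a, NormedAddCommGroup (W a)]
  [∀ a, NormedSpace ℂ (W a)] [∀ a, FiniteDimensional ℂ (W a)]
  {B : Type*} [NormedAddCommGroup B] [NormedSpace ℂ B]
  {S : Type*} [TopologicalSpace S] [ChartedSpace B S] [IsManifold 𝓘(ℂ, B) ω S]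
  {F₀ : Type*} [NormedAddCommGroup F₀] [InnerProductSpace ℂ F₀] [FiniteDimensional ℂ F₀]
  {E₀ : S → Type*} [TopologicalSpace (TotalSpace F₀ E₀)] [∀ x, TopologicalSpace (E₀ x)]
  [∀ x, AddCommGroup (E₀ x)] [∀ x, Module ℂ (E₀ x)] [FiberBundle F₀ E₀]
  [VectorBundle ℂ F₀ E₀] [ContMDiffVectorBundle ω F₀ E₀ 𝓘(ℂ, B)]
  {F₁ : Type*} [NormedAddCommGroup F₁] [InnerProductSpace ℂ F₁] [FiniteDimensional ℂ F₁]
  {E₁ : S → Type*} [TopologicalSpace (TotalSpace F₁ E₁)] [∀ x, TopologicalSpace (E₁ x)]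
  [∀ x, AddCommGroup (E₁ x)] [∀ x, Module ℂ (E₁ x)] [FiberBundle F₁ E₁]
  [VectorBundle ℂ F₁ E₁] [ContMDiffVectorBundle ω F₁ E₁ 𝓘(ℂ, B)]
  {V : Type*} [NormedAddCommGroup V] [NormedSpace ℂ V]
  {M : Type*} [TopologicalSpace M] [ChartedSpace V M] [IsManifold 𝓘(ℂ, V) ω M]
  {D : AdmissibleManifold A W B F₀ E₀ F₁ E₁ V M} {x : A → ℝ} {pot Θ Z : ℝ → ℝ}
  {w : TotalSpace (F₀ × F₁) (E₀ ×ᵇ E₁)}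

theorem eventually_rsq_pos (hx : D.IsParameter x) (h0 : w.2.1 ≠ 0) (h1 : w.2.2 ≠ 0) :
    ∀ᶠ y in 𝓝 w, 0 < D.rsq₀ y ∧ 0 < D.rsq₁ y := by
  obtain ⟨S₀, O, Λ, Λ', Q, K, ψ₀, ψ₁, hw, h⟩ := exists_isLocalFrame D hx w.proj
  have hc := (h.hol w hw).continuousAt
  have c0 : ContinuousAt (fun y => (Λ y).2.1) w := continuousAt_fst.comp (continuousAt_snd.comp hc)
  have c1 : ContinuousAt (fun y => (Λ y).2.2) w := continuousAt_snd.comp (continuousAt_snd.comp hc)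
  filter_upwards [h.eventually_proj_mem hw, c0.eventually_ne ((h.eq_zero₀ w hw).not.2 h0),
    c1.eventually_ne ((h.eq_zero₁ w hw).not.2 h1)] with y hy e0 e1
  rw [h.rsq₀ y hy, h.rsq₁ y hy]
  exact ⟨normSq₀_pos ψ₀ e0, normSq₁_pos ψ₁ e1⟩

theorem contDiffAt_logr (hx : D.IsParameter x) (h0 : w.2.1 ≠ 0) (h1 : w.2.2 ≠ 0) :
    ContDiffAt ℝ 2 (D.logr₀ ∘ (extChartAt (𝓘(ℂ, B).prod 𝓘(ℂ, F₀ × F₁)) w).symm)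
      (extChartAt (𝓘(ℂ, B).prod 𝓘(ℂ, F₀ × F₁)) w w) ∧
    ContDiffAt ℝ 2 (D.logr₁ ∘ (extChartAt (𝓘(ℂ, B).prod 𝓘(ℂ, F₀ × F₁)) w).symm)
      (extChartAt (𝓘(ℂ, B).prod 𝓘(ℂ, F₀ × F₁)) w w) := by
  obtain ⟨S₀, O, Λ, Λ', Q, K, ψ₀, ψ₁, hw, h⟩ := exists_isLocalFrame D hx w.proj
  have hB := h.bundle _ (h.mapsTo w hw)
  have p0 := normSq₀_pos ψ₀ ((h.eq_zero₀ w hw).not.2 h0)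
  have p1 := normSq₁_pos ψ₁ ((h.eq_zero₁ w hw).not.2 h1)
  have s0 : ContDiffAt ℝ 2 (fun l => Real.log (normSq₀ ψ₀ l) / 2) (Λ w) :=
    (((contDiffAt_normSq₀ hB.smooth₀).log p0.ne').div_const 2).of_le (by norm_cast)
  have s1 : ContDiffAt ℝ 2 (fun l => Real.log (normSq₁ ψ₁ l) / 2) (Λ w) :=
    (((contDiffAt_normSq₁ hB.smooth₁).log p1.ne').div_const 2).of_le (by norm_cast)
  constructor
  · refine (contDiffAt_chart_comp s0 (h.hol w hw)).congr_of_eventuallyEq (eventually_chart_symm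
      (p := fun y => D.logr₀ y = Real.log (normSq₀ ψ₀ (Λ y)) / 2) ?_)
    filter_upwards [h.eventually_proj_mem hw] with y hy
    rw [AdmissibleManifold.logr₀, h.rsq₀ y hy]
  · refine (contDiffAt_chart_comp s1 (h.hol w hw)).congr_of_eventuallyEq (eventually_chart_symm
      (p := fun y => D.logr₁ y = Real.log (normSq₁ ψ₁ (Λ y)) / 2) ?_)
    filter_upwards [h.eventually_proj_mem hw] with y hy
    rw [AdmissibleManifold.logr₁, h.rsq₁ y hy]

theorem exp_two_mul_logr (h0 : 0 < D.rsq₀ w) (h1 : 0 < D.rsq₁ w) :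
    Real.exp (2 * D.logr₀ w) = D.rsq₀ w ∧ Real.exp (2 * D.logr₁ w) = D.rsq₁ w := by
  constructor
  · rw [AdmissibleManifold.logr₀, mul_div_cancel₀ _ two_ne_zero, Real.exp_log h0]
  · rw [AdmissibleManifold.logr₁, mul_div_cancel₀ _ two_ne_zero, Real.exp_log h1]

theorem totMoment_eq_tanh (h0 : 0 < D.rsq₀ w) (h1 : 0 < D.rsq₁ w) :
    totMoment D w = Real.tanh (D.logr₀ w - D.logr₁ w) := by
  obtain ⟨e0, e1⟩ := exp_two_mul_logr h0 h1
  rw [totMoment, ← exp_quotient_eq_tanh, e0, e1]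

theorem totPot_eq_flowPot (h0 : 0 < D.rsq₀ w) (h1 : 0 < D.rsq₁ w) :
    totPot D pot w = D.logr₀ w + D.logr₁ w + flowPot pot (D.logr₀ w - D.logr₁ w) := by
  obtain ⟨e0, e1⟩ := exp_two_mul_logr h0 h1
  rw [totPot, totMoment_eq_tanh h0 h1, flowPot, ← add_assoc, ← log_exp_add_exp, e0, e1]

/-- On `M₀` the potential is `log r_0 + log r_∞ + H(τ)` with `τ = log r_0 - log r_∞`, `H' = z` and
`H'' = Θ(z)`. The chain rule gives the coefficients `1 + z` and `1 - z` of the two connection terms.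
-/
theorem ddc_totPot (hx : D.IsParameter x) (hp : IsMomentProfile Θ Z pot) (h0 : w.2.1 ≠ 0)
    (h1 : w.2.2 ≠ 0) : ddc (𝓘(ℂ, B).prod 𝓘(ℂ, F₀ × F₁)) (totPot D pot) w =
      ddc (𝓘(ℂ, B).prod 𝓘(ℂ, F₀ × F₁)) D.logr₀ w + ddc (𝓘(ℂ, B).prod 𝓘(ℂ, F₀ × F₁)) D.logr₁ w
      + Z (totMoment D w) • (ddc (𝓘(ℂ, B).prod 𝓘(ℂ, F₀ × F₁)) D.logr₀ w
        - ddc (𝓘(ℂ, B).prod 𝓘(ℂ, F₀ × F₁)) D.logr₁ w)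
      + Θ (Z (totMoment D w)) • (sq (dReal (𝓘(ℂ, B).prod 𝓘(ℂ, F₀ × F₁))
        (fun w => D.logr₀ w - D.logr₁ w) w) + sq (D.θ w)) := by
  obtain ⟨s0, s1⟩ := contDiffAt_logr hx h0 h1
  have hpos := eventually_rsq_pos hx h0 h1
  have e : totPot D pot =ᶠ[𝓝 w] fun w =>
      D.logr₀ w + D.logr₁ w + flowPot pot (D.logr₀ w - D.logr₁ w) := by
    filter_upwards [hpos] with y hy
    exact totPot_eq_flowPot hy.1 hy.2
  have hτ := s0.sub s1
  have e1 := hp.ddcFlat_flowPot hτ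
  have e2 := ddcFlat_sub s0 s1
  have e3 := ddcFlat_add s0 s1
  have e4 := ddcFlat_add (s0.add s1) ((hp.contDiff_flowPot.contDiffAt.of_le (by norm_cast)).comp _ hτ)
  have hz := totMoment_eq_tanh hpos.self_of_nhds.1 hpos.self_of_nhds.2
  rw [ddc_congr e]
  have e5 : ∀ f : TotalSpace (F₀ × F₁) (E₀ ×ᵇ E₁) → ℝ,
      (f ∘ (extChartAt (𝓘(ℂ, B).prod 𝓘(ℂ, F₀ × F₁)) w).symm)
        (extChartAt (𝓘(ℂ, B).prod 𝓘(ℂ, F₀ × F₁)) w w) = f w := fun f => by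
    simp only [Function.comp_apply, extChartAt_to_inv]
  rw [e5, e5, ← hz, e2] at e1
  refine e4.trans ?_
  rw [e3, add_assoc (_ + _)]
  exact congrArg _ e1

theorem dReal_moment (hx : D.IsParameter x) (hp : IsMomentProfile Θ Z pot) (h0 : w.2.1 ≠ 0)
    (h1 : w.2.2 ≠ 0) : dReal (𝓘(ℂ, B).prod 𝓘(ℂ, F₀ × F₁)) (fun w => Z (quotMoment D (D.q w))) w =
      Θ (Z (totMoment D w)) • dReal (𝓘(ℂ, B).prod 𝓘(ℂ, F₀ × F₁)) (fun w => D.logr₀ w - D.logr₁ w) w := by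
  obtain ⟨s0, s1⟩ := contDiffAt_logr hx h0 h1
  have hpos := eventually_rsq_pos hx h0 h1
  obtain ⟨S₀, O, Λ, Λ', Q, K, ψ₀, ψ₁, hw, h⟩ := exists_isLocalFrame D hx w.proj
  have hne : ∀ᶠ y in 𝓝 w, y.2 ≠ 0 := by
    have hc : ContinuousAt (fun y => (Λ y).2) w := continuousAt_snd.comp (h.hol w hw).continuousAt
    filter_upwards [h.eventually_proj_mem hw, hc.eventually_ne
      (h.ne_zero hw fun e => h0 (congrArg Prod.fst e))] with y hy e
    exact (h.ne_zero_iff hy).1 e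
  have e : (fun w => Z (quotMoment D (D.q w))) =ᶠ[𝓝 w] fun w =>
      Z (Real.tanh (D.logr₀ w - D.logr₁ w)) := by
    filter_upwards [hpos, hne] with y hy hy0
    rw [quotMoment_q hx hy0, totMoment_eq_tanh hy.1 hy.2]
  have hz := totMoment_eq_tanh hpos.self_of_nhds.1 hpos.self_of_nhds.2
  rw [dReal_congr e]
  have hτ := ((s0.sub s1).differentiableAt (by norm_num)).hasFDerivAt
  have e5 : ∀ f : TotalSpace (F₀ × F₁) (E₀ ×ᵇ E₁) → ℝ,
      (f ∘ (extChartAt (𝓘(ℂ, B).prod 𝓘(ℂ, F₀ × F₁)) w).symm)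
        (extChartAt (𝓘(ℂ, B).prod 𝓘(ℂ, F₀ × F₁)) w w) = f w := fun f => by
    simp only [Function.comp_apply, extChartAt_to_inv]
  have e6 := (hp.hasDerivAt_moment_tanh _).comp_hasFDerivAt _ hτ
  beta_reduce at e6
  rw [e5, e5, ← hz] at e6
  exact e6.fderiv

theorem isAdmissibleMetric_admMetric (hx : D.IsParameter x) (hp : IsMomentProfile Θ Z pot) :
    D.IsAdmissibleMetric x Θ (fun m => Z (quotMoment D m)) (admMetric D x pot) where
  profile_smooth := hp.smooth
  profile_pos := hp.pos
  profile_left := hp.left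
  profile_right := hp.right
  profile_deriv_left := hp.deriv_left
  profile_deriv_right := hp.deriv_right
  kahler := isKahlerMetric_admMetric hx hp
  moment_smooth := smoothOn_moment hx hp.smooth_moment
  moment_mem w h0 h1 := by
    have hpos := (eventually_rsq_pos hx h0 h1).self_of_nhds
    rw [quotMoment_q hx fun e => h0 (congrArg Prod.fst e), totMoment_eq_tanh hpos.1 hpos.2]
    exact hp.mem _ (tanh_mem _)
  moment w h0 h1 := by
    rw [dReal_moment hx hp h0 h1, quotMoment_q hx fun e => h0 (congrArg Prod.fst e)]
    refine ContinuousLinearMap.ext fun v => ?_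
    simp [AdmissibleManifold.θ]
  metric w h0 h1 := by
    have hne : w.2 ≠ 0 := fun e => h0 (congrArg Prod.fst e)
    have hpos := (eventually_rsq_pos hx h0 h1).self_of_nhds
    have hΘ : Θ (Z (totMoment D w)) ≠ 0 := by
      rw [totMoment_eq_tanh hpos.1 hpos.2]
      exact (hp.pos _ (hp.mem _ (tanh_mem _))).ne'
    -- The relation `Ω_∞ - Ω_0 = ∑ ω_a` trades `z ∑ g_a` for curvature terms, and `(1 + z) Ω_0 + (1
    -- - z) Ω_∞ + z (Ω_∞ - Ω_0) = Ω_0 + Ω_∞`, as in `totTensor`.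
    have hsum : ∑ a, ((1 + x a * Z (totMoment D w)) / x a) • pull (D.g a w.proj) (D.dProj w) =
        ∑ a, (x a)⁻¹ • pull (D.g a w.proj) (D.dProj w) + Z (totMoment D w) •
          (pull (D.Ω₁ w.proj) (D.dProj w) - pull (D.Ω₀ w.proj) (D.dProj w)) := by
      rw [← pull_sub, D.curvature, pull_sum, Finset.smul_sum, ← Finset.sum_add_distrib]
      refine Finset.sum_congr rfl fun a _ => ?_
      have hxa : x a ≠ 0 := fun e => by
        have := (hx a).2
        rw [e, mul_zero] at this
        exact this.false
      rw [← add_smul]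
      congr 1
      field_simp
    have hsq : (Θ (Z (totMoment D w)))⁻¹ • sq (Θ (Z (totMoment D w)) •
        dReal (𝓘(ℂ, B).prod 𝓘(ℂ, F₀ × F₁)) (fun w => D.logr₀ w - D.logr₁ w) w) =
        Θ (Z (totMoment D w)) • sq (dReal (𝓘(ℂ, B).prod 𝓘(ℂ, F₀ × F₁))
          (fun w => D.logr₀ w - D.logr₁ w) w) := by
      refine ContinuousLinearMap.ext fun v => ContinuousLinearMap.ext fun v' => ?_
      simp only [_root_.smul_apply, sq_apply, smul_eq_mul]
      field_simp
    rw [pull_admMetric hx hp.smooth_potential hne, dReal_moment hx hp h0 h1, quotMoment_q hx hne, hsq,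
      hsum, totTensor, ddc_totPot hx hp h0 h1, AdmissibleManifold.fs₀, AdmissibleManifold.fs₁]
    module

/-- The admissible metrics belong to the admissible class. -/
theorem inClass_admMetric (hx : D.IsParameter x) (hp : IsMomentProfile Θ Z pot) :
    D.InClass x (admMetric D x pot) :=
  ⟨admMetric D x fun _ => 0, fun m => quotMoment D m, fun m => pot (quotMoment D m),
    isAdmissibleMetric_admMetric hx isMomentProfile_canonical, fun _ hw => quotMoment_q hx hw,
    smoothOn_moment hx hp.smooth_potential, admMetric_eq_add_ddc hx hp.smooth_potential⟩

/-- Solutions of the extremal equation define weighted extremal admissible metrics. -/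
theorem exists_weightedExtremal [FiniteDimensional ℂ V] [Nontrivial F₀] [Nontrivial F₁]
    (hx : D.IsParameter x) {a p : ℝ} (ha : 1 < a)
    (h : HasWeightedProfile (fun i => finrank ℂ (W i)) (finrank ℂ F₀ - 1) (finrank ℂ F₁ - 1) a p x
      fun i => |x i| * D.c i) :
    ∃ (Θ : ℝ → ℝ) (z : M → ℝ) (g : M → Bil V), D.IsAdmissibleMetric x Θ z g ∧ D.InClass x g ∧
      IsWeightedExtremal (fun m => z m + a) p g := by
  obtain ⟨α, β, η, O, hO, hsub, hη, hpos, hode⟩ := h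
  obtain ⟨Z, pot, hp⟩ := exists_isMomentProfile hO hsub hη hpos
  have hK := isKillingPotential_moment hx hp
  refine ⟨_, _, admMetric D x pot, isAdmissibleMetric_admMetric hx hp, inClass_admMetric hx hp,
    isKahlerMetric_admMetric hx hp, fun m => ?_, ?_, ?_⟩
  · have := (hp.mem_Icc _ (moment_mem_Icc hx m)).1
    linarith
  · simpa using isKillingPotential_affine hK 1 a
  -- The profile equation holds for any `Q` equal to `Θ P` on the open interval. Taking `Q = Θ P`
  -- everywhere makes its derivatives those of the curvature formula.
  · have e : weightedScal (fun m => Z (quotMoment D m) + a) p (admMetric D x pot) =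
        fun m => α * Z (quotMoment D m) + β :=
      funext fun m => weightedScal_admMetric hx hp rfl rfl
        (hode _ _ (fun t => rfl) (fun t _ => rfl)) m
    rw [e]
    exact isKillingPotential_affine hK α β

end AdmissibleMetric

end WeightedExtremal
end

/-! ### Conclusion for small parameters and for nonnegative curvature. -/

theorem theorem3p1
    {A : Type*} [Fintype A]
    {W : A → Type*} [∀ a, NormedAddCommGroup (W a)] [∀ a, NormedSpace ℂ (W a)]
    [∀ a, FiniteDimensional ℂ (W a)] [∀ a, Nontrivial (W a)]
    {B : Type*} [NormedAddCommGroup B] [NormedSpace ℂ B] [FiniteDimensional ℂ B]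
    {S : Type*} [TopologicalSpace S] [ChartedSpace B S] [IsManifold 𝓘(ℂ, B) ω S]
    [CompactSpace S] [T2Space S] [ConnectedSpace S]
    {F₀ : Type*} [NormedAddCommGroup F₀] [InnerProductSpace ℂ F₀] [FiniteDimensional ℂ F₀]
    [Nontrivial F₀]
    {E₀ : S → Type*} [TopologicalSpace (TotalSpace F₀ E₀)] [∀ x, TopologicalSpace (E₀ x)]
    [∀ x, AddCommGroup (E₀ x)] [∀ x, Module ℂ (E₀ x)] [FiberBundle F₀ E₀]
    [VectorBundle ℂ F₀ E₀] [ContMDiffVectorBundle ω F₀ E₀ 𝓘(ℂ, B)]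
    {F₁ : Type*} [NormedAddCommGroup F₁] [InnerProductSpace ℂ F₁] [FiniteDimensional ℂ F₁]
    [Nontrivial F₁]
    {E₁ : S → Type*} [TopologicalSpace (TotalSpace F₁ E₁)] [∀ x, TopologicalSpace (E₁ x)]
    [∀ x, AddCommGroup (E₁ x)] [∀ x, Module ℂ (E₁ x)] [FiberBundle F₁ E₁]
    [VectorBundle ℂ F₁ E₁] [ContMDiffVectorBundle ω F₁ E₁ 𝓘(ℂ, B)]
    {V : Type*} [NormedAddCommGroup V] [NormedSpace ℂ V] [FiniteDimensional ℂ V]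
    {M : Type*} [TopologicalSpace M] [ChartedSpace V M] [IsManifold 𝓘(ℂ, V) ω M] [T2Space M]
    (D : AdmissibleManifold A W B F₀ E₀ F₁ E₁ V M) :
    (∀ a : ℝ, 1 < a → ∀ p : ℝ, ∃ δ : ℝ, 0 < δ ∧
      ∀ x : A → ℝ, D.IsParameter x → (∀ i, |x i| < δ) →
        ∃ (Θ : ℝ → ℝ) (z : M → ℝ) (g : M → Bil V),
          D.IsAdmissibleMetric x Θ z g ∧ D.InClass x g ∧
            IsWeightedExtremal (fun m => z m + a) p g) ∧
    ((∀ i, 0 ≤ D.c i) →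
      ∀ a : ℝ, 1 < a → ∀ p : ℝ, ∀ x : A → ℝ, D.IsParameter x →
        ∃ (Θ : ℝ → ℝ) (z : M → ℝ) (g : M → Bil V),
          D.IsAdmissibleMetric x Θ z g ∧ D.InClass x g ∧
            IsWeightedExtremal (fun m => z m + a) p g) := by
  have hd : ∀ i, 1 ≤ Module.finrank ℂ (W i) := fun i => Module.finrank_pos
  refine ⟨fun a ha p => ?_, fun hc a ha p x hx => ?_⟩
  · obtain ⟨δ, hδ, h⟩ := hasWeightedProfile_of_small (Module.finrank ℂ F₀ - 1)
      (Module.finrank ℂ F₁ - 1) hd ha p D.c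
    exact ⟨δ, hδ, fun x hx hxδ => exists_weightedExtremal hx ha (h x hxδ)⟩
  · exact exists_weightedExtremal hx ha (hasWeightedProfile_of_nonneg _ _ hd ha p
      (fun i => (hx i).1) fun i => mul_nonneg (abs_nonneg _) (hc i))
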